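/- Let $K/\mathbb{Q}_p$ be a finite extension with maximal unramified subfield $K_0$, $f=[K_0:\mathbb{Q}_p]$, $W=\mathcal{O}_{K_0}$ with Frobenius $\varphi$, $\pi_K$ a uniformizer of $K$, and $E(u)\in W[u]$ its minimal polynomial over $K_0$ (or over $\mathbb{Q}_p$; both are allowed). Let $L=K(\pi_L)$ with $\pi_L^{p^f-1}=\pi_K$, $\Delta=\mathrm{Gal}(L/K)$, $\omega_f:\Delta\to W^\times$, $\omega_f(g)=g(\pi_L)/\pi_L$, $u=v^{p^f-1}$ and $P(v)=E(v^{p^f-1})$. Let $F/\mathbb{Q}_p$ be finite with ring of integers $\Lambda$ and an embedding $\sigma_0:K_0\to F$; put $\sigma_j=\sigma_0\circ\varphi^{-j}$ and $E_j=\sigma_j(E)$ for $j\in\mathbb{Z}/f$. Let $n\ge1$ and $\tau=\bigoplus_{i=1}^n\chi_i$ with $\chi_i=(\sigma_0\circ\omega_f)^{\mathbf a_i}:\Delta\to\Lambda^\times$, $0\le \mathbf a_i=\sum_{k<f}a_{i,k}p^k<p^f-1$ (base $p$ digits). Let $\mathbf a_i^{(j)}=\sum_{k<f}a_{i,f-j+k}p^k$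 (indices modulo $f$), and choose $s_j\in S_n$ with $i\mapsto \mathbf a^{(j)}_{s_j(i)}$ non-decreasing. Let $P_j\subset \mathrm{GL}_n=\mathrm{GL}(\tau)$ be the stabilizer of the filtration of $\tau=\Lambda^n$ whose $k$-th step is the sum of the isotypic parts for $\chi_{s_j(1)},\dots,\chi_{s_j(k)}$. For a $\Lambda$-algebra $R$ with $p$ nilpotent and integers $a\le b$, let $Y^{[a,b],\tau}(R)$ be the groupoid of Kisin modules $\mathfrak M$ over $R$ of rank $n$ with descent datum, height in $[a,b]$ and type $\tau$: finitely generated projective $(W\otimes_{\mathbb{Z}_p} R)[\![v]\!]$-modules, Zariski locally on $\mathrm{Spec}\,R$ free of rank $n$, with an isomorphism $\phi:\varphi^*(\mathfrak M)[1/P(v)]\cong\mathfrak M[1/P(v)]$ such that $P(v)^a\mathfrak M\supset\phi(\varphi^*\mathfrak M)\supset P(v)^b\mathfrak M$, and with a commuting semilinear action of $\Delta$ (where $g\in\Delta$ acts on $(W\otimes R)[\![v]\!]$ by $v\mapsto(\omega_f(g)\otimes 1)v$), such that Zariski locally on $\mathrm{Spec}\,R$ each $\mathfrak M^{(j)}/v\mathfrak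 M^{(j)}$ is isomorphic to $\tau$. Here $Q^{(j)}\subset Q$ is the part of a $(W\otimes R)[\![v]\!]$-module on which $W$ acts through $\sigma_j$. Base change along $R\to R'$ is extension of scalars to $(W\otimes R')[\![v]\!]$, and makes $Y^{[a,b],\tau}$ a category fibred in groupoids. An eigenbasis of $\mathfrak M$ is a family of $R[\![v]\!]$-bases $(f_i^{(j)})_i$ of the $\mathfrak M^{(j)}$ such that $\Delta$ acts on $f^{(j)}_i$ through $\chi_i$; an eigenbasis modulo $P(v)^N$ is a family of such bases of $\mathfrak M^{(j)}/\sigma_j(P(v))^N\mathfrak M^{(j)}$ over $R[\![v]\!]/\sigma_j(P(v))^N$. Fix $N>b-a$, and let $\pi^{(\infty)}:\widetilde Y^{[a,b],\tau,(\infty)}\to Y^{[a,b],\tau}$ (resp. $\pi^{(N)}:\widetilde Y^{[a,b],\tau}\to Y^{[a,b],\tau}$) be the map $(\mathfrak M,\beta)\mapsto\mathfrak M$ from the stack of pairs of an object $\mathfrak M$ and an eigenbasis $\beta$ (resp. an eigenbasis $\beta$ modulo $P(v)^N$). Let $L^{+,E_j(u)}\mathcal P_j(R)=\{g\in\varprojlim_r\mathrm{GL}_n(R[u]/E_j(u)^r)\mid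 g\bmod u\in P_j\}$. Let $\mathcal P_j$ be the parahoric group scheme over $\Lambda[u]$ attached to $P_j$, $\mathcal P_j(A)=(A\otimes_{\Lambda[u]}\mathfrak A_j)^\times$ with $\mathfrak A_j=\{x\in M_n(\Lambda[u])\mid x\bmod u \text{ preserves the filtration defining } P_j\}$, and let $\mathcal P_{j,N}$ be the Weil restriction $\mathrm{Res}_{(\Lambda[u]/E_j(u)^N)/\Lambda}\mathcal P_j$, i.e. $\mathcal P_{j,N}(R)=\mathcal P_j(R[u]/E_j(u)^N)$. Then $\pi^{(\infty)}$ is a torsor for the Zariski topology for $\prod_{j\in\mathbb{Z}/f}L^{+,E_j(u)}\mathcal P_j$, and $\pi^{(N)}$ is a torsor for the Zariski topology for $\prod_{j\in\mathbb{Z}/f}\mathcal P_{j,N}$. In both cases $g=(g_j)_j$ acts on bases on the right through the transition matrices $D_j^{-1}\,g_j(v^{p^f-1})\,D_j$, where $D_j=\mathrm{diag}(v^{\mathbf a_1^{(j)}},\dots,v^{\mathbf a_n^{(j)}})$. In particular $\pi^{(N)}$ is representable and smooth, and $\pi^{(\infty)}$ is formally smooth. -/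

import Mathlib

open scoped TensorProduct Polynomial PowerSeries

universe u

noncomputable section

namespace KisinDescent

/-! ## The fields, the tame extension and the tame type -/

/-- `K'` is unramified over `ℚ_p`: `p` generates the maximal ideal of its ring of integers. -/
def IsUnramifiedSub (p : ℕ) [Fact p.Prime] {K : Type u} [Field K] [Algebra ℚ_[p] K]
    [Algebra ℤ_[p] K] [IsScalarTower ℤ_[p] ℚ_[p] K] (K' : IntermediateField ℚ_[p] K) : Prop :=
  (Ideal.span {(p : integralClosure ℤ_[p] K')}).IsMaximal

/-- If `a = ∑ a_l p^l` (`0 ≤ l < f`, base `p` digits), then `twistExp p f a j` is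
`a^{(j)} = ∑_{k < f} a_{f - j + k} p^k`, the subscripts being read modulo `f`. -/
def twistExp (p f a : ℕ) (j : ZMod f) : ℕ :=
  ∑ k ∈ Finset.range f, (a / p ^ ((f - j.val + k) % f) % p) * p ^ k

/-- The standing data: `K/ℚ_p` finite with uniformizer `πK`, its maximal unramified subfield `K0`,
`L = K(πL)` with `πL^(p^f - 1) = πK`, the coefficient field `F` with an embedding `σ0 : K0 → F`,
and a principal series type `τ = ⊕ χ i` of `Gal(L/K)` with an orientation `s`.
The fields `E`, `φ`, `ω`, `a` are names for objects that the other data determine: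
the minimal polynomial of `πK`, the Frobenius of `W`, the fundamental character of niveau `f`
and the exponents of the characters `χ i` in terms of it. -/
structure Setup (p : ℕ) [Fact p.Prime] where
  K : Type u
  [fieldK : Field K]
  [algK : Algebra ℚ_[p] K]
  [finK : FiniteDimensional ℚ_[p] K]
  [algZK : Algebra ℤ_[p] K]
  [towerK : IsScalarTower ℤ_[p] ℚ_[p] K]
  /-- a uniformizer of `K` -/
  πK : integralClosure ℤ_[p] K
  uniformizer : (Ideal.span {πK}).IsMaximal
  /-- the maximal unramified subextension -/
  K0 : IntermediateField ℚ_[p] K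
  K0_greatest : IsGreatest {K' : IntermediateField ℚ_[p] K | IsUnramifiedSub p K'} K0
  L : Type u
  [fieldL : Field L]
  [algL : Algebra K L]
  /-- a root of `πK` of order `p^f - 1`, where `f = [K0 : ℚ_p]` -/
  πL : L
  πL_pow : πL ^ (p ^ Module.finrank ℚ_[p] K0 - 1) = algebraMap K L πK
  πL_gen : IntermediateField.adjoin K {πL} = ⊤
  F : Type u
  [fieldF : Field F]
  [algF : Algebra ℚ_[p] F]
  [finF : FiniteDimensional ℚ_[p] F]
  [algZF : Algebra ℤ_[p] F]
  [towerF : IsScalarTower ℤ_[p] ℚ_[p] F]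
  σ0 : K0 →ₐ[ℚ_[p]] F
  /-- the minimal polynomial of `πK`, over `K0` or over `ℚ_p`, as a polynomial over `W` -/
  E : (integralClosure ℤ_[p] K0)[X]
  E_minpoly :
    E.map (algebraMap (integralClosure ℤ_[p] K0) K0) = minpoly K0 (πK : K) ∨
    E.map (algebraMap (integralClosure ℤ_[p] K0) K0) =
      (minpoly ℚ_[p] (πK : K)).map (algebraMap ℚ_[p] K0)
  /-- the Frobenius automorphism of `W` -/
  φ : integralClosure ℤ_[p] K0 ≃ₐ[ℤ_[p]] integralClosure ℤ_[p] K0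
  φ_frob : ∀ x, (p : integralClosure ℤ_[p] K0) ∣ φ x - x ^ p
  /-- the fundamental character `g ↦ g(πL)/πL` of `Δ = Gal(L/K)`, with values in `Wˣ` -/
  ω : (L ≃ₐ[K] L) →* (integralClosure ℤ_[p] K0)ˣ
  ω_spec : ∀ g : L ≃ₐ[K] L,
    algebraMap K L (((ω g : integralClosure ℤ_[p] K0) : K0) : K) * πL = g πL
  n : ℕ
  n_pos : 0 < n
  /-- the characters of the type `τ = ⊕ χ i`, with values in `Λˣ` -/
  χ : Fin n → ((L ≃ₐ[K] L) →* (integralClosure ℤ_[p] F)ˣ)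
  /-- `χ i = (σ0 ∘ ω)^(a i)` with `0 ≤ a i < p^f - 1` -/
  a : Fin n → ℕ
  a_lt : ∀ i, a i < p ^ Module.finrank ℚ_[p] K0 - 1
  χ_eq : ∀ i g, (((χ i g : integralClosure ℤ_[p] F)) : F) =
    σ0 ((ω g : integralClosure ℤ_[p] K0) : K0) ^ a i
  /-- the orientation of `τ` -/
  s : ZMod (Module.finrank ℚ_[p] K0) → Equiv.Perm (Fin n)
  s_mono : ∀ j, Monotone fun i => twistExp p (Module.finrank ℚ_[p] K0) (a (s j i)) j

attribute [instance] Setup.fieldK Setup.algK Setup.finK Setup.algZK Setup.towerK Setup.fieldL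
  Setup.algL Setup.fieldF Setup.algF Setup.finF Setup.algZF Setup.towerF

variable {p : ℕ} [Fact p.Prime]

namespace Setup

variable (D : Setup.{u} p)

/-- `f = [K0 : ℚ_p]`, the residue degree of `K`. -/
def f : ℕ := Module.finrank ℚ_[p] D.K0

/-- `d = p^f - 1`, so that `u = v^d`. -/
def d : ℕ := p ^ D.f - 1

/-- The ring of integers `W` of `K0`. -/
def W : Type u := integralClosure ℤ_[p] D.K0

instance : CommRing D.W := inferInstanceAs (CommRing (integralClosure ℤ_[p] D.K0))
instance : Algebra ℤ_[p] D.W := inferInstanceAs (Algebra ℤ_[p] (integralClosure ℤ_[p] D.K0))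

/-- The ring of integers `Λ` of the coefficient field `F`. -/
def Lam : Type u := integralClosure ℤ_[p] D.F

instance : CommRing D.Lam := inferInstanceAs (CommRing (integralClosure ℤ_[p] D.F))
instance : Algebra ℤ_[p] D.Lam := inferInstanceAs (Algebra ℤ_[p] (integralClosure ℤ_[p] D.F))

/-- `Δ = Gal(L/K)`. -/
abbrev Gal : Type u := D.L ≃ₐ[D.K] D.L

/-- The Frobenius of `W`. -/
def frobW : D.W ≃ₐ[ℤ_[p]] D.W := D.φ

/-- The fundamental character. -/
def om (g : D.Gal) : D.W := ((D.ω g : (integralClosure ℤ_[p] D.K0)ˣ) : integralClosure ℤ_[p] D.K0)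

/-- The values of `χ i` in `Λ`. -/
def chi (i : Fin D.n) (g : D.Gal) : D.Lam :=
  ((D.χ i g : (integralClosure ℤ_[p] D.F)ˣ) : integralClosure ℤ_[p] D.F)

/-- The map `W → Λ` induced by `σ0`. -/
def sigma0 : D.W →ₐ[ℤ_[p]] D.Lam :=
  AlgHom.codRestrict
    ((D.σ0.restrictScalars ℤ_[p]).comp (integralClosure ℤ_[p] D.K0).val)
    (integralClosure ℤ_[p] D.F)
    (fun x => IsIntegral.map (D.σ0.restrictScalars ℤ_[p]) x.2)

/-- `σ_j = σ_0 ∘ φ^{-j} : W → Λ`. -/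
def sigma (j : ZMod D.f) : D.W →ₐ[ℤ_[p]] D.Lam :=
  D.sigma0.comp ((D.frobW⁻¹ ^ j.val : D.W ≃ₐ[ℤ_[p]] D.W) : D.W →ₐ[ℤ_[p]] D.W)

/-- `E` as a polynomial over `W`. -/
def EW : D.W[X] := D.E

/-- The exponents `a_i^{(j)}`. -/
def ex (j : ZMod D.f) (i : Fin D.n) : ℕ := twistExp p D.f (D.a i) j

/-- The permutation `s_j`. -/
def ori (j : ZMod D.f) : Equiv.Perm (Fin D.n) := D.s j

end Setup

/-! ## The category `Nilp_Λ` -/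

/-- A `Λ`-algebra in which `p` is nilpotent. -/
structure NilpAlg (D : Setup.{u} p) where
  carrier : Type u
  [ring : CommRing carrier]
  [alg : Algebra D.Lam carrier]
  nilp : IsNilpotent (p : carrier)

instance (D : Setup.{u} p) : CoeSort (NilpAlg D) (Type u) := ⟨NilpAlg.carrier⟩

attribute [instance] NilpAlg.ring NilpAlg.alg

variable {D : Setup.{u} p}

instance (R : NilpAlg D) : Algebra ℤ_[p] R :=
  ((algebraMap D.Lam R).comp (algebraMap ℤ_[p] D.Lam)).toAlgebra

instance (R : NilpAlg D) : IsScalarTower ℤ_[p] D.Lam R :=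
  IsScalarTower.of_algebraMap_eq fun _ => rfl

/-- The localization `R[1/g]`. -/
def NilpAlg.away (R : NilpAlg D) (g : R) : NilpAlg D where
  carrier := Localization.Away g
  nilp := by
    have h := R.nilp.map (algebraMap R (Localization.Away g))
    rwa [map_natCast] at h

/-- The structure map `R → R[1/g]`. -/
def NilpAlg.toAway (R : NilpAlg D) (g : R) : R →ₐ[D.Lam] R.away g :=
  IsScalarTower.toAlgHom D.Lam R (Localization.Away g)

/-! ## Extension of scalars along a ring homomorphism -/

/-- A copy of `T`, regarded as an `S`-algebra through `g : S → T`. -/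
@[nolint unusedArguments]
def Along {S T : Type u} [CommRing S] [CommRing T] (_ : S →+* T) : Type u := T

instance {S T : Type u} [CommRing S] [CommRing T] (g : S →+* T) : CommRing (Along g) :=
  inferInstanceAs (CommRing T)

instance {S T : Type u} [CommRing S] [CommRing T] (g : S →+* T) : Algebra S (Along g) :=
  RingHom.toAlgebra (S := T) g

/-- `g^* M = T ⊗_{S,g} M`, as a `T`-module. -/
def Ext {S T : Type u} [CommRing S] [CommRing T] (g : S →+* T) (M : Type u) [AddCommGroup M]
    [Module S M] : Type u := Along g ⊗[S] M

section Ext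

variable {S T : Type u} [CommRing S] [CommRing T] (g : S →+* T) (M : Type u) [AddCommGroup M]
  [Module S M]

instance : AddCommGroup (Ext g M) := inferInstanceAs (AddCommGroup (Along g ⊗[S] M))

instance : Module T (Ext g M) := inferInstanceAs (Module (Along g) (Along g ⊗[S] M))

variable {M}

/-- The map `m ↦ 1 ⊗ m` from `M` to `g^* M`. -/
def Ext.of (m : M) : Ext g M := (1 : Along g) ⊗ₜ[S] m

end Ext

/-! ## The ring `(W ⊗ R)[[v]]` -/

section Ring

variable (R : NilpAlg D)

/-- `W ⊗_{ℤ_p} R`. -/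
abbrev WR : Type u := D.W ⊗[ℤ_[p]] R

/-- `(W ⊗_{ℤ_p} R)[[v]]`. -/
abbrev SS : Type u := (WR R)⟦X⟧

/-- The Frobenius of `(W ⊗ R)[[v]]`: Frobenius on `W`, trivial on `R`, and `v ↦ v^p`. -/
def frob : SS R →+* SS R :=
  (PowerSeries.expand p (Fact.out : p.Prime).ne_zero : SS R →ₐ[WR R] SS R).toRingHom.comp
    (PowerSeries.map
      (Algebra.TensorProduct.map (D.frobW : D.W →ₐ[ℤ_[p]] D.W) (AlgHom.id ℤ_[p] R)).toRingHom)

/-- The automorphism `ĝ` of `(W ⊗ R)[[v]]`: `v ↦ (ω(g) ⊗ 1) v`, trivial on the coefficients. -/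
def galS (g : D.Gal) : SS R →+* SS R := PowerSeries.rescale ((D.om g) ⊗ₜ[ℤ_[p]] (1 : R))

/-- `P(v) = E(v^(p^f - 1))`. -/
def PS : SS R := Polynomial.aeval ((PowerSeries.X : SS R) ^ D.d) D.EW

/-- The inclusion `R[[v]] → (W ⊗ R)[[v]]`. -/
def incl : R⟦X⟧ →+* SS R :=
  PowerSeries.map (Algebra.TensorProduct.includeRight : R →ₐ[ℤ_[p]] WR R).toRingHom

/-- The constant `w ⊗ 1` of `(W ⊗ R)[[v]]`. -/
def cW (w : D.W) : SS R := PowerSeries.C (w ⊗ₜ[ℤ_[p]] (1 : R))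

/-- The constant `1 ⊗ r` of `(W ⊗ R)[[v]]`. -/
def cR (r : R) : SS R := PowerSeries.C ((1 : D.W) ⊗ₜ[ℤ_[p]] r)

/-- The image of `c ∈ Λ` in `(W ⊗ R)[[v]]`. -/
def cL (c : D.Lam) : SS R := cR R (algebraMap D.Lam R c)

variable {R}

/-- The map `(W ⊗ R)[[v]] → (W ⊗ R')[[v]]` induced by `h : R → R'`. -/
def baseS {R' : NilpAlg D} (h : R →ₐ[D.Lam] R') : SS R →+* SS R' :=
  PowerSeries.map
    (Algebra.TensorProduct.map (AlgHom.id ℤ_[p] D.W) (h.restrictScalars ℤ_[p])).toRingHom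

end Ring

/-- `x` lies in the summand `Q^{(j)}` of `Q`, on which `W` acts through `σ_j`. -/
def InComp (R : NilpAlg D) (j : ZMod D.f) {Q : Type u} [AddCommGroup Q] [Module (SS R) Q]
    (x : Q) : Prop :=
  ∀ w : D.W, cW R w • x = cL R (D.sigma j w) • x


/-! ## Kisin modules with descent datum -/

section Loc

variable (R : NilpAlg D) (M : Type u) [AddCommGroup M] [Module (SS R) M]

/-- `M[1/P(v)]`. -/
abbrev InvP : Type u := LocalizedModule (Submonoid.powers (PS R)) M

variable {M}

/-- The map `M → M[1/P(v)]`. -/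
def toInvP : M →ₗ[SS R] InvP R M := LocalizedModule.mkLinearMap (Submonoid.powers (PS R)) M

/-- `z ∈ P(v)^a M`, as a submodule of `M[1/P(v)]`, for an integer `a`:
`P^(max(-a,0)) z = P^(max(a,0)) x` for some `x ∈ M`. -/
def InPowLattice (a : ℤ) (z : InvP R M) : Prop :=
  ∃ x : M, PS R ^ (-a).toNat • z = PS R ^ a.toNat • toInvP R x

end Loc

variable (D) in
/-- A Kisin module of rank `n` with descent datum over `R`. -/
structure KisinDD (R : NilpAlg D) where
  carrier : Type u
  [addCommGroup : AddCommGroup carrier]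
  [module : Module (SS R) carrier]
  finite : Module.Finite (SS R) carrier
  projective : Module.Projective (SS R) carrier
  /-- Zariski locally on `Spec R`, the module is free of rank `n` -/
  locallyFree : ∃ t : Finset R, Ideal.span (t : Set R) = ⊤ ∧ ∀ g ∈ t,
    Nonempty (Module.Basis (Fin D.n) (SS (R.away g)) (Ext (baseS (R.toAway g)) carrier))
  /-- the Frobenius `φ^*(M)[1/P(v)] ≅ M[1/P(v)]` -/
  phi : InvP R (Ext (frob R) carrier) ≃ₗ[SS R] InvP R carrier
  /-- the descent datum -/
  gal : ∀ g : D.Gal, carrier →ₛₗ[galS R g] carrier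
  gal_bij : ∀ g, Function.Bijective (gal g)
  gal_mul : ∀ g h m, gal (g * h) m = gal g (gal h m)
  /-- the descent datum commutes with Frobenius: if `φ_M(1 ⊗ m) = P^(-k) x`,
  then `φ_M(1 ⊗ ĝ m) = P^(-k) ĝ x` -/
  gal_phi : ∀ (g : D.Gal) (m x : carrier) (k : ℕ),
    PS R ^ k • phi (toInvP R (Ext.of (frob R) m)) = toInvP R x →
    PS R ^ k • phi (toInvP R (Ext.of (frob R) (gal g m))) = toInvP R (gal g x)

attribute [instance] KisinDD.addCommGroup KisinDD.module

instance (R : NilpAlg D) : CoeSort (KisinDD D R) (Type u) := ⟨KisinDD.carrier⟩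

namespace KisinDD

variable {R : NilpAlg D} (M : KisinDD D R)

/-- The height of `M` is in `[a, b]`: `P^a M ⊇ φ_M(φ^* M) ⊇ P^b M`. -/
def HasHeight (a b : ℤ) : Prop :=
  (∀ y : Ext (frob R) M, InPowLattice R a (M.phi (toInvP R y))) ∧
  (∀ z : InvP R M, InPowLattice R b z → ∃ y : Ext (frob R) M, M.phi (toInvP R y) = z)

/-- `M / t M`. -/
abbrev Quo (t : SS R) : Type u := M ⧸ (Ideal.span {t} • (⊤ : Submodule (SS R) M))

variable {M}

/-- The class of `m` in `M / t M`. -/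
def Quo.mk (t : SS R) (m : M) : M.Quo t := Submodule.Quotient.mk m

/-- `x` is in `(M / t M)^{(j)}` and `Δ` acts on `x` through `χ_i`. -/
def IsEigenQuo (t : SS R) (j : ZMod D.f) (i : Fin D.n) (x : M.Quo t) : Prop :=
  InComp R j x ∧ ∀ (g : D.Gal) (m : M), Quo.mk t m = x → Quo.mk t (M.gal g m) = cL R (D.chi i g) • x

/-- `x` is in `M^{(j)}` and `Δ` acts on `x` through `χ_i`. -/
def IsEigen (j : ZMod D.f) (i : Fin D.n) (x : M) : Prop :=
  InComp R j x ∧ ∀ g : D.Gal, M.gal g x = cL R (D.chi i g) • x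

variable (M)

/-- `M` has type `τ`: Zariski locally on `Spec R`, each `D^{(j)} = M^{(j)} / v M^{(j)}` is isomorphic
to `τ`. That is, for each `g` in a covering family there are eigenvectors `x_i ∈ D^{(j)}` for
the characters `χ_i` that become a basis of `D^{(j)}[1/g]` over `R[1/g]`. -/
def HasType : Prop :=
  ∃ t : Finset R, Ideal.span (t : Set R) = ⊤ ∧ ∀ g ∈ t, ∀ j : ZMod D.f,
    ∃ x : Fin D.n → M.Quo PowerSeries.X,
      (∀ i, IsEigenQuo PowerSeries.X j i (x i)) ∧
      (∀ y : M.Quo PowerSeries.X, InComp R j y →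
        ∃ (k : ℕ) (c : Fin D.n → R), cR R (g ^ k) • y = ∑ i, cR R (c i) • x i) ∧
      (∀ c : Fin D.n → R, ∑ i, cR R (c i) • x i = 0 → ∃ k : ℕ, ∀ i, g ^ k * c i = 0)

end KisinDD

/-- The objects of `Y^{[a,b],τ}(R)`. -/
structure Y (D : Setup.{u} p) (a b : ℤ) (R : NilpAlg D) extends KisinDD D R where
  height : toKisinDD.HasHeight a b
  type : toKisinDD.HasType

instance (a b : ℤ) (R : NilpAlg D) : CoeSort (Y D a b R) (Type u) := ⟨fun M => M.carrier⟩

/-- A morphism `M → N` of the fibred category `Y^{[a,b],τ}` over `h : R → R'`: an isomorphism of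
the base change of `M` along `h` with `N`, compatible with Frobenius and descent data. -/
structure Arrow {a b : ℤ} {R R' : NilpAlg D} (h : R →ₐ[D.Lam] R') (M : Y D a b R)
    (N : Y D a b R') where
  iso : Ext (baseS h) M ≃ₗ[SS R'] N
  phi_comm : ∀ (m x : M) (k : ℕ),
    PS R ^ k • M.phi (toInvP R (Ext.of (frob R) m)) = toInvP R x →
    PS R' ^ k • N.phi (toInvP R' (Ext.of (frob R') (iso (Ext.of (baseS h) m)))) =
      toInvP R' (iso (Ext.of (baseS h) x))
  gal_comm : ∀ (g : D.Gal) (m : M),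
    iso (Ext.of (baseS h) (M.gal g m)) = N.gal g (iso (Ext.of (baseS h) m))

/-- The underlying map `M → N`. -/
def Arrow.app {a b : ℤ} {R R' : NilpAlg D} {h : R →ₐ[D.Lam] R'} {M : Y D a b R} {N : Y D a b R'}
    (α : Arrow h M N) (m : M) : N := α.iso (Ext.of (baseS h) m)

/-! ## The polynomials `E_j(u)` and `σ_j(P(v))` -/

section Poly

variable (R : NilpAlg D) (j : ZMod D.f)

/-- `E_j(u) = σ_j(E(u))`, over `Λ`. -/
def EL : D.Lam[X] := D.EW.map (D.sigma j : D.W →+* D.Lam)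

/-- `E_j(u)` over `R`. -/
def ER : R[X] := (EL j).map (algebraMap D.Lam R)

/-- The map `R[u] → R[[v]]`, `u ↦ v^(p^f - 1)`. -/
def uToV : R[X] →+* R⟦X⟧ :=
  Polynomial.eval₂RingHom (PowerSeries.C : R →+* R⟦X⟧) (PowerSeries.X ^ D.d)

/-- `σ_j(P(v)) = E_j(v^(p^f - 1))` in `R[[v]]`. -/
def PR : R⟦X⟧ := uToV R (ER R j)

/-- `R[u] / E_j(u)^r`. -/
def Trunc (r : ℕ) : Type u := R[X] ⧸ Ideal.span {ER R j ^ r}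

instance (r : ℕ) : CommRing (Trunc R j r) :=
  inferInstanceAs (CommRing (R[X] ⧸ Ideal.span {ER R j ^ r}))

/-- The quotient map `R[u] → R[u] / E_j(u)^r`. -/
def Trunc.mk (r : ℕ) : R[X] →+* Trunc R j r := Ideal.Quotient.mk _

/-- `R[u] / E_j(u)^r` is a `Λ[u]`-algebra. -/
instance (r : ℕ) : Algebra D.Lam[X] (Trunc R j r) :=
  ((Trunc.mk R j r).comp (Polynomial.mapRingHom (algebraMap D.Lam R))).toAlgebra

/-- `R[[v]] / σ_j(P(v))^r`. -/
abbrev TruncV (r : ℕ) : Type u := R⟦X⟧ ⧸ Ideal.span {PR R j ^ r}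

/-- The map `R[u] / E_j(u)^r → R[[v]] / σ_j(P(v))^r`, `u ↦ v^(p^f - 1)`. -/
def truncToV (r : ℕ) : Trunc R j r →+* TruncV R j r :=
  Ideal.quotientMap (Ideal.span {PR R j ^ r}) (uToV R) (by
    rw [Ideal.span_le, Set.singleton_subset_iff]
    simp only [SetLike.mem_coe, Ideal.mem_comap, map_pow]
    exact Ideal.subset_span rfl)

/-- The transition map `R[u] / E_j(u)^(r+1) → R[u] / E_j(u)^r`. -/
def truncStep (r : ℕ) : Trunc R j (r + 1) →+* Trunc R j r :=
  Ideal.Quotient.factor (by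
    rw [Ideal.span_le, Set.singleton_subset_iff]
    exact Ideal.mem_span_singleton.2 (pow_dvd_pow _ (Nat.le_succ r)))

variable {R}

theorem ER_map {R' : NilpAlg D} (h : R →ₐ[D.Lam] R') :
    (ER R j).map (h : R →+* R') = ER R' j := by
  rw [ER, ER, Polynomial.map_map]
  congr 1
  exact h.comp_algebraMap

/-- The map `R[u] / E_j(u)^r → R'[u] / E_j(u)^r` induced by `h : R → R'`. -/
def truncBase {R' : NilpAlg D} (h : R →ₐ[D.Lam] R') (r : ℕ) :
    Trunc R j r →+* Trunc R' j r :=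
  Ideal.quotientMap (Ideal.span {ER R' j ^ r}) (Polynomial.mapRingHom (h : R →+* R')) (by
    rw [Ideal.span_le, Set.singleton_subset_iff]
    simp only [SetLike.mem_coe, Ideal.mem_comap, map_pow, Polynomial.coe_mapRingHom, ER_map]
    exact Ideal.subset_span rfl)

@[simp] theorem truncBase_mk {R' : NilpAlg D} (h : R →ₐ[D.Lam] R') (r : ℕ) (x : R[X]) :
    truncBase j h r (Trunc.mk R j r x) = Trunc.mk R' j r (x.map (h : R →+* R')) := rfl

end Poly

/-! ## The parabolic `P_j` -/

section Parabolic

variable (j : ZMod D.f) (A : Type u) [CommRing A]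

/-- `Fil^k (A^n)`, for `A^n = τ ⊗ A`: the sum of the isotypic parts for the characters
`χ_{s_j(1)}, …, χ_{s_j(k)}`. -/
def InFil (k : Fin D.n) (x : Fin D.n → A) : Prop :=
  ∀ i, (¬ ∃ l ≤ k, D.χ i = D.χ (D.ori j l)) → x i = 0

/-- The matrices that preserve the filtration. -/
def parabolicAlg : Subalgebra A (Matrix (Fin D.n) (Fin D.n) A) where
  carrier := {x | ∀ k y, InFil j A k y → InFil j A k (x.mulVec y)}
  mul_mem' := by
    intro x x' hx hx' k y hy
    rw [← Matrix.mulVec_mulVec]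
    exact hx k _ (hx' k y hy)
  add_mem' := by
    intro x x' hx hx' k y hy i hi
    rw [Matrix.add_mulVec, Pi.add_apply, hx k y hy i hi, hx' k y hy i hi, add_zero]
  algebraMap_mem' := by
    intro r k y hy i hi
    rw [Algebra.algebraMap_eq_smul_one, Matrix.smul_mulVec, Matrix.one_mulVec, Pi.smul_apply,
      hy i hi, smul_zero]

/-- `P_j(A)`: the stabilizer of the filtration in `GL_n(A)`. -/
def parabolic : Subgroup (GL (Fin D.n) A) where
  carrier := {g | (g : Matrix (Fin D.n) (Fin D.n) A) ∈ parabolicAlg j A ∧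
    ((g⁻¹ : GL (Fin D.n) A) : Matrix (Fin D.n) (Fin D.n) A) ∈ parabolicAlg j A}
  mul_mem' := by
    rintro g h ⟨hg, hg'⟩ ⟨hh, hh'⟩
    refine ⟨?_, ?_⟩
    · rw [Units.val_mul]
      exact mul_mem hg hh
    · rw [mul_inv_rev, Units.val_mul]
      exact mul_mem hh' hg'
  one_mem' := by
    refine ⟨?_, ?_⟩
    · rw [Units.val_one]
      exact one_mem _
    · rw [inv_one, Units.val_one]
      exact one_mem _
  inv_mem' := by
    rintro g ⟨hg, hg'⟩
    exact ⟨hg', by rwa [inv_inv]⟩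

variable {A}

theorem mem_parabolicAlg_iff (x : Matrix (Fin D.n) (Fin D.n) A) :
    x ∈ parabolicAlg j A ↔ ∀ k m i, (∃ l ≤ k, D.χ i = D.χ (D.ori j l)) →
      (¬ ∃ l ≤ k, D.χ m = D.χ (D.ori j l)) → x m i = 0 := by
  constructor
  · intro hx k m i hi hm
    have h := hx k (Pi.single i 1) (fun i' hi' => by
      rw [Pi.single_apply, if_neg]
      rintro rfl
      exact hi' hi) m hm
    simpa using h
  · intro hx k y hy m hm
    change ∑ i, x m i * y i = 0
    refine Finset.sum_eq_zero fun i _ => ?_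
    by_cases hi : ∃ l ≤ k, D.χ i = D.χ (D.ori j l)
    · rw [hx k m i hi hm, zero_mul]
    · rw [hy i hi, mul_zero]

theorem map_mem_parabolic {B : Type u} [CommRing B] (h : A →+* B) {g : GL (Fin D.n) A}
    (hg : g ∈ parabolic j A) : Matrix.GeneralLinearGroup.map h g ∈ parabolic j B := by
  have key : ∀ x : Matrix (Fin D.n) (Fin D.n) A, x ∈ parabolicAlg j A →
      x.map h ∈ parabolicAlg j B := by
    intro x hx
    rw [mem_parabolicAlg_iff] at hx ⊢
    intro k m i hi hm
    rw [Matrix.map_apply, hx k m i hi hm, map_zero]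
  refine ⟨key _ hg.1, ?_⟩
  rw [← map_inv]
  exact key _ hg.2

end Parabolic

/-! ## The positive loop groups `L^{+,E_j(u)} 𝒫_j` -/

section Loop

variable (R : NilpAlg D) (j : ZMod D.f)

/-- `R[u] / (E_j(u)^r, u)`. -/
abbrev TruncU (r : ℕ) : Type u := Trunc R j r ⧸ Ideal.span {Trunc.mk R j r Polynomial.X}

/-- `L^{+,E_j(u)} 𝒫_j (R)`: the elements `g = (g_r)` of
`L^{+,E_j(u)} GL_n (R) = lim_r GL_n(R[u]/E_j(u)^r)` with `g mod u` in `P_j`. -/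
def LoopP : Subgroup (∀ r : ℕ, GL (Fin D.n) (Trunc R j r)) where
  carrier := {g | (∀ r, Matrix.GeneralLinearGroup.map (truncStep R j r) (g (r + 1)) = g r) ∧
    ∀ r, Matrix.GeneralLinearGroup.map
      (Ideal.Quotient.mk (Ideal.span {Trunc.mk R j r Polynomial.X})) (g r) ∈
        parabolic j (TruncU R j r)}
  mul_mem' := by
    rintro g h ⟨hg, hg'⟩ ⟨hh, hh'⟩
    refine ⟨fun r => ?_, fun r => ?_⟩
    · rw [Pi.mul_apply, Pi.mul_apply, map_mul, hg, hh]
    · rw [Pi.mul_apply, map_mul]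
      exact mul_mem (hg' r) (hh' r)
  one_mem' := ⟨fun r => by simp, fun r => by
    rw [Pi.one_apply, map_one]
    exact one_mem _⟩
  inv_mem' := by
    rintro g ⟨hg, hg'⟩
    refine ⟨fun r => ?_, fun r => ?_⟩
    · rw [Pi.inv_apply, Pi.inv_apply, map_inv, hg]
    · rw [Pi.inv_apply, map_inv]
      exact inv_mem (hg' r)

/-- The group `∏_j L^{+,E_j(u)} 𝒫_j (R)`. -/
abbrev LoopGroup : Type u := ∀ j : ZMod D.f, LoopP R j

variable {R}

/-- The map `L^{+,E_j(u)} 𝒫_j (R) → L^{+,E_j(u)} 𝒫_j (R')` induced by `h : R → R'`. -/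
def loopPMap {R' : NilpAlg D} (h : R →ₐ[D.Lam] R') : LoopP R j →* LoopP R' j where
  toFun g := ⟨fun r => Matrix.GeneralLinearGroup.map (truncBase j h r) (g.1 r), by
    refine ⟨fun r => ?_, fun r => ?_⟩
    · have hc : (truncStep R' j r).comp (truncBase j h (r + 1)) =
          (truncBase j h r).comp (truncStep R j r) :=
        Ideal.Quotient.ringHom_ext (RingHom.ext fun x => rfl)
      change _ = Matrix.GeneralLinearGroup.map (truncBase j h r) (g.1 r)
      rw [← g.2.1 r]
      ext m i
      exact RingHom.congr_fun hc _
    · have hle : Ideal.span {Trunc.mk R j r Polynomial.X} ≤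
          (Ideal.span {Trunc.mk R' j r Polynomial.X}).comap (truncBase j h r) := by
        rw [Ideal.span_le, Set.singleton_subset_iff]
        simp only [SetLike.mem_coe, Ideal.mem_comap, truncBase_mk, Polynomial.map_X]
        exact Ideal.subset_span rfl
      have hm := map_mem_parabolic j
        (Ideal.quotientMap (Ideal.span {Trunc.mk R' j r Polynomial.X}) (truncBase j h r) hle)
        (g.2.2 r)
      exact hm⟩
  map_one' := by
    ext r : 2
    simp
  map_mul' g g' := by
    ext r : 2
    simp

/-- The map `∏_j L^{+,E_j(u)} 𝒫_j (R) → ∏_j L^{+,E_j(u)} 𝒫_j (R')`. -/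
def loopGroupMap {R' : NilpAlg D} (h : R →ₐ[D.Lam] R') : LoopGroup R →* LoopGroup R' where
  toFun g j := loopPMap j h (g j)
  map_one' := by
    funext j
    simp
  map_mul' g g' := by
    funext j
    simp

end Loop

/-! ## The parahoric group schemes and the groups `𝒫_{j,N}` -/

section Parahoric

variable (j : ZMod D.f)

variable (D) in
/-- The parahoric order `𝔄_j = {x ∈ M_n(Λ[u]) : x mod u preserves the filtration}`. -/
def order : Subalgebra D.Lam[X] (Matrix (Fin D.n) (Fin D.n) D.Lam[X]) where
  carrier := {x | x.map (Polynomial.constantCoeff : D.Lam[X] →+* D.Lam) ∈ parabolicAlg j D.Lam}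
  mul_mem' := by
    intro x y hx hy
    simp only [Set.mem_ofPred_eq, Matrix.map_mul] at hx hy ⊢
    exact mul_mem hx hy
  add_mem' := by
    intro x y hx hy
    simp only [Set.mem_ofPred_eq] at hx hy ⊢
    rw [Matrix.map_add _ (map_add _)]
    exact add_mem hx hy
  algebraMap_mem' := by
    intro r
    have h : ((algebraMap D.Lam[X] (Matrix (Fin D.n) (Fin D.n) D.Lam[X])) r).map
        (Polynomial.constantCoeff : D.Lam[X] →+* D.Lam) =
        algebraMap D.Lam _ (Polynomial.constantCoeff r) := by
      rw [Matrix.algebraMap_eq_diagonal, Matrix.algebraMap_eq_diagonal,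
        Matrix.diagonal_map (map_zero _)]
      rfl
    simp only [Set.mem_ofPred_eq, h]
    exact Subalgebra.algebraMap_mem _ _

/-- `𝒫_j(A) = (A ⊗ 𝔄_j)ˣ` for a `Λ[u]`-algebra `A`: the parahoric group scheme over `Λ[u]`
attached to `P_j`, as the unit group of the order `𝔄_j`. -/
abbrev Parahoric (A : Type u) [CommRing A] [Algebra D.Lam[X] A] : Type u :=
  (A ⊗[D.Lam[X]] order D j)ˣ

/-- `𝒫_{j,N}(R) = 𝒫_j(R[u]/E_j(u)^N)`, the Weil restriction of the parahoric group scheme from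
`Λ[u]/E_j(u)^N` to `Λ`. -/
abbrev ParahoricN (R : NilpAlg D) (N : ℕ) : Type u := Parahoric j (Trunc R j N)

/-- The group `∏_j 𝒫_{j,N}(R)`. -/
abbrev ParahoricGroup (N : ℕ) (R : NilpAlg D) : Type u := ∀ j : ZMod D.f, ParahoricN j R N

/-- The map `R[u]/E_j(u)^r → R'[u]/E_j(u)^r` as a map of `Λ[u]`-algebras. -/
def truncBaseAlg {R R' : NilpAlg D} (h : R →ₐ[D.Lam] R') (r : ℕ) :
    Trunc R j r →ₐ[D.Lam[X]] Trunc R' j r where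
  __ := truncBase j h r
  commutes' x := by
    change truncBase j h r (Trunc.mk R j r (x.map (algebraMap D.Lam R))) =
      Trunc.mk R' j r (x.map (algebraMap D.Lam R'))
    rw [truncBase_mk, Polynomial.map_map]
    congr 2
    exact h.comp_algebraMap

/-- The map `∏_j 𝒫_{j,N}(R) → ∏_j 𝒫_{j,N}(R')` induced by `h : R → R'`. -/
def parahoricGroupMap (N : ℕ) {R R' : NilpAlg D} (h : R →ₐ[D.Lam] R') :
    ParahoricGroup N R →* ParahoricGroup N R' where
  toFun g j := Units.map
    (Algebra.TensorProduct.map (truncBaseAlg j h N) (AlgHom.id D.Lam[X] (order D j))).toMonoidHom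
    (g j)
  map_one' := by
    funext j
    simp
  map_mul' g g' := by
    funext j
    simp

end Parahoric

/-! ## Eigenbases -/

section Eigenbasis

variable {a b : ℤ} {R : NilpAlg D}

/-- An eigenbasis of `M`: for each `j` an `R[[v]]`-basis of `M^{(j)}` whose `i`-th member lies in the
`χ_i`-isotypic part. The objects of the total space over `M` are the pairs `(M, β)`. -/
@[ext] structure Eigenbasis (M : Y D a b R) where
  vec : ZMod D.f → Fin D.n → M
  eigen : ∀ j i, KisinDD.IsEigen (M := M.toKisinDD) j i (vec j i)
  span : ∀ j (y : M), InComp R j y → ∃ c : Fin D.n → R⟦X⟧, y = ∑ i, incl R (c i) • vec j i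
  indep : ∀ j (c : Fin D.n → R⟦X⟧), ∑ i, incl R (c i) • vec j i = 0 → ∀ i, c i = 0

/-- `M / P(v)^N M`. -/
abbrev QuoN (N : ℕ) (M : Y D a b R) : Type u := M.toKisinDD.Quo (PS R ^ N)

/-- The reduction map `M → M / P(v)^N M`. -/
def QuoN.mk (N : ℕ) {M : Y D a b R} (m : M) : QuoN N M := KisinDD.Quo.mk (PS R ^ N) m

/-- An eigenbasis of `M` modulo `P(v)^N`: for each `j` a basis of
`(M / P(v)^N M)^{(j)} = M^{(j)} / σ_j(P(v))^N M^{(j)}` over `R[[v]] / σ_j(P(v))^N` whose `i`-th member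
lies in the `χ_i`-isotypic part. -/
@[ext] structure EigenbasisMod (N : ℕ) (M : Y D a b R) where
  vec : ZMod D.f → Fin D.n → QuoN N M
  eigen : ∀ j i, KisinDD.IsEigenQuo (M := M.toKisinDD) (PS R ^ N) j i (vec j i)
  span : ∀ j (y : QuoN N M), InComp R j y →
    ∃ c : Fin D.n → R⟦X⟧, y = ∑ i, incl R (c i) • vec j i
  indep : ∀ j (c : Fin D.n → R⟦X⟧), ∑ i, incl R (c i) • vec j i = 0 →
    ∀ i, c i ∈ Ideal.span {PR R j ^ N}

/-- `e'` is the image of the eigenbasis `e` under the base change morphism `α`. -/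
def Eigenbasis.Pull {R' : NilpAlg D} {h : R →ₐ[D.Lam] R'} {M : Y D a b R} {M' : Y D a b R'}
    (α : Arrow h M M') (e : Eigenbasis M) (e' : Eigenbasis M') : Prop :=
  ∀ j i, α.app (e.vec j i) = e'.vec j i

/-- `e'` is the image of `e` under the map `M / P(v)^N M → M' / P(v)^N M'` induced by `α`. -/
def EigenbasisMod.Pull {N : ℕ} {R' : NilpAlg D} {h : R →ₐ[D.Lam] R'} {M : Y D a b R}
    {M' : Y D a b R'} (α : Arrow h M M') (e : EigenbasisMod N M) (e' : EigenbasisMod N M') : Prop :=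
  ∀ j i (m : M), QuoN.mk N m = e.vec j i → QuoN.mk N (α.app m) = e'.vec j i

end Eigenbasis

/-! ## The actions on eigenbases -/

section Action

variable {a b : ℤ} {R : NilpAlg D}

variable (D) in
/-- The diagonal matrix with entries `v^(a_i^{(j)})` over a ring with an element `v`. -/
def diagV (j : ZMod D.f) {A : Type u} [CommRing A] (v : A) : Matrix (Fin D.n) (Fin D.n) A :=
  Matrix.diagonal fun i => v ^ D.ex j i

/-- The right action of `∏_j L^{+,E_j(u)} 𝒫_j (R)`: `e' = e · g` if for each `j`
the transition matrix `B ∈ M_n(R[[v]])`, `e'_k = ∑_m B_{mk} e_m`, satisfies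
`D B = g_j(v^(p^f - 1)) D` with `D = diag(v^(a_i^{(j)}))`, i.e. `B = D⁻¹ g_j D`.
The identity is to hold modulo `σ_j(P(v))^r` for all `r`. -/
def Eigenbasis.Act {M : Y D a b R} (e : Eigenbasis M) (g : LoopGroup R) (e' : Eigenbasis M) :
    Prop :=
  ∀ j, ∃ B : Matrix (Fin D.n) (Fin D.n) R⟦X⟧,
    (∀ k, e'.vec j k = ∑ m, incl R (B m k) • e.vec j m) ∧
    ∀ r : ℕ,
      diagV D j (Ideal.Quotient.mk (Ideal.span {PR R j ^ r}) PowerSeries.X) *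
          B.map (Ideal.Quotient.mk (Ideal.span {PR R j ^ r})) =
        ((g j).1 r : Matrix (Fin D.n) (Fin D.n) (Trunc R j r)).map (truncToV R j r) *
          diagV D j (Ideal.Quotient.mk (Ideal.span {PR R j ^ r}) PowerSeries.X)

/-- `y = D⁻¹ x(v^(p^f - 1)) D` over `Λ[v]`, with `D = diag(v^(a_i^{(j)}))`. -/
def IsConj (j : ZMod D.f) (x y : Matrix (Fin D.n) (Fin D.n) D.Lam[X]) : Prop :=
  diagV D j Polynomial.X * y =
    x.map (Polynomial.expand D.Lam D.d) * diagV D j Polynomial.X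

variable (R) in
/-- The map `Λ[v] → R[[v]] / σ_j(P(v))^N`. -/
def polyToV (j : ZMod D.f) (N : ℕ) : D.Lam[X] →+* TruncV R j N :=
  (Ideal.Quotient.mk (Ideal.span {PR R j ^ N})).comp
    (Polynomial.coeToPowerSeries.ringHom.comp (Polynomial.mapRingHom (algebraMap D.Lam R)))

/-- The ring homomorphism `ψ : (R[u]/E_j(u)^N) ⊗ 𝔄_j → M_n(R[[v]] / σ_j(P(v))^N)` is
`c ⊗ x ↦ c(v^(p^f - 1)) D⁻¹ x(v^(p^f - 1)) D`. There is exactly one such homomorphism. -/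
def IsConjHom (j : ZMod D.f) (N : ℕ)
    (ψ : (Trunc R j N ⊗[D.Lam[X]] order D j) →+* Matrix (Fin D.n) (Fin D.n) (TruncV R j N)) :
    Prop :=
  ∀ (c : Trunc R j N) (x : order D j) (y : Matrix (Fin D.n) (Fin D.n) D.Lam[X]),
    IsConj j x.1 y → ψ (c ⊗ₜ x) = truncToV R j N c • y.map (polyToV R j N)

/-- The right action of `∏_j 𝒫_{j,N}(R)`: `e' = e · g` if for each `j` one has
`e'_k = ∑_m B_{mk} e_m` with `B` modulo `σ_j(P(v))^N` the image of `g_j` under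
`c ⊗ x ↦ c D⁻¹ x D`. -/
def EigenbasisMod.Act {N : ℕ} {M : Y D a b R} (e : EigenbasisMod N M) (g : ParahoricGroup N R)
    (e' : EigenbasisMod N M) : Prop :=
  ∀ j, ∃ ψ : (Trunc R j N ⊗[D.Lam[X]] order D j) →+* Matrix (Fin D.n) (Fin D.n) (TruncV R j N),
    IsConjHom j N ψ ∧
    ∃ B : Matrix (Fin D.n) (Fin D.n) R⟦X⟧,
      (∀ k, e'.vec j k = ∑ m, incl R (B m k) • e.vec j m) ∧
      B.map (Ideal.Quotient.mk (Ideal.span {PR R j ^ N})) =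
        ψ (g j : Trunc R j N ⊗[D.Lam[X]] order D j)

end Action

/-! ## Torsors, smooth and formally smooth morphisms over `Y^{[a,b],τ}`

A morphism of stacks to `Y^{[a,b],τ}` whose objects over `M` are pairs `(M, e)` with `e` in a set
`T M` is the same as the presheaf `T` on the fibred category `Y^{[a,b],τ}`. Below, `pull α e e'`
says that `e'` is the pullback of `e` along `α`, and `act e g e'` says that `e' = e · g`. -/

section Torsor

/-- Every object of `Y^{[a,b],τ}` has a pullback along every map of `Nilp_Λ`. -/
def HasPullbacks (D : Setup.{u} p) (a b : ℤ) : Prop :=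
  ∀ (R R' : NilpAlg D) (h : R →ₐ[D.Lam] R') (M : Y D a b R),
    ∃ M' : Y D a b R', Nonempty (Arrow h M M')

variable {a b : ℤ} (T : ∀ R : NilpAlg D, Y D a b R → Type u)
  (pull : ∀ (R R' : NilpAlg D) (h : R →ₐ[D.Lam] R') (M : Y D a b R) (M' : Y D a b R'),
    Arrow h M M' → T R M → T R' M' → Prop)

/-- `T` is a (right) torsor over `Y^{[a,b],τ}` for the group functor `G` and the Zariski topology:
a sheaf of sets with an action of `G` that is compatible with pullback, simply transitive where
sections exist, and Zariski locally has sections. -/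
structure IsZariskiTorsor (G : NilpAlg D → Type u) [∀ R, Group (G R)]
    (Gmap : ∀ (R R' : NilpAlg D), (R →ₐ[D.Lam] R') → G R →* G R')
    (act : ∀ (R : NilpAlg D) (M : Y D a b R), T R M → G R → T R M → Prop) : Prop where
  exists_pull : ∀ (R R' : NilpAlg D) (h : R →ₐ[D.Lam] R') (M : Y D a b R) (M' : Y D a b R')
    (α : Arrow h M M') (e : T R M), ∃! e' : T R' M', pull R R' h M M' α e e'
  glue : ∀ (R : NilpAlg D) (M : Y D a b R) (t : Finset R), Ideal.span (t : Set R) = ⊤ →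
    ∀ (M' : ∀ g : t, Y D a b (R.away g.1)) (α : ∀ g : t, Arrow (R.toAway g.1) M (M' g))
      (e' : ∀ g : t, T (R.away g.1) (M' g)),
      (∀ (g₁ g₂ : t) (R'' : NilpAlg D) (h₁ : R.away g₁.1 →ₐ[D.Lam] R'')
        (h₂ : R.away g₂.1 →ₐ[D.Lam] R''),
        h₁.comp (R.toAway g₁.1) = h₂.comp (R.toAway g₂.1) →
        ∀ (M'' : Y D a b R'') (β₁ : Arrow h₁ (M' g₁) M'') (β₂ : Arrow h₂ (M' g₂) M''),
          (∀ m : M, β₁.app ((α g₁).app m) = β₂.app ((α g₂).app m)) →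
          ∀ e₁ e₂ : T R'' M'', pull _ _ h₁ _ _ β₁ (e' g₁) e₁ → pull _ _ h₂ _ _ β₂ (e' g₂) e₂ →
            e₁ = e₂) →
      ∃! e : T R M, ∀ g : t, pull _ _ _ _ _ (α g) e (e' g)
  exists_act : ∀ (R : NilpAlg D) (M : Y D a b R) (e : T R M) (g : G R), ∃! e', act R M e g e'
  act_one : ∀ (R : NilpAlg D) (M : Y D a b R) (e : T R M), act R M e 1 e
  act_mul : ∀ (R : NilpAlg D) (M : Y D a b R) (e e' e'' : T R M) (g g' : G R),
    act R M e g e' → act R M e' g' e'' → act R M e (g * g') e''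
  act_pull : ∀ (R R' : NilpAlg D) (h : R →ₐ[D.Lam] R') (M : Y D a b R) (M' : Y D a b R')
    (α : Arrow h M M') (e₁ e₂ : T R M) (g : G R) (e₁' e₂' : T R' M'),
    act R M e₁ g e₂ → pull R R' h M M' α e₁ e₁' → pull R R' h M M' α e₂ e₂' →
    act R' M' e₁' (Gmap R R' h g) e₂'
  simply_transitive : ∀ (R : NilpAlg D) (M : Y D a b R) (e e' : T R M), ∃! g : G R, act R M e g e'
  locally_nonempty : ∀ (R : NilpAlg D) (M : Y D a b R), ∃ t : Finset R,
    Ideal.span (t : Set R) = ⊤ ∧ ∀ g ∈ t, ∃ (M' : Y D a b (R.away g))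
      (_ : Arrow (R.toAway g) M M'), Nonempty (T (R.away g) M')

/-- The morphism to `Y^{[a,b],τ}` given by `T` is (representable and) smooth: for each `R` in
`Nilp_Λ` and each `M` in `Y^{[a,b],τ}(R)`, the fibre product of `T` with `Spec R` over `Y^{[a,b],τ}` is
`Spec B` for a smooth `R`-algebra `B`, with universal object `(MB, eB)`. -/
def IsSmoothOver : Prop :=
  ∀ (R : NilpAlg D) (M : Y D a b R), ∃ (B : NilpAlg D) (i : R →ₐ[D.Lam] B) (MB : Y D a b B)
    (α : Arrow i M MB) (eB : T B MB), (i : R →+* B).Smooth ∧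
    ∀ (R' : NilpAlg D) (h : R →ₐ[D.Lam] R') (M' : Y D a b R') (β : Arrow h M M') (e' : T R' M'),
      ∃! c : B →ₐ[D.Lam] R', c.comp i = h ∧
        ∃ γ : Arrow c MB M', (∀ m : M, γ.app (α.app m) = β.app m) ∧
          pull B R' c MB M' γ eB e'

/-- The morphism to `Y^{[a,b],τ}` given by `T` is formally smooth: sections lift along surjections
with nilpotent kernel. -/
def IsFormallySmoothOver : Prop :=
  ∀ (R R' : NilpAlg D) (h : R →ₐ[D.Lam] R'), Function.Surjective h →
    IsNilpotent (RingHom.ker (h : R →+* R')) →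
    ∀ (M : Y D a b R) (M' : Y D a b R') (α : Arrow h M M') (e' : T R' M'),
      ∃ e : T R M, pull R R' h M M' α e e'

end Torsor

end KisinDescent

end

/-! The structure of Δ and of W reduces everything to bases. Since W/p has p^f elements, the f maps
φ^{-j} mod p are distinct, and Dedekind independence makes the matrix of conjugates of a basis of W
invertible (`Setup.isUnit_det_conjMatrix`). Hence W ⊗ R ≅ ∏_j R through the σ_j, and an eigenbasis
of 𝔐 is the same as one (W ⊗ R)[[v]]-basis (x_i) with Δ acting on x_i through χ_i (`IsEB`), its j-th
part being (ε_j x_i). The character ω identifies Δ with the d-th roots of unity of W, where d = p^f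
- 1. So Δ is cyclic, d is invertible wherever p is nilpotent, and χ_i is the power a_i^(j) of σ_j ∘
ω for every j.

Existence and lifting come from `exists_isEB_of_mod`. A family that is an eigenbasis modulo a
Δ-stable ideal I is averaged over Δ into exact eigenvectors without changing it modulo I, and
Nakayama makes it a basis if I lies in the Jacobson radical. With I = (P^N) this lifts eigenbases
modulo P^N to exact ones. With I the kernel of base change along a surjection with nilpotent kernel
it gives formal smoothness. A variant modulo v turns the type condition into local eigenbases. The
ideal (P^N) is allowed because E is a power of u modulo p, so E_j is u^m plus a nilpotent polynomial
and the E_j-adic and u-adic topologies agree.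

Simple transitivity is a computation of transition matrices (`semiInv_iff`). With ζ the value of σ_j
∘ ω at a generator, an entry satisfies ζ^{a_m} B_mk(ζv) = ζ^{a_k} B_mk(v). Differences of distinct
powers of ζ are units, so B_mk = v^e h(v^d) with 0 ≤ e < d and a_m + e = a_k + dε, where ε = 1 if
a_m > a_k and ε = 0 otherwise. This says B = D⁻¹ G(v^d) D with G_mk = u^ε h_mk, and divisibility by
u for a_m > a_k is exactly the condition that G mod u lies in P_j. As R[u]/E_j^r = R[[u]]/E_j^r, the
limit over r is R[[u]], which gives L⁺𝒫_j. The truncated group follows because 𝔄_j is free on the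
matrices u^ε times elementary matrices.

The sheaf property and representability rest on natural coordinates of (W ⊗ R)[[v]] modulo 0 or P^N
with values in R (`IsCoord`). Together with a dual basis of 𝔐 they reduce gluing of eigenbases to
gluing of elements of R. Modulo P^N the coordinates are finite in number, and eigenbases are the
solutions of finitely many polynomial equations (`frameRel`), hence are represented by a finitely
presented algebra. Lifting of eigenbases and universality make it formally smooth, thus smooth. -/

noncomputable section

namespace KisinDescent

/-! ### Base change of modules along semilinear maps, and Nakayama for bases -/

section BaseChange

variable {S T U : Type u} [CommRing S] [CommRing T] [CommRing U] {g : S →+* T} {g₂ : T →+* U}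
  {g₃ : S →+* U}

/-- The semilinear map `m ↦ 1 ⊗ m`. -/
def Ext.ofₛₗ (g : S →+* T) (M : Type u) [AddCommGroup M] [Module S M] : M →ₛₗ[g] Ext g M where
  toFun := Ext.of g
  map_add' x y := TensorProduct.tmul_add (1 : Along g) x y
  map_smul' s m := by
    have h : (1 : Along g) ⊗ₜ[S] (s • m) = (s • (1 : Along g)) ⊗ₜ[S] m :=
      (TensorProduct.smul_tmul s (1 : Along g) m).symm
    change (1 : Along g) ⊗ₜ[S] (s • m) = (show Along g from g s) • ((1 : Along g) ⊗ₜ[S] m)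
    rw [h, TensorProduct.smul_tmul', Algebra.smul_def]
    rfl

variable {M M' M'' N : Type u} [AddCommGroup M] [Module S M] [AddCommGroup M'] [Module T M']
  [AddCommGroup M''] [Module U M''] [AddCommGroup N]

theorem Ext.span_of : Submodule.span T (Set.range (Ext.of (M := M) g)) = ⊤ := by
  rw [eq_top_iff]
  rintro x -
  refine TensorProduct.induction_on (R := S) (M := Along g) (N := M) x (zero_mem _) (fun t m => ?_)
    (fun x y hx hy => add_mem hx hy)
  have h : (t ⊗ₜ[S] m : Along g ⊗[S] M) = t • ((1 : Along g) ⊗ₜ[S] m) := by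
    rw [TensorProduct.smul_tmul', smul_eq_mul, mul_one]
  rw [h]
  exact Submodule.smul_mem (R := T) _ t (Submodule.subset_span ⟨m, rfl⟩)

theorem semilinear_ext_of_span {M : Type*} [Module U N] {f : M → M'}
    (hf : Submodule.span T (Set.range f) = ⊤) {k k' : M' →ₛₗ[g₂] N}
    (h : ∀ m, k (f m) = k' (f m)) : k = k' := by
  ext x
  have hx : x ∈ Submodule.span T (Set.range f) := hf ▸ Submodule.mem_top
  induction hx using Submodule.span_induction with
  | mem x hx => obtain ⟨m, rfl⟩ := hx; exact h m
  | zero => rw [map_zero, map_zero]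
  | add x y _ _ hx hy => rw [map_add, map_add, hx, hy]
  | smul a x _ hx => rw [map_smulₛₗ, map_smulₛₗ, hx]

/-- Universal property of T ⊗_S M for maps that are semilinear over a further ring homomorphism. The
relation g₂ ∘ g = g₃ is a pointwise hypothesis so that it covers commutations such as that of
Frobenius with base change, which do not hold by definition. -/
theorem Ext.exists_lift [Module U N] (h : ∀ s, g₂ (g s) = g₃ s) (k : M →ₛₗ[g₃] N) :
    ∃ k' : Ext g M →ₛₗ[g₂] N, ∀ m, k' (Ext.of g m) = k m := by
  let gA : Along g →+* U := g₂
  let F : Along g →+ M →+ N :=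
    AddMonoidHom.mk' (fun t => AddMonoidHom.mk' (fun m => gA t • k m) (fun x y => by simp))
      (fun t t' => by
        ext m
        change gA (t + t') • k m = gA t • k m + gA t' • k m
        rw [map_add, add_smul])
  let L : Along g ⊗[S] M →+ N := TensorProduct.liftAddHom F (fun s t m => by
    have hs : gA (algebraMap S (Along g) s) = g₃ s := h s
    change gA (s • t) • k m = gA t • k (s • m)
    rw [Algebra.smul_def, map_mul, hs, map_smulₛₗ, smul_smul, mul_comm])
  have hL : ∀ (t : Along g) (m : M), L (t ⊗ₜ m) = gA t • k m := fun t m => rfl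
  have hsm : ∀ (t : Along g) (x : Along g ⊗[S] M), L (t • x) = gA t • L x := fun t x => by
    induction x with
    | zero => rw [smul_zero, map_zero, smul_zero]
    | tmul t' m => rw [TensorProduct.smul_tmul', hL, hL, smul_smul, smul_eq_mul, map_mul]
    | add x y hx hy => rw [smul_add, map_add, map_add, smul_add, hx, hy]
  refine ⟨{ toFun := L, map_add' := L.map_add, map_smul' := hsm }, fun m => ?_⟩
  change L (1 ⊗ₜ m) = k m
  rw [hL, map_one, one_smul]

/-- The semilinear map `f : M → M'` exhibits `M'` as the base change of `M`. -/
def IsBC (f : M →ₛₗ[g] M') : Prop :=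
  Submodule.span T (Set.range f) = ⊤ ∧
    ∃ j : M' →ₗ[T] Ext g M, ∀ m, j (f m) = Ext.of g m

theorem IsBC.ofₛₗ : IsBC (Ext.ofₛₗ g M) := ⟨Ext.span_of, LinearMap.id, fun _ => rfl⟩

theorem IsBC.exists_lift {f : M →ₛₗ[g] M'} (hf : IsBC f) [Module U N]
    (h : ∀ s, g₂ (g s) = g₃ s) (k : M →ₛₗ[g₃] N) :
    ∃ k' : M' →ₛₗ[g₂] N, ∀ m, k' (f m) = k m := by
  obtain ⟨k', hk'⟩ := Ext.exists_lift h k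
  obtain ⟨j, hj⟩ := hf.2
  exact ⟨k'.comp j, fun m => by rw [LinearMap.comp_apply, hj, hk']⟩

theorem IsBC.ext {f : M →ₛₗ[g] M'} (hf : IsBC f) [Module U N] {k k' : M' →ₛₗ[g₂] N}
    (h : ∀ m, k (f m) = k' (f m)) : k = k' := semilinear_ext_of_span hf.1 h

theorem span_range_trans {f : M →ₛₗ[g] M'} (hf : Submodule.span T (Set.range f) = ⊤)
    {f₂ : M' →ₛₗ[g₂] M''} (hf₂ : Submodule.span U (Set.range f₂) = ⊤) {f₃ : M → M''}
    (h : ∀ m, f₂ (f m) = f₃ m) : Submodule.span U (Set.range f₃) = ⊤ := by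
  rw [eq_top_iff, ← hf₂, Submodule.span_le]
  rintro _ ⟨x, rfl⟩
  have hx : x ∈ Submodule.span T (Set.range f) := hf ▸ Submodule.mem_top
  induction hx using Submodule.span_induction with
  | mem x hx => obtain ⟨m, rfl⟩ := hx; exact Submodule.subset_span ⟨m, (h m).symm⟩
  | zero => rw [map_zero]; exact zero_mem _
  | add x y _ _ hx hy => rw [map_add]; exact add_mem hx hy
  | smul a x _ hx => rw [map_smulₛₗ]; exact Submodule.smul_mem _ _ hx

theorem IsBC.trans {f : M →ₛₗ[g] M'} (hf : IsBC f) {f₂ : M' →ₛₗ[g₂] M''} (hf₂ : IsBC f₂)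
    {f₃ : M →ₛₗ[g₃] M''} (hg : ∀ s, g₂ (g s) = g₃ s) (h : ∀ m, f₂ (f m) = f₃ m) : IsBC f₃ := by
  refine ⟨span_range_trans hf.1 hf₂.1 h, ?_⟩
  obtain ⟨k, hk⟩ := hf.exists_lift hg (Ext.ofₛₗ g₃ M)
  obtain ⟨j, hj⟩ := hf₂.exists_lift (g₂ := RingHom.id U) (fun _ => rfl) k
  exact ⟨j, fun m => by rw [← h, hj, hk]; rfl⟩

/-- The half of transitivity that makes arrows of the fibred category cartesian: a map between two
base changes of M that is compatible with the maps from M is itself a base change. -/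
theorem IsBC.cancel {f : M →ₛₗ[g] M'} (hf : IsBC f) {f₂ : M' →ₛₗ[g₂] M''}
    {f₃ : M →ₛₗ[g₃] M''} (hf₃ : IsBC f₃) (hg : ∀ s, g₂ (g s) = g₃ s)
    (h : ∀ m, f₂ (f m) = f₃ m) : IsBC f₂ := by
  refine ⟨?_, ?_⟩
  · rw [eq_top_iff, ← hf₃.1]
    refine Submodule.span_mono ?_
    rintro _ ⟨m, rfl⟩
    exact ⟨f m, h m⟩
  · let k₀ : M →ₛₗ[g₃] Ext g₂ M' :=
      { toFun := fun m => Ext.of g₂ (f m)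
        map_add' := fun x y => by
          rw [map_add]
          exact (Ext.ofₛₗ g₂ M').map_add _ _
        map_smul' := fun s x => by
          rw [map_smulₛₗ, ← hg]
          exact (Ext.ofₛₗ g₂ M').map_smulₛₗ _ _ }
    obtain ⟨j, hj⟩ := hf₃.exists_lift (g₂ := RingHom.id U) (fun _ => rfl) k₀
    have he : j.comp f₂ = Ext.ofₛₗ g₂ M' := hf.ext fun m => by
      rw [LinearMap.comp_apply, h, hj]; rfl
    exact ⟨j, fun m => by rw [← LinearMap.comp_apply, he]; rfl⟩

theorem IsBC.bijective_lift {f : M →ₛₗ[g] M'} (hf : IsBC f) {k : Ext g M →ₗ[T] M'}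
    (hk : ∀ m, k (Ext.of g m) = f m) : Function.Bijective k := by
  obtain ⟨j, hj⟩ := hf.2
  have h₁ : k ∘ₗ j = LinearMap.id := hf.ext fun m => by
    rw [LinearMap.comp_apply, hj, hk]; rfl
  have h₂ : j ∘ₗ k = LinearMap.id := IsBC.ofₛₗ.ext fun m => by
    rw [LinearMap.comp_apply]
    erw [hk, hj]
    rfl
  exact Function.bijective_iff_has_inverse.2
    ⟨j, fun x => LinearMap.congr_fun h₂ x, fun x => LinearMap.congr_fun h₁ x⟩

/-- The base change of a module as a linear equivalence. -/
def IsBC.equiv {f : M →ₛₗ[g] M'} (hf : IsBC f) : Ext g M ≃ₗ[T] M' :=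
  LinearEquiv.ofBijective
    (Ext.exists_lift (g := g) (g₂ := RingHom.id T) (fun _ => rfl) f).choose
    (hf.bijective_lift
      (Ext.exists_lift (g := g) (g₂ := RingHom.id T) (fun _ => rfl) f).choose_spec)

theorem IsBC.equiv_of {f : M →ₛₗ[g] M'} (hf : IsBC f) (m : M) :
    hf.equiv (Ext.of g m) = f m :=
  (Ext.exists_lift (g := g) (g₂ := RingHom.id T) (fun _ => rfl) f).choose_spec m

theorem IsBC.of_equiv (e : Ext g M ≃ₗ[T] M') {f : M →ₛₗ[g] M'} (h : ∀ m, e (Ext.of g m) = f m) :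
    IsBC f := by
  refine ⟨?_, e.symm, fun m => by rw [← h, LinearEquiv.coe_coe, LinearEquiv.symm_apply_apply]⟩
  exact span_range_trans (g₂ := RingHom.id T) (f := Ext.ofₛₗ g M) (f₂ := e.toLinearMap) Ext.span_of
    (by
      have := e.range
      rw [eq_top_iff, ← this]
      rintro _ ⟨x, rfl⟩
      exact Submodule.subset_span ⟨x, rfl⟩) h

theorem finite_ext [Module.Finite S M] : Module.Finite T (Ext g M) :=
  inferInstanceAs (Module.Finite (Along g) (Along g ⊗[S] M))

theorem projective_ext [Module.Projective S M] : Module.Projective T (Ext g M) :=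
  inferInstanceAs (Module.Projective (Along g) (Along g ⊗[S] M))

/-- `x` is a basis of `M`. -/
def IsBas {ι : Type*} (S : Type u) [CommRing S] {M : Type u} [AddCommGroup M] [Module S M]
    (x : ι → M) : Prop :=
  LinearIndependent S x ∧ Submodule.span S (Set.range x) = ⊤

/-- Linear forms extend along base change. Applied to a dual basis, this reduces statements about 𝔐
to statements about power series, with no need for 𝔐 to be free. -/
theorem IsBC.exists_functional {f : M →ₛₗ[g] M'} (hf : IsBC f) (s : M →ₗ[S] S) :
    ∃ s' : M' →ₗ[T] T, ∀ m, s' (f m) = g (s m) := by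
  obtain ⟨s', hs'⟩ := hf.exists_lift (g₂ := RingHom.id T) (g₃ := g) (fun _ => rfl)
    (g.toSemilinearMap.comp s : M →ₛₗ[g] T)
  exact ⟨s', hs'⟩

theorem IsBC.isBas {n : ℕ} {f : M →ₛₗ[g] M'} (hf : IsBC f) {x : Fin n → M} (hx : IsBas S x) :
    IsBas T (fun i => f (x i)) := by
  constructor
  · rw [Fintype.linearIndependent_iff]
    intro c hc i
    let b := Module.Basis.mk hx.1 hx.2.ge
    obtain ⟨s', hs'⟩ := hf.exists_functional (b.coord i)
    have h := congrArg s' hc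
    simp only [map_sum, map_smul, hs', map_zero, smul_eq_mul] at h
    have hb : ∀ k, b.coord i (x k) = if k = i then 1 else 0 := fun k => by
      have : x k = b k := (Module.Basis.mk_apply hx.1 hx.2.ge k).symm
      rw [this, Module.Basis.coord_apply, Module.Basis.repr_self, Finsupp.single_apply]
    simpa [hb, apply_ite] using h
  · rw [eq_top_iff, ← hf.1, Submodule.span_le]
    rintro _ ⟨m, rfl⟩
    have hm : m ∈ Submodule.span S (Set.range x) := hx.2 ▸ Submodule.mem_top
    induction hm using Submodule.span_induction with
    | mem _ h => obtain ⟨i, rfl⟩ := h; exact Submodule.subset_span ⟨i, rfl⟩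
    | zero => rw [map_zero]; exact zero_mem _
    | add _ _ _ _ h h' => rw [map_add]; exact add_mem h h'
    | smul _ _ _ h => rw [map_smulₛₗ]; exact Submodule.smul_mem _ _ h

/-- A finite projective module has a dual basis. -/
theorem exists_dualBasis (S M : Type u) [CommRing S] [AddCommGroup M] [Module S M]
    [Module.Finite S M] [Module.Projective S M] :
    ∃ (m : ℕ) (q : Fin m → M) (s : Fin m → M →ₗ[S] S), ∀ y, y = ∑ l, s l y • q l := by
  obtain ⟨m, f, hf⟩ := Module.Finite.exists_fin' S M
  obtain ⟨r, hr⟩ := Module.projective_lifting_property f LinearMap.id hf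
  refine ⟨m, fun l => f (Pi.single l 1), fun l => LinearMap.proj l ∘ₗ r, fun y => ?_⟩
  conv_lhs => rw [← LinearMap.id_apply (R := S) y, ← hr, LinearMap.comp_apply,
    LinearMap.pi_apply_eq_sum_univ f]
  refine Finset.sum_congr rfl fun l _ => ?_
  rw [LinearMap.comp_apply, LinearMap.proj_apply]
  congr 2
  ext k
  simp [Pi.single_apply, eq_comm]

theorem IsBC.dualBasis {f : M →ₛₗ[g] M'} (hf : IsBC f) {m : ℕ} {q : Fin m → M}
    {s : Fin m → M →ₗ[S] S} (h : ∀ y, y = ∑ l, s l y • q l) {s' : Fin m → M' →ₗ[T] T}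
    (hs : ∀ l y, s' l (f y) = g (s l y)) (y : M') : y = ∑ l, s' l y • f (q l) := by
  have : (LinearMap.id : M' →ₗ[T] M') = ∑ l, (s' l).smulRight (f (q l)) := hf.ext fun y => by
    rw [LinearMap.id_apply]
    conv_lhs => rw [h y, map_sum]
    simp [LinearMap.sum_apply, hs]
  simpa [LinearMap.sum_apply] using LinearMap.congr_fun this y

/-- A family that is a basis modulo an ideal in the Jacobson radical is a basis. -/
theorem isBas_of_mod {n : ℕ} [Module.Finite S M] [Module.Projective S M] {I : Ideal S}
    (hI : I ≤ Ideal.jacobson ⊥) (x : Fin n → M)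
    (hspan : ∀ y, ∃ c : Fin n → S, y - ∑ i, c i • x i ∈ (I • ⊤ : Submodule S M))
    (hind : ∀ c : Fin n → S, ∑ i, c i • x i ∈ (I • ⊤ : Submodule S M) → ∀ i, c i ∈ I) :
    IsBas S x := by
  have htop : Submodule.span S (Set.range x) = ⊤ := by
    have h := Submodule.le_of_le_smul_of_le_jacobson_bot (N := Submodule.span S (Set.range x))
      (N' := (⊤ : Submodule S M)) Module.Finite.fg_top hI
      (fun y _ => by
        obtain ⟨c, hc⟩ := hspan y
        rw [← add_sub_cancel (∑ i, c i • x i) y]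
        exact Submodule.add_mem_sup (Submodule.sum_mem _ fun i _ =>
          Submodule.smul_mem _ _ (Submodule.subset_span ⟨i, rfl⟩)) hc)
    exact eq_top_iff.2 h
  refine ⟨?_, htop⟩
  let f : (Fin n → S) →ₗ[S] M := Fintype.linearCombination S x
  have hf : Function.Surjective f := by
    rw [← LinearMap.range_eq_top, Fintype.range_linearCombination, htop]
  obtain ⟨r, hr⟩ := Module.projective_lifting_property f LinearMap.id hf
  have hr' : ∀ y, f (r y) = y := fun y => LinearMap.congr_fun hr y
  -- `e` is the projector onto the kernel of `f`. Independence modulo I puts the entries of `e c` in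
  -- I, and expanding e(e c) = e c over the standard basis gives ker f ⊆ I · ker f. As an image of
  -- S^n the kernel is finitely generated, so Nakayama kills it.
  let e : (Fin n → S) →ₗ[S] (Fin n → S) := LinearMap.id - r ∘ₗ f
  have hfe : ∀ c, f (e c) = 0 := fun c => by simp [e, hr']
  have hker : ∀ c, f c = 0 → e c = c := fun c hc => by simp [e, hc]
  have hfg : (LinearMap.range e).FG := (LinearMap.range_eq_map e) ▸ Module.Finite.fg_top.map e
  have hle : LinearMap.range e ≤ I • LinearMap.range e := by
    rintro _ ⟨c, rfl⟩
    have hc : ∀ i, e c i ∈ I := hind (e c) (by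
      have := hfe c
      rw [Fintype.linearCombination_apply] at this
      rw [this]
      exact zero_mem _)
    rw [← hker (e c) (hfe c)]
    have h₁ : e (e c) = ∑ i, e c i • e (Pi.single i 1) := by
      conv_lhs => rw [LinearMap.pi_apply_eq_sum_univ e (e c)]
      refine Finset.sum_congr rfl fun i _ => ?_
      congr 2
      ext k
      simp [Pi.single_apply, eq_comm]
    rw [h₁]
    exact Submodule.sum_mem _ fun i _ => Submodule.smul_mem_smul (hc i) ⟨_, rfl⟩
  have h0 := Submodule.eq_bot_of_le_smul_of_le_jacobson_bot I _ hfg hle hI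
  rw [Fintype.linearIndependent_iff]
  intro c hc i
  have : e c = 0 := (Submodule.eq_bot_iff _).1 h0 _ ⟨c, rfl⟩
  rw [hker c (by rw [Fintype.linearCombination_apply]; exact hc)] at this
  exact congrFun this i

end BaseChange

end KisinDescent

namespace KisinDescent

/-! ### Semilinear maps between the localizations M[1/P] -/

section Localize

variable {S T : Type u} [CommRing S] [CommRing T] {g : S →+* T} {P : S} {Q : T}
variable {M N : Type u} [AddCommGroup M] [Module S M] [AddCommGroup N] [Module T N]

/-- The form for additive maps with pointwise semilinearity serves to compare two composites of maps
that are semilinear over different ring homomorphisms. -/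
theorem span_ext {U : Type u} [CommRing U] {h : T →+* U} {M : Type*} {M' N' : Type u}
    [AddCommGroup M'] [Module T M'] [AddCommGroup N'] [Module U N'] {f : M → M'}
    (hf : Submodule.span T (Set.range f) = ⊤) {k k' : M' →+ N'}
    (hk : ∀ t x, k (t • x) = h t • k x) (hk' : ∀ t x, k' (t • x) = h t • k' x)
    (he : ∀ m, k (f m) = k' (f m)) (x : M') : k x = k' x :=
  LinearMap.congr_fun (semilinear_ext_of_span hf
    (k := { toFun := k, map_add' := k.map_add, map_smul' := hk })
    (k' := { toFun := k', map_add' := k'.map_add, map_smul' := hk' }) he) x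

theorem loc_bijective (P : S) (M : Type u) [AddCommGroup M] [Module S M] :
    Function.Bijective fun z : LocalizedModule (Submonoid.powers P) M => P • z := by
  have h := IsLocalizedModule.map_units (LocalizedModule.mkLinearMap (Submonoid.powers P) M)
    ⟨P, Submonoid.mem_powers P⟩
  rw [Module.End.isUnit_iff] at h
  exact h

theorem loc_pow_injective (P : S) (M : Type u) [AddCommGroup M] [Module S M] (k : ℕ)
    {z z' : LocalizedModule (Submonoid.powers P) M} (h : P ^ k • z = P ^ k • z') : z = z' := by
  induction k with
  | zero => simpa using h
  | succ k ih =>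
    rw [pow_succ', mul_smul, mul_smul] at h
    exact ih ((loc_bijective P M).1 h)

theorem loc_pow_surjective (P : S) (M : Type u) [AddCommGroup M] [Module S M] (k : ℕ)
    (z : LocalizedModule (Submonoid.powers P) M) : ∃ z', P ^ k • z' = z := by
  induction k with
  | zero => exact ⟨z, by simp⟩
  | succ k ih =>
    obtain ⟨z', h⟩ := ih
    obtain ⟨z'', h'⟩ := (loc_bijective P M).2 z'
    exact ⟨z'', by rw [pow_succ, mul_smul]; exact (congrArg _ h').trans h⟩

theorem loc_exists (z : LocalizedModule (Submonoid.powers P) M) :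
    ∃ (k : ℕ) (x : M), P ^ k • z = LocalizedModule.mkLinearMap (Submonoid.powers P) M x := by
  obtain ⟨⟨x, s⟩, h⟩ :=
    IsLocalizedModule.surj (Submonoid.powers P) (LocalizedModule.mkLinearMap _ M) z
  obtain ⟨k, hk⟩ := s.2
  refine ⟨k, x, ?_⟩
  rw [← h]
  exact congrArg (· • z) hk

theorem loc_lift (k : M →ₛₗ[g] N) (hb : Function.Bijective fun y : N => g P • y) :
    ∃ k' : LocalizedModule (Submonoid.powers P) M →ₛₗ[g] N,
      ∀ m, k' (LocalizedModule.mkLinearMap (Submonoid.powers P) M m) = k m := by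
  -- N becomes an S-module through g, so that the S-linear universal property of the localization
  -- applies to a semilinear map.
  let _ : Module S N := Module.compHom N g
  have hs : ∀ (s : S) (y : N), s • y = g s • y := fun _ _ => rfl
  let k₀ : M →ₗ[S] N := { toFun := k, map_add' := k.map_add, map_smul' := k.map_smulₛₗ }
  have hu : ∀ x : Submonoid.powers P, IsUnit (algebraMap S (Module.End S N) x) := by
    rintro ⟨_, j, rfl⟩
    rw [map_pow]
    refine IsUnit.pow j ?_
    rw [Module.End.isUnit_iff]
    exact hb
  refine ⟨{ toFun := LocalizedModule.lift (Submonoid.powers P) k₀ hu, map_add' := map_add _,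
            map_smul' := fun s x => map_smul (LocalizedModule.lift (Submonoid.powers P) k₀ hu) s x },
    fun m => ?_⟩
  change LocalizedModule.lift (Submonoid.powers P) k₀ hu _ = k₀ m
  rw [← LinearMap.comp_apply, LocalizedModule.lift_comp]

theorem loc_ext {k k' : LocalizedModule (Submonoid.powers P) M →+ N}
    (hk : ∀ t x, k (t • x) = g t • k x) (hk' : ∀ t x, k' (t • x) = g t • k' x)
    (hb : Function.Injective fun y : N => g P • y)
    (he : ∀ m, k (LocalizedModule.mkLinearMap (Submonoid.powers P) M m) =
      k' (LocalizedModule.mkLinearMap (Submonoid.powers P) M m)) (z) : k z = k' z := by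
  obtain ⟨j, x, hx⟩ := loc_exists z
  have h := he x
  rw [← hx, hk, hk', map_pow] at h
  clear hx
  induction j with
  | zero => simpa using h
  | succ j ih =>
    rw [pow_succ', mul_smul, mul_smul] at h
    exact ih (hb h)

theorem exists_locMap (f : M →ₛₗ[g] N) (h : g P = Q) :
    ∃ k' : LocalizedModule (Submonoid.powers P) M →ₛₗ[g] LocalizedModule (Submonoid.powers Q) N,
      ∀ m, k' (LocalizedModule.mkLinearMap (Submonoid.powers P) M m) =
        LocalizedModule.mkLinearMap (Submonoid.powers Q) N (f m) := by
  refine loc_lift ((LocalizedModule.mkLinearMap (Submonoid.powers Q) N).comp f) ?_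
  rw [h]
  exact loc_bijective Q N

/-- The map of localizations induced by a semilinear map. -/
def locMap (f : M →ₛₗ[g] N) (h : g P = Q) :
    LocalizedModule (Submonoid.powers P) M →ₛₗ[g] LocalizedModule (Submonoid.powers Q) N :=
  (exists_locMap f h).choose

theorem locMap_mk (f : M →ₛₗ[g] N) (h : g P = Q) (m : M) :
    locMap f h (LocalizedModule.mkLinearMap (Submonoid.powers P) M m) =
      LocalizedModule.mkLinearMap (Submonoid.powers Q) N (f m) :=
  (exists_locMap f h).choose_spec m

theorem locMap_pow_smul (f : M →ₛₗ[g] N) (h : g P = Q) (k : ℕ)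
    (z : LocalizedModule (Submonoid.powers P) M) :
    locMap f h (P ^ k • z) = Q ^ k • locMap f h z := by
  subst h
  rw [map_smulₛₗ, map_pow]

end Localize

variable {p : ℕ} [Fact p.Prime] {D : Setup.{u} p}

/-! ### The fundamental character and the Frobenius of W -/

namespace Setup

variable (D)

instance : IsDomain D.W := inferInstanceAs (IsDomain (integralClosure ℤ_[p] D.K0))

theorem p_not_isUnit : ¬ IsUnit (p : D.W) := fun h => by
  have h₁ : (Ideal.span {(p : integralClosure ℤ_[p] D.K0)}).IsMaximal := D.K0_greatest.1
  exact h₁.ne_top (Ideal.span_singleton_eq_top.2 h)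

theorem f_pos : 0 < D.f := Module.finrank_pos

theorem one_lt_pow : 1 < p ^ D.f := Nat.one_lt_pow D.f_pos.ne' (Fact.out : p.Prime).one_lt

theorem d_pos : 0 < D.d := Nat.sub_pos_of_lt D.one_lt_pow

theorem d_add_one : D.d + 1 = p ^ D.f := Nat.sub_add_cancel D.one_lt_pow.le

instance : NeZero D.f := ⟨D.f_pos.ne'⟩

/-- Otherwise the zero ideal would be maximal, the ring of integers of K a field, and ℤ_p a field by
integrality. -/
theorem πK_ne_zero : (D.πK : D.K) ≠ 0 := by
  intro h
  have h0 : D.πK = 0 := Subtype.ext h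
  have hm := D.uniformizer
  rw [h0, Ideal.span_singleton_eq_bot.2 rfl] at hm
  have hf : IsField (integralClosure ℤ_[p] D.K) := by
    by_contra hf
    exact Ring.ne_bot_of_isMaximal_of_not_isField hm hf rfl
  have hinj : Function.Injective (algebraMap ℤ_[p] (integralClosure ℤ_[p] D.K)) := by
    have h₁ : Function.Injective (algebraMap ℤ_[p] D.K) := by
      rw [IsScalarTower.algebraMap_eq ℤ_[p] ℚ_[p] D.K]
      exact (algebraMap ℚ_[p] D.K).injective.comp (IsFractionRing.injective ℤ_[p] ℚ_[p])
    exact fun x y hxy => h₁ (congrArg (fun z : integralClosure ℤ_[p] D.K => (z : D.K)) hxy)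
  have := isField_of_isIntegral_of_isField hinj hf
  exact PadicInt.prime_p.not_isUnit (this.mul_inv_cancel (a := (p : ℤ_[p]))
    (Nat.cast_ne_zero.2 (Fact.out : p.Prime).ne_zero) |>.elim fun b hb => IsUnit.of_mul_eq_one b hb)

theorem πL_ne_zero : D.πL ≠ 0 := by
  intro h
  have h₁ := D.πL_pow
  have hd := D.d_pos
  rw [h, zero_pow (show p ^ Module.finrank ℚ_[p] D.K0 - 1 ≠ 0 from hd.ne')] at h₁
  exact D.πK_ne_zero ((map_eq_zero (algebraMap D.K D.L)).1 h₁.symm)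

theorem algebraMap_om_injective :
    Function.Injective fun w : D.W =>
      algebraMap D.K D.L (((show integralClosure ℤ_[p] D.K0 from w) : D.K0) : D.K) :=
  fun _ _ h => Subtype.ext (Subtype.ext ((algebraMap D.K D.L).injective h))

theorem om_pow_d (g : D.Gal) : D.om g ^ D.d = 1 := by
  apply D.algebraMap_om_injective
  have h := D.ω_spec g
  have h₁ : (g D.πL) ^ D.d = D.πL ^ D.d := by
    have h₂ : D.πL ^ D.d = algebraMap D.K D.L D.πK := D.πL_pow
    rw [← map_pow, h₂, AlgEquiv.commutes]
  rw [← h, mul_pow] at h₁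
  have h₃ := mul_right_cancel₀ (pow_ne_zero _ D.πL_ne_zero) (h₁.trans (one_mul _).symm)
  rw [← map_pow] at h₃
  exact h₃.trans (map_one _).symm

theorem p_dvd_d_not : ¬ (p : D.W) ∣ (D.d : D.W) := by
  intro h
  have h₁ : (p : D.W) ∣ (D.d : D.W) + 1 := by
    have : ((D.d : D.W) + 1) = (p : D.W) ^ D.f := by exact_mod_cast congrArg _ D.d_add_one
    rw [this]
    exact dvd_pow_self _ D.f_pos.ne'
  exact D.p_not_isUnit (isUnit_of_dvd_one ((dvd_add_right h).1 h₁))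

/-- If η ≠ 1, then 1 + η + … + η^{d-1} = 0 in the domain W. This sum is d modulo p, and p does not
divide d = p^f - 1. -/
theorem eq_one_of_pow_d {η : D.W} (h : η ^ D.d = 1) (hp : (p : D.W) ∣ η - 1) : η = 1 := by
  by_contra hne
  have h₁ : (∑ i ∈ Finset.range D.d, η ^ i) * (η - 1) = 0 := by rw [geom_sum_mul, h, sub_self]
  have h₂ := (mul_eq_zero.1 h₁).resolve_right (sub_ne_zero.2 hne)
  apply D.p_dvd_d_not
  have h₃ : (p : D.W) ∣ ∑ i ∈ Finset.range D.d, (η ^ i - 1) :=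
    Finset.dvd_sum fun i _ => hp.trans (by simpa using sub_dvd_pow_sub_pow η 1 i)
  rw [Finset.sum_sub_distrib, h₂] at h₃
  simpa using h₃

/-- The values of ω are Teichmüller elements: φ(ζ)ζ^{-p} is a d-th root of unity congruent to 1
modulo p, hence 1. The inverse of ζ is written ζ^{d-1}. -/
theorem frobW_om (g : D.Gal) : D.frobW (D.om g) = D.om g ^ p := by
  have h₁ : D.om g * D.om g ^ (D.d - 1) = 1 := by
    rw [← pow_succ', Nat.sub_add_cancel D.d_pos, om_pow_d]
  set ζ := D.om g
  set ζ' := ζ ^ (D.d - 1)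
  have hz' : ζ' ^ D.d = 1 := by rw [← pow_mul, mul_comm, pow_mul, om_pow_d, one_pow]
  have hη : D.frobW ζ * ζ' ^ p = 1 := by
    apply D.eq_one_of_pow_d
    · rw [mul_pow, ← map_pow, om_pow_d, map_one, one_mul, ← pow_mul, mul_comm, pow_mul, hz',
        one_pow]
    · have h₂ : (p : D.W) ∣ D.frobW ζ - ζ ^ p := D.φ_frob ζ
      have h₃ : D.frobW ζ * ζ' ^ p - 1 = (D.frobW ζ - ζ ^ p) * ζ' ^ p := by
        rw [sub_mul, ← mul_pow, h₁, one_pow]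
      rw [h₃]
      exact h₂.mul_right _
  calc D.frobW ζ = D.frobW ζ * ζ' ^ p * ζ ^ p := by
        rw [mul_assoc, ← mul_pow, mul_comm ζ', h₁, one_pow, mul_one]
    _ = ζ ^ p := by rw [hη, one_mul]

end Setup

/-! ### Compatibilities of base change, Frobenius and Δ on (W ⊗ R)[[v]] -/

section RingMaps

variable {R R' R'' : NilpAlg D}

theorem baseS_C (h : R →ₐ[D.Lam] R') (x : WR R) :
    baseS h (PowerSeries.C x) = PowerSeries.C (Algebra.TensorProduct.map (AlgHom.id ℤ_[p] D.W)
      (h.restrictScalars ℤ_[p]) x) := PowerSeries.map_C _ _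

theorem baseS_X (h : R →ₐ[D.Lam] R') : baseS h PowerSeries.X = PowerSeries.X :=
  PowerSeries.map_X _

theorem baseS_cW (h : R →ₐ[D.Lam] R') (w : D.W) : baseS h (cW R w) = cW R' w := by
  rw [cW, baseS_C, Algebra.TensorProduct.map_tmul, map_one]
  rfl

theorem baseS_cR (h : R →ₐ[D.Lam] R') (r : R) : baseS h (cR R r) = cR R' (h r) := by
  rw [cR, baseS_C, Algebra.TensorProduct.map_tmul, map_one]
  rfl

theorem baseS_cL (h : R →ₐ[D.Lam] R') (c : D.Lam) : baseS h (cL R c) = cL R' c := by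
  rw [cL, baseS_cR, AlgHom.commutes]
  rfl

theorem baseS_comp (h : R →ₐ[D.Lam] R') (h' : R' →ₐ[D.Lam] R'') (x : SS R) :
    baseS h' (baseS h x) = baseS (h'.comp h) x := by
  ext k
  simp only [baseS, PowerSeries.coeff_map]
  induction PowerSeries.coeff k x using TensorProduct.induction_on with
  | zero => simp
  | tmul w r => simp
  | add x y hx hy => simp only [map_add, hx, hy]

theorem frob_coeff (x : SS R) (k : ℕ) : PowerSeries.coeff k (frob R x) =
    if p ∣ k then Algebra.TensorProduct.map (D.frobW : D.W →ₐ[ℤ_[p]] D.W) (AlgHom.id ℤ_[p] R)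
      (PowerSeries.coeff (k / p) x) else 0 := by
  change PowerSeries.coeff k (PowerSeries.expand p (Fact.out : p.Prime).ne_zero
    (PowerSeries.map _ x)) = _
  rw [PowerSeries.coeff_expand]
  rfl

theorem frob_baseS (h : R →ₐ[D.Lam] R') (x : SS R) :
    frob R' (baseS h x) = baseS h (frob R x) := by
  ext k
  rw [frob_coeff]
  simp only [baseS, PowerSeries.coeff_map, frob_coeff]
  split_ifs with hk
  · induction PowerSeries.coeff (k / p) x using TensorProduct.induction_on with
    | zero => simp
    | tmul w r => simp
    | add x y hx hy => simp only [map_add, hx, hy]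
  · rw [map_zero]

theorem galS_baseS (h : R →ₐ[D.Lam] R') (g : D.Gal) (x : SS R) :
    galS R' g (baseS h x) = baseS h (galS R g x) := by
  ext k
  simp only [baseS, galS, PowerSeries.coeff_map, PowerSeries.coeff_rescale, map_mul, map_pow]
  simp

/-- On the coefficient of v^{pl} one side multiplies by φ(ω(g)^l) and the other by ω(g)^{pl}, so
this is the identity φ(ω(g)) = ω(g)^p. -/
theorem frob_galS (g : D.Gal) (x : SS R) : frob R (galS R g x) = galS R g (frob R x) := by
  ext k
  simp only [galS, frob_coeff, PowerSeries.coeff_rescale]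
  split_ifs with hk
  · obtain ⟨l, rfl⟩ := hk
    rw [Nat.mul_div_cancel_left _ (Fact.out : p.Prime).pos, map_mul,
      map_pow, Algebra.TensorProduct.map_tmul]
    congr 1
    rw [pow_mul, Algebra.TensorProduct.tmul_pow (D.om g) (1 : R) p, one_pow, map_one,
      ← D.frobW_om]
    rfl
  · rw [mul_zero]

theorem om_mul (g h : D.Gal) : D.om (g * h) = D.om g * D.om h := by
  simp only [Setup.om, map_mul]
  rfl

theorem galS_mul (g h : D.Gal) (x : SS R) : galS R (g * h) x = galS R g (galS R h x) := by
  ext k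
  simp only [galS, PowerSeries.coeff_rescale, om_mul]
  rw [← mul_assoc, ← mul_pow, Algebra.TensorProduct.tmul_mul_tmul, one_mul]

theorem galS_C (g : D.Gal) (x : WR R) : galS R g (PowerSeries.C x) = PowerSeries.C x := by
  ext k
  rw [galS, PowerSeries.coeff_rescale, PowerSeries.coeff_C]
  split_ifs with h
  · rw [h, pow_zero, one_mul]
  · rw [mul_zero]

theorem PS_eq (R : NilpAlg D) : PS R = Polynomial.eval₂
    (PowerSeries.C.comp (algebraMap D.W (WR R))) ((PowerSeries.X : SS R) ^ D.d) D.EW := by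
  rw [PS, Polynomial.aeval_def]
  congr 1
  ext1 w
  exact PowerSeries.algebraMap_apply

theorem baseS_PS (h : R →ₐ[D.Lam] R') : baseS h (PS R) = PS R' := by
  rw [PS_eq, PS_eq, Polynomial.hom_eval₂, map_pow, baseS_X]
  congr 1
  ext w
  exact congrArg _ (baseS_cW h w)

theorem galS_PS (g : D.Gal) : galS R g (PS R) = PS R := by
  rw [PS_eq, Polynomial.hom_eval₂, map_pow]
  congr 1
  · ext w
    exact congrArg _ (galS_C g _)
  · rw [galS, PowerSeries.rescale_X, mul_pow, ← map_pow, Algebra.TensorProduct.tmul_pow, D.om_pow_d,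
      one_pow, ← Algebra.TensorProduct.one_def, map_one, one_mul]

end RingMaps

end KisinDescent

namespace KisinDescent

variable {p : ℕ} [Fact p.Prime] {D : Setup.{u} p}

/-! ### Frobenius as a semilinear map; arrows are cartesian and compose -/

section Frobenius

variable {R R' R'' : NilpAlg D}

/-- The semilinear Frobenius `m ↦ φ_M(1 ⊗ m)`. -/
def KisinDD.Phi (M : KisinDD D R) : M →ₛₗ[frob R] InvP R M :=
  ((M.phi.toLinearMap ∘ₗ toInvP R).comp (Ext.ofₛₗ (frob R) M) : M →ₛₗ[frob R] InvP R M)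

/-- Every element of M[1/P] lies in M after multiplication by some P^k, and P^k acts injectively.
Hence the elementwise compatibility demanded by the definitions is the commutation of Frobenius with
the induced map of localizations, and `phi_comm_of_comm` goes back. -/
theorem comm_of_phi_comm {S T : NilpAlg D} {M : KisinDD D S} {M' : KisinDD D T}
    {g : SS S →+* SS T} (hg : g (PS S) = PS T) (f : M →ₛₗ[g] M')
    (h : ∀ (m x : M) (k : ℕ), PS S ^ k • M.Phi m = toInvP S x →
      PS T ^ k • M'.Phi (f m) = toInvP T (f x)) (m : M) :
    M'.Phi (f m) = locMap f hg (M.Phi m) := by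
  obtain ⟨k, x, hx⟩ := loc_exists (M.Phi m)
  apply loc_pow_injective _ _ k
  rw [h m x k hx, ← locMap_pow_smul, hx, locMap_mk]
  rfl

theorem phi_comm_of_comm {S T : NilpAlg D} {M : KisinDD D S} {M' : KisinDD D T}
    {g : SS S →+* SS T} (hg : g (PS S) = PS T) (f : M →ₛₗ[g] M') {m : M}
    (h : M'.Phi (f m) = locMap f hg (M.Phi m)) (x : M) (k : ℕ)
    (hx : PS S ^ k • M.Phi m = toInvP S x) : PS T ^ k • M'.Phi (f m) = toInvP T (f x) := by
  rw [h, ← locMap_pow_smul, hx]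
  exact locMap_mk f hg x

theorem KisinDD.Phi_gal (M : KisinDD D R) (g : D.Gal) (m : M) :
    M.Phi (M.gal g m) = locMap (M.gal g) (galS_PS g) (M.Phi m) :=
  comm_of_phi_comm _ (M.gal g) (fun m x k hx => M.gal_phi g m x k hx) m

variable {a b : ℤ}

/-- An arrow as a semilinear map. -/
def Arrow.sl {h : R →ₐ[D.Lam] R'} {M : Y D a b R} {M' : Y D a b R'} (α : Arrow h M M') :
    M →ₛₗ[baseS h] M' :=
  (α.iso.toLinearMap.comp (Ext.ofₛₗ (baseS h) M) : M →ₛₗ[baseS h] M')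

theorem Arrow.sl_apply {h : R →ₐ[D.Lam] R'} {M : Y D a b R} {M' : Y D a b R'} (α : Arrow h M M')
    (m : M) : α.sl m = α.app m := rfl

theorem Arrow.isBC {h : R →ₐ[D.Lam] R'} {M : Y D a b R} {M' : Y D a b R'} (α : Arrow h M M') :
    IsBC α.sl := IsBC.of_equiv α.iso fun _ => rfl

theorem Arrow.Phi_sl {h : R →ₐ[D.Lam] R'} {M : Y D a b R} {M' : Y D a b R'} (α : Arrow h M M')
    (m : M) : M'.Phi (α.sl m) = locMap α.sl (baseS_PS h) (M.Phi m) :=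
  comm_of_phi_comm _ α.sl (fun m x k hx => α.phi_comm m x k hx) m

theorem Arrow.sl_gal {h : R →ₐ[D.Lam] R'} {M : Y D a b R} {M' : Y D a b R'} (α : Arrow h M M')
    (g : D.Gal) (m : M) : α.sl (M.gal g m) = M'.gal g (α.sl m) := α.gal_comm g m

theorem exists_arrow_of_isBC {h : R →ₐ[D.Lam] R'} {M : Y D a b R} {M' : Y D a b R'}
    {f : M →ₛₗ[baseS h] M'} (hf : IsBC f)
    (hφ : ∀ m, M'.Phi (f m) = locMap f (baseS_PS h) (M.Phi m))
    (hγ : ∀ g m, f (M.gal g m) = M'.gal g (f m)) : ∃ α : Arrow h M M', ∀ m, α.app m = f m :=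
  ⟨{ iso := hf.equiv
     phi_comm := fun m x k hx => by
      rw [hf.equiv_of, hf.equiv_of]
      exact phi_comm_of_comm (baseS_PS h) f (hφ m) x k hx
     gal_comm := fun g m => by rw [hf.equiv_of, hf.equiv_of, hγ] }, fun m => hf.equiv_of m⟩

/-- Arrows of `Y^{[a,b],τ}` are cartesian. -/
theorem Arrow.exists_factor {h : R →ₐ[D.Lam] R'} {h' : R' →ₐ[D.Lam] R''} {h'' : R →ₐ[D.Lam] R''}
    (hh : h'.comp h = h'') {M : Y D a b R} {M' : Y D a b R'} {M'' : Y D a b R''}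
    (α : Arrow h M M') (δ : Arrow h'' M M'') :
    ∃ β : Arrow h' M' M'', ∀ m, β.app (α.app m) = δ.app m := by
  have hc : ∀ s, baseS h' (baseS h s) = baseS h'' s := fun s => by rw [baseS_comp, hh]
  -- The factor extends `δ` along the base change `α`. It is a base change by cancellation, and its
  -- compatibilities with Frobenius and Δ need only be checked on the image of `α`, which spans.
  obtain ⟨f, hf⟩ := α.isBC.exists_lift hc δ.sl
  have hfBC : IsBC f := α.isBC.cancel δ.isBC hc hf
  obtain ⟨β, hβ⟩ := exists_arrow_of_isBC hfBC
    (fun m => by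
      refine span_ext (h := (frob R'').comp (baseS h')) α.isBC.1
        (k := M''.Phi.toAddMonoidHom.comp f.toAddMonoidHom)
        (k' := (locMap f (baseS_PS h')).toAddMonoidHom.comp M'.Phi.toAddMonoidHom)
        (fun t x => ?_) (fun t x => ?_) (fun x => ?_) m
      · change M''.Phi (f (t • x)) = frob R'' (baseS h' t) • M''.Phi (f x)
        rw [map_smulₛₗ, map_smulₛₗ]
      · change locMap f (baseS_PS h') (M'.Phi (t • x)) =
          frob R'' (baseS h' t) • locMap f (baseS_PS h') (M'.Phi x)
        rw [map_smulₛₗ, map_smulₛₗ, frob_baseS]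
      · change M''.Phi (f (α.sl x)) = locMap f (baseS_PS h') (M'.Phi (α.sl x))
        rw [hf, δ.Phi_sl, α.Phi_sl]
        refine loc_ext (g := baseS h'') (k := (locMap δ.sl (baseS_PS h'')).toAddMonoidHom)
          (k' := (locMap f (baseS_PS h')).toAddMonoidHom.comp
            (locMap α.sl (baseS_PS h)).toAddMonoidHom)
          (fun t x => (locMap δ.sl (baseS_PS h'')).map_smulₛₗ t x) (fun t x => ?_) ?_ (fun m => ?_) _
        · change locMap f (baseS_PS h') (locMap α.sl (baseS_PS h) (t • x)) = baseS h'' t •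
            locMap f (baseS_PS h') (locMap α.sl (baseS_PS h) x)
          rw [map_smulₛₗ, map_smulₛₗ, hc]
        · rw [baseS_PS]
          exact (loc_bijective _ _).1
        · change locMap δ.sl (baseS_PS h'') _ =
            locMap f (baseS_PS h') (locMap α.sl (baseS_PS h) _)
          rw [locMap_mk, locMap_mk, locMap_mk, hf])
    (fun g m => by
      refine span_ext (h := (galS R'' g).comp (baseS h')) α.isBC.1
        (k := f.toAddMonoidHom.comp (M'.gal g).toAddMonoidHom)
        (k' := (M''.gal g).toAddMonoidHom.comp f.toAddMonoidHom)
        (fun t x => ?_) (fun t x => ?_) (fun x => ?_) m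
      · change f (M'.gal g (t • x)) = galS R'' g (baseS h' t) • f (M'.gal g x)
        rw [map_smulₛₗ, map_smulₛₗ, galS_baseS]
      · change M''.gal g (f (t • x)) = galS R'' g (baseS h' t) • M''.gal g (f x)
        rw [map_smulₛₗ, map_smulₛₗ]
      · change f (M'.gal g (α.sl x)) = M''.gal g (f (α.sl x))
        rw [← α.sl_gal, hf, hf, δ.sl_gal])
  exact ⟨β, fun m => by rw [hβ]; exact hf m⟩

theorem Arrow.exists_comp {h : R →ₐ[D.Lam] R'} {h' : R' →ₐ[D.Lam] R''} {h'' : R →ₐ[D.Lam] R''}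
    (hh : h'.comp h = h'') {M : Y D a b R} {M' : Y D a b R'} {M'' : Y D a b R''}
    (α : Arrow h M M') (β : Arrow h' M' M'') :
    ∃ δ : Arrow h'' M M'', ∀ m, δ.app m = β.app (α.app m) := by
  have hc : ∀ s, baseS h' (baseS h s) = baseS h'' s := fun s => by rw [baseS_comp, hh]
  let f : M →ₛₗ[baseS h''] M'' :=
    { toFun := fun m => β.sl (α.sl m)
      map_add' := fun x y => by rw [map_add, map_add]
      map_smul' := fun s x => by rw [map_smulₛₗ, map_smulₛₗ, hc] }
  obtain ⟨δ, hδ⟩ := exists_arrow_of_isBC (f := f) (α.isBC.trans β.isBC hc fun _ => rfl)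
    (fun m => by
      change M''.Phi (β.sl (α.sl m)) = _
      rw [β.Phi_sl, α.Phi_sl]
      refine loc_ext (g := baseS h'') (k' := (locMap f (baseS_PS h'')).toAddMonoidHom)
          (k := (locMap β.sl (baseS_PS h')).toAddMonoidHom.comp
            (locMap α.sl (baseS_PS h)).toAddMonoidHom) (fun t x => ?_)
          (fun t x => (locMap f (baseS_PS h'')).map_smulₛₗ t x) ?_ (fun m => ?_) _
      · change locMap β.sl (baseS_PS h') (locMap α.sl (baseS_PS h) (t • x)) = baseS h'' t •
          locMap β.sl (baseS_PS h') (locMap α.sl (baseS_PS h) x)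
        rw [map_smulₛₗ, map_smulₛₗ, hc]
      · rw [baseS_PS]
        exact (loc_bijective _ _).1
      · change locMap β.sl (baseS_PS h') (locMap α.sl (baseS_PS h) _) =
          locMap f (baseS_PS h'') _
        rw [locMap_mk, locMap_mk, locMap_mk]
        rfl)
    (fun g m => by
      change β.sl (α.sl _) = M''.gal g (β.sl (α.sl m))
      rw [α.sl_gal, β.sl_gal])
  exact ⟨δ, hδ⟩

end Frobenius

/-! ### Pullback of Kisin modules with descent datum -/

section Pullback

variable {R R' : NilpAlg D} {h : R →ₐ[D.Lam] R'} {M : KisinDD D R} {M' : Type u} [AddCommGroup M']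
  [Module (SS R') M'] {f : M →ₛₗ[baseS h] M'}

theorem exists_frobExt (f : M →ₛₗ[baseS h] M') :
    ∃ f₁ : Ext (frob R) M →ₛₗ[baseS h] Ext (frob R') M',
      ∀ m, f₁ (Ext.of (frob R) m) = Ext.of (frob R') (f m) :=
  Ext.exists_lift (g₃ := (frob R').comp (baseS h)) (fun s => (frob_baseS h s).symm)
    { toFun := fun m => Ext.ofₛₗ (frob R') M' (f m)
      map_add' := fun x y => by rw [map_add, map_add]
      map_smul' := fun s x => by rw [map_smulₛₗ, map_smulₛₗ]; rfl }

/-- Both φ_M and its inverse are extended by the universal properties of base change and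
localization. The extensions are mutually inverse because both composites are the identity on the
image of M, and this image generates. -/
theorem IsBC.exists_phi (hf : IsBC f) {f₁ : Ext (frob R) M →ₛₗ[baseS h] Ext (frob R') M'}
    (hf₁ : ∀ m, f₁ (Ext.of (frob R) m) = Ext.of (frob R') (f m)) :
    ∃ φ' : InvP R' (Ext (frob R') M') ≃ₗ[SS R'] InvP R' M',
      ∀ z, φ' (locMap f₁ (baseS_PS h) z) = locMap f (baseS_PS h) (M.phi z) := by
  set ι := locMap f (baseS_PS h) with hι
  set ι₁ := locMap f₁ (baseS_PS h) with hι₁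
  obtain ⟨k, hk⟩ := hf.exists_lift (g₂ := frob R') (g₃ := (baseS h).comp (frob R))
    (frob_baseS h) (N := InvP R' M')
    { toFun := fun m => ι (M.Phi m)
      map_add' := fun x y => by rw [map_add, map_add]
      map_smul' := fun s x => by rw [map_smulₛₗ, map_smulₛₗ]; rfl }
  obtain ⟨k₁, hk₁⟩ := Ext.exists_lift (g := frob R') (g₂ := RingHom.id (SS R')) (fun _ => rfl) k
  obtain ⟨F, hF⟩ := loc_lift (P := PS R') k₁ (loc_bijective _ _)
  obtain ⟨l, hl⟩ := hf.exists_lift (g₂ := RingHom.id (SS R')) (g₃ := baseS h) (fun _ => rfl)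
    (N := InvP R' (Ext (frob R') M'))
    { toFun := fun m => ι₁ (M.phi.symm (toInvP R m))
      map_add' := fun x y => by rw [map_add, map_add, map_add]
      map_smul' := fun s x => by rw [map_smul, map_smul, map_smulₛₗ] }
  obtain ⟨G, hG⟩ := loc_lift (P := PS R') l (loc_bijective _ _)
  have hFι : ∀ z, F (ι₁ z) = ι (M.phi z) := fun z => by
    refine loc_ext (g := baseS h) (k := F.toAddMonoidHom.comp ι₁.toAddMonoidHom)
      (k' := ι.toAddMonoidHom.comp M.phi.toLinearMap.toAddMonoidHom) (fun t x => ?_)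
      (fun t x => ?_) ?_ (fun m => ?_) z
    · change F (ι₁ (t • x)) = _ • F (ι₁ x)
      rw [map_smulₛₗ, map_smul]
    · change ι (M.phi (t • x)) = _ • ι (M.phi x)
      rw [map_smul, map_smulₛₗ]
    · rw [baseS_PS]
      exact (loc_bijective _ _).1
    · refine span_ext (h := baseS h) (Ext.span_of (M := M) (g := frob R))
        (k := F.toAddMonoidHom.comp (ι₁.toAddMonoidHom.comp (toInvP R).toAddMonoidHom))
        (k' := ι.toAddMonoidHom.comp
          (M.phi.toLinearMap.toAddMonoidHom.comp (toInvP R).toAddMonoidHom))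
        (fun t x => ?_) (fun t x => ?_) (fun x => ?_) m
      · change F (ι₁ (toInvP R (t • x))) = _ • F (ι₁ (toInvP R x))
        rw [map_smul, map_smulₛₗ, map_smul]
      · change ι (M.phi (toInvP R (t • x))) = _ • ι (M.phi (toInvP R x))
        rw [map_smul, map_smul, map_smulₛₗ]
      · change F (ι₁ (LocalizedModule.mkLinearMap _ _ (Ext.of (frob R) x))) = ι (M.Phi x)
        rw [hι₁, locMap_mk, hF, hf₁, hk₁, hk]
        rfl
  have hGι : ∀ z, G (ι z) = ι₁ (M.phi.symm z) := fun z => by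
    refine loc_ext (g := baseS h) (k := G.toAddMonoidHom.comp ι.toAddMonoidHom)
      (k' := ι₁.toAddMonoidHom.comp M.phi.symm.toLinearMap.toAddMonoidHom) (fun t x => ?_)
      (fun t x => ?_) ?_ (fun m => ?_) z
    · change G (ι (t • x)) = _ • G (ι x)
      rw [map_smulₛₗ, map_smul]
    · change ι₁ (M.phi.symm (t • x)) = _ • ι₁ (M.phi.symm x)
      rw [map_smul, map_smulₛₗ]
    · rw [baseS_PS]
      exact (loc_bijective _ _).1
    · change G (ι (LocalizedModule.mkLinearMap _ _ m)) = ι₁ (M.phi.symm (toInvP R m))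
      rw [hι, locMap_mk, hG, hl]
      rfl
  have hFG : ∀ z, F (G z) = z := fun z => by
    refine loc_ext (g := RingHom.id (SS R')) (k := F.toAddMonoidHom.comp G.toAddMonoidHom)
      (k' := AddMonoidHom.id _) (fun t x => ?_) (fun _ _ => rfl) (loc_bijective _ _).1
      (fun m => ?_) z
    · change F (G (t • x)) = _ • F (G x)
      rw [map_smul, map_smul]; rfl
    · refine span_ext (h := RingHom.id (SS R')) hf.1
        (k := F.toAddMonoidHom.comp (G.toAddMonoidHom.comp (toInvP R').toAddMonoidHom))
        (k' := (toInvP R').toAddMonoidHom) (fun t x => ?_) (fun t x => (toInvP R').map_smul t x)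
        (fun x => ?_) m
      · change F (G (toInvP R' (t • x))) = _ • F (G (toInvP R' x))
        rw [map_smul, map_smul, map_smul]; rfl
      · change F (G (LocalizedModule.mkLinearMap _ _ (f x))) =
          LocalizedModule.mkLinearMap (Submonoid.powers (PS R')) M' (f x)
        rw [← locMap_mk f (baseS_PS h), ← hι, hGι, hFι, LinearEquiv.apply_symm_apply]
  have hGF : ∀ z, G (F z) = z := fun z => by
    refine loc_ext (g := RingHom.id (SS R')) (k := G.toAddMonoidHom.comp F.toAddMonoidHom)
      (k' := AddMonoidHom.id _) (fun t x => ?_) (fun _ _ => rfl) (loc_bijective _ _).1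
      (fun m => ?_) z
    · change G (F (t • x)) = _ • G (F x)
      rw [map_smul, map_smul]; rfl
    · refine span_ext (h := RingHom.id (SS R'))
        (span_range_trans (f := f) (f₂ := Ext.ofₛₗ (frob R') M')
          (f₃ := fun x => Ext.of (frob R') (f x)) hf.1 Ext.span_of fun _ => rfl)
        (k := G.toAddMonoidHom.comp (F.toAddMonoidHom.comp (toInvP R').toAddMonoidHom))
        (k' := (toInvP R').toAddMonoidHom) (fun t x => ?_) (fun t x => (toInvP R').map_smul t x)
        (fun x => ?_) m
      · change G (F (toInvP R' (t • x))) = _ • G (F (toInvP R' x))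
        rw [map_smul, map_smul, map_smul]; rfl
      · change G (F (LocalizedModule.mkLinearMap _ _ (Ext.of (frob R') (f x)))) =
          LocalizedModule.mkLinearMap (Submonoid.powers (PS R')) _ (Ext.of (frob R') (f x))
        rw [← hf₁, ← locMap_mk f₁ (baseS_PS h), ← hι₁, hFι, hGι, LinearEquiv.symm_apply_apply]
  exact ⟨LinearEquiv.ofLinearMap F G (LinearMap.ext hFG) (LinearMap.ext hGF), hFι⟩

theorem IsBC.exists_gal (hf : IsBC f) (g : D.Gal) :
    ∃ γ : M' →ₛₗ[galS R' g] M', ∀ m, γ (f m) = f (M.gal g m) :=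
  hf.exists_lift (g₂ := galS R' g) (g₃ := (baseS h).comp (galS R g)) (galS_baseS h g)
    { toFun := fun m => f (M.gal g m)
      map_add' := fun x y => by rw [map_add, map_add]
      map_smul' := fun s x => by rw [map_smulₛₗ, map_smulₛₗ]; rfl }

/-- The map `R[1/g] → R'` induced by a map `R → R'` under which `g` becomes invertible. -/
def awayLift (k : R →ₐ[D.Lam] R') (g : R) (hu : IsUnit (k g)) : R.away g →ₐ[D.Lam] R' where
  __ := IsLocalization.Away.lift (S := Localization.Away g) g (g := (k : R →+* R')) hu
  commutes' c := by
    have h₁ : algebraMap D.Lam (R.away g) c = R.toAway g (algebraMap D.Lam R c) :=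
      ((R.toAway g).commutes c).symm
    rw [h₁]
    refine (IsLocalization.Away.lift_eq (S := Localization.Away g) g hu _).trans ?_
    exact k.commutes c

theorem awayLift_comp (k : R →ₐ[D.Lam] R') (g : R) (hu : IsUnit (k g)) :
    (awayLift k g hu).comp (R.toAway g) = k :=
  AlgHom.ext fun r => IsLocalization.Away.lift_eq (S := Localization.Away g) g hu r

theorem isUnit_toAway (g : R) : IsUnit (R.toAway g g) :=
  IsLocalization.Away.algebraMap_isUnit (S := Localization.Away g) g

/-- The map `R[1/g] → R'[1/h(g)]`. -/
def awayMap (h : R →ₐ[D.Lam] R') (g : R) : R.away g →ₐ[D.Lam] R'.away (h g) :=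
  awayLift ((R'.toAway (h g)).comp h) g (isUnit_toAway (h g))

theorem awayMap_comp (h : R →ₐ[D.Lam] R') (g : R) :
    (awayMap h g).comp (R.toAway g) = (R'.toAway (h g)).comp h :=
  awayLift_comp _ _ _

/-- Base changes along the two routes of a commutative square agree. This compares the restriction
of a pullback to an open set with the pullback of a restriction. -/
theorem IsBC.exists_square {R₁ R₂ R₃ R₄ : NilpAlg D} {h : R₁ →ₐ[D.Lam] R₂}
    {i : R₁ →ₐ[D.Lam] R₃} {h' : R₃ →ₐ[D.Lam] R₄} {i' : R₂ →ₐ[D.Lam] R₄}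
    (hc : h'.comp i = i'.comp h) {M₁ M₂ M₃ M₄ : Type u} [AddCommGroup M₁] [AddCommGroup M₂]
    [AddCommGroup M₃] [AddCommGroup M₄] [Module (SS R₁) M₁] [Module (SS R₂) M₂]
    [Module (SS R₃) M₃] [Module (SS R₄) M₄] {f : M₁ →ₛₗ[baseS h] M₂} (hf : IsBC f)
    {k : M₁ →ₛₗ[baseS i] M₃} (hk : IsBC k) {l : M₂ →ₛₗ[baseS i'] M₄} (hl : IsBC l) :
    ∃ f' : M₃ →ₛₗ[baseS h'] M₄, IsBC f' ∧ ∀ m, f' (k m) = l (f m) := by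
  let c : M₁ →ₛₗ[baseS (i'.comp h)] M₄ :=
    { toFun := fun m => l (f m)
      map_add' := fun x y => by rw [map_add, map_add]
      map_smul' := fun s x => by rw [map_smulₛₗ, map_smulₛₗ, baseS_comp] }
  have hcBC : IsBC c := hf.trans hl (baseS_comp h i') fun _ => rfl
  have hs : ∀ s, baseS h' (baseS i s) = baseS (i'.comp h) s := fun s => by rw [baseS_comp, hc]
  obtain ⟨f', hf'⟩ := hk.exists_lift hs c
  exact ⟨f', hk.cancel hcBC hs hf', hf'⟩

/-- The pullback of a Kisin module with descent datum. -/
theorem KisinDD.exists_pullback (h : R →ₐ[D.Lam] R') (M : KisinDD D R) :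
    ∃ (N : KisinDD D R') (f : M →ₛₗ[baseS h] N), IsBC f ∧
      (∀ m, N.Phi (f m) = locMap f (baseS_PS h) (M.Phi m)) ∧
      (∀ g m, f (M.gal g m) = N.gal g (f m)) ∧
      ∀ a b, M.HasHeight a b → N.HasHeight a b := by
  have := M.finite
  have := M.projective
  let f := Ext.ofₛₗ (baseS h) M
  have hf : IsBC f := IsBC.ofₛₗ
  obtain ⟨f₁, hf₁⟩ := exists_frobExt f
  obtain ⟨φ, hφ⟩ := hf.exists_phi hf₁
  choose γ hγ using hf.exists_gal
  have hγmul : ∀ g g' m, γ (g * g') m = γ g (γ g' m) := fun g g' m => by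
    refine span_ext (h := galS R' (g * g')) hf.1 (k := (γ (g * g')).toAddMonoidHom)
      (k' := (γ g).toAddMonoidHom.comp (γ g').toAddMonoidHom)
      (fun t x => (γ (g * g')).map_smulₛₗ t x) (fun t x => ?_) (fun x => ?_) m
    · change γ g (γ g' (t • x)) = _ • γ g (γ g' x)
      rw [map_smulₛₗ, map_smulₛₗ, galS_mul]
    · change γ (g * g') (f x) = γ g (γ g' (f x))
      rw [hγ, hγ, hγ, M.gal_mul]
  have hMone : ∀ m, M.gal 1 m = m := fun m => (M.gal_bij 1).1 (by rw [← M.gal_mul, one_mul])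
  have hgalS1 : ∀ s, galS R' (1 : D.Gal) s = s := fun s => by
    have : D.om 1 = 1 := by simp only [Setup.om, map_one]; rfl
    rw [galS, this, ← Algebra.TensorProduct.one_def, PowerSeries.rescale_one]
    rfl
  have hγone : ∀ m, γ 1 m = m := fun m => by
    refine span_ext (h := RingHom.id (SS R')) hf.1 (k := (γ 1).toAddMonoidHom)
      (k' := AddMonoidHom.id _) (fun t x => ?_) (fun t x => rfl) (fun x => ?_) m
    · change γ 1 (t • x) = t • γ 1 x
      rw [map_smulₛₗ, hgalS1]
    · change γ 1 (f x) = f x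
      rw [hγ, hMone]
  let Φ : Ext (baseS h) M →ₛₗ[frob R'] InvP R' (Ext (baseS h) M) :=
    ((φ.toLinearMap ∘ₗ toInvP R').comp (Ext.ofₛₗ (frob R') _) :)
  have hΦ : ∀ m, Φ (f m) = locMap f (baseS_PS h) (M.Phi m) := fun m => by
    have := hφ (toInvP R (Ext.of (frob R) m))
    rw [toInvP, locMap_mk, hf₁] at this
    exact this
  have hΦγ : ∀ g m, Φ (γ g m) = locMap (γ g) (galS_PS g) (Φ m) := fun g m => by
    refine span_ext (h := (frob R').comp (galS R' g)) hf.1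
      (k := Φ.toAddMonoidHom.comp (γ g).toAddMonoidHom)
      (k' := (locMap (γ g) (galS_PS g)).toAddMonoidHom.comp Φ.toAddMonoidHom)
      (fun t x => ?_) (fun t x => ?_) (fun x => ?_) m
    · change Φ (γ g (t • x)) = _ • Φ (γ g x)
      rw [map_smulₛₗ, map_smulₛₗ]; rfl
    · change locMap (γ g) (galS_PS g) (Φ (t • x)) = _ • locMap (γ g) (galS_PS g) (Φ x)
      rw [map_smulₛₗ, map_smulₛₗ, ← frob_galS]; rfl
    · change Φ (γ g (f x)) = locMap (γ g) (galS_PS g) (Φ (f x))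
      rw [hγ, hΦ, hΦ, M.Phi_gal]
      refine loc_ext (g := (galS R' g).comp (baseS h))
        (k := (locMap f (baseS_PS h)).toAddMonoidHom.comp
          (locMap (M.gal g) (galS_PS g)).toAddMonoidHom)
        (k' := (locMap (γ g) (galS_PS g)).toAddMonoidHom.comp
          (locMap f (baseS_PS h)).toAddMonoidHom) (fun t x => ?_) (fun t x => ?_) ?_ (fun m => ?_) _
      · change locMap f (baseS_PS h) (locMap (M.gal g) (galS_PS g) (t • x)) = _ •
          locMap f (baseS_PS h) (locMap (M.gal g) (galS_PS g) x)
        rw [map_smulₛₗ, map_smulₛₗ, ← galS_baseS]; rfl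
      · change locMap (γ g) (galS_PS g) (locMap f (baseS_PS h) (t • x)) = _ •
          locMap (γ g) (galS_PS g) (locMap f (baseS_PS h) x)
        rw [map_smulₛₗ, map_smulₛₗ]; rfl
      · rw [RingHom.comp_apply, baseS_PS, galS_PS]
        exact (loc_bijective _ _).1
      · change locMap f (baseS_PS h) (locMap (M.gal g) (galS_PS g) _) =
          locMap (γ g) (galS_PS g) (locMap f (baseS_PS h) _)
        rw [locMap_mk, locMap_mk, locMap_mk, locMap_mk, hγ]
  let N : KisinDD D R' :=
    { carrier := Ext (baseS h) M
      finite := finite_ext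
      projective := projective_ext
      locallyFree := by
        classical
        obtain ⟨t, ht, hb⟩ := M.locallyFree
        refine ⟨t.image h, ?_, ?_⟩
        · have := congrArg (Ideal.map (h : R →+* R')) ht
          rw [Ideal.map_span, Ideal.map_top] at this
          rw [Finset.coe_image]
          exact this
        · intro g' hg'
          obtain ⟨g, hg, rfl⟩ := Finset.mem_image.1 hg'
          obtain ⟨e⟩ := hb g hg
          obtain ⟨f', hf', -⟩ := IsBC.exists_square (awayMap_comp h g) hf
            (IsBC.ofₛₗ (g := baseS (R.toAway g)) (M := M))
            (IsBC.ofₛₗ (g := baseS (R'.toAway (h g))) (M := Ext (baseS h) M))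
          have hbas := hf'.isBas (x := e) ⟨e.linearIndependent, e.span_eq⟩
          exact ⟨Module.Basis.mk hbas.1 hbas.2.ge⟩
      phi := φ
      gal := γ
      gal_bij := fun g => Function.bijective_iff_has_inverse.2 ⟨γ g⁻¹,
        fun m => by rw [← hγmul, inv_mul_cancel, hγone],
        fun m => by rw [← hγmul, mul_inv_cancel, hγone]⟩
      gal_mul := hγmul
      gal_phi := fun g m x k hx => by
        have h₁ := congrArg (locMap (γ g) (galS_PS g)) hx
        rw [map_smulₛₗ, map_pow, galS_PS] at h₁
        have h₂ : φ (toInvP R' (Ext.of (frob R') (γ g m))) =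
          locMap (γ g) (galS_PS g) (φ (toInvP R' (Ext.of (frob R') m))) := hΦγ g m
        rw [h₂, h₁]
        exact locMap_mk _ _ _ }
  refine ⟨N, f, hf, hΦ, fun g m => (hγ g m).symm, fun a b hab => ⟨fun y => ?_, fun z hz => ?_⟩⟩
  · obtain ⟨ha, -⟩ := hab
    have hy : y ∈ Submodule.span (SS R')
      (Set.range fun x => Ext.of (frob R') (f x)) :=
        (span_range_trans (f := f) (f₂ := Ext.ofₛₗ (frob R') (Ext (baseS h) M))
          (f₃ := fun x => Ext.of (frob R') (f x)) hf.1 Ext.span_of fun _ => rfl) ▸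
          Submodule.mem_top
    change InPowLattice R' a (φ (toInvP R' y))
    induction hy using Submodule.span_induction with
    | mem y hy =>
      obtain ⟨m, rfl⟩ := hy
      obtain ⟨x, hx⟩ := ha (Ext.of (frob R) m)
      refine ⟨f x, ?_⟩
      have h₁ := congrArg (locMap f (baseS_PS h)) hx
      rw [map_smulₛₗ, map_smulₛₗ, map_pow, map_pow, baseS_PS] at h₁
      have h₂ : φ (toInvP R' (Ext.of (frob R') (f m))) =
        locMap f (baseS_PS h) (M.phi (toInvP R (Ext.of (frob R) m))) := hΦ m
      have h₃ : locMap f (baseS_PS h) (toInvP R x) = toInvP R' (f x) := locMap_mk _ _ _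
      rw [h₂, h₁, h₃]
    | zero => exact ⟨0, by simp⟩
    | add y y' _ _ hy hy' =>
      obtain ⟨x, hx⟩ := hy
      obtain ⟨x', hx'⟩ := hy'
      exact ⟨x + x', by rw [map_add, map_add, smul_add, hx, hx', map_add, smul_add]⟩
    | smul c y _ hy =>
      obtain ⟨x, hx⟩ := hy
      exact ⟨c • x, by rw [map_smul, map_smul, smul_comm, hx, map_smul, smul_comm]⟩
  · obtain ⟨-, hb⟩ := hab
    obtain ⟨x, hx⟩ := hz
    -- The lattice P^b M' is generated by images from M, for which the height condition on M
    -- provides preimages under φ. The exponents max(-b, 0) and max(b, 0) keep the relation free of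
    -- negative powers, so it is additive and linear in `x`; the power of P on the left is cancelled
    -- at the end.
    have key : ∃ y : Ext (frob R') (Ext (baseS h) M),
        PS R' ^ (-b).toNat • φ (toInvP R' y) = PS R' ^ b.toNat • toInvP R' x := by
      have hx : x ∈ Submodule.span (SS R') (Set.range f) := hf.1 ▸ Submodule.mem_top
      clear * - hx hφ hb hf₁
      induction hx using Submodule.span_induction with
      | mem x hx =>
        obtain ⟨m, rfl⟩ := hx
        obtain ⟨z, hz⟩ := loc_pow_surjective (PS R) M (-b).toNat (PS R ^ b.toNat • toInvP R m)
        obtain ⟨y, rfl⟩ := hb z ⟨m, hz⟩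
        refine ⟨f₁ y, ?_⟩
        have h₁ := congrArg (locMap f (baseS_PS h)) hz
        rw [map_smulₛₗ, map_smulₛₗ, map_pow, map_pow, baseS_PS, ← hφ] at h₁
        have h₂ : locMap f₁ (baseS_PS h) (toInvP R y) = toInvP R' (f₁ y) := locMap_mk _ _ _
        have h₃ : locMap f (baseS_PS h) (toInvP R m) = toInvP R' (f m) := locMap_mk _ _ _
        rw [← h₂, h₁, h₃]
      | zero => exact ⟨0, by simp⟩
      | add x x' _ _ hx hx' =>
        obtain ⟨y, hy⟩ := hx
        obtain ⟨y', hy'⟩ := hx'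
        exact ⟨y + y', by rw [map_add, map_add, smul_add, hy, hy', map_add, smul_add]⟩
      | smul c x _ hx =>
        obtain ⟨y, hy⟩ := hx
        exact ⟨c • y, by rw [map_smul, map_smul, smul_comm, hy, map_smul, smul_comm]⟩
    obtain ⟨y, hy⟩ := key
    exact ⟨y, loc_pow_injective _ _ _ (hy.trans hx.symm)⟩

end Pullback

end KisinDescent

/-! ### Arithmetic of W: the polynomial E modulo p, the residue field and the conjugates -/

namespace KisinDescent

variable {p : ℕ} [Fact p.Prime] {D : Setup.{u} p}

/-- Spectral norm at most 1 means that the coefficients of the minimal polynomial over ℚ_p have norm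
at most 1, so this polynomial lies in ℤ_p[X]. -/
theorem isIntegral_of_spectralNorm_le_one {K : Type u} [Field K] [Algebra ℚ_[p] K]
    [FiniteDimensional ℚ_[p] K] [Algebra ℤ_[p] K] [IsScalarTower ℤ_[p] ℚ_[p] K] {x : K}
    (h : spectralNorm ℚ_[p] K x ≤ 1) : IsIntegral ℤ_[p] x := by
  have hx : IsIntegral ℚ_[p] x := Algebra.IsIntegral.isIntegral x
  have hc := (spectralValue_le_one_iff (minpoly.monic hx)).1 h
  have hl : minpoly ℚ_[p] x ∈ Polynomial.lifts (algebraMap ℤ_[p] ℚ_[p]) := by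
    rw [Polynomial.lifts_iff_coeff_lifts]
    exact fun n => ⟨⟨_, hc n⟩, rfl⟩
  obtain ⟨q, hq, -, hm⟩ := Polynomial.lifts_and_natDegree_eq_and_monic hl (minpoly.monic hx)
  refine ⟨q, hm, ?_⟩
  have h₀ := minpoly.aeval ℚ_[p] x
  rw [← hq, Polynomial.aeval_map_algebraMap] at h₀
  exact h₀

/-- The spectral norm is multiplicative: if x had norm at least 1, then x⁻¹ would have norm at most
1 and be integral. -/
theorem spectralNorm_lt_one_of_not_isUnit {K : Type u} [Field K] [Algebra ℚ_[p] K]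
    [FiniteDimensional ℚ_[p] K] [Algebra ℤ_[p] K] [IsScalarTower ℤ_[p] ℚ_[p] K]
    {x : integralClosure ℤ_[p] K} (hx : ¬ IsUnit x) : spectralNorm ℚ_[p] K (x : K) < 1 := by
  by_contra! h
  have hx0 : (x : K) ≠ 0 := by
    intro h0
    rw [h0, spectralNorm_zero] at h
    exact absurd h (by norm_num)
  have hmul : spectralNorm ℚ_[p] K (x : K) * spectralNorm ℚ_[p] K (x : K)⁻¹ = 1 := by
    have h₁ := map_mul (spectralMulAlgNorm ℚ_[p] K) (x : K) (x : K)⁻¹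
    rw [mul_inv_cancel₀ hx0, map_one] at h₁
    exact h₁.symm
  have hle : spectralNorm ℚ_[p] K (x : K)⁻¹ ≤ 1 := by
    by_contra! h'
    nlinarith
  exact hx (IsUnit.of_mul_eq_one ⟨(x : K)⁻¹, isIntegral_of_spectralNorm_le_one hle⟩
    (Subtype.ext (mul_inv_cancel₀ hx0)))

/-- The spectral norm is the supremum of the |c_k|^{1/(n-k)} for the coefficients c_k of the minimal
polynomial of degree n, so norm less than 1 forces |c_k| < 1 for all k < n. -/
theorem dvd_coeff_minpoly_of_not_isUnit {K : Type u} [Field K] [Algebra ℚ_[p] K]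
    [FiniteDimensional ℚ_[p] K] [Algebra ℤ_[p] K] [IsScalarTower ℤ_[p] ℚ_[p] K]
    {x : integralClosure ℤ_[p] K} (hx : ¬ IsUnit x) {k : ℕ}
    (hk : k < (minpoly ℤ_[p] (x : K)).natDegree) :
    (p : ℤ_[p]) ∣ (minpoly ℤ_[p] (x : K)).coeff k := by
  have hq := minpoly.isIntegrallyClosed_eq_field_fractions' (R := ℤ_[p]) ℚ_[p] x.2
  rw [← PadicInt.norm_lt_one_iff_dvd, PadicInt.norm_def]
  have h₁ := spectralNorm_lt_one_of_not_isUnit hx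
  have hk' : k < (minpoly ℚ_[p] (x : K)).natDegree := by
    rwa [hq, (minpoly.monic x.2).natDegree_map]
  have h₂ := (le_ciSup (spectralValueTerms_bddAbove (minpoly ℚ_[p] (x : K))) k).trans_lt h₁
  rw [spectralValueTerms_of_lt_natDegree _ hk', hq, Polynomial.coeff_map] at h₂
  by_contra! h₃
  refine absurd h₂ (not_lt.2 (Real.one_le_rpow h₃ (div_nonneg zero_le_one ?_)))
  rw [← hq]
  exact sub_nonneg.2 (Nat.cast_le.2 hk'.le)

namespace Setup

variable (D)

theorem πK_not_isUnit : ¬ IsUnit D.πK := fun h =>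
  D.uniformizer.ne_top (Ideal.span_singleton_eq_top.2 h)

instance spanP_isMaximal : (Ideal.span {(p : D.W)}).IsMaximal := D.K0_greatest.1

theorem algebraMap_W_injective :
    Function.Injective (algebraMap (integralClosure ℤ_[p] D.K0) D.K0) := Subtype.val_injective

/-- In both allowed cases E divides the minimal polynomial of π_K over ℤ_p, which is a power of X
modulo p. As W/p is a field, the monic divisor E is also a power of X modulo p. -/
theorem EW_spec : 0 < D.EW.natDegree ∧ D.EW.Monic ∧
    ∀ k < D.EW.natDegree, (p : D.W) ∣ D.EW.coeff k := by
  let W := integralClosure ℤ_[p] D.K0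
  change 0 < D.E.natDegree ∧ D.E.Monic ∧ ∀ k < D.E.natDegree, (p : W) ∣ D.E.coeff k
  have hint : IsIntegral ℚ_[p] (D.πK : D.K) := Algebra.IsIntegral.isIntegral _
  have hint0 : IsIntegral D.K0 (D.πK : D.K) := Algebra.IsIntegral.isIntegral _
  have hinj := D.algebraMap_W_injective
  have hq := minpoly.isIntegrallyClosed_eq_field_fractions' (R := ℤ_[p]) ℚ_[p] D.πK.2
  set q := minpoly ℤ_[p] (D.πK : D.K) with hqdef
  have hqm : q.Monic := minpoly.monic D.πK.2
  have hqW : (q.map (algebraMap ℤ_[p] W)).map (algebraMap W D.K0) =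
      (minpoly ℚ_[p] (D.πK : D.K)).map (algebraMap ℚ_[p] D.K0) := by
    rw [hq, Polynomial.map_map, Polynomial.map_map, ← IsScalarTower.algebraMap_eq,
      ← IsScalarTower.algebraMap_eq]
  have hmon : D.E.Monic := by
    refine Polynomial.monic_of_injective hinj ?_
    rcases D.E_minpoly with h | h
    · rw [h]; exact minpoly.monic hint0
    · rw [h]; exact (minpoly.monic hint).map _
  have hpos : 0 < D.E.natDegree := by
    rw [← hmon.natDegree_map (algebraMap W D.K0)]
    rcases D.E_minpoly with h | h
    · rw [h]; exact minpoly.natDegree_pos hint0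
    · rw [h, (minpoly.monic hint).natDegree_map]; exact minpoly.natDegree_pos hint
  have hdvd : D.E ∣ q.map (algebraMap ℤ_[p] W) := by
    rw [← Polynomial.map_dvd_map _ hinj hmon, hqW]
    rcases D.E_minpoly with h | h
    · rw [h]
      refine minpoly.dvd _ _ ?_
      rw [Polynomial.aeval_map_algebraMap, minpoly.aeval]
    · rw [h]
  let k := W ⧸ Ideal.span {(p : W)}
  have : (Ideal.span {(p : W)}).IsMaximal := D.K0_greatest.1
  let _ : Field k := Ideal.Quotient.field _
  let π : W →+* k := Ideal.Quotient.mk _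
  have hqk : (q.map (algebraMap ℤ_[p] W)).map π = Polynomial.X ^ q.natDegree := by
    ext i
    rw [Polynomial.coeff_map, Polynomial.coeff_map, Polynomial.coeff_X_pow]
    split_ifs with hi
    · rw [hi, hqm.coeff_natDegree, map_one, map_one]
    · rcases lt_or_gt_of_ne hi with hi | hi
      · obtain ⟨c, hc⟩ := dvd_coeff_minpoly_of_not_isUnit D.πK_not_isUnit hi
        rw [← hqdef] at hc
        rw [hc, map_mul, map_natCast]
        exact Ideal.Quotient.eq_zero_iff_mem.2
          (Ideal.mul_mem_right _ _ (Ideal.subset_span rfl))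
      · rw [Polynomial.coeff_eq_zero_of_natDegree_lt hi, map_zero, map_zero]
  have hdvdk : D.E.map π ∣ Polynomial.X ^ q.natDegree := hqk ▸ Polynomial.map_dvd π hdvd
  obtain ⟨i, -, hi⟩ := (dvd_prime_pow Polynomial.prime_X _).1 hdvdk
  have hi' := Polynomial.eq_of_monic_of_associated (hmon.map π) (Polynomial.monic_X_pow i) hi
  refine ⟨hpos, hmon, fun l hl => ?_⟩
  have hdeg : D.E.natDegree = i := by
    rw [← hmon.natDegree_map π, hi', Polynomial.natDegree_X_pow]
  have h₁ := congrArg (fun r => Polynomial.coeff r l) hi'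
  simp only [Polynomial.coeff_map, Polynomial.coeff_X_pow] at h₁
  rw [if_neg (by omega)] at h₁
  exact Ideal.mem_span_singleton.1 (Ideal.Quotient.eq_zero_iff_mem.1 h₁)

instance : Module.Finite ℤ_[p] D.W :=
  have : IsNoetherian ℤ_[p] (integralClosure ℤ_[p] D.K0) :=
    IsIntegralClosure.isNoetherian ℤ_[p] ℚ_[p] D.K0 (integralClosure ℤ_[p] D.K0)
  inferInstanceAs (Module.Finite ℤ_[p] (integralClosure ℤ_[p] D.K0))

instance : Module.Free ℤ_[p] D.W :=
  have : Module.IsTorsionFree ℤ_[p] D.K0 := .trans_faithfulSMul ℤ_[p] ℚ_[p] D.K0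
  IsIntegralClosure.module_free ℤ_[p] ℚ_[p] D.K0 (integralClosure ℤ_[p] D.K0)

theorem finrank_W : Module.finrank ℤ_[p] D.W = D.f :=
  have : Module.IsTorsionFree ℤ_[p] D.K0 := .trans_faithfulSMul ℤ_[p] ℚ_[p] D.K0
  IsIntegralClosure.rank ℤ_[p] ℚ_[p] D.K0 (integralClosure ℤ_[p] D.K0)

/-- The residue field of `W`. -/
abbrev resField : Type u := D.W ⧸ Ideal.span {(p : D.W)}

instance : Field D.resField := Ideal.Quotient.field _

/-- A basis of `W` over `ℤ_p`. -/
def basisW : Module.Basis (ZMod D.f) ℤ_[p] D.W :=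
  (Module.finBasisOfFinrankEq ℤ_[p] D.W D.finrank_W).reindex
    (Fintype.equivOfCardEq (by rw [Fintype.card_fin, ZMod.card]))

theorem p_pow_dvd_iff (n : ℕ) (x : D.W) :
    (p : D.W) ^ n ∣ x ↔ ∀ i, (p : ℤ_[p]) ^ n ∣ D.basisW.repr x i := by
  have hp : ∀ y : D.W, (p : D.W) ^ n * y = ((p : ℤ_[p]) ^ n) • y := fun y => by
    rw [Algebra.smul_def, map_pow, map_natCast]
  constructor
  · rintro ⟨y, rfl⟩ i
    rw [hp, map_smul, Finsupp.smul_apply, smul_eq_mul]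
    exact Dvd.intro _ rfl
  · intro h
    choose c hc using h
    refine ⟨∑ i, c i • D.basisW i, ?_⟩
    rw [hp, Finset.smul_sum]
    conv_lhs => rw [← D.basisW.sum_repr x]
    exact Finset.sum_congr rfl fun i _ => by rw [hc, mul_smul]

/-- Coordinates in a ℤ_p-basis of W, reduced modulo p, identify W/p with 𝔽_p^f. -/
theorem card_resField : Nat.card D.resField = p ^ D.f := by
  let F : D.W → (ZMod D.f → ZMod p) := fun w i => PadicInt.toZMod (D.basisW.repr w i)
  have hF : ∀ w w', F w = F w' ↔ (p : D.W) ∣ w - w' := fun w w' => by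
    rw [← pow_one (p : D.W), p_pow_dvd_iff, funext_iff]
    refine forall_congr' fun i => ?_
    rw [pow_one, map_sub, Finsupp.sub_apply, ← Ideal.mem_span_singleton,
      ← PadicInt.maximalIdeal_eq_span_p, ← PadicInt.ker_toZMod, RingHom.mem_ker, map_sub,
      sub_eq_zero]
  have hmk : ∀ w w' : D.W, (Ideal.Quotient.mk (Ideal.span {(p : D.W)}) w =
      Ideal.Quotient.mk _ w') ↔ (p : D.W) ∣ w - w' := fun w w' => by
    rw [Ideal.Quotient.eq, Ideal.mem_span_singleton]
  let s : D.resField → D.W := Function.surjInv Ideal.Quotient.mk_surjective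
  have hs : ∀ q, Ideal.Quotient.mk _ (s q) = q := Function.surjInv_eq _
  have hb : Function.Bijective fun q : D.resField => F (s q) := by
    refine ⟨fun q q' h => ?_, fun c => ?_⟩
    · rw [← hs q, ← hs q', hmk]
      exact (hF _ _).1 h
    · refine ⟨Ideal.Quotient.mk _ (∑ i, ((c i).val : ℤ_[p]) • D.basisW i), ?_⟩
      have h₁ : F (s (Ideal.Quotient.mk _ (∑ i, ((c i).val : ℤ_[p]) • D.basisW i))) =
          F (∑ i, ((c i).val : ℤ_[p]) • D.basisW i) := (hF _ _).2 ((hmk _ _).1 (hs _))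
      refine h₁.trans (funext fun i => ?_)
      change PadicInt.toZMod (D.basisW.repr _ i) = _
      rw [D.basisW.repr_sum_self, map_natCast, ZMod.natCast_zmod_val]
  rw [Nat.card_eq_of_bijective _ hb, Nat.card_pi, Finset.prod_const, Nat.card_zmod,
    Finset.card_univ, ZMod.card]

instance : IsAdicComplete (Ideal.span {(p : D.W)}) D.W where
  haus' x hx := by
    have h : ∀ i, D.basisW.repr x i = 0 := fun i => by
      refine IsHausdorff.haus' (I := IsLocalRing.maximalIdeal ℤ_[p]) _ fun n => ?_
      have h₁ := hx n
      rw [SModEq.zero, Ideal.span_singleton_pow, smul_eq_mul, Ideal.mul_top,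
        Ideal.mem_span_singleton, p_pow_dvd_iff] at h₁
      rw [SModEq.zero, PadicInt.maximalIdeal_eq_span_p, Ideal.span_singleton_pow, smul_eq_mul,
        Ideal.mul_top, Ideal.mem_span_singleton]
      exact h₁ i
    rw [← D.basisW.sum_repr x]
    simp [h]
  prec' f hf := by
    have h : ∀ i, ∃ L, ∀ n, D.basisW.repr (f n) i ≡ L
        [SMOD (IsLocalRing.maximalIdeal ℤ_[p] ^ n • ⊤ : Submodule ℤ_[p] ℤ_[p])] := fun i => by
      refine IsPrecomplete.prec' _ fun {m n} hmn => ?_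
      have h₁ := hf hmn
      rw [SModEq.sub_mem, Ideal.span_singleton_pow, smul_eq_mul, Ideal.mul_top,
        Ideal.mem_span_singleton, p_pow_dvd_iff] at h₁
      rw [SModEq.sub_mem, PadicInt.maximalIdeal_eq_span_p, Ideal.span_singleton_pow, smul_eq_mul,
        Ideal.mul_top, Ideal.mem_span_singleton]
      simpa using h₁ i
    choose L hL using h
    refine ⟨∑ i, L i • D.basisW i, fun n => ?_⟩
    rw [SModEq.sub_mem, Ideal.span_singleton_pow, smul_eq_mul, Ideal.mul_top,
        Ideal.mem_span_singleton, p_pow_dvd_iff]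
    intro i
    have h₁ := hL i n
    rw [SModEq.sub_mem, PadicInt.maximalIdeal_eq_span_p, Ideal.span_singleton_pow, smul_eq_mul,
        Ideal.mul_top, Ideal.mem_span_singleton] at h₁
    rw [map_sub, Finsupp.sub_apply, D.basisW.repr_sum_self]
    exact h₁

/-- W is p-adically complete, so p lies in every maximal ideal; as (p) is maximal, it is the only
one. -/
theorem isUnit_iff_not_dvd (x : D.W) : IsUnit x ↔ ¬ (p : D.W) ∣ x := by
  have hl := IsAdicComplete.le_jacobson_bot (Ideal.span {(p : D.W)})
  refine ⟨fun h hd => D.p_not_isUnit (isUnit_of_dvd_unit hd h), fun h => ?_⟩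
  by_contra hu
  obtain ⟨m, hm, hx⟩ := exists_max_ideal_of_mem_nonunits hu
  have h₁ : Ideal.span {(p : D.W)} ≤ m := hl.trans (sInf_le ⟨bot_le, hm⟩)
  rw [← (D.spanP_isMaximal).eq_of_le hm.ne_top h₁, Ideal.mem_span_singleton] at hx
  exact h hx

theorem frobW_pow (m : ℕ) (x : D.W) : (p : D.W) ∣ (D.frobW ^ m) x - x ^ p ^ m := by
  induction m with
  | zero => simp
  | succ m ih =>
    have h₁ : (p : D.W) ∣ D.frobW ((D.frobW ^ m) x) - ((D.frobW ^ m) x) ^ p := D.φ_frob _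
    have h₂ : (p : D.W) ∣ ((D.frobW ^ m) x) ^ p - (x ^ p ^ m) ^ p :=
      ih.trans (sub_dvd_pow_sub_pow _ _ _)
    have h₃ : (D.frobW ^ (m + 1)) x = D.frobW ((D.frobW ^ m) x) := by
      rw [pow_succ', AlgEquiv.mul_apply]
    rw [h₃, pow_succ, pow_mul]
    simpa using dvd_add h₁ h₂

/-- The maps `w ↦ φ^{-j}(w) mod p`. -/
def twistRes (j : ZMod D.f) : D.W →* D.resField :=
  (Ideal.Quotient.mk (Ideal.span {(p : D.W)}) : D.W →* D.resField).comp
    ((D.frobW⁻¹ ^ j.val : D.W ≃ₐ[ℤ_[p]] D.W) : D.W →* D.W)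

/-- If φ^{-i} and φ^{-j} agreed modulo p, then with m = j - i < f all p^f elements of the residue
field would be roots of X^{p^m} - X. -/
theorem twistRes_ne {i j : ZMod D.f} (hij : i.val < j.val) : D.twistRes i ≠ D.twistRes j := by
  intro h
  set m := j.val - i.val with hm
  have hmf : m < D.f := (Nat.sub_le _ _).trans_lt (ZMod.val_lt j)
  have hfix : ∀ x : D.W, (p : D.W) ∣ x ^ p ^ m - x := fun x => by
    have h₁ := DFunLike.congr_fun h x
    have h₂ : (p : D.W) ∣ (D.frobW⁻¹ ^ i.val) x - (D.frobW⁻¹ ^ j.val) x :=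
      Ideal.mem_span_singleton.1 (Ideal.Quotient.eq.1 h₁)
    have h₃ := map_dvd ((D.frobW ^ j.val : D.W ≃ₐ[ℤ_[p]] D.W)) h₂
    rw [map_natCast, map_sub, ← AlgEquiv.mul_apply, ← AlgEquiv.mul_apply, inv_pow, inv_pow,
      mul_inv_cancel, AlgEquiv.one_apply,
      show D.frobW ^ j.val * (D.frobW ^ i.val)⁻¹ = D.frobW ^ m from
        (pow_sub D.frobW hij.le).symm] at h₃
    have h₄ := dvd_sub h₃ (D.frobW_pow m x)
    simpa using h₄
  have hm0 : m ≠ 0 := Nat.sub_ne_zero_of_lt hij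
  have hp1 := (Fact.out : p.Prime).one_lt
  have hfin : Finite D.resField := Nat.finite_of_card_ne_zero (by
    rw [card_resField]; exact (pow_pos (Fact.out : p.Prime).pos _).ne')
  let _ := Fintype.ofFinite D.resField
  have hq1 : 1 < p ^ m := Nat.one_lt_pow hm0 hp1
  have hP := FiniteField.X_pow_card_sub_X_ne_zero D.resField hq1
  have hdeg := FiniteField.X_pow_card_sub_X_natDegree_eq D.resField hq1
  have hroots : (Finset.univ : Finset D.resField).val ≤
      (Polynomial.X ^ p ^ m - Polynomial.X : D.resField[X]).roots := by
    refine (Multiset.le_iff_subset Finset.univ.nodup).2 fun x _ => ?_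
    rw [Polynomial.mem_roots hP]
    obtain ⟨y, rfl⟩ := Ideal.Quotient.mk_surjective x
    simp only [Polynomial.IsRoot.def, Polynomial.eval_sub, Polynomial.eval_pow, Polynomial.eval_X]
    rw [← map_pow, ← map_sub]
    exact Ideal.Quotient.eq_zero_iff_mem.2 (Ideal.mem_span_singleton.2 (hfix y))
  have h₁ := (Multiset.card_le_card hroots).trans (Polynomial.card_roots' _)
  rw [hdeg, Finset.card_val, Finset.card_univ, ← Nat.card_eq_fintype_card, card_resField] at h₁
  exact absurd h₁ (not_le.2 (Nat.pow_lt_pow_right hp1 hmf))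

theorem twistRes_injective : Function.Injective D.twistRes := fun i j h => by
  rcases lt_trichotomy i.val j.val with hij | hij | hij
  · exact absurd h (D.twistRes_ne hij)
  · exact ZMod.val_injective _ hij
  · exact absurd h.symm (D.twistRes_ne hij)

/-- The matrix of the conjugates of a basis of `W`. -/
def conjMatrix : Matrix (ZMod D.f) (ZMod D.f) D.W :=
  .of fun j i => (D.frobW⁻¹ ^ j.val) (D.basisW i)

/-- A linear relation between the rows modulo p would be a relation between the maps φ^{-j} mod p on
all of W. These are distinct multiplicative characters into a field, hence independent by Dedekind.
-/
theorem isUnit_det_conjMatrix : IsUnit D.conjMatrix.det := by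
  rw [isUnit_iff_not_dvd, ← Ideal.mem_span_singleton, ← Ideal.Quotient.eq_zero_iff_mem,
    RingHom.map_det]
  intro h
  obtain ⟨v, hv, h₀⟩ := Matrix.exists_vecMul_eq_zero_iff.2 h
  have hb : ∀ i, ∑ j, v j * D.twistRes j (D.basisW i) = 0 := fun i => congrFun h₀ i
  have hlin : ∀ x, ∑ j, v j * D.twistRes j x = 0 := fun x => by
    rw [← D.basisW.sum_repr x]
    have h₁ : ∀ j, D.twistRes j (∑ i, D.basisW.repr x i • D.basisW i) = ∑ i,
        Ideal.Quotient.mk (Ideal.span {(p : D.W)}) (algebraMap ℤ_[p] D.W (D.basisW.repr x i)) *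
          D.twistRes j (D.basisW i) := fun j => by
      change Ideal.Quotient.mk _ ((D.frobW⁻¹ ^ j.val) _) = ∑ i, Ideal.Quotient.mk _ _ *
        Ideal.Quotient.mk _ ((D.frobW⁻¹ ^ j.val) _)
      rw [map_sum, map_sum]
      refine Finset.sum_congr rfl fun i _ => ?_
      rw [map_smul, Algebra.smul_def, map_mul]
    simp_rw [h₁, Finset.mul_sum]
    rw [Finset.sum_comm]
    refine Finset.sum_eq_zero fun i _ => ?_
    have h₂ := congrArg (Ideal.Quotient.mk (Ideal.span {(p : D.W)})
      (algebraMap ℤ_[p] D.W (D.basisW.repr x i)) * ·) (hb i)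
    simp only [Finset.mul_sum, mul_zero] at h₂
    rw [← h₂]
    exact Finset.sum_congr rfl fun j _ => by ring
  have hind := (linearIndependent_monoidHom D.W D.resField).comp D.twistRes D.twistRes_injective
  rw [Fintype.linearIndependent_iff] at hind
  refine hv (funext (hind v (funext fun x => ?_)))
  simpa using hlin x

end Setup

end KisinDescent

namespace KisinDescent

variable {p : ℕ} [Fact p.Prime] {D : Setup.{u} p}

/-! ### The decomposition of W ⊗ R and of (W ⊗ R)[[v]]-modules -/

section Components

variable (R : NilpAlg D)

/-- The map `W ⊗ R → R`, `w ⊗ r ↦ σ_j(w) r`. -/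
def pj (j : ZMod D.f) : WR R →ₐ[ℤ_[p]] R :=
  Algebra.TensorProduct.productMap
    ((IsScalarTower.toAlgHom ℤ_[p] D.Lam R).comp (D.sigma j)) (AlgHom.id ℤ_[p] R)

variable {R}

@[simp] theorem pj_tmul (j : ZMod D.f) (w : D.W) (r : R) :
    pj R j (w ⊗ₜ r) = algebraMap D.Lam R (D.sigma j w) * r :=
  Algebra.TensorProduct.productMap_apply_tmul _ _ _ _

theorem pj_map {R' : NilpAlg D} (h : R →ₐ[D.Lam] R') (j : ZMod D.f) (x : WR R) :
    pj R' j (Algebra.TensorProduct.map (AlgHom.id ℤ_[p] D.W) (h.restrictScalars ℤ_[p]) x) =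
      h (pj R j x) := by
  induction x using TensorProduct.induction_on with
  | zero => simp only [map_zero]
  | tmul w r =>
    rw [Algebra.TensorProduct.map_tmul, pj_tmul, pj_tmul, map_mul, AlgHom.commutes]
    rfl
  | add x y hx hy => simp only [map_add, hx, hy]

theorem exists_sum_basisW (x : WR R) :
    ∃ r : ZMod D.f → R, x = ∑ i, (D.basisW i) ⊗ₜ[ℤ_[p]] r i := by
  induction x using TensorProduct.induction_on with
  | zero => exact ⟨0, by simp⟩
  | tmul w r =>
    refine ⟨fun i => D.basisW.repr w i • r, ?_⟩
    conv_lhs => rw [← D.basisW.sum_repr w, TensorProduct.sum_tmul]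
    exact Finset.sum_congr rfl fun i _ => TensorProduct.smul_tmul _ _ _
  | add x y hx hy =>
    obtain ⟨r, rfl⟩ := hx
    obtain ⟨r', rfl⟩ := hy
    exact ⟨r + r', by simp [TensorProduct.tmul_add, Finset.sum_add_distrib]⟩

theorem pj_sum (j : ZMod D.f) (r : ZMod D.f → R) :
    pj R j (∑ i, (D.basisW i) ⊗ₜ[ℤ_[p]] r i) = (D.conjMatrix.map
      ((algebraMap D.Lam R).comp (D.sigma0 : D.W →+* D.Lam))).mulVec r j := by
  rw [map_sum]
  simp only [pj_tmul]
  rfl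

/-- This is W ⊗ R ≅ ∏_j R. In coordinates for a basis of W the map is multiplication by the image of
the matrix of conjugates, whose determinant is a unit already in W. -/
theorem pj_bijective : Function.Bijective fun (x : WR R) j => pj R j x := by
  set A := D.conjMatrix.map ((algebraMap D.Lam R).comp (D.sigma0 : D.W →+* D.Lam)) with hA
  have hdet : IsUnit A.det := by
    have := D.isUnit_det_conjMatrix.map ((algebraMap D.Lam R).comp (D.sigma0 : D.W →+* D.Lam))
    rwa [RingHom.map_det] at this
  constructor
  · intro x y h
    obtain ⟨r, rfl⟩ := exists_sum_basisW x
    obtain ⟨r', rfl⟩ := exists_sum_basisW y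
    have h₁ : A.mulVec r = A.mulVec r' := funext fun j => by
      have := congrFun h j
      simp only [pj_sum] at this
      exact this
    have h₂ := congrArg (A⁻¹.mulVec) h₁
    rw [Matrix.mulVec_mulVec, Matrix.mulVec_mulVec, Matrix.nonsing_inv_mul _ hdet,
      Matrix.one_mulVec, Matrix.one_mulVec] at h₂
    rw [h₂]
  · intro y
    refine ⟨∑ i, (D.basisW i) ⊗ₜ[ℤ_[p]] (A⁻¹.mulVec y) i, funext fun j => ?_⟩
    simp only [pj_sum]
    rw [← hA, Matrix.mulVec_mulVec, Matrix.mul_nonsing_inv _ hdet, Matrix.one_mulVec]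

theorem pj_ext {x y : WR R} (h : ∀ j, pj R j x = pj R j y) : x = y :=
  pj_bijective.1 (funext h)

variable (R) in
/-- The idempotent of `W ⊗ R` that cuts out the `j`-th component. -/
def idem (j : ZMod D.f) : WR R := (pj_bijective.2 (Pi.single j 1)).choose

theorem pj_idem (i j : ZMod D.f) : pj R i (idem R j) = if i = j then 1 else 0 := by
  have h := congrFun (pj_bijective.2 (Pi.single j (1 : R))).choose_spec i
  rw [Pi.single_apply] at h
  exact h

theorem pj_includeRight (j : ZMod D.f) (r : R) : pj R j ((1 : D.W) ⊗ₜ[ℤ_[p]] r) = r := by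
  rw [pj_tmul, map_one, map_one, one_mul]

theorem sum_idem : ∑ j, idem R j = 1 := by
  refine pj_ext fun i => ?_
  simp [pj_idem]

/-- The map `(W ⊗ R)[[v]] → R[[v]]` of coefficient rings induced by `w ⊗ r ↦ σ_j(w) r`. -/
def pS (R : NilpAlg D) (j : ZMod D.f) : SS R →+* R⟦X⟧ := PowerSeries.map (pj R j : WR R →+* R)

theorem coeff_pS (j : ZMod D.f) (x : SS R) (k : ℕ) :
    PowerSeries.coeff k (pS R j x) = pj R j (PowerSeries.coeff k x) := PowerSeries.coeff_map _ _ _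

theorem pS_ext {x y : SS R} (h : ∀ j, pS R j x = pS R j y) : x = y := by
  ext k
  refine pj_ext fun j => ?_
  rw [← coeff_pS, ← coeff_pS, h]

theorem pS_surj (y : ZMod D.f → R⟦X⟧) : ∃ x : SS R, ∀ j, pS R j x = y j := by
  choose c hc using fun k => (pj_bijective (R := R)).2 fun j => PowerSeries.coeff k (y j)
  refine ⟨PowerSeries.mk c, fun j => ?_⟩
  ext k
  rw [coeff_pS, PowerSeries.coeff_mk]
  exact congrFun (hc k) j

theorem pS_incl (j : ZMod D.f) (x : R⟦X⟧) : pS R j (incl R x) = x := by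
  ext k
  rw [coeff_pS, incl, PowerSeries.coeff_map]
  exact pj_includeRight j _

theorem pS_C (j : ZMod D.f) (x : WR R) : pS R j (PowerSeries.C x) = PowerSeries.C (pj R j x) :=
  PowerSeries.map_C _ _

theorem pS_X (j : ZMod D.f) : pS R j PowerSeries.X = PowerSeries.X := PowerSeries.map_X _

theorem pS_cR (j : ZMod D.f) (r : R) : pS R j (cR R r) = PowerSeries.C r := by
  rw [cR, pS_C, pj_includeRight]

theorem pS_cW (j : ZMod D.f) (w : D.W) :
    pS R j (cW R w) = PowerSeries.C (algebraMap D.Lam R (D.sigma j w)) := by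
  rw [cW, pS_C, pj_tmul, mul_one]

variable (R) in
/-- The idempotent of `(W ⊗ R)[[v]]` that cuts out the `j`-th component. -/
def eps (j : ZMod D.f) : SS R := PowerSeries.C (idem R j)

theorem pS_eps (i j : ZMod D.f) : pS R i (eps R j) = if i = j then 1 else 0 := by
  rw [eps, pS_C, pj_idem]
  split_ifs <;> simp

/-- On the j-th component (W ⊗ R)[[v]] acts through its quotient R[[v]]; hence coefficients of
vectors there may be taken in R[[v]]. -/
theorem mul_eps (j : ZMod D.f) (x : SS R) : x * eps R j = incl R (pS R j x) * eps R j := by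
  refine pS_ext fun i => ?_
  rw [map_mul, map_mul, pS_eps, pS_incl]
  split_ifs with h
  · rw [h]
  · rw [mul_zero, mul_zero]

theorem sum_eps : ∑ j, eps R j = 1 := by
  rw [← map_one PowerSeries.C, ← sum_idem, map_sum]
  rfl

theorem pS_baseS {R' : NilpAlg D} (h : R →ₐ[D.Lam] R') (j : ZMod D.f) (x : SS R) :
    pS R' j (baseS h x) = PowerSeries.map (h : R →+* R') (pS R j x) := by
  ext k
  rw [coeff_pS, PowerSeries.coeff_map, coeff_pS, baseS, PowerSeries.coeff_map]
  exact pj_map h j _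

theorem baseS_eps {R' : NilpAlg D} (h : R →ₐ[D.Lam] R') (j : ZMod D.f) :
    baseS h (eps R j) = eps R' j := by
  refine pS_ext fun i => ?_
  rw [pS_baseS, pS_eps, pS_eps]
  split_ifs <;> simp

theorem baseS_incl {R' : NilpAlg D} (h : R →ₐ[D.Lam] R') (x : R⟦X⟧) :
    baseS h (incl R x) = incl R' (PowerSeries.map (h : R →+* R') x) := by
  refine pS_ext fun i => ?_
  rw [pS_baseS, pS_incl, pS_incl]

theorem galS_eps (g : D.Gal) (j : ZMod D.f) : galS R g (eps R j) = eps R j := galS_C _ _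

theorem pS_galS (g : D.Gal) (j : ZMod D.f) (x : SS R) : pS R j (galS R g x) =
    PowerSeries.rescale (algebraMap D.Lam R (D.sigma j (D.om g))) (pS R j x) := by
  ext k
  rw [coeff_pS, galS, PowerSeries.coeff_rescale, PowerSeries.coeff_rescale, coeff_pS, map_mul,
    map_pow, pj_tmul, mul_one]

theorem pS_PS (j : ZMod D.f) : pS R j (PS R) = PR R j := by
  rw [PS_eq, Polynomial.hom_eval₂, map_pow, pS_X, PR, ER, EL, Polynomial.map_map, uToV,
    Polynomial.coe_eval₂RingHom, Polynomial.eval₂_map]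
  congr 1
  ext1 w
  exact pS_cW j w

variable {Q : Type u} [AddCommGroup Q] [Module (SS R) Q]

theorem InComp.C_smul {j : ZMod D.f} {y : Q} (hy : InComp R j y) (x : WR R) :
    (PowerSeries.C x : SS R) • y = cR R (pj R j x) • y := by
  induction x using TensorProduct.induction_on with
  | zero => rw [map_zero, map_zero, cR, TensorProduct.tmul_zero, map_zero]
  | tmul w r =>
    have h₁ : w ⊗ₜ[ℤ_[p]] r = ((1 : D.W) ⊗ₜ[ℤ_[p]] r) * (w ⊗ₜ[ℤ_[p]] (1 : R)) := by
      rw [Algebra.TensorProduct.tmul_mul_tmul, one_mul, mul_one]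
    have h₂ : cR R (algebraMap D.Lam R (D.sigma j w) * r) =
        cR R r * cL R (D.sigma j w) := by
      rw [cL, cR, cR, cR, ← map_mul, Algebra.TensorProduct.tmul_mul_tmul, one_mul, mul_comm]
    rw [pj_tmul, h₁, map_mul, mul_smul, h₂, mul_smul]
    exact congrArg _ (hy w)
  | add x x' hx hx' =>
    rw [map_add, add_smul, hx, hx', map_add, cR, cR, cR, TensorProduct.tmul_add, map_add, add_smul]

theorem InComp.eps_smul {j : ZMod D.f} {y : Q} (hy : InComp R j y) : eps R j • y = y := by
  rw [eps, hy.C_smul, pj_idem, if_pos rfl, cR, ← Algebra.TensorProduct.one_def, map_one, one_smul]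

theorem InComp.smul_eq {j : ZMod D.f} {y : Q} (hy : InComp R j y) (x : SS R) :
    x • y = incl R (pS R j x) • y := by
  rw [← hy.eps_smul, smul_smul, mul_eps, mul_smul]

theorem inComp_eps_smul (j : ZMod D.f) (y : Q) : InComp R j (eps R j • y) := fun w => by
  rw [smul_smul, smul_smul, mul_eps, mul_eps j (cL R _), pS_cW, cL, pS_cR]

theorem eps_mul_eps (i j : ZMod D.f) : eps R i * eps R j = if i = j then eps R i else 0 := by
  refine pS_ext fun k => ?_
  rw [map_mul, pS_eps, pS_eps]
  by_cases h : i = j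
  · subst h
    rw [if_pos rfl, pS_eps]
    split_ifs <;> simp
  · rw [if_neg h, map_zero]
    by_cases hk : k = i
    · rw [if_neg (fun hk' => h (hk ▸ hk')), mul_zero]
    · rw [if_neg hk, zero_mul]

theorem sum_eps_smul (y : Q) : ∑ j, eps R j • y = y := by
  rw [← Finset.sum_smul, sum_eps, one_smul]

end Components

end KisinDescent

namespace KisinDescent

variable {p : ℕ} [Fact p.Prime] {D : Setup.{u} p}

/-! ### Cyclic shifts of base p digits -/

section Digits

theorem sum_digits (p a f : ℕ) : ∑ l ∈ Finset.range f, (a / p ^ l % p) * p ^ l = a % p ^ f := by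
  induction f with
  | zero => simp [Nat.mod_one]
  | succ f ih => rw [Finset.sum_range_succ, ih, Nat.mod_pow_succ, mul_comm (a / p ^ f % p)]

theorem pow_mod_modEq {p f : ℕ} (hp : 1 < p) (m : ℕ) : p ^ m ≡ p ^ (m % f) [MOD p ^ f - 1] := by
  have h₁ : p ^ f ≡ 1 [MOD p ^ f - 1] := by
    have := Nat.sub_add_cancel (Nat.one_le_pow f p (by omega))
    conv_lhs => rw [← this]
    exact Nat.add_modEq_left
  conv_lhs => rw [← Nat.mod_add_div m f, pow_add, pow_mul]
  simpa using (Nat.ModEq.refl (p ^ (m % f))).mul (h₁.pow (m / f))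

/-- Modulo p^f - 1 one has p^f = 1, so multiplication by p^j rotates the digits by j places. -/
theorem twistExp_modEq {p f a : ℕ} [NeZero f] (hp : 1 < p) (ha : a < p ^ f) (j : ZMod f) :
    twistExp p f a j ≡ a * p ^ j.val [MOD p ^ f - 1] := by
  have hf : 0 < f := NeZero.pos f
  have hj : j.val < f := ZMod.val_lt j
  have h₁ : twistExp p f a j =
      ∑ l ∈ Finset.range f, (a / p ^ l % p) * p ^ ((l + j.val) % f) := by
    -- The k-th digit of a^(j) is the digit of a at l = k - j modulo f, so the two index maps are
    -- translations by f - j and by j.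
    refine Finset.sum_nbij' (fun k => (f - j.val + k) % f) (fun l => (l + j.val) % f)
      (fun k _ => Finset.mem_range.2 (Nat.mod_lt _ hf))
      (fun k _ => Finset.mem_range.2 (Nat.mod_lt _ hf)) (fun k hk => ?_) (fun l hl => ?_)
      (fun k hk => ?_)
    · rw [Nat.mod_add_mod, show f - j.val + k + j.val = k + f by omega, Nat.add_mod_right,
        Nat.mod_eq_of_lt (Finset.mem_range.1 hk)]
    · rw [Nat.add_mod_mod, show f - j.val + (l + j.val) = l + f by omega, Nat.add_mod_right,
        Nat.mod_eq_of_lt (Finset.mem_range.1 hl)]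
    · rw [Nat.mod_add_mod, show f - j.val + k + j.val = k + f by omega, Nat.add_mod_right,
        Nat.mod_eq_of_lt (Finset.mem_range.1 hk)]
  have h₂ : a = ∑ l ∈ Finset.range f, (a / p ^ l % p) * p ^ l := by
    rw [sum_digits, Nat.mod_eq_of_lt ha]
  rw [h₁]
  conv_rhs => rw [h₂, Finset.sum_mul]
  have h₃ : ∀ s : Finset ℕ, ∑ l ∈ s, (a / p ^ l % p) * p ^ ((l + j.val) % f) ≡
      ∑ l ∈ s, (a / p ^ l % p) * p ^ l * p ^ j.val [MOD p ^ f - 1] := fun s => by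
    induction s using Finset.cons_induction with
    | empty => exact Nat.ModEq.rfl
    | cons l s hl ih =>
      rw [Finset.sum_cons, Finset.sum_cons]
      refine Nat.ModEq.add ?_ ih
      rw [mul_assoc, ← pow_add]
      exact (Nat.ModEq.refl _).mul (pow_mod_modEq hp _).symm
  exact h₃ _

/-- A number with f digits is at most p^f - 1. Equality would give p^f - 1 ∣ a p^j, hence a = 0
since p^j is prime to p^f - 1; but the twist of 0 is 0. -/
theorem twistExp_lt {p f a : ℕ} [NeZero f] (hp : 1 < p) (ha : a < p ^ f - 1) (j : ZMod f) :
    twistExp p f a j < p ^ f - 1 := by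
  have h₁ : twistExp p f a j < p ^ f := by
    have h₂ : ∀ (c : ℕ → ℕ) (m : ℕ), (∀ k, c k < p) → ∑ k ∈ Finset.range m, c k * p ^ k < p ^ m := by
      intro c m hc
      induction m with
      | zero => simp
      | succ m ih =>
        rw [Finset.sum_range_succ, pow_succ]
        have h₄ : c m * p ^ m + p ^ m ≤ p ^ m * p := by
          rw [mul_comm (p ^ m) p, ← Nat.succ_mul]
          exact Nat.mul_le_mul_right _ (hc m)
        omega
    exact h₂ _ f fun k => Nat.mod_lt _ (by omega)
  refine lt_of_le_of_ne (by omega) fun he => ?_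
  have h₂ := twistExp_modEq hp (show a < p ^ f by omega) j
  rw [he] at h₂
  have h₃ : p ^ f - 1 ∣ a * p ^ j.val := (Nat.modEq_zero_iff_dvd).1
    (h₂.symm.trans (Nat.modEq_zero_iff_dvd.2 dvd_rfl))
  have hcop : Nat.Coprime (p ^ f - 1) (p ^ j.val) := by
    refine Nat.Coprime.pow_right _ ?_
    have hpf : p ∣ p ^ f := dvd_pow_self p (NeZero.ne f)
    have h1 : 1 ≤ p ^ f := Nat.one_le_pow _ _ (by omega)
    have : Nat.Coprime (p ^ f - 1) (p ^ f) := by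
      have := (Nat.coprime_self_add_right (m := p ^ f - 1) (n := 1)).2 (Nat.coprime_one_right _)
      rwa [Nat.sub_add_cancel h1] at this
    exact this.coprime_dvd_right hpf
  have ha0 : a = 0 := Nat.eq_zero_of_dvd_of_lt (hcop.dvd_of_dvd_mul_right h₃) ha
  rw [ha0] at he
  simp [twistExp] at he
  omega

end Digits

/-! ### Δ is cyclic of order d; its characters in terms of σ_j ∘ ω -/

namespace Setup

variable (D)

/-- A generator of the cyclic group of units of the residue field is a simple root of X^d - 1, as d
is prime to p, and lifts by Hensel. For 0 < m < d the element ζ^m - 1 is nonzero modulo p, hence a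
unit. -/
theorem exists_primitive : ∃ ζ : D.W, ζ ^ D.d = 1 ∧ ∀ m, 0 < m → m < D.d → IsUnit (ζ ^ m - 1) := by
  have hfin : Finite D.resField := Nat.finite_of_card_ne_zero (by
    rw [card_resField]; exact (pow_pos (Fact.out : p.Prime).pos _).ne')
  obtain ⟨u, hu⟩ := IsCyclic.exists_generator (α := D.resFieldˣ)
  have hcard : Nat.card D.resFieldˣ = D.d := by
    rw [Nat.card_units, card_resField]; rfl
  have hord : orderOf u = D.d := by rw [orderOf_eq_card_of_forall_mem_zpowers hu, hcard]
  obtain ⟨a₀, ha₀⟩ := Ideal.Quotient.mk_surjective (u : D.resField)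
  have hud : (u : D.resField) ^ D.d = 1 := by
    rw [← Units.val_pow_eq_pow_val, ← hord, pow_orderOf_eq_one, Units.val_one]
  have hdk : IsUnit (D.d : D.resField) := by
    rw [isUnit_iff_ne_zero]
    intro h
    refine D.p_dvd_d_not (Ideal.mem_span_singleton.1 (Ideal.Quotient.eq_zero_iff_mem.1 ?_))
    rw [map_natCast]
    exact h
  obtain ⟨ζ, hζ, hζ'⟩ := HenselianRing.is_henselian (I := Ideal.span {(p : D.W)})
    (Polynomial.X ^ D.d - 1 : D.W[X]) (Polynomial.monic_X_pow_sub_C 1 D.d_pos.ne') a₀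
    (by
      rw [← Ideal.Quotient.eq_zero_iff_mem]
      simp [ha₀, hud])
    (by
      simp only [Polynomial.derivative_sub, Polynomial.derivative_X_pow, Polynomial.derivative_one,
        sub_zero, Polynomial.eval_mul, Polynomial.eval_pow, Polynomial.eval_X, map_mul, map_pow, ha₀,
        Polynomial.eval_natCast, map_natCast]
      exact hdk.mul (u.isUnit.pow _))
  have hζd : ζ ^ D.d = 1 := by
    simpa [Polynomial.IsRoot.def, sub_eq_zero] using hζ
  refine ⟨ζ, hζd, fun m hm hmd => ?_⟩
  rw [isUnit_iff_not_dvd, ← Ideal.mem_span_singleton, ← Ideal.Quotient.eq_zero_iff_mem, map_sub,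
    map_pow, Ideal.Quotient.eq.2 hζ', ha₀, map_one, sub_eq_zero]
  intro h
  have h₁ : u ^ m = 1 := Units.ext h
  exact absurd (Nat.le_of_dvd hm (orderOf_dvd_of_pow_eq_one h₁)) (by rw [hord]; omega)

/-- Eisenstein's criterion at the prime (π_K) of the ring of integers of K. -/
theorem irreducible_X_pow_sub : Irreducible (Polynomial.X ^ D.d - Polynomial.C (D.πK : D.K)) := by
  have : IsFractionRing (integralClosure ℤ_[p] D.K) D.K :=
    integralClosure.isFractionRing_of_finite_extension ℚ_[p] D.K
  have : IsIntegrallyClosed (integralClosure ℤ_[p] D.K) :=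
    integralClosure.isIntegrallyClosedOfFiniteExtension ℚ_[p]
  let f : (integralClosure ℤ_[p] D.K)[X] := Polynomial.X ^ D.d - Polynomial.C D.πK
  have hf : f.Monic := Polynomial.monic_X_pow_sub_C _ D.d_pos.ne'
  have hdeg : f.natDegree = D.d := Polynomial.natDegree_X_pow_sub_C
  have hπ0 : D.πK ≠ 0 := fun h => D.πK_ne_zero (congrArg Subtype.val h)
  have hE : f.IsEisensteinAt (Ideal.span {D.πK}) :=
    { leading := by
        rw [hf.leadingCoeff]
        exact fun h => D.uniformizer.ne_top ((Ideal.eq_top_iff_one _).2 h)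
      mem := by
        intro n hn
        rw [hdeg] at hn
        simp only [f, Polynomial.coeff_sub, Polynomial.coeff_X_pow, Polynomial.coeff_C]
        rw [if_neg hn.ne, zero_sub]
        split_ifs
        · exact neg_mem (Ideal.subset_span rfl)
        · simp
      notMem := by
        simp only [f, Polynomial.coeff_sub, Polynomial.coeff_X_pow, Polynomial.coeff_C]
        rw [if_neg D.d_pos.ne, zero_sub, if_true, neg_mem_iff, Ideal.span_singleton_pow,
          Ideal.mem_span_singleton]
        rintro ⟨c, hc⟩
        have h₁ : D.πK * 1 = D.πK * (D.πK * c) := by rw [mul_one, ← mul_assoc, ← sq]; exact hc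
        exact D.πK_not_isUnit (IsUnit.of_mul_eq_one c (mul_left_cancel₀ hπ0 h₁).symm) }
  have h := hE.irreducible D.uniformizer.isPrime hf.isPrimitive (by rw [hdeg]; exact D.d_pos)
  rw [hf.irreducible_iff_irreducible_map_fraction_map (K := D.K)] at h
  simpa [f] using h

/-- ω is onto the d-th roots of unity: ζ π_L is another root of the minimal polynomial X^d - π_K of
the generator π_L, so π_L ↦ ζ π_L extends to an automorphism. -/
theorem exists_gal_pow (ζ : D.W) (hζ : ζ ^ D.d = 1) : ∃ g : D.Gal, D.om g = ζ := by
  set z : D.L := algebraMap D.K D.L (((show integralClosure ℤ_[p] D.K0 from ζ) : D.K0) : D.K) with hz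
  have hzd : z ^ D.d = 1 := by
    rw [hz, ← map_pow]
    have : ((((show integralClosure ℤ_[p] D.K0 from ζ) : D.K0) : D.K)) ^ D.d = 1 := by
      have := congrArg (fun w : D.W => (((show integralClosure ℤ_[p] D.K0 from w) : D.K0) : D.K)) hζ
      exact this
    rw [this, map_one]
  have hπ : D.πL ^ D.d = algebraMap D.K D.L D.πK := D.πL_pow
  let q : D.K[X] := Polynomial.X ^ D.d - Polynomial.C (D.πK : D.K)
  have hqm : q.Monic := Polynomial.monic_X_pow_sub_C _ D.d_pos.ne'
  have hq : q = minpoly D.K D.πL :=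
    minpoly.eq_of_irreducible_of_monic D.irreducible_X_pow_sub (by simp [q, hπ]) hqm
  have hint : IsIntegral D.K D.πL := ⟨q, hqm, by simp [q, hπ]⟩
  have hroot : z * D.πL ∈ (minpoly D.K D.πL).aroots D.L := by
    rw [← hq, Polynomial.mem_aroots]
    refine ⟨hqm.ne_zero, ?_⟩
    simp [q, mul_pow, hzd, hπ]
  let e : D.L ≃ₐ[D.K] IntermediateField.adjoin D.K {D.πL} :=
    (IntermediateField.topEquiv.symm).trans (IntermediateField.equivOfEq D.πL_gen.symm)
  have he : e D.πL = IntermediateField.AdjoinSimple.gen D.K D.πL := Subtype.ext rfl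
  let F := (IntermediateField.algHomAdjoinIntegralEquiv D.K (K := D.L) hint).symm ⟨_, hroot⟩
  have hF : F (IntermediateField.AdjoinSimple.gen D.K D.πL) = z * D.πL :=
    IntermediateField.algHomAdjoinIntegralEquiv_symm_apply_gen D.K hint ⟨_, hroot⟩
  have hfin : FiniteDimensional D.K D.L :=
    have := IntermediateField.adjoin.finiteDimensional hint
    Module.Finite.equiv e.symm.toLinearEquiv
  let G : D.L →ₐ[D.K] D.L := F.comp (e : D.L →ₐ[D.K] _)
  let g : D.Gal := AlgEquiv.ofBijective G (Algebra.IsAlgebraic.algHom_bijective G)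
  have hg : g D.πL = z * D.πL := by
    change F (e D.πL) = _
    rw [he, hF]
  refine ⟨g, D.algebraMap_om_injective ?_⟩
  have h := D.ω_spec g
  rw [hg] at h
  exact mul_right_cancel₀ D.πL_ne_zero h

theorem om_injective : Function.Injective D.om := fun g h hgh => by
  have h₁ : g D.πL = h D.πL := by
    rw [← D.ω_spec, ← D.ω_spec]
    exact congrArg (fun w : D.W => algebraMap D.K D.L
      (((show integralClosure ℤ_[p] D.K0 from w) : D.K0) : D.K) * D.πL) hgh
  have h₂ : (g : D.L →ₐ[D.K] D.L) = h := by
    have h₃ : ∀ x : D.L, x ∈ IntermediateField.adjoin D.K {D.πL} → g x = h x := fun x hx => by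
      induction hx using IntermediateField.adjoin_induction with
      | mem x hx => rw [Set.mem_singleton_iff.1 hx, h₁]
      | algebraMap x => rw [AlgEquiv.commutes, AlgEquiv.commutes]
      | add x y _ _ hx hy => rw [map_add, map_add, hx, hy]
      | inv x _ hx => rw [map_inv₀, map_inv₀, hx]
      | mul x y _ _ hx hy => rw [map_mul, map_mul, hx, hy]
    exact AlgHom.ext fun x => h₃ x (by rw [D.πL_gen]; trivial)
  exact AlgEquiv.ext fun x => DFunLike.congr_fun h₂ x

/-- ω identifies Δ with the d-th roots of unity. A generator makes equivariance a single equation,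
and the units ω(g₀)^m - 1 separate the weights. -/
theorem exists_generator : ∃ g₀ : D.Gal, (∀ m, 0 < m → m < D.d → IsUnit (D.om g₀ ^ m - 1)) ∧
    ∀ g : D.Gal, ∃ k : ℕ, g = g₀ ^ k := by
  obtain ⟨ζ, hζ, hu⟩ := D.exists_primitive
  obtain ⟨g₀, hg₀⟩ := D.exists_gal_pow ζ hζ
  refine ⟨g₀, fun m hm hmd => by rw [hg₀]; exact hu m hm hmd, fun g => ?_⟩
  have hprim : IsPrimitiveRoot ζ D.d := by
    refine IsPrimitiveRoot.mk_of_lt ζ D.d_pos hζ fun m hm hmd h => ?_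
    have := hu m hm hmd
    rw [h, sub_self] at this
    exact not_isUnit_zero this
  have hd0 : NeZero D.d := ⟨D.d_pos.ne'⟩
  obtain ⟨k, -, hk⟩ := hprim.eq_pow_of_pow_eq_one (D.om_pow_d g)
  refine ⟨k, D.om_injective ?_⟩
  have hpow : ∀ k, D.om (g₀ ^ k) = D.om g₀ ^ k := fun k => by
    simp only [om, map_pow]
    rfl
  rw [hpow, hg₀, hk]

/-- A generator of `Δ`. -/
def gen : D.Gal := D.exists_generator.choose

theorem isUnit_om_gen_pow_sub_one {m : ℕ} (hm : 0 < m) (hmd : m < D.d) :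
    IsUnit (D.om D.gen ^ m - 1) := D.exists_generator.choose_spec.1 m hm hmd

theorem exists_eq_gen_pow (g : D.Gal) : ∃ k : ℕ, g = D.gen ^ k :=
  D.exists_generator.choose_spec.2 g

theorem om_one : D.om 1 = 1 := by simp only [om, map_one]; rfl

theorem gen_pow_d : D.gen ^ D.d = 1 := D.om_injective (by
  have : D.om (D.gen ^ D.d) = D.om D.gen ^ D.d := by simp only [om, map_pow]; rfl
  rw [this, om_pow_d, om_one])

theorem chi_mul (i : Fin D.n) (g h : D.Gal) : D.chi i (g * h) = D.chi i g * D.chi i h := by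
  simp only [chi, map_mul]
  rfl

theorem chi_one (i : Fin D.n) : D.chi i 1 = 1 := by simp only [chi, map_one]; rfl

theorem chi_pow (i : Fin D.n) (g : D.Gal) (k : ℕ) : D.chi i (g ^ k) = D.chi i g ^ k := by
  simp only [chi, map_pow]; rfl

theorem chi_eq_sigma0 (i : Fin D.n) (g : D.Gal) : D.chi i g = D.sigma0 (D.om g) ^ D.a i := by
  apply Subtype.val_injective (p := fun x => x ∈ integralClosure ℤ_[p] D.F)
  exact D.χ_eq i g

theorem sigma0_om (j : ZMod D.f) (g : D.Gal) :
    D.sigma0 (D.om g) = D.sigma j (D.om g) ^ p ^ j.val := by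
  have h₁ : ∀ m : ℕ, (D.frobW ^ m) (D.om g) = D.om g ^ p ^ m := fun m => by
    induction m with
    | zero => simp
    | succ m ih => rw [pow_succ', AlgEquiv.mul_apply, ih, map_pow, frobW_om, ← pow_mul, pow_succ']
  have h₂ : D.sigma j (D.om g) = D.sigma0 ((D.frobW⁻¹ ^ j.val) (D.om g)) := rfl
  rw [h₂, ← map_pow, ← map_pow, ← h₁, inv_pow, ← AlgEquiv.mul_apply, inv_mul_cancel,
    AlgEquiv.one_apply]

theorem sigma_om_pow_d (j : ZMod D.f) (g : D.Gal) : D.sigma j (D.om g) ^ D.d = 1 := by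
  rw [← map_pow, om_pow_d, map_one]

/-- One has σ_0 ∘ ω = (σ_j ∘ ω)^{p^j}, so χ_i is the power a_i p^j of σ_j ∘ ω. This exponent is
a_i^(j) modulo d, and ω has order dividing d. -/
theorem chi_eq_sigma (j : ZMod D.f) (i : Fin D.n) (g : D.Gal) :
    D.chi i g = D.sigma j (D.om g) ^ D.ex j i := by
  have h := twistExp_modEq (f := D.f) (Fact.out : p.Prime).one_lt
    ((D.a_lt i).trans (Nat.sub_lt (by have := D.one_lt_pow; exact this.pos) one_pos)) j
  rw [chi_eq_sigma0, D.sigma0_om j, ← pow_mul, mul_comm]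
  exact (pow_eq_pow_of_modEq h (D.sigma_om_pow_d j g)).symm

theorem ex_lt (j : ZMod D.f) (i : Fin D.n) : D.ex j i < D.d :=
  twistExp_lt (f := D.f) (Fact.out : p.Prime).one_lt (D.a_lt i) j

/-- Being units rather than merely nonzero, these differences stay invertible in every Λ-algebra R.
-/
theorem isUnit_sigma_pow_sub {j : ZMod D.f} {a b : ℕ} (ha : a < D.d) (hb : b < D.d) (hab : a ≠ b) :
    IsUnit (D.sigma j (D.om D.gen) ^ a - D.sigma j (D.om D.gen) ^ b) := by
  have hu : IsUnit (D.sigma j (D.om D.gen)) :=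
    IsUnit.of_pow_eq_one (D.sigma_om_pow_d j _) D.d_pos.ne'
  have key : ∀ a b, a < b → b < D.d →
      IsUnit (D.sigma j (D.om D.gen) ^ b - D.sigma j (D.om D.gen) ^ a) := fun a b hab hb => by
    have h₁ := (D.isUnit_om_gen_pow_sub_one (Nat.sub_pos_of_lt hab)
      ((Nat.sub_le b a).trans_lt hb)).map (D.sigma j)
    have h₂ : D.sigma j (D.om D.gen) ^ b - D.sigma j (D.om D.gen) ^ a =
        D.sigma j (D.om D.gen) ^ a * (D.sigma j (D.om D.gen) ^ (b - a) - 1) := by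
      rw [mul_sub, mul_one, ← pow_add, Nat.add_sub_cancel' hab.le]
    rw [h₂]
    rw [map_sub, map_pow, map_one] at h₁
    exact (hu.pow a).mul h₁
  rcases lt_or_gt_of_ne hab with h | h
  · rw [← neg_sub]
    exact (key a b h hb).neg
  · exact key b a h ha

theorem chi_eq_iff (j : ZMod D.f) (i m : Fin D.n) : D.χ i = D.χ m ↔ D.ex j i = D.ex j m := by
  have key : D.χ i = D.χ m ↔ ∀ g, D.chi i g = D.chi m g :=
    ⟨fun h g => by simp only [chi]; rw [h], fun h => MonoidHom.ext fun g => Units.ext (h g)⟩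
  rw [key]
  refine ⟨fun h => ?_, fun h g => by rw [D.chi_eq_sigma j, D.chi_eq_sigma j, h]⟩
  by_contra hne
  have h₁ := h D.gen
  have h₂ := D.isUnit_sigma_pow_sub (j := j) (D.ex_lt j i) (D.ex_lt j m) hne
  rw [← chi_eq_sigma, ← chi_eq_sigma, h₁, sub_self] at h₂
  have : Nontrivial D.Lam := inferInstanceAs (Nontrivial (integralClosure ℤ_[p] D.F))
  exact not_isUnit_zero h₂

end Setup

/-- Equal characters mean equal exponents a^(j), and s_j sorts the exponents. So the k-th step of
the filtration is spanned by the i with a_i ≤ a_{s_j(k)}, and preserving all steps means that no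
entry leads from an exponent to a strictly larger one. -/
theorem mem_parabolicAlg_iff_ex {A : Type u} [CommRing A] (j : ZMod D.f)
    (x : Matrix (Fin D.n) (Fin D.n) A) :
    x ∈ parabolicAlg j A ↔ ∀ m i, D.ex j i < D.ex j m → x m i = 0 := by
  have hmono : Monotone fun i => D.ex j (D.ori j i) := D.s_mono j
  rw [mem_parabolicAlg_iff]
  simp only [D.chi_eq_iff j]
  constructor
  · intro h m i hlt
    refine h ((D.ori j).symm i) m i ⟨_, le_rfl, by rw [Equiv.apply_symm_apply]⟩ ?_
    rintro ⟨l, hl, he⟩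
    have := hmono hl
    simp only [Equiv.apply_symm_apply] at this
    omega
  · rintro h k m i ⟨l, hl, he⟩ hm
    refine h m i ?_
    have h₁ := hmono hl
    have h₂ : k ≤ (D.ori j).symm m := by
      by_contra! hlt
      exact hm ⟨_, hlt.le, by rw [Equiv.apply_symm_apply]⟩
    have h₃ := hmono h₂
    simp only [Equiv.apply_symm_apply] at h₁ h₃
    refine lt_of_le_of_ne (by omega) fun hne => hm ⟨l, hl, ?_⟩
    rw [← hne, he]

end KisinDescent

namespace KisinDescent

/-! ### Polynomials that are a power of the variable up to nilpotents -/

section NilDistinguished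

variable {S : Type*} [CommRing S]

/-- `f` is a power of the variable plus a nilpotent polynomial. -/
def NilDist (f : S[X]) : Prop := ∃ m, 0 < m ∧ IsNilpotent (f - Polynomial.X ^ m)

variable {f : S[X]}

/-- Modulo f^r both f and f - X^m are nilpotent, hence so is X. With the converse
`NilDist.exists_X_pow_dvd`, the f-adic and X-adic topologies coincide. -/
theorem NilDist.exists_dvd_X_pow (hf : NilDist f) (r : ℕ) :
    ∃ M, f ^ r ∣ (Polynomial.X : S[X]) ^ M := by
  obtain ⟨m, -, hn⟩ := hf
  let π := Ideal.Quotient.mk (Ideal.span {f ^ r})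
  have h₁ : IsNilpotent (π f) := ⟨r, by
    rw [← map_pow]
    exact Ideal.Quotient.eq_zero_iff_mem.2 (Ideal.subset_span rfl)⟩
  have h₂ : IsNilpotent (π Polynomial.X ^ m) := by
    have h₃ := (Commute.all _ _).isNilpotent_sub h₁ (hn.map π)
    rwa [map_sub, sub_sub_cancel, map_pow] at h₃
  obtain ⟨c, hc⟩ := h₂
  refine ⟨m * c, Ideal.mem_span_singleton.1 (Ideal.Quotient.eq_zero_iff_mem.1 ?_)⟩
  rw [← hc, ← pow_mul]
  exact map_pow _ _ _

theorem NilDist.exists_X_pow_dvd (hf : NilDist f) (s : ℕ) :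
    ∃ r, (Polynomial.X : S[X]) ^ s ∣ f ^ r := by
  obtain ⟨m, hm, hn⟩ := hf
  let π := Ideal.Quotient.mk (Ideal.span {(Polynomial.X : S[X]) ^ s})
  have h₁ : IsNilpotent (π Polynomial.X ^ m) := ⟨s, by
    have h₀ : π (Polynomial.X ^ s) = 0 :=
      Ideal.Quotient.eq_zero_iff_mem.2 (Ideal.subset_span rfl)
    rw [← pow_mul, mul_comm, pow_mul, ← map_pow, h₀, zero_pow hm.ne']⟩
  have h₂ : IsNilpotent (π f) := by
    have h₃ := (Commute.all _ _).isNilpotent_add h₁ (hn.map π)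
    rwa [map_sub, map_pow, add_sub_cancel] at h₃
  obtain ⟨c, hc⟩ := h₂
  refine ⟨c, Ideal.mem_span_singleton.1 (Ideal.Quotient.eq_zero_iff_mem.1 ?_)⟩
  rw [← hc]
  exact map_pow _ _ _

theorem X_pow_dvd_sub_trunc (M : ℕ) (x : S⟦X⟧) :
    (PowerSeries.X : S⟦X⟧) ^ M ∣ x - (x.trunc M : S[X]) := by
  rw [PowerSeries.X_pow_dvd_iff]
  intro k hk
  rw [map_sub, Polynomial.coeff_coe, PowerSeries.coeff_trunc, if_pos hk, sub_self]

theorem coe_dvd_coe {a b : S[X]} (h : a ∣ b) : (a : S⟦X⟧) ∣ (b : S⟦X⟧) := by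
  obtain ⟨c, rfl⟩ := h
  exact ⟨c, Polynomial.coe_mul _ _⟩

theorem NilDist.exists_polynomial (hf : NilDist f) (r : ℕ) (x : S⟦X⟧) :
    ∃ q : S[X], (f : S⟦X⟧) ^ r ∣ x - q := by
  obtain ⟨M, hM⟩ := hf.exists_dvd_X_pow r
  refine ⟨x.trunc M, dvd_trans ?_ (X_pow_dvd_sub_trunc M x)⟩
  simpa using coe_dvd_coe hM

theorem X_pow_dvd_of_coe {q : S[X]} {M : ℕ} (h : (PowerSeries.X : S⟦X⟧) ^ M ∣ q) :
    Polynomial.X ^ M ∣ q := by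
  rw [Polynomial.X_pow_dvd_iff]
  intro k hk
  rw [← Polynomial.coeff_coe]
  exact PowerSeries.X_pow_dvd_iff.1 h k hk

/-- Injectivity of S[X]/f^r → S[[X]]/f^r: the quotient series may be truncated at a power of X that
f^r divides. -/
theorem NilDist.dvd_of_coe_dvd (hf : NilDist f) (r : ℕ) {q : S[X]}
    (h : (f : S⟦X⟧) ^ r ∣ q) : f ^ r ∣ q := by
  obtain ⟨M, hM⟩ := hf.exists_dvd_X_pow r
  obtain ⟨y, hy⟩ := h
  have h₁ : Polynomial.X ^ M ∣ q - f ^ r * y.trunc M := by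
    apply X_pow_dvd_of_coe
    rw [Polynomial.coe_sub, Polynomial.coe_mul, hy, Polynomial.coe_pow, ← mul_sub]
    exact (X_pow_dvd_sub_trunc M y).mul_left _
  have h₂ := dvd_add (hM.trans h₁) (Dvd.intro (y.trunc M) rfl)
  rwa [sub_add_cancel] at h₂

theorem NilDist.exists_X_pow_dvd' (hf : NilDist f) (s : ℕ) :
    ∃ r, ∀ r', r ≤ r' → (PowerSeries.X : S⟦X⟧) ^ s ∣ (f : S⟦X⟧) ^ r' := by
  obtain ⟨r, hr⟩ := hf.exists_X_pow_dvd s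
  refine ⟨r, fun r' h => ?_⟩
  have := coe_dvd_coe (hr.trans (pow_dvd_pow f h))
  simpa using this

theorem NilDist.eq_zero (hf : NilDist f) {y : S⟦X⟧} (h : ∀ r, (f : S⟦X⟧) ^ r ∣ y) : y = 0 := by
  ext k
  obtain ⟨r, hr⟩ := hf.exists_X_pow_dvd' (k + 1)
  exact PowerSeries.X_pow_dvd_iff.1 ((hr r le_rfl).trans (h r)) k (Nat.lt_succ_self k)

/-- S[[X]] is f-adically complete: the coefficient of X^k in x_r is constant once r is so large that
X^{k+1} divides f^r. -/
theorem NilDist.exists_limit (hf : NilDist f) (x : ℕ → S⟦X⟧)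
    (hx : ∀ r, (f : S⟦X⟧) ^ r ∣ x (r + 1) - x r) : ∃ y, ∀ r, (f : S⟦X⟧) ^ r ∣ y - x r := by
  have hx' : ∀ r s, (f : S⟦X⟧) ^ r ∣ x (r + s) - x r := fun r s => by
    induction s with
    | zero => simp
    | succ s ih =>
      have := dvd_add ((pow_dvd_pow _ (Nat.le_add_right r s)).trans (hx (r + s))) ih
      rwa [sub_add_sub_cancel] at this
  choose N hN using hf.exists_X_pow_dvd'
  let y : S⟦X⟧ := PowerSeries.mk fun k => PowerSeries.coeff k (x (N (k + 1)))
  have hy : ∀ k r, N (k + 1) ≤ r → PowerSeries.coeff k y = PowerSeries.coeff k (x r) := by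
    intro k r hr
    obtain ⟨s, rfl⟩ := Nat.exists_eq_add_of_le hr
    have h₁ := PowerSeries.X_pow_dvd_iff.1 ((hN (k + 1) _ le_rfl).trans (hx' _ s)) k
      (Nat.lt_succ_self k)
    rw [map_sub, sub_eq_zero] at h₁
    rw [PowerSeries.coeff_mk, h₁]
  refine ⟨y, fun r => ?_⟩
  obtain ⟨M, hM⟩ := hf.exists_dvd_X_pow r
  -- A single index r + s beyond the stabilization points of all coefficients below M; modulo X^M,
  -- hence modulo f^r, the limit then agrees with x_{r+s}.
  obtain ⟨s, hs⟩ : ∃ s, ∀ k < M, N (k + 1) ≤ r + s :=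
    ⟨∑ k ∈ Finset.range M, N (k + 1), fun k hk =>
      (Finset.single_le_sum (f := fun k => N (k + 1)) (fun _ _ => Nat.zero_le _)
        (Finset.mem_range.2 hk)).trans (Nat.le_add_left _ _)⟩
  have h₁ : (PowerSeries.X : S⟦X⟧) ^ M ∣ y - x (r + s) := by
    rw [PowerSeries.X_pow_dvd_iff]
    intro k hk
    rw [map_sub, hy k _ (hs k hk), sub_self]
  have h₂ : (f : S⟦X⟧) ^ r ∣ PowerSeries.X ^ M := by simpa using coe_dvd_coe hM
  have := dvd_add (h₂.trans h₁) (hx' r s)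
  rwa [sub_add_sub_cancel] at this

end NilDistinguished

/-! ### Weights: S[[v]] over S[[v^d]] -/

section Weights

variable {S : Type*} [CommRing S] {d : ℕ}

/-- The power series `∑ c_{dk+e} u^k` for `f = ∑ c_k v^k`. -/
def wt (d e : ℕ) (f : S⟦X⟧) : S⟦X⟧ := PowerSeries.mk fun k => PowerSeries.coeff (d * k + e) f

theorem coeff_wt (e : ℕ) (f : S⟦X⟧) (k : ℕ) :
    PowerSeries.coeff k (wt d e f) = PowerSeries.coeff (d * k + e) f := PowerSeries.coeff_mk _ _

theorem wt_sub (e : ℕ) (f g : S⟦X⟧) : wt d e (f - g) = wt d e f - wt d e g := by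
  ext k; simp [coeff_wt]

theorem wt_add (e : ℕ) (f g : S⟦X⟧) : wt d e (f + g) = wt d e f + wt d e g := by
  ext k; simp [coeff_wt]

theorem wt_C_mul (e : ℕ) (c : S) (f : S⟦X⟧) :
    wt d e (PowerSeries.C c * f) = PowerSeries.C c * wt d e f := by
  ext k; simp [coeff_wt]

theorem wt_ext (hd : d ≠ 0) {f g : S⟦X⟧} (h : ∀ e < d, wt d e f = wt d e g) : f = g := by
  ext k
  have h₁ := congrArg (PowerSeries.coeff (k / d)) (h (k % d) (Nat.mod_lt _ (Nat.pos_of_ne_zero hd)))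
  rwa [coeff_wt, coeff_wt, Nat.div_add_mod] at h₁

theorem wt_X_pow_mul_expand (hd : d ≠ 0) {e e' : ℕ} (he : e < d) (he' : e' < d) (h : S⟦X⟧) :
    wt d e (PowerSeries.X ^ e' * PowerSeries.expand d hd h) = if e = e' then h else 0 := by
  ext k
  rw [coeff_wt, PowerSeries.coeff_X_pow_mul', PowerSeries.coeff_expand]
  by_cases hee : e = e'
  · subst hee
    rw [if_pos (Nat.le_add_left _ _), Nat.add_sub_cancel, if_pos (Dvd.intro _ rfl),
      Nat.mul_div_cancel_left _ (Nat.pos_of_ne_zero hd), if_pos rfl]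
  · rw [if_neg hee, map_zero]
    split_ifs with h₁ h₂
    · exfalso
      apply hee
      have h₃ : (d * k + e) % d = (d * k + e - e' + e') % d := by rw [Nat.sub_add_cancel h₁]
      obtain ⟨c, hc⟩ := h₂
      rwa [hc, Nat.mul_add_mod, Nat.mul_add_mod, Nat.mod_eq_of_lt he, Nat.mod_eq_of_lt he'] at h₃
    · rfl
    · rfl

/-- S[[v]] is free over S[[v^d]] on 1, v, …, v^{d-1}, and `wt` gives the coordinates. Divisibility
by a series in v^d can therefore be tested weight by weight, as in `expand_dvd_iff`. -/
theorem eq_sum_wt (hd : d ≠ 0) (f : S⟦X⟧) : f = ∑ e ∈ Finset.range d,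
    PowerSeries.X ^ e * PowerSeries.expand d hd (wt d e f) := by
  refine wt_ext hd fun e he => ?_
  have hs : ∀ s : Finset ℕ, wt d e (∑ i ∈ s, PowerSeries.X ^ i *
      PowerSeries.expand d hd (wt d i f)) = ∑ i ∈ s, wt d e (PowerSeries.X ^ i *
      PowerSeries.expand d hd (wt d i f)) := fun s => by
    induction s using Finset.cons_induction with
    | empty => ext k; simp [coeff_wt]
    | cons a s ha ih => rw [Finset.sum_cons, Finset.sum_cons, wt_add, ih]
  rw [hs, Finset.sum_congr rfl fun i hi =>
    wt_X_pow_mul_expand hd he (Finset.mem_range.1 hi) (wt d i f)]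
  rw [Finset.sum_ite_eq, if_pos (Finset.mem_range.2 he)]

theorem wt_expand_mul (hd : d ≠ 0) {e : ℕ} (he : e < d) (t f : S⟦X⟧) :
    wt d e (PowerSeries.expand d hd t * f) = t * wt d e f := by
  have hs : ∀ s : Finset ℕ, (∀ i ∈ s, i < d) → wt d e (PowerSeries.expand d hd t *
      ∑ i ∈ s, PowerSeries.X ^ i * PowerSeries.expand d hd (wt d i f)) =
      ∑ i ∈ s, if e = i then t * wt d i f else 0 := fun s hs => by
    induction s using Finset.cons_induction with
    | empty => ext k; simp [coeff_wt]
    | cons a s ha ih =>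
      rw [Finset.sum_cons, mul_add, wt_add, Finset.sum_cons,
        ih fun i hi => hs i (Finset.mem_cons_of_mem hi), mul_left_comm, ← map_mul,
        wt_X_pow_mul_expand hd he (hs a (Finset.mem_cons_self _ _))]
  conv_lhs => rw [eq_sum_wt hd f]
  rw [hs _ fun i hi => Finset.mem_range.1 hi, Finset.sum_ite_eq, if_pos (Finset.mem_range.2 he)]

theorem expand_dvd_iff (hd : d ≠ 0) (t f : S⟦X⟧) :
    PowerSeries.expand d hd t ∣ f ↔ ∀ e < d, t ∣ wt d e f := by
  constructor
  · rintro ⟨y, rfl⟩ e he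
    exact ⟨_, wt_expand_mul hd he t y⟩
  · intro h
    rw [eq_sum_wt hd f]
    refine Finset.dvd_sum fun e he => Dvd.dvd.mul_left ?_ _
    obtain ⟨y, hy⟩ := h e (Finset.mem_range.1 he)
    exact ⟨_, by rw [hy, map_mul]⟩

theorem wt_rescale {ζ : S} (hζ : ζ ^ d = 1) (e : ℕ) (f : S⟦X⟧) :
    wt d e (PowerSeries.rescale ζ f) = PowerSeries.C (ζ ^ e) * wt d e f := by
  ext k
  rw [coeff_wt, PowerSeries.coeff_rescale, PowerSeries.coeff_C_mul, coeff_wt, pow_add, pow_mul, hζ,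
    one_pow, one_mul]

theorem expand_injective (hd : d ≠ 0) :
    Function.Injective (PowerSeries.expand d hd : S⟦X⟧ → S⟦X⟧) := fun f g h => by
  ext k
  rw [← PowerSeries.coeff_expand_mul d hd f, ← PowerSeries.coeff_expand_mul d hd g, h]

theorem map_wt {T : Type*} [CommRing T] (φ : S →+* T) (e : ℕ) (f : S⟦X⟧) :
    PowerSeries.map φ (wt d e f) = wt d e (PowerSeries.map φ f) := by
  ext k
  rw [PowerSeries.coeff_map, coeff_wt, coeff_wt, PowerSeries.coeff_map]

/-- If `f(ζv)a = bf(v)` modulo `t(v^d)`, with weights `a = ζ^k`, `b = ζ^l` and differences of powers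
of `ζ` units, then `f` is `v^e h(v^d)` modulo `t(v^d)`, where `k + e = l` modulo `d`. -/
theorem dvd_sub_of_rescale (hd : d ≠ 0) {ζ : S} (hζ : ζ ^ d = 1)
    (hu : ∀ a b, a < d → b < d → a ≠ b → IsUnit (ζ ^ a - ζ ^ b)) {k l e : ℕ} (he : e < d)
    (hkl : (k + e) % d = l % d) {t f : S⟦X⟧}
    (h : PowerSeries.expand d hd t ∣ PowerSeries.C (ζ ^ k) * PowerSeries.rescale ζ f -
      PowerSeries.C (ζ ^ l) * f) :
    PowerSeries.expand d hd t ∣ f - PowerSeries.X ^ e * PowerSeries.expand d hd (wt d e f) := by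
  have hmod : ∀ a, ζ ^ a = ζ ^ (a % d) := fun a => by
    conv_lhs => rw [← Nat.div_add_mod a d, pow_add, pow_mul, hζ, one_pow, one_mul]
  rw [expand_dvd_iff] at h ⊢
  intro e' he'
  rw [wt_sub, wt_X_pow_mul_expand hd he' he]
  by_cases hee : e' = e
  · subst hee
    rw [if_pos rfl, sub_self]
    exact dvd_zero _
  · rw [if_neg hee, sub_zero]
    have h₁ := h e' he'
    rw [wt_sub, wt_C_mul, wt_C_mul, wt_rescale hζ, ← mul_assoc, ← map_mul, ← pow_add, ← sub_mul,
      ← map_sub, hmod (k + e'), hmod l] at h₁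
    -- In a weight e' ≠ e the hypothesis says that t divides (ζ^{k+e'} - ζ^l) times the component of
    -- f. The factor is a unit because the two exponents differ modulo d.
    have hne : (k + e') % d ≠ l % d := by
      rw [← hkl]
      intro hc
      have := Nat.ModEq.add_left_cancel' k hc
      rw [Nat.ModEq, Nat.mod_eq_of_lt he, Nat.mod_eq_of_lt he'] at this
      exact hee this
    have hd0 := Nat.pos_of_ne_zero hd
    have h₂ := hu _ _ (Nat.mod_lt (k + e') hd0) (Nat.mod_lt l hd0) hne
    exact (h₂.map PowerSeries.C).dvd_mul_left.1 h₁

end Weights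

end KisinDescent

namespace KisinDescent

variable {p : ℕ} [Fact p.Prime] {D : Setup.{u} p}

/-! ### E_j and P(v) over a ring in which p is nilpotent -/

section Distinguished

variable (R : NilpAlg D) (j : ZMod D.f)

/-- E - u^{deg E} is divisible by p, and p is nilpotent in R. -/
theorem nilDist_ER : NilDist (ER R j) := by
  obtain ⟨hpos, hmon, hdvd⟩ := D.EW_spec
  refine ⟨D.EW.natDegree, hpos, ?_⟩
  obtain ⟨q, hq⟩ : Polynomial.C (p : D.W) ∣ D.EW - Polynomial.X ^ D.EW.natDegree := by
    rw [Polynomial.C_dvd_iff_dvd_coeff]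
    intro k
    rw [Polynomial.coeff_sub, Polynomial.coeff_X_pow]
    rcases lt_trichotomy k D.EW.natDegree with h | h | h
    · rw [if_neg h.ne, sub_zero]
      exact hdvd k h
    · rw [if_pos h, h, hmon.coeff_natDegree, sub_self]
      exact dvd_zero _
    · rw [if_neg h.ne', sub_zero, Polynomial.coeff_eq_zero_of_natDegree_lt h]
      exact dvd_zero _
  have h₁ : ER R j - Polynomial.X ^ D.EW.natDegree = Polynomial.C (p : R) *
      (q.map (D.sigma j : D.W →+* D.Lam)).map (algebraMap D.Lam R) := by
    have h₂ := congrArg (fun r : D.W[X] => (r.map (D.sigma j : D.W →+* D.Lam)).map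
      (algebraMap D.Lam R)) hq
    simpa [ER, EL] using h₂
  rw [h₁]
  exact (Commute.all _ _).isNilpotent_mul_right (R.nilp.map Polynomial.C)

theorem ER_monic : (ER R j).Monic := (D.EW_spec.2.1.map _).map _

variable {R j}

theorem uToV_eq (x : R[X]) : uToV R x = PowerSeries.expand D.d D.d_pos.ne' (x : R⟦X⟧) := by
  have h : uToV R = (PowerSeries.expand D.d D.d_pos.ne' : R⟦X⟧ →ₐ[R] R⟦X⟧).toRingHom.comp
      Polynomial.coeToPowerSeries.ringHom := by
    refine Polynomial.ringHom_ext (fun r => ?_) ?_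
    · simp [uToV, PowerSeries.expand_C]
    · simp [uToV, PowerSeries.expand_X]
  rw [h]
  rfl

theorem PR_pow_eq (N : ℕ) :
    PR R j ^ N = PowerSeries.expand D.d D.d_pos.ne' ((ER R j : R⟦X⟧) ^ N) := by
  rw [PR, uToV_eq, map_pow]

theorem map_PR {R' : NilpAlg D} (h : R →ₐ[D.Lam] R') :
    PowerSeries.map (h : R →+* R') (PR R j) = PR R' j := by
  rw [← pS_PS, ← pS_baseS, baseS_PS, pS_PS]

theorem exists_X_dvd_PS_pow (R : NilpAlg D) : ∃ r, (PowerSeries.X : SS R) ∣ PS R ^ r := by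
  choose r hr using fun j => (nilDist_ER R j).exists_X_pow_dvd' 1
  -- One exponent that is large enough for all components at once.
  refine ⟨∑ j, r j, ?_⟩
  rw [PowerSeries.X_dvd_iff]
  refine pj_ext fun j => ?_
  rw [← PowerSeries.coeff_zero_eq_constantCoeff_apply, ← coeff_pS, map_pow, pS_PS, PR_pow_eq,
    PowerSeries.coeff_zero_eq_constantCoeff_apply, PowerSeries.constantCoeff_expand, map_zero]
  exact PowerSeries.X_dvd_iff.1 (by
    simpa using hr j (∑ j, r j) (Finset.single_le_sum (fun _ _ => Nat.zero_le _) (Finset.mem_univ j)))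

theorem X_mem_jacobson (S : Type*) [CommRing S] :
    (PowerSeries.X : S⟦X⟧) ∈ Ideal.jacobson (⊥ : Ideal S⟦X⟧) := by
  rw [Ideal.mem_jacobson_bot]
  intro y
  rw [PowerSeries.isUnit_iff_constantCoeff]
  simp

/-- Some power of P is divisible by v, which lies in the Jacobson radical, and the Jacobson radical
is a radical ideal. -/
theorem PS_mem_jacobson (R : NilpAlg D) : PS R ∈ Ideal.jacobson (⊥ : Ideal (SS R)) := by
  obtain ⟨r, hr⟩ := exists_X_dvd_PS_pow R
  have h₁ : PS R ^ r ∈ Ideal.jacobson (⊥ : Ideal (SS R)) :=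
    Ideal.mem_of_dvd _ hr (X_mem_jacobson _)
  exact Ideal.isRadical_jacobson _ ⟨r, h₁⟩

/-- An element of the kernel has nilpotent constant coefficient, so 1 + xy has a unit as constant
coefficient. -/
theorem ker_baseS_le_jacobson {R R' : NilpAlg D} (h : R →ₐ[D.Lam] R')
    (hn : IsNilpotent (RingHom.ker (h : R →+* R'))) :
    RingHom.ker (baseS h) ≤ Ideal.jacobson (⊥ : Ideal (SS R)) := by
  intro x hx
  rw [Ideal.mem_jacobson_bot]
  intro y
  obtain ⟨k, hk⟩ := hn
  have h₁ : IsNilpotent (PowerSeries.constantCoeff x) := by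
    refine ⟨k, pj_ext fun j => ?_⟩
    rw [map_pow, map_zero]
    have h₂ : pj R j (PowerSeries.constantCoeff x) ∈ RingHom.ker (h : R →+* R') := by
      have h₃ := congrArg (fun z => PowerSeries.coeff 0 (pS R' j z)) (RingHom.mem_ker.1 hx)
      simp only [pS_baseS, PowerSeries.coeff_map, coeff_pS, map_zero] at h₃
      exact RingHom.mem_ker.2 (by simpa using h₃)
    have h₄ := Ideal.pow_mem_pow h₂ k
    rw [hk] at h₄
    exact h₄
  rw [PowerSeries.isUnit_iff_constantCoeff, map_add, map_mul, map_one]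
  exact ((Commute.all _ _).isNilpotent_mul_right h₁).isUnit_add_one

end Distinguished

/-! ### Averaging over Δ -/

section Average

variable {R : NilpAlg D}

theorem cR_mul (r s : R) : cR R (r * s) = cR R r * cR R s := by
  rw [cR, cR, cR, ← map_mul, Algebra.TensorProduct.tmul_mul_tmul, one_mul]

theorem cR_one : cR R 1 = 1 := by rw [cR, ← Algebra.TensorProduct.one_def, map_one]

theorem cL_mul (r s : D.Lam) : cL R (r * s) = cL R r * cL R s := by rw [cL, map_mul, cR_mul]; rfl

theorem cL_one : cL R (1 : D.Lam) = 1 := by rw [cL, map_one, cR_one]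

theorem galS_cL (g : D.Gal) (c : D.Lam) : galS R g (cL R c) = cL R c := galS_C _ _

/-- d = p^f - 1 with p nilpotent. This is what makes averaging over Δ possible. -/
theorem isUnit_d (R : NilpAlg D) : IsUnit (D.d : SS R) := by
  have h₁ : IsNilpotent (p : SS R) := by
    have h₂ := R.nilp.map
      ((PowerSeries.C : WR R →+* SS R).comp (Algebra.TensorProduct.includeRight :
        R →ₐ[ℤ_[p]] WR R).toRingHom)
    rwa [map_natCast] at h₂
  have h₃ : ((D.d : SS R) + 1) = (p : SS R) ^ D.f := by exact_mod_cast congrArg _ D.d_add_one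
  rw [eq_sub_of_add_eq h₃]
  exact (h₁.pow_of_pos D.f_pos.ne').isUnit_sub_one

variable {Q : Type u} [AddCommGroup Q] [Module (SS R) Q]

/-- A semilinear action of `Δ`. -/
structure GalAction (γ : ∀ g : D.Gal, Q →ₛₗ[galS R g] Q) : Prop where
  one : ∀ x, γ 1 x = x
  mul : ∀ g h x, γ (g * h) x = γ g (γ h x)

theorem GalAction.eigen_of_gen {γ : ∀ g : D.Gal, Q →ₛₗ[galS R g] Q} (hγ : GalAction γ)
    {i : Fin D.n} {x : Q} (hx : γ D.gen x = cL R (D.chi i D.gen) • x) (g : D.Gal) :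
    γ g x = cL R (D.chi i g) • x := by
  obtain ⟨k, rfl⟩ := D.exists_eq_gen_pow g
  induction k with
  | zero => rw [pow_zero, hγ.one, D.chi_one, cL_one, one_smul]
  | succ k ih =>
    rw [pow_succ, hγ.mul, hx, map_smulₛₗ, ih, smul_smul, galS_cL, ← cL_mul, D.chi_mul, mul_comm]

/-- Averaging over `Δ`. -/
theorem GalAction.exists_average {γ : ∀ g : D.Gal, Q →ₛₗ[galS R g] Q} (hγ : GalAction γ)
    (i : Fin D.n) (m : Q) : ∃ m' : Q, (∀ g, γ g m' = cL R (D.chi i g) • m') ∧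
      ∀ U : Submodule (SS R) Q, (∀ y ∈ U, γ D.gen y ∈ U) →
        γ D.gen m - cL R (D.chi i D.gen) • m ∈ U → m' - m ∈ U := by
  obtain ⟨u, hu⟩ := (isUnit_d R).exists_left_inv
  set c := cL R (D.chi i D.gen) with hc
  set c' := cL R (D.chi i D.gen ^ (D.d - 1)) with hc'
  have hcd : D.chi i D.gen ^ D.d = 1 := by rw [← D.chi_pow, D.gen_pow_d, D.chi_one]
  have hcc : c' * c = 1 := by
    rw [hc, hc', ← cL_mul, ← pow_succ, Nat.sub_add_cancel D.d_pos, hcd, cL_one]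
  have hpow : ∀ (z : D.Lam) (k : ℕ), cL R (z ^ k) = cL R z ^ k := fun z k => by
    induction k with
    | zero => rw [pow_zero, pow_zero, cL_one]
    | succ k ih => rw [pow_succ, pow_succ, cL_mul, ih]
  have hc'd : c' ^ D.d = 1 := by
    rw [hc', ← hpow, ← pow_mul, mul_comm, pow_mul, hcd, one_pow, cL_one]
  -- The terms of the projector onto the isotypic part: `c'` is the inverse of the value `c` of χ_i
  -- at the generator, and the average is d⁻¹ times the sum of the d terms.
  let F : ℕ → Q := fun k => c' ^ k • γ (D.gen ^ k) m
  have hF : ∀ k, γ D.gen (F k) = c • F (k + 1) := fun k => by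
    have h₁ : galS R D.gen (c' ^ k) = c' ^ k := by rw [map_pow, hc', galS_cL]
    simp only [F]
    rw [map_smulₛₗ, h₁, ← hγ.mul, ← pow_succ', smul_smul, pow_succ c', mul_left_comm,
      mul_comm c c', hcc, mul_one]
  -- The sum is cyclic because F(d) = F(0), both the generator and `c'` having order dividing d.
  have hshift : ∑ k ∈ Finset.range D.d, F (k + 1) = ∑ k ∈ Finset.range D.d, F k := by
    have h₁ := (Finset.sum_range_succ' F D.d).symm.trans (Finset.sum_range_succ F D.d)
    have h₂ : F D.d = F 0 := by
      simp only [F]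
      rw [hc'd, D.gen_pow_d, pow_zero, pow_zero]
    rw [h₂] at h₁
    exact add_right_cancel h₁
  refine ⟨u • ∑ k ∈ Finset.range D.d, F k, hγ.eigen_of_gen ?_, fun U hU hm => ?_⟩
  · have hgu : galS R D.gen u = u := by
      have h₁ := congrArg (galS R D.gen) hu
      rw [map_mul, map_natCast, map_one] at h₁
      exact (isUnit_d R).mul_right_cancel (h₁.trans hu.symm)
    rw [map_smulₛₗ, hgu, map_sum, Finset.sum_congr rfl fun k _ => hF k, ← Finset.smul_sum, hshift,
      smul_comm]
  -- If m is an eigenvector modulo the stable submodule U, then each term of the average is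
  -- congruent to m. The average itself does not depend on U.
  · have h₁ : ∀ k, γ (D.gen ^ k) m - c ^ k • m ∈ U := fun k => by
      induction k with
      | zero => rw [pow_zero, hγ.one, pow_zero, one_smul, sub_self]; exact zero_mem _
      | succ k ih =>
        have h₂ := hU _ ih
        rw [map_sub, map_smulₛₗ, ← hγ.mul, ← pow_succ'] at h₂
        have h₃ : galS R D.gen (c ^ k) = c ^ k := by rw [map_pow, hc, galS_cL]
        rw [h₃] at h₂
        have h₄ := add_mem h₂ (U.smul_mem (c ^ k) hm)
        rwa [smul_sub, sub_add_sub_cancel, smul_smul, ← pow_succ] at h₄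
    have h₅ : m = u • ∑ k ∈ Finset.range D.d, c' ^ k • c ^ k • m := by
      simp_rw [smul_smul, ← mul_pow, hcc, one_pow, one_smul]
      rw [Finset.sum_const, Finset.card_range, ← Nat.cast_smul_eq_nsmul (SS R), smul_smul, hu,
        one_smul]
    have h₆ : u • ∑ k ∈ Finset.range D.d, F k - m =
        u • ∑ k ∈ Finset.range D.d, c' ^ k • (γ (D.gen ^ k) m - c ^ k • m) := by
      refine (congrArg (_ - ·) h₅).trans ?_
      simp only [smul_sub, Finset.sum_sub_distrib, F]
    rw [h₆]
    exact U.smul_mem _ (U.sum_mem fun k _ => U.smul_mem _ (h₁ k))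

theorem KisinDD.galAction (M : KisinDD D R) : GalAction M.gal where
  one _ := (M.gal_bij 1).1 (by rw [← M.gal_mul, one_mul])
  mul := M.gal_mul

theorem gal_mem_smul_top {γ : ∀ g : D.Gal, Q →ₛₗ[galS R g] Q} {t : SS R} {g : D.Gal}
    (ht : t ∣ galS R g t) {y : Q} (hy : y ∈ Ideal.span {t} • (⊤ : Submodule (SS R) Q)) :
    γ g y ∈ Ideal.span {t} • (⊤ : Submodule (SS R) Q) := by
  rw [Submodule.ideal_span_singleton_smul, Submodule.mem_smul_pointwise_iff_exists] at hy ⊢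
  obtain ⟨z, -, rfl⟩ := hy
  obtain ⟨c, hc⟩ := ht
  exact ⟨c • γ g z, trivial, by rw [map_smulₛₗ, hc, mul_smul]⟩

theorem X_dvd_galS (g : D.Gal) : (PowerSeries.X : SS R) ∣ galS R g PowerSeries.X := by
  rw [galS, PowerSeries.rescale_X]
  exact dvd_mul_left _ _

theorem PS_pow_dvd_galS (g : D.Gal) (N : ℕ) : PS R ^ N ∣ galS R g (PS R ^ N) := by
  rw [map_pow, galS_PS]

end Average

end KisinDescent

namespace KisinDescent

variable {p : ℕ} [Fact p.Prime] {D : Setup.{u} p}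

/-! ### Exact eigenbases and their reductions -/

section Exact

variable {R : NilpAlg D}

/-- `x` is a basis of `M` such that `Δ` acts on `x i` through `χ_i`. -/
def IsEB (M : KisinDD D R) (x : Fin D.n → M) : Prop :=
  IsBas (SS R) x ∧ ∀ i g, M.gal g (x i) = cL R (D.chi i g) • x i

variable {Q : Type u} [AddCommGroup Q] [Module (SS R) Q]

theorem gal_mem_ideal_smul {γ : ∀ g : D.Gal, Q →ₛₗ[galS R g] Q} {I : Ideal (SS R)} {g : D.Gal}
    (hI : ∀ s ∈ I, galS R g s ∈ I) {y : Q} (hy : y ∈ (I • ⊤ : Submodule (SS R) Q)) :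
    γ g y ∈ (I • ⊤ : Submodule (SS R) Q) := by
  refine Submodule.smul_induction_on hy (fun s hs z _ => ?_) (fun y z hy hz => ?_)
  · rw [map_smulₛₗ]
    exact Submodule.smul_mem_smul (hI s hs) trivial
  · rw [map_add]
    exact add_mem hy hz

/-- Averaging replaces each x_i by an exact eigenvector congruent to it modulo IM. The family
remains a basis modulo I, and since I lies in the Jacobson radical it is a basis of M by
`isBas_of_mod`. -/
theorem exists_isEB_of_mod (M : KisinDD D R) {I : Ideal (SS R)} (hI : I ≤ Ideal.jacobson ⊥)
    (hγ : ∀ s ∈ I, galS R D.gen s ∈ I) (x : Fin D.n → M)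
    (heig : ∀ i, M.gal D.gen (x i) - cL R (D.chi i D.gen) • x i ∈ (I • ⊤ : Submodule (SS R) M))
    (hspan : ∀ y, ∃ c : Fin D.n → SS R, y - ∑ i, c i • x i ∈ (I • ⊤ : Submodule (SS R) M))
    (hind : ∀ c : Fin D.n → SS R, ∑ i, c i • x i ∈ (I • ⊤ : Submodule (SS R) M) → ∀ i, c i ∈ I) :
    ∃ x', IsEB M x' ∧ ∀ i, x' i - x i ∈ (I • ⊤ : Submodule (SS R) M) := by
  choose x' h₁ h₂ using fun i => M.galAction.exists_average i (x i)
  have h₃ : ∀ i, x' i - x i ∈ (I • ⊤ : Submodule (SS R) M) := fun i =>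
    h₂ i _ (fun y hy => gal_mem_ideal_smul hγ hy) (heig i)
  have h₄ : ∀ c : Fin D.n → SS R, ∑ i, c i • x' i - ∑ i, c i • x i ∈
      (I • ⊤ : Submodule (SS R) M) := fun c => by
    rw [← Finset.sum_sub_distrib]
    refine Submodule.sum_mem _ fun i _ => ?_
    rw [← smul_sub]
    exact Submodule.smul_mem _ _ (h₃ i)
  have := M.finite
  have := M.projective
  refine ⟨x', ⟨isBas_of_mod hI x' (fun y => ?_) (fun c hc => hind c ?_), h₁⟩, h₃⟩
  · obtain ⟨c, hc⟩ := hspan y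
    refine ⟨c, ?_⟩
    have := sub_mem hc (h₄ c)
    rwa [sub_sub, add_sub_cancel] at this
  · have := sub_mem hc (h₄ c)
    rwa [sub_sub_cancel] at this

theorem IsBas.exists_sum {ι : Type*} [Fintype ι] {S : Type u} [CommRing S] {M : Type u}
    [AddCommGroup M] [Module S M] {x : ι → M} (hx : IsBas S x) (y : M) :
    ∃ c : ι → S, y = ∑ i, c i • x i := by
  have hy : y ∈ Submodule.span S (Set.range x) := hx.2 ▸ Submodule.mem_top
  obtain ⟨c, hc⟩ := (Submodule.mem_span_range_iff_exists_fun S).1 hy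
  exact ⟨c, hc.symm⟩

theorem isBas_of {ι : Type*} [Fintype ι] {S : Type u} [CommRing S] {M : Type u}
    [AddCommGroup M] [Module S M] {x : ι → M} (h₁ : ∀ y, ∃ c : ι → S, y = ∑ i, c i • x i)
    (h₂ : ∀ c : ι → S, ∑ i, c i • x i = 0 → ∀ i, c i = 0) : IsBas S x := by
  refine ⟨Fintype.linearIndependent_iff.2 h₂, eq_top_iff.2 fun y _ => ?_⟩
  obtain ⟨c, rfl⟩ := h₁ y
  exact Submodule.sum_mem _ fun i _ => Submodule.smul_mem _ _ (Submodule.subset_span ⟨i, rfl⟩)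

theorem smul_eps_smul (j : ZMod D.f) (s : SS R) (y : Q) :
    s • eps R j • y = incl R (pS R j s) • eps R j • y := by
  rw [smul_smul, mul_eps, mul_smul]

theorem span_of_components {x : Fin D.n → Q}
    (h : ∀ j (y : Q), InComp R j y → ∃ c : Fin D.n → R⟦X⟧, y = ∑ i, incl R (c i) • eps R j • x i)
    (y : Q) : ∃ c : Fin D.n → SS R, y = ∑ i, c i • x i := by
  choose c hc using fun j => h j (eps R j • y) (inComp_eps_smul j y)
  refine ⟨fun i => ∑ j, incl R (c j i) * eps R j, ?_⟩
  conv_lhs => rw [← sum_eps_smul (R := R) y]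
  simp_rw [Finset.sum_smul]
  rw [Finset.sum_comm]
  refine Finset.sum_congr rfl fun j _ => (hc j).trans (Finset.sum_congr rfl fun i _ => ?_)
  rw [mul_smul]

theorem span_components {x : Fin D.n → Q} (h : ∀ y : Q, ∃ c : Fin D.n → SS R, y = ∑ i, c i • x i)
    (j : ZMod D.f) (y : Q) (hy : InComp R j y) :
    ∃ c : Fin D.n → R⟦X⟧, y = ∑ i, incl R (c i) • eps R j • x i := by
  obtain ⟨c, hc⟩ := h y
  refine ⟨fun i => pS R j (c i), ?_⟩
  rw [← hy.eps_smul, hc, Finset.smul_sum]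
  refine Finset.sum_congr rfl fun i _ => ?_
  rw [smul_comm, smul_eps_smul]

theorem eps_smul_sum (j : ZMod D.f) (c : Fin D.n → SS R) (x : Fin D.n → Q) :
    eps R j • ∑ i, c i • x i = ∑ i, incl R (pS R j (c i)) • eps R j • x i := by
  rw [Finset.smul_sum]
  refine Finset.sum_congr rfl fun i _ => ?_
  rw [smul_comm, smul_eps_smul]

theorem dvd_of_pS {s t : SS R} (h : ∀ j, pS R j s ∣ pS R j t) : s ∣ t := by
  choose c hc using h
  obtain ⟨z, hz⟩ := pS_surj (R := R) c
  exact ⟨z, pS_ext fun j => by rw [map_mul, hz, hc]⟩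

/-- Together with its companions this passes between one (W ⊗ R)[[v]]-basis and R[[v]]-bases of all
components. The parameter t covers exact independence (t = 0) and independence modulo P^N. -/
theorem indep_of_components {t : SS R} {x : Fin D.n → Q}
    (h : ∀ j (c : Fin D.n → R⟦X⟧), ∑ i, incl R (c i) • eps R j • x i = 0 →
      ∀ i, pS R j t ∣ c i) (c : Fin D.n → SS R) (hc : ∑ i, c i • x i = 0) (i : Fin D.n) :
    t ∣ c i :=
  dvd_of_pS fun j => h j (fun i => pS R j (c i)) (by rw [← eps_smul_sum, hc, smul_zero]) i

theorem indep_components {t : SS R} {x : Fin D.n → Q}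
    (h : ∀ c : Fin D.n → SS R, ∑ i, c i • x i = 0 → ∀ i, t ∣ c i) (j : ZMod D.f)
    (c : Fin D.n → R⟦X⟧) (hc : ∑ i, incl R (c i) • eps R j • x i = 0) (i : Fin D.n) :
    pS R j t ∣ c i := by
  have h₁ := map_dvd (pS R j) (h (fun i => incl R (c i) * eps R j) (by simpa [mul_smul] using hc) i)
  rwa [map_mul, pS_incl, pS_eps, if_pos rfl, mul_one] at h₁

theorem eps_smul_sum_vec {x : ZMod D.f → Q} (hx : ∀ j, InComp R j (x j)) (j : ZMod D.f) :
    eps R j • ∑ l, x l = x j := by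
  rw [Finset.smul_sum, Finset.sum_eq_single j]
  · exact (hx j).eps_smul
  · intro l _ hl
    rw [← (hx l).eps_smul, smul_smul, eps_mul_eps, if_neg hl.symm, zero_smul]
  · exact fun h => absurd (Finset.mem_univ j) h

variable {a b : ℤ} {M : Y D a b R}

/-- The eigenbasis `(ε_j x_i)`. -/
def IsEB.eigenbasis {x : Fin D.n → M} (hx : IsEB M.toKisinDD x) : Eigenbasis M where
  vec j i := eps R j • x i
  eigen j i := ⟨inComp_eps_smul _ _, fun g => by rw [map_smulₛₗ, galS_eps, hx.2, smul_comm]⟩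
  span := span_components hx.1.exists_sum
  indep j c hc i := by
    have := indep_components (t := 0) (fun c hc i => zero_dvd_iff.2
      (Fintype.linearIndependent_iff.1 hx.1.1 c hc i)) j c hc i
    rwa [map_zero, zero_dvd_iff] at this

/-- Summing over j is inverse to x ↦ (ε_j x)_j, so an eigenbasis is the same as a single equivariant
basis of M. -/
theorem Eigenbasis.isEB (e : Eigenbasis M) : IsEB M.toKisinDD fun i => ∑ j, e.vec j i := by
  have he : ∀ j i, eps R j • ∑ l, e.vec l i = e.vec j i := fun j i =>
    eps_smul_sum_vec (x := fun l => e.vec l i) (fun l => (e.eigen l i).1) j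
  refine ⟨isBas_of ?_ fun c hc i => ?_, fun i g => ?_⟩
  · refine span_of_components fun j y hy => ?_
    simp_rw [he]
    exact e.span j y hy
  · refine zero_dvd_iff.1 (indep_of_components (t := 0) (fun j c hc i => ?_) c hc i)
    rw [map_zero, zero_dvd_iff]
    simp_rw [he] at hc
    exact e.indep j c hc i
  · rw [map_sum, Finset.smul_sum]
    exact Finset.sum_congr rfl fun j _ => (e.eigen j i).2 g

theorem Eigenbasis.exists_isEB (e : Eigenbasis M) :
    ∃ x, IsEB M.toKisinDD x ∧ ∀ j i, e.vec j i = eps R j • x i :=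
  ⟨_, e.isEB, fun j i =>
    (eps_smul_sum_vec (x := fun l => e.vec l i) (fun l => (e.eigen l i).1) j).symm⟩

theorem quo_mk_eq_iff {M : KisinDD D R} {t : SS R} {m m' : M} :
    KisinDD.Quo.mk t m = KisinDD.Quo.mk t m' ↔
      m - m' ∈ (Ideal.span {t} • ⊤ : Submodule (SS R) M) :=
  Submodule.Quotient.eq _

theorem quo_mk_smul {M : KisinDD D R} (t s : SS R) (m : M) :
    KisinDD.Quo.mk t (s • m) = s • KisinDD.Quo.mk t m := rfl

theorem quo_mk_sum {M : KisinDD D R} (t : SS R) {ι : Type*} (s : Finset ι) (m : ι → M) :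
    KisinDD.Quo.mk t (∑ i ∈ s, m i) = ∑ i ∈ s, KisinDD.Quo.mk t (m i) :=
  map_sum (Submodule.mkQ (Ideal.span {t} • (⊤ : Submodule (SS R) M))) m s

theorem quo_mk_surj {M : KisinDD D R} {t : SS R} (y : M.Quo t) :
    ∃ m : M, KisinDD.Quo.mk t m = y :=
  Submodule.Quotient.mk_surjective _ y

theorem mem_span_smul_of_isBas {S : Type u} [CommRing S] {M : Type u} [AddCommGroup M]
    [Module S M] {ι : Type*} [Fintype ι] {x : ι → M} (hx : IsBas S x) {t : S} {c : ι → S}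
    (hc : ∑ i, c i • x i ∈ (Ideal.span {t} • ⊤ : Submodule S M)) (i : ι) : t ∣ c i := by
  rw [Submodule.ideal_span_singleton_smul, Submodule.mem_smul_pointwise_iff_exists] at hc
  obtain ⟨z, -, hz⟩ := hc
  obtain ⟨c', rfl⟩ := hx.exists_sum z
  have h₁ : ∑ i, (c i - t * c' i) • x i = 0 := by
    simp_rw [sub_smul, Finset.sum_sub_distrib, mul_smul, ← Finset.smul_sum]
    rw [hz, sub_self]
  exact ⟨c' i, sub_eq_zero.1 (Fintype.linearIndependent_iff.1 hx.1 _ h₁ i)⟩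

theorem isEigenQuo_of {M : KisinDD D R} {t : SS R} (ht : ∀ g, t ∣ galS R g t) {j : ZMod D.f}
    {i : Fin D.n} {x : M} (hx : ∀ g, M.gal g x = cL R (D.chi i g) • x) :
    KisinDD.IsEigenQuo t j i (KisinDD.Quo.mk t (eps R j • x)) := by
  refine ⟨inComp_eps_smul (Q := M.Quo t) j (KisinDD.Quo.mk t x), fun g m hm => ?_⟩
  have h₁ := (Submodule.Quotient.eq _).1 hm
  have h₂ := gal_mem_smul_top (γ := M.gal) (ht g) h₁
  rw [map_sub, map_smulₛₗ, galS_eps, hx, smul_comm] at h₂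
  exact (Submodule.Quotient.eq _).2 h₂

/-- The reduction modulo `P(v)^N` of an exact eigenbasis. -/
def IsEB.eigenbasisMod {x : Fin D.n → M} (hx : IsEB M.toKisinDD x) (N : ℕ) :
    EigenbasisMod N M where
  vec j i := QuoN.mk N (eps R j • x i)
  eigen j i := isEigenQuo_of (fun g => PS_pow_dvd_galS g N) fun g => hx.2 i g
  span := span_components (Q := QuoN N M) (x := fun i => QuoN.mk N (x i)) fun y => by
    obtain ⟨m, rfl⟩ := quo_mk_surj y
    obtain ⟨c, rfl⟩ := hx.1.exists_sum m
    exact ⟨c, quo_mk_sum _ _ _⟩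
  indep j c hc i := by
    rw [Ideal.mem_span_singleton, ← pS_PS, ← map_pow]
    refine indep_components (Q := QuoN N M) (x := fun i => QuoN.mk N (x i)) (fun c hc => ?_) j c hc i
    have h₁ : QuoN.mk N (∑ i, c i • x i) = 0 := (quo_mk_sum _ _ _).trans hc
    exact mem_span_smul_of_isBas hx.1 ((Submodule.Quotient.mk_eq_zero _).1 h₁)

theorem span_PS_pow_le_jacobson (R : NilpAlg D) {N : ℕ} (hN : N ≠ 0) :
    Ideal.span {PS R ^ N} ≤ Ideal.jacobson (⊥ : Ideal (SS R)) := by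
  rw [Ideal.span_singleton_le_iff_mem]
  exact Ideal.pow_mem_of_mem _ (PS_mem_jacobson R) N (Nat.pos_of_ne_zero hN)

theorem galS_mem_span {t : SS R} {g : D.Gal} (ht : t ∣ galS R g t) (s : SS R)
    (hs : s ∈ Ideal.span {t}) : galS R g s ∈ Ideal.span {t} := by
  rw [Ideal.mem_span_singleton] at hs ⊢
  exact ht.trans (map_dvd _ hs)

/-- Lifts to M of the vectors ∑_j e_i^(j) are a Δ-eigenbasis modulo P^N, so `exists_isEB_of_mod`
applies with I = (P^N). Questions about eigenbases modulo P^N thereby reduce to exact ones. -/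
theorem EigenbasisMod.exists_isEB {N : ℕ} (hN : N ≠ 0) (e : EigenbasisMod N M) :
    ∃ x, IsEB M.toKisinDD x ∧ ∀ j i, e.vec j i = QuoN.mk N (eps R j • x i) := by
  choose m hm using fun j i => quo_mk_surj (e.vec j i)
  have hv : ∀ i, KisinDD.Quo.mk (PS R ^ N) (∑ j, m j i) = ∑ j, e.vec j i := fun i => by
    rw [quo_mk_sum]
    exact Finset.sum_congr rfl fun j _ => hm j i
  have he : ∀ j i, eps R j • ∑ l, e.vec l i = e.vec j i := fun j i =>
    eps_smul_sum_vec (x := fun l => e.vec l i) (fun l => (e.eigen l i).1) j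
  obtain ⟨x, hx, hxm⟩ := exists_isEB_of_mod M.toKisinDD (span_PS_pow_le_jacobson R hN)
    (galS_mem_span (PS_pow_dvd_galS D.gen N)) (fun i => ∑ j, m j i) (fun i => by
      rw [← quo_mk_eq_iff, map_sum, quo_mk_smul, hv, quo_mk_sum, Finset.smul_sum]
      exact Finset.sum_congr rfl fun j _ => (e.eigen j i).2 _ _ (hm j i))
    (fun y => by
      obtain ⟨c, hc⟩ := span_of_components (Q := QuoN N M) (x := fun i => ∑ j, e.vec j i)
        (fun j y hy => by
          obtain ⟨c, hc⟩ := e.span j y hy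
          exact ⟨c, hc.trans (Finset.sum_congr rfl fun i _ => by rw [he])⟩) (QuoN.mk N y)
      refine ⟨c, quo_mk_eq_iff.1 (hc.trans ?_)⟩
      rw [quo_mk_sum]
      exact Finset.sum_congr rfl fun i _ => by rw [quo_mk_smul, hv])
    (fun c hc i => by
      rw [Ideal.mem_span_singleton]
      refine indep_of_components (Q := QuoN N M) (x := fun i => ∑ j, e.vec j i)
        (fun j c hc i => ?_) c ?_ i
      · simp_rw [he] at hc
        rw [map_pow, pS_PS, ← Ideal.mem_span_singleton]
        exact e.indep j c hc i
      · refine (Finset.sum_congr rfl fun i _ => ?_).trans ((quo_mk_sum _ _ _).symm.trans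
          ((Submodule.Quotient.mk_eq_zero _).2 hc))
        rw [quo_mk_smul, hv])
  refine ⟨x, hx, fun j i => ?_⟩
  have h₁ : QuoN.mk N (x i) = ∑ j, e.vec j i := (quo_mk_eq_iff.2 (hxm i)).trans (hv i)
  rw [QuoN.mk, quo_mk_smul]
  change _ = eps R j • QuoN.mk N (x i)
  rw [h₁, he]

end Exact

end KisinDescent

namespace KisinDescent

variable {p : ℕ} [Fact p.Prime] {D : Setup.{u} p}

/-! ### Eigenbases under pullback -/

section Eigenbases

variable {a b : ℤ} {R R' : NilpAlg D} {h : R →ₐ[D.Lam] R'} {M : Y D a b R} {M' : Y D a b R'}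

theorem map_mem_span_smul {S T : Type u} [CommRing S] [CommRing T] {g : S →+* T}
    {M N : Type u} [AddCommGroup M] [Module S M] [AddCommGroup N] [Module T N] (f : M →ₛₗ[g] N)
    {t : S} {t' : T} (ht : g t = t') {y : M} (hy : y ∈ (Ideal.span {t} • ⊤ : Submodule S M)) :
    f y ∈ (Ideal.span {t'} • ⊤ : Submodule T N) := by
  rw [Submodule.ideal_span_singleton_smul, Submodule.mem_smul_pointwise_iff_exists] at hy ⊢
  obtain ⟨z, -, rfl⟩ := hy
  exact ⟨f z, trivial, by rw [map_smulₛₗ, ht]⟩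

theorem Eigenbasis.exists_eq (e : Eigenbasis M) : ∃ (x : Fin D.n → M) (hx : IsEB M.toKisinDD x),
    e = hx.eigenbasis := by
  obtain ⟨x, hx, he⟩ := e.exists_isEB
  exact ⟨x, hx, Eigenbasis.ext (funext fun j => funext fun i => he j i)⟩

theorem EigenbasisMod.exists_eq {N : ℕ} (hN : N ≠ 0) (e : EigenbasisMod N M) :
    ∃ (x : Fin D.n → M) (hx : IsEB M.toKisinDD x), e = hx.eigenbasisMod N := by
  obtain ⟨x, hx, he⟩ := e.exists_isEB hN
  exact ⟨x, hx, EigenbasisMod.ext (funext fun j => funext fun i => he j i)⟩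

theorem IsEB.map {x : Fin D.n → M} (hx : IsEB M.toKisinDD x) (α : Arrow h M M') :
    IsEB M'.toKisinDD fun i => α.app (x i) := by
  refine ⟨α.isBC.isBas hx.1, fun i g => ?_⟩
  change M'.gal g (α.sl (x i)) = cL R' (D.chi i g) • α.sl (x i)
  rw [← α.sl_gal, hx.2, map_smulₛₗ, baseS_cL]

theorem IsEB.pull {x : Fin D.n → M} (hx : IsEB M.toKisinDD x) (α : Arrow h M M') :
    Eigenbasis.Pull α hx.eigenbasis (hx.map α).eigenbasis := fun j i => by
  change α.sl (eps R j • x i) = eps R' j • α.sl (x i)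
  rw [map_smulₛₗ, baseS_eps]

theorem app_mod (α : Arrow h M M') {N : ℕ} {m m' : M} (hm : QuoN.mk N m = QuoN.mk N m') :
    QuoN.mk N (α.app m) = QuoN.mk N (α.app m') := by
  refine quo_mk_eq_iff.2 ?_
  have h₁ := map_mem_span_smul α.sl (t' := PS R' ^ N) (by rw [map_pow, baseS_PS])
    (quo_mk_eq_iff.1 hm)
  rwa [map_sub] at h₁

theorem IsEB.pullMod {x : Fin D.n → M} (hx : IsEB M.toKisinDD x) (α : Arrow h M M') (N : ℕ) :
    EigenbasisMod.Pull α (hx.eigenbasisMod N) ((hx.map α).eigenbasisMod N) := fun j i _ hm =>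
  (app_mod α hm).trans (congrArg (QuoN.mk N) (hx.pull α j i))

theorem Eigenbasis.Pull.unique {α : Arrow h M M'} {e : Eigenbasis M} {e₁ e₂ : Eigenbasis M'}
    (h₁ : e.Pull α e₁) (h₂ : e.Pull α e₂) : e₁ = e₂ :=
  Eigenbasis.ext (funext fun j => funext fun i => (h₁ j i).symm.trans (h₂ j i))

theorem EigenbasisMod.Pull.unique {N : ℕ} {α : Arrow h M M'} {e : EigenbasisMod N M}
    {e₁ e₂ : EigenbasisMod N M'} (h₁ : e.Pull α e₁) (h₂ : e.Pull α e₂) : e₁ = e₂ :=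
  EigenbasisMod.ext (funext fun j => funext fun i => by
    obtain ⟨m, hm⟩ := quo_mk_surj (e.vec j i)
    exact (h₁ j i m hm).symm.trans (h₂ j i m hm))

theorem Eigenbasis.exists_pull (α : Arrow h M M') (e : Eigenbasis M) :
    ∃! e' : Eigenbasis M', e.Pull α e' := by
  obtain ⟨x, hx, rfl⟩ := e.exists_eq
  exact ⟨_, hx.pull α, fun e' he' => he'.unique (hx.pull α)⟩

theorem EigenbasisMod.exists_pull {N : ℕ} (hN : N ≠ 0) (α : Arrow h M M') (e : EigenbasisMod N M) :
    ∃! e' : EigenbasisMod N M', e.Pull α e' := by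
  obtain ⟨x, hx, rfl⟩ := e.exists_eq hN
  exact ⟨_, hx.pullMod α N, fun e' he' => he'.unique (hx.pullMod α N)⟩

end Eigenbases

/-! ### Lifting eigenbases along nilpotent thickenings -/

section FormallySmooth

variable {a b : ℤ}

/-- Expand y in a dual basis: its coefficients are linear forms, and these extend along the base
change and vanish there. -/
theorem mem_ker_smul_of_app_eq_zero {R R' : NilpAlg D} {h : R →ₐ[D.Lam] R'} {M : Type u}
    [AddCommGroup M] [Module (SS R) M] [Module.Finite (SS R) M] [Module.Projective (SS R) M]
    {M' : Type u} [AddCommGroup M'] [Module (SS R') M'] {f : M →ₛₗ[baseS h] M'} (hf : IsBC f)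
    {y : M} (hy : f y = 0) : y ∈ (RingHom.ker (baseS h) • ⊤ : Submodule (SS R) M) := by
  obtain ⟨m, q, s, hq⟩ := exists_dualBasis (SS R) M
  rw [hq y]
  refine Submodule.sum_mem _ fun l _ => Submodule.smul_mem_smul ?_ trivial
  obtain ⟨s', hs'⟩ := hf.exists_functional (s l)
  rw [RingHom.mem_ker, ← hs', hy, map_zero]

theorem baseS_surjective {R R' : NilpAlg D} {h : R →ₐ[D.Lam] R'} (hs : Function.Surjective h) :
    Function.Surjective (baseS h) := fun y => by
  choose z hz using fun j k => hs (PowerSeries.coeff k (pS R' j y))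
  obtain ⟨x, hx⟩ := pS_surj (R := R) fun j => PowerSeries.mk (z j)
  refine ⟨x, pS_ext fun j => PowerSeries.ext fun k => ?_⟩
  rw [pS_baseS, hx, PowerSeries.coeff_map, PowerSeries.coeff_mk]
  exact hz j k

theorem surjective_of_isBC {S T : Type u} [CommRing S] [CommRing T] {g : S →+* T}
    (hg : Function.Surjective g) {M N : Type u} [AddCommGroup M] [Module S M] [AddCommGroup N]
    [Module T N] {f : M →ₛₗ[g] N} (hf : IsBC f) : Function.Surjective f := fun y => by
  have hy : y ∈ Submodule.span T (Set.range f) := hf.1 ▸ Submodule.mem_top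
  induction hy using Submodule.span_induction with
  | mem x hx => exact hx
  | zero => exact ⟨0, map_zero _⟩
  | add x y _ _ hx hy =>
    obtain ⟨m, rfl⟩ := hx
    obtain ⟨n, rfl⟩ := hy
    exact ⟨m + n, map_add _ _ _⟩
  | smul t x _ hx =>
    obtain ⟨m, rfl⟩ := hx
    obtain ⟨s, rfl⟩ := hg t
    exact ⟨s • m, map_smulₛₗ _ _ _⟩

/-- Arbitrary preimages of the vectors form an eigenbasis modulo ker(`baseS h`), an ideal that is
stable under Δ and lies in the Jacobson radical, so `exists_isEB_of_mod` corrects them. -/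
theorem IsEB.exists_lift {R R' : NilpAlg D} {h : R →ₐ[D.Lam] R'} {M : Y D a b R}
    {M' : Y D a b R'} (hs : Function.Surjective h)
    (hn : IsNilpotent (RingHom.ker (h : R →+* R'))) (α : Arrow h M M') {x' : Fin D.n → M'}
    (hx' : IsEB M'.toKisinDD x') : ∃ x, IsEB M.toKisinDD x ∧ ∀ i, α.app (x i) = x' i := by
  have := M.finite
  have := M.projective
  have hker : ∀ y ∈ (RingHom.ker (baseS h) • ⊤ : Submodule (SS R) M), α.sl y = 0 := fun y hy => by
    refine Submodule.smul_induction_on hy (fun s hs z _ => ?_) (fun y z hy hz => ?_)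
    · rw [map_smulₛₗ, RingHom.mem_ker.1 hs, zero_smul]
    · rw [map_add, hy, hz, add_zero]
  choose y hy using fun i => surjective_of_isBC (baseS_surjective hs) α.isBC (x' i)
  obtain ⟨x, hx, hxy⟩ := exists_isEB_of_mod M.toKisinDD (ker_baseS_le_jacobson h hn)
    (fun s hs => by rw [RingHom.mem_ker, ← galS_baseS, RingHom.mem_ker.1 hs, map_zero]) y
    (fun i => by
      refine mem_ker_smul_of_app_eq_zero α.isBC ?_
      rw [map_sub, map_smulₛₗ, α.sl_gal, hy, hx'.2, baseS_cL, sub_self])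
    (fun z => by
      obtain ⟨c', hc'⟩ := hx'.1.exists_sum (α.sl z)
      choose c hc using fun i => baseS_surjective hs (c' i)
      refine ⟨c, mem_ker_smul_of_app_eq_zero α.isBC ?_⟩
      rw [map_sub, hc', map_sum, sub_eq_zero]
      exact Finset.sum_congr rfl fun i _ => by rw [map_smulₛₗ, hc, hy])
    (fun c hc i => by
      have h₁ := hker _ hc
      rw [map_sum] at h₁
      refine RingHom.mem_ker.2 (Fintype.linearIndependent_iff.1 hx'.1.1 (fun i => baseS h (c i)) ?_ i)
      rw [← h₁]
      exact Finset.sum_congr rfl fun i _ => by rw [map_smulₛₗ, hy])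
  refine ⟨x, hx, fun i => ?_⟩
  have h₁ := hker _ (hxy i)
  rw [map_sub, hy, sub_eq_zero] at h₁
  exact h₁

theorem eigenbasis_isFormallySmooth : IsFormallySmoothOver (D := D) (a := a) (b := b)
    (fun _ M => Eigenbasis M) (fun _ _ _ _ _ α => Eigenbasis.Pull α) := by
  intro R R' h hs hn M M' α e'
  obtain ⟨x', hx', rfl⟩ := e'.exists_eq
  obtain ⟨x, hx, hxx⟩ := hx'.exists_lift hs hn α
  obtain rfl : (fun i => α.app (x i)) = x' := funext hxx
  exact ⟨_, hx.pull α⟩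

end FormallySmooth

/-! ### The type condition as local existence of eigenbases -/

section TypeCondition

variable {R : NilpAlg D}

theorem exists_pow_mul_eq_of_toAway {R : NilpAlg D} (g : R) (z : R.away g) :
    ∃ (k : ℕ) (r : R), R.toAway g (g ^ k) * z = R.toAway g r := by
  obtain ⟨⟨r, s⟩, hrs⟩ := IsLocalization.surj (Submonoid.powers g) (S := Localization.Away g) z
  obtain ⟨k, hk⟩ := s.2
  refine ⟨k, r, ?_⟩
  have h₁ : z * R.toAway g s = R.toAway g r := hrs
  rw [mul_comm, ← h₁, ← hk]

theorem toAway_eq_zero {R : NilpAlg D} {g r : R} (h : R.toAway g r = 0) : ∃ k, g ^ k * r = 0 := by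
  have h₁ : algebraMap R (Localization.Away g) r = 0 := h
  obtain ⟨⟨_, k, rfl⟩, hc⟩ :=
    (IsLocalization.map_eq_zero_iff (Submonoid.powers g) (Localization.Away g) r).1 h₁
  exact ⟨k, hc⟩

theorem exists_common_pow {ι : Type*} [Finite ι] {R : Type*} [CommRing R] (g : R)
    (P : ι → R → Prop) (hP : ∀ i r s, P i r → P i (s * r)) (h : ∀ i, ∃ k : ℕ, P i (g ^ k)) :
    ∃ k : ℕ, ∀ i, P i (g ^ k) := by
  have := Fintype.ofFinite ι
  choose k hk using h
  refine ⟨∑ i, k i, fun i => ?_⟩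
  rw [← Nat.sub_add_cancel (Finset.single_le_sum (f := k) (fun _ _ => Nat.zero_le _)
    (Finset.mem_univ i)), pow_add]
  exact hP i _ _ (hk i)

theorem exists_common_toAway {ι : Type*} [Finite ι] (g : R) (z : ι → R.away g) :
    ∃ (k : ℕ) (r : ι → R), ∀ i, R.toAway g (g ^ k) * z i = R.toAway g (r i) := by
  obtain ⟨k, hk⟩ := exists_common_pow (ι := ι) g
    (fun i s => ∃ r, R.toAway g s * z i = R.toAway g r)
    (fun i r s ⟨t, ht⟩ => ⟨s * t, by rw [map_mul, mul_assoc, ht, map_mul]⟩)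
    (fun i => exists_pow_mul_eq_of_toAway g (z i))
  choose r hr using hk
  exact ⟨k, r, hr⟩

theorem X_dvd_iff_pj {x : SS R} :
    PowerSeries.X ∣ x ↔ ∀ j, pj R j (PowerSeries.constantCoeff x) = 0 := by
  rw [PowerSeries.X_dvd_iff]
  exact ⟨fun h j => by rw [h, map_zero], fun h => pj_ext fun j => by rw [h, map_zero]⟩

theorem X_dvd_sub_constantCoeff {S : Type*} [CommRing S] (x : S⟦X⟧) :
    PowerSeries.X ∣ x - PowerSeries.C (PowerSeries.constantCoeff x) := by
  rw [PowerSeries.X_dvd_iff]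
  simp

theorem constantCoeff_baseS {R' : NilpAlg D} (h : R →ₐ[D.Lam] R') (x : SS R) (j : ZMod D.f) :
    pj R' j (PowerSeries.constantCoeff (baseS h x)) = h (pj R j (PowerSeries.constantCoeff x)) := by
  rw [← pj_map]
  congr 1

theorem constantCoeff_cR (x : R) : PowerSeries.constantCoeff (cR R x) = 1 ⊗ₜ x :=
  PowerSeries.constantCoeff_C _

/-- Clearing denominators is possible only modulo v: a power series over R[1/g] has infinitely many
coefficients and no common denominator in general, whereas membership in vM concerns only the
constant coefficients of finitely many linear forms. -/
theorem exists_pow_smul_mem {g : R} {M : Type u} [AddCommGroup M] [Module (SS R) M]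
    [Module.Finite (SS R) M] [Module.Projective (SS R) M] {M' : Type u} [AddCommGroup M']
    [Module (SS (R.away g)) M'] {f : M →ₛₗ[baseS (R.toAway g)] M'} (hf : IsBC f) {y : M}
    (hy : f y ∈ (Ideal.span {(PowerSeries.X : SS (R.away g))} • ⊤ : Submodule (SS (R.away g)) M')) :
    ∃ k : ℕ, cR R (g ^ k) • y ∈ (Ideal.span {(PowerSeries.X : SS R)} • ⊤ : Submodule (SS R) M) := by
  obtain ⟨m, q, s, hq⟩ := exists_dualBasis (SS R) M
  obtain ⟨k, hk⟩ := exists_common_pow (ι := Fin m × ZMod D.f) g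
    (fun i r => r * pj R i.2 (PowerSeries.constantCoeff (s i.1 y)) = 0)
    (fun i r t h => by rw [mul_assoc, h, mul_zero]) (fun i => by
      refine toAway_eq_zero ?_
      obtain ⟨s', hs'⟩ := hf.exists_functional (s i.1)
      rw [← constantCoeff_baseS, ← hs']
      refine X_dvd_iff_pj.1 ?_ i.2
      rw [Submodule.ideal_span_singleton_smul, Submodule.mem_smul_pointwise_iff_exists] at hy
      obtain ⟨z, -, hz⟩ := hy
      rw [← hz, map_smul]
      exact dvd_mul_right _ _)
  refine ⟨k, ?_⟩
  rw [hq y, Finset.smul_sum]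
  refine Submodule.sum_mem _ fun l _ => ?_
  rw [smul_smul]
  refine Submodule.smul_mem_smul (Ideal.mem_span_singleton.2 (X_dvd_iff_pj.2 fun j => ?_)) trivial
  rw [map_mul, constantCoeff_cR, map_mul, pj_includeRight]
  exact hk (l, j)

theorem isUnit_baseS_cR (g : R) (k : ℕ) : IsUnit (baseS (R.toAway g) (cR R (g ^ k))) := by
  rw [baseS_cR, map_pow]
  have h₁ := ((isUnit_toAway (R := R) g).pow k).map
    ((PowerSeries.C : WR (R.away g) →+* SS (R.away g)).comp
      (Algebra.TensorProduct.includeRight : R.away g →ₐ[ℤ_[p]] WR (R.away g)).toRingHom)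
  exact h₁

/-- An eigenbasis of `M[1/g]` whose members lie in `M`. -/
def IsEBAt (M : KisinDD D R) (g : R) (x : Fin D.n → M) : Prop :=
  (∀ i σ, M.gal σ (x i) = cL R (D.chi i σ) • x i) ∧
    IsBas (SS (R.away g)) fun i => Ext.of (baseS (R.toAway g)) (x i)

theorem InComp.smul_mod_X {Q : Type u} [AddCommGroup Q] [Module (SS R) Q] {j : ZMod D.f} {y : Q}
    (hy : InComp R j y) (s : SS R) :
    s • y - cR R (pj R j (PowerSeries.constantCoeff s)) • y ∈
      (Ideal.span {(PowerSeries.X : SS R)} • ⊤ : Submodule (SS R) Q) := by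
  rw [← hy.C_smul, ← sub_smul]
  exact Submodule.smul_mem_smul (Ideal.mem_span_singleton.2 (X_dvd_sub_constantCoeff s)) trivial

section Away

variable {g : R} {M : Type u} [AddCommGroup M] [Module (SS R) M] {M' : Type u} [AddCommGroup M']
  [Module (SS (R.away g)) M'] {f : M →ₛₗ[baseS (R.toAway g)] M'}

theorem clear_denominators (f : M →ₛₗ[baseS (R.toAway g)] M') (j : ZMod D.f) (z : Fin D.n → M)
    (c : Fin D.n → SS (R.away g)) {k : ℕ} {r : Fin D.n → R}
    (hr : ∀ i, R.toAway g (g ^ k) * pj (R.away g) j (PowerSeries.constantCoeff (c i)) =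
      R.toAway g (r i)) :
    cR (R.away g) (R.toAway g (g ^ k)) • eps (R.away g) j • ∑ i, c i • f (z i) -
      f (∑ i, cR R (r i) • eps R j • z i) ∈
        (Ideal.span {(PowerSeries.X : SS (R.away g))} • ⊤ : Submodule (SS (R.away g)) M') := by
  rw [map_sum, Finset.smul_sum, Finset.smul_sum, ← Finset.sum_sub_distrib]
  refine Submodule.sum_mem _ fun i _ => ?_
  rw [map_smulₛₗ, map_smulₛₗ, baseS_cR, baseS_eps, ← hr, cR_mul, mul_smul, ← smul_sub,
    smul_comm (eps _ j)]
  exact Submodule.smul_mem _ _ ((inComp_eps_smul j (f (z i))).smul_mod_X (c i))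

theorem span_X_le_jacobson (R : NilpAlg D) :
    Ideal.span {(PowerSeries.X : SS R)} ≤ Ideal.jacobson (⊥ : Ideal (SS R)) :=
  (Ideal.span_singleton_le_iff_mem (Ideal.jacobson (⊥ : Ideal (SS R)))).2 (X_mem_jacobson (WR R))

/-- The hypotheses say that the z_i form a basis of M/vM after inverting g. The images over R[1/g]
are then a basis modulo v, which lies in the Jacobson radical. -/
theorem isBas_of_mod_X [Module.Finite (SS R) M] [Module.Projective (SS R) M]
    [Module.Finite (SS (R.away g)) M'] [Module.Projective (SS (R.away g)) M'] (hf : IsBC f)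
    {z : Fin D.n → M}
    (hspan : ∀ j (w : M), ∃ (k : ℕ) (c : Fin D.n → R),
      cR R (g ^ k) • eps R j • w - ∑ i, cR R (c i) • eps R j • z i ∈
        (Ideal.span {(PowerSeries.X : SS R)} • ⊤ : Submodule (SS R) M))
    (hind : ∀ j (c : Fin D.n → R), ∑ i, cR R (c i) • eps R j • z i ∈
      (Ideal.span {(PowerSeries.X : SS R)} • ⊤ : Submodule (SS R) M) →
        ∃ k : ℕ, ∀ i, g ^ k * c i = 0) :
    IsBas (SS (R.away g)) fun i => f (z i) := by
  refine isBas_of_mod (I := Ideal.span {PowerSeries.X})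
    (span_X_le_jacobson (R.away g)) (fun i => f (z i)) (fun w => ?_)
    (fun c hc i => ?_)
  · set U := Submodule.span (SS (R.away g)) (Set.range fun i => f (z i)) ⊔
      (Ideal.span {(PowerSeries.X : SS (R.away g))} • ⊤ : Submodule (SS (R.away g)) M') with hU
    have hzU : ∀ i, f (z i) ∈ U := fun i =>
      Submodule.mem_sup_left (Submodule.subset_span ⟨i, rfl⟩)
    have hcomp : ∀ (w : M) j, f (eps R j • w) ∈ U := fun w j => by
      obtain ⟨k, c, hc⟩ := hspan j w
      have h₂ := map_mem_span_smul f (baseS_X _) hc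
      obtain ⟨v, hv⟩ := (isUnit_baseS_cR g k).exists_left_inv
      rw [map_sub, map_smulₛₗ, map_sum] at h₂
      have h₃ : ∑ i, f (cR R (c i) • eps R j • z i) ∈ U := Submodule.sum_mem _ fun i _ => by
        rw [map_smulₛₗ, map_smulₛₗ]
        exact U.smul_mem _ (U.smul_mem _ (hzU i))
      have h₄ := U.smul_mem v ((U.sub_mem_iff_left h₃).1 (Submodule.mem_sup_right h₂))
      rwa [smul_smul, hv, one_smul] at h₄
    have hUtop : w ∈ U := by
      have hw : w ∈ Submodule.span (SS (R.away g)) (Set.range f) := hf.1 ▸ Submodule.mem_top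
      refine Submodule.span_le.2 ?_ hw
      rintro _ ⟨m, rfl⟩
      rw [← sum_eps_smul (R := R) m, map_sum]
      exact U.sum_mem fun j _ => hcomp m j
    obtain ⟨y₁, hy₁, y₂, hy₂, rfl⟩ := Submodule.mem_sup.1 hUtop
    obtain ⟨c, rfl⟩ := (Submodule.mem_span_range_iff_exists_fun _).1 hy₁
    exact ⟨c, by rwa [add_sub_cancel_left]⟩
  · rw [Ideal.mem_span_singleton, X_dvd_iff_pj]
    intro j
    obtain ⟨k, r, hr⟩ := exists_common_toAway g
      fun i => pj (R.away g) j (PowerSeries.constantCoeff (c i))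
    have h₁ := (Submodule.sub_mem_iff_right _ (Submodule.smul_mem _ _ (Submodule.smul_mem _ _ hc))).1
      (clear_denominators f j z c hr)
    obtain ⟨k', hk'⟩ := exists_pow_smul_mem hf h₁
    obtain ⟨k'', hk''⟩ := hind j (fun i => g ^ k' * r i) (by
      refine Set.mem_of_eq_of_mem ?_ hk'
      rw [Finset.smul_sum]
      exact Finset.sum_congr rfl fun i _ => by rw [cR_mul, mul_smul])
    have h₃ := congrArg (R.toAway g) (hk'' i)
    rw [map_mul, map_mul, map_zero, ← hr] at h₃
    have hu : ∀ k : ℕ, IsUnit (R.toAway g (g ^ k)) := fun k => by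
      rw [map_pow]
      exact (isUnit_toAway g).pow k
    exact (hu k).mul_right_eq_zero.1 ((hu k').mul_right_eq_zero.1
      ((hu k'').mul_right_eq_zero.1 h₃))

end Away

/-- The eigenvectors modulo v are lifted to M and averaged. As vM is Δ-stable this changes nothing
modulo v, so the averages are exact eigenvectors that form a basis over R[1/g]. -/
theorem KisinDD.HasType.exists_isEBAt {M : KisinDD D R} (hM : M.HasType) :
    ∃ t : Finset R, Ideal.span (t : Set R) = ⊤ ∧ ∀ g ∈ t, ∃ x, IsEBAt M g x := by
  obtain ⟨t, ht, hM⟩ := hM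
  refine ⟨t, ht, fun g hg => ?_⟩
  choose x hx hspan hind using hM g hg
  choose y hy using fun j i => quo_mk_surj (x j i)
  have hv : ∀ i, KisinDD.Quo.mk PowerSeries.X (∑ j, y j i) = ∑ j, x j i := fun i => by
    rw [quo_mk_sum]
    exact Finset.sum_congr rfl fun j _ => hy j i
  choose z hz hzy using fun i => M.galAction.exists_average i (∑ j, y j i)
  have hzx : ∀ i, KisinDD.Quo.mk PowerSeries.X (z i) = ∑ j, x j i := fun i => by
    rw [← hv]
    refine quo_mk_eq_iff.2 (hzy i _
      (fun w hw => gal_mem_smul_top (γ := M.gal) (X_dvd_galS D.gen) hw) ?_)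
    rw [← quo_mk_eq_iff, map_sum, quo_mk_smul, hv, quo_mk_sum, Finset.smul_sum]
    exact Finset.sum_congr rfl fun j _ => (hx j i).2 _ _ (hy j i)
  have hze : ∀ j i, KisinDD.Quo.mk PowerSeries.X (eps R j • z i) = x j i := fun j i => by
    rw [quo_mk_smul, hzx, eps_smul_sum_vec (x := fun l => x l i) fun l => (hx l i).1]
  have hsum : ∀ j (c : Fin D.n → R), KisinDD.Quo.mk PowerSeries.X
      (∑ i, cR R (c i) • eps R j • z i) = ∑ i, cR R (c i) • x j i := fun j c => by
    rw [quo_mk_sum]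
    exact Finset.sum_congr rfl fun i _ => by rw [quo_mk_smul, hze]
  refine ⟨z, hz, ?_⟩
  have := M.finite
  have := M.projective
  have := finite_ext (g := baseS (R.toAway g)) (M := M)
  have := projective_ext (g := baseS (R.toAway g)) (M := M)
  refine isBas_of_mod_X (f := Ext.ofₛₗ (baseS (R.toAway g)) M) IsBC.ofₛₗ (fun j w => ?_)
    (fun j c hc => hind j c ?_)
  · obtain ⟨k, c, hc⟩ := hspan j (KisinDD.Quo.mk PowerSeries.X (eps R j • w))
      (inComp_eps_smul (Q := M.Quo PowerSeries.X) j (KisinDD.Quo.mk PowerSeries.X w))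
    exact ⟨k, c, quo_mk_eq_iff.1 ((quo_mk_smul _ _ _).trans (hc.trans (hsum j c).symm))⟩
  · rw [← hsum]
    exact (Submodule.Quotient.mk_eq_zero _).2 hc

/-- The converse. Local eigenbases, unlike the formulation through M/vM and powers of g, are carried
along base change directly, and so the type of a pullback is obtained. -/
theorem KisinDD.hasType_of_isEBAt {M : KisinDD D R} {t : Finset R}
    (ht : Ideal.span (t : Set R) = ⊤) (hM : ∀ g ∈ t, ∃ x, IsEBAt M g x) : M.HasType := by
  refine ⟨t, ht, fun g hg j => ?_⟩
  obtain ⟨x, hx, hb⟩ := hM g hg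
  have := M.finite
  have := M.projective
  set f := Ext.ofₛₗ (baseS (R.toAway g)) M with hf
  have hfbc : IsBC f := IsBC.ofₛₗ
  refine ⟨fun i => KisinDD.Quo.mk PowerSeries.X (eps R j • x i),
    fun i => isEigenQuo_of X_dvd_galS (hx i), fun y hy => ?_, fun c hc => ?_⟩
  · obtain ⟨y, rfl⟩ := quo_mk_surj y
    obtain ⟨c, hc⟩ := hb.exists_sum (f y)
    obtain ⟨k, r, hr⟩ := exists_common_toAway g
      fun i => pj (R.away g) j (PowerSeries.constantCoeff (c i))
    have h₁ : f (cR R (g ^ k) • eps R j • y - ∑ i, cR R (r i) • eps R j • x i) ∈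
        (Ideal.span {(PowerSeries.X : SS (R.away g))} • ⊤ :
          Submodule (SS (R.away g)) (Ext (baseS (R.toAway g)) M)) := by
      have h₂ := clear_denominators f j x c hr
      rw [map_sub, map_smulₛₗ, map_smulₛₗ, baseS_cR, baseS_eps, hc]
      exact h₂
    obtain ⟨k', hk'⟩ := exists_pow_smul_mem hfbc h₁
    refine ⟨k' + k, fun i => g ^ k' * r i, ?_⟩
    rw [smul_sub, ← quo_mk_eq_iff, quo_mk_smul, quo_mk_smul, quo_mk_smul, smul_smul, ← cR_mul,
      ← pow_add] at hk'
    rw [← hy.eps_smul, hk', quo_mk_smul, quo_mk_sum, Finset.smul_sum]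
    exact Finset.sum_congr rfl fun i _ => by rw [quo_mk_smul, smul_smul, cR_mul]
  · have h₁ : ∑ i, cR R (c i) • eps R j • x i ∈
        (Ideal.span {(PowerSeries.X : SS R)} • ⊤ : Submodule (SS R) M) :=
      (Submodule.Quotient.mk_eq_zero _).1 ((quo_mk_sum PowerSeries.X _ _).trans hc)
    have h₂ := map_mem_span_smul f (baseS_X (R.toAway g)) h₁
    rw [map_sum] at h₂
    have h₃ : ∀ i, R.toAway g (c i) = 0 := fun i => by
      have h₄ := mem_span_smul_of_isBas hb (c := fun i => cR _ (R.toAway g (c i)) * eps _ j)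
        (t := PowerSeries.X) (by
          refine Set.mem_of_eq_of_mem (Finset.sum_congr rfl fun i _ => ?_) h₂
          rw [map_smulₛₗ, map_smulₛₗ, baseS_cR, baseS_eps, smul_smul]
          rfl) i
      have h₅ := X_dvd_iff_pj.1 h₄ j
      rw [map_mul, constantCoeff_cR, map_mul, pj_includeRight, eps, PowerSeries.constantCoeff_C,
        pj_idem, if_pos rfl, mul_one] at h₅
      exact h₅
    exact exists_common_pow g (fun i r => r * c i = 0)
      (fun i r s h => by rw [mul_assoc, h, mul_zero]) fun i => toAway_eq_zero (h₃ i)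

end TypeCondition

/-! ### Pullbacks and local eigenbases in Y -/

section Pullback

variable {a b : ℤ}

theorem IsBas.map_equiv {S : Type u} [CommRing S] {M N : Type u} [AddCommGroup M] [Module S M]
    [AddCommGroup N] [Module S N] (e : M ≃ₗ[S] N) {ι : Type*} {x : ι → M} (hx : IsBas S x) :
    IsBas S fun i => e (x i) := by
  refine ⟨hx.1.map' e.toLinearMap e.ker, ?_⟩
  have h₁ : (Set.range fun i => e (x i)) = e.toLinearMap '' Set.range x := by
    rw [← Set.range_comp]; rfl
  rw [h₁, Submodule.span_image, hx.2, Submodule.map_top, e.range]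

theorem Y.exists_pullback {R R' : NilpAlg D} (h : R →ₐ[D.Lam] R') (M : Y D a b R) :
    ∃ N : Y D a b R', Nonempty (Arrow h M N) := by
  classical
  obtain ⟨N, f, hf, hφ, hγ, hh⟩ := M.toKisinDD.exists_pullback h
  obtain ⟨t, ht, hM⟩ := M.type.exists_isEBAt
  have htype : N.HasType := by
    refine KisinDD.hasType_of_isEBAt (t := t.image h) ?_ fun g' hg' => ?_
    · rw [Finset.coe_image]
      have h₁ := congrArg (Ideal.map (h : R →+* R')) ht
      rw [Ideal.map_span, Ideal.map_top] at h₁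
      exact h₁
    · obtain ⟨g, hg, rfl⟩ := Finset.mem_image.1 hg'
      obtain ⟨x, hx, hb⟩ := hM g hg
      refine ⟨fun i => f (x i), fun i σ => by rw [← hγ, hx, map_smulₛₗ, baseS_cL], ?_⟩
      obtain ⟨f', hf', hff⟩ := IsBC.exists_square (awayMap_comp h g) hf
        (IsBC.ofₛₗ (g := baseS (R.toAway g)) (M := M))
        (IsBC.ofₛₗ (g := baseS (R'.toAway (h g))) (M := N))
      have h₁ := hf'.isBas hb
      exact (funext fun i => hff (x i) : (fun i => f' (Ext.of (baseS (R.toAway g)) (x i))) = _) ▸ h₁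
  let N' : Y D a b R' := { toKisinDD := N, height := hh a b M.height, type := htype }
  obtain ⟨α, -⟩ := exists_arrow_of_isBC (M := M) (M' := N') hf hφ hγ
  exact ⟨N', ⟨α⟩⟩

theorem Y.exists_locally_isEB {R : NilpAlg D} (M : Y D a b R) :
    ∃ t : Finset R, Ideal.span (t : Set R) = ⊤ ∧ ∀ g ∈ t, ∃ (M' : Y D a b (R.away g))
      (_ : Arrow (R.toAway g) M M') (x : Fin D.n → M'), IsEB M'.toKisinDD x := by
  obtain ⟨t, ht, hM⟩ := M.type.exists_isEBAt
  refine ⟨t, ht, fun g hg => ?_⟩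
  obtain ⟨x, hx, hb⟩ := hM g hg
  obtain ⟨M', ⟨α⟩⟩ := M.exists_pullback (R.toAway g)
  refine ⟨M', α, fun i => α.sl (x i), hb.map_equiv α.iso, fun i σ => ?_⟩
  rw [← α.sl_gal, hx, map_smulₛₗ, baseS_cL]

end Pullback

end KisinDescent

namespace KisinDescent

variable {p : ℕ} [Fact p.Prime] {D : Setup.{u} p}

/-! ### Conjugation by diag(v^{a_i}) -/

section Shift

variable (D) in
/-- The integer `e ∈ [0, d)` with `a_m + e ≡ a_k` modulo `d`. -/
def shift (j : ZMod D.f) (m k : Fin D.n) : ℕ :=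
  if D.ex j m ≤ D.ex j k then D.ex j k - D.ex j m else D.ex j k + D.d - D.ex j m

variable (D) in
/-- `1` below the block diagonal and `0` elsewhere. -/
def below (j : ZMod D.f) (m k : Fin D.n) : ℕ := if D.ex j m ≤ D.ex j k then 0 else 1

theorem shift_lt (j : ZMod D.f) (m k : Fin D.n) : shift D j m k < D.d := by
  have h₁ := D.ex_lt j m
  have h₂ := D.ex_lt j k
  unfold shift
  split_ifs <;> omega

/-- The identity behind D⁻¹ G(v^d) D: it gives v^{a_m} · v^e h(v^d) = (u^ε h)(v^d) · v^{a_k} with u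
= v^d. Both exponents a_m and a_k lie in [0, d), so ε is 0 or 1. -/
theorem ex_add_shift (j : ZMod D.f) (m k : Fin D.n) :
    D.ex j m + shift D j m k = D.ex j k + D.d * below D j m k := by
  have h₁ := D.ex_lt j m
  have h₂ := D.ex_lt j k
  unfold shift below
  split_ifs <;> simp <;> omega

theorem shift_self (j : ZMod D.f) (m : Fin D.n) : shift D j m m = 0 := by simp [shift]

variable {S : Type u} [CommRing S] (j : ZMod D.f)

/-- The matrix `D⁻¹ G(v^d) D`, where `G_{mk} = u^{ε_{mk}} H_{mk}`. -/
def conjMat (H : Matrix (Fin D.n) (Fin D.n) S⟦X⟧) : Matrix (Fin D.n) (Fin D.n) S⟦X⟧ :=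
  Matrix.of fun m k => PowerSeries.X ^ shift D j m k * PowerSeries.expand D.d D.d_pos.ne' (H m k)

/-- The matrix `G_{mk} = u^{ε_{mk}} H_{mk}`. -/
def lowerMat (H : Matrix (Fin D.n) (Fin D.n) S⟦X⟧) : Matrix (Fin D.n) (Fin D.n) S⟦X⟧ :=
  Matrix.of fun m k => PowerSeries.X ^ below D j m k * H m k

theorem diagV_mul_apply {A : Type u} [CommRing A] (v : A) (B : Matrix (Fin D.n) (Fin D.n) A)
    (m k : Fin D.n) : (diagV D j v * B) m k = v ^ D.ex j m * B m k := by
  rw [diagV, Matrix.diagonal_mul]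

theorem mul_diagV_apply {A : Type u} [CommRing A] (v : A) (B : Matrix (Fin D.n) (Fin D.n) A)
    (m k : Fin D.n) : (B * diagV D j v) m k = B m k * v ^ D.ex j k := by
  rw [diagV, Matrix.mul_diagonal]

theorem diagV_mul_conjMat (H : Matrix (Fin D.n) (Fin D.n) S⟦X⟧) :
    diagV D j PowerSeries.X * conjMat j H =
      (lowerMat j H).map (PowerSeries.expand D.d D.d_pos.ne') * diagV D j PowerSeries.X := by
  ext1 m k
  rw [diagV_mul_apply, mul_diagV_apply, Matrix.map_apply, conjMat, lowerMat, Matrix.of_apply,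
    Matrix.of_apply, map_mul, map_pow, PowerSeries.expand_X, ← mul_assoc, ← pow_add,
    ex_add_shift, ← pow_mul, pow_add]
  ring

theorem X_pow_mul_cancel {a : ℕ} {x y : S⟦X⟧}
    (h : PowerSeries.X ^ a * x = PowerSeries.X ^ a * y) : x = y := by
  ext n
  have := congrArg (PowerSeries.coeff (n + a)) h
  rwa [PowerSeries.coeff_X_pow_mul, PowerSeries.coeff_X_pow_mul] at this

theorem diagV_mul_cancel {B B' : Matrix (Fin D.n) (Fin D.n) S⟦X⟧}
    (h : diagV D j PowerSeries.X * B = diagV D j PowerSeries.X * B') : B = B' := by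
  ext1 m k
  have := congrFun (congrFun h m) k
  rw [diagV_mul_apply, diagV_mul_apply] at this
  exact X_pow_mul_cancel this

theorem map_conjMat {T : Type u} [CommRing T] (φ : S →+* T)
    (H : Matrix (Fin D.n) (Fin D.n) S⟦X⟧) :
    (conjMat j H).map (PowerSeries.map φ) = conjMat j (H.map (PowerSeries.map φ)) := by
  ext1 m k
  simp [conjMat, PowerSeries.map_expand]

/-- Conjugation by D is multiplicative, D can be cancelled because v is a nonzerodivisor, and u ↦
v^d is injective. -/
theorem conjMat_mul_eq_one_iff {H H' : Matrix (Fin D.n) (Fin D.n) S⟦X⟧} :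
    conjMat j H * conjMat j H' = 1 ↔ lowerMat j H * lowerMat j H' = 1 := by
  have h₁ : diagV D j (PowerSeries.X : S⟦X⟧) * (conjMat j H * conjMat j H') =
      (lowerMat j H * lowerMat j H').map (PowerSeries.expand D.d D.d_pos.ne') *
        diagV D j PowerSeries.X := by
    rw [← mul_assoc, diagV_mul_conjMat, mul_assoc, diagV_mul_conjMat, ← mul_assoc]
    congr 1
    exact (Matrix.map_mul (f := (PowerSeries.expand D.d D.d_pos.ne' : S⟦X⟧ →ₐ[S] S⟦X⟧).toRingHom)).symm
  constructor
  · intro h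
    rw [h, mul_one] at h₁
    ext1 m k
    have h₂ := congrFun (congrFun h₁ m) k
    rw [mul_diagV_apply, Matrix.map_apply, diagV, Matrix.diagonal_apply] at h₂
    refine expand_injective D.d_pos.ne' ?_
    refine X_pow_mul_cancel (a := D.ex j k) ?_
    rw [mul_comm, ← h₂, Matrix.one_apply]
    split_ifs with hmk
    · subst hmk
      rw [map_one, mul_one]
    · rw [map_zero, mul_zero]
  · intro h
    refine diagV_mul_cancel j ?_
    rw [h₁, h, mul_one, Matrix.map_one _ (map_zero _) (map_one _), one_mul]

end Shift

/-! ### Transition matrices between exact eigenbases -/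

section ChangeOfBasis

variable {R : NilpAlg D}

/-- `A` is the matrix of a `Δ`-equivariant map between eigenbases. -/
def SemiInv (A : Matrix (Fin D.n) (Fin D.n) (SS R)) : Prop :=
  ∀ m k, cL R (D.chi m D.gen) * galS R D.gen (A m k) = cL R (D.chi k D.gen) * A m k

theorem IsBas.exists_matrix {S : Type u} [CommRing S] {M : Type u} [AddCommGroup M] [Module S M]
    {ι : Type*} [Fintype ι] {x : ι → M} (hx : IsBas S x) (y : ι → M) :
    ∃ A : Matrix ι ι S, ∀ k, y k = ∑ m, A m k • x m := by
  choose c hc using fun k => hx.exists_sum (y k)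
  exact ⟨Matrix.of fun m k => c k m, hc⟩

theorem sum_smul_sum {S : Type u} [CommRing S] {M : Type u} [AddCommGroup M] [Module S M]
    {ι : Type*} [Fintype ι] (x : ι → M) (A B : Matrix ι ι S) (k : ι) :
    ∑ l, B l k • ∑ m, A m l • x m = ∑ m, (A * B) m k • x m := by
  simp_rw [Finset.smul_sum, Matrix.mul_apply, Finset.sum_smul]
  rw [Finset.sum_comm]
  refine Finset.sum_congr rfl fun m _ => Finset.sum_congr rfl fun l _ => ?_
  rw [smul_smul, mul_comm]

theorem IsBas.matrix_ext {S : Type u} [CommRing S] {M : Type u} [AddCommGroup M] [Module S M]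
    {ι : Type*} [Fintype ι] {x : ι → M} (hx : IsBas S x) {A B : Matrix ι ι S}
    (h : ∀ k, ∑ m, A m k • x m = ∑ m, B m k • x m) : A = B := by
  ext m k
  have h₁ : ∑ m, (A m k - B m k) • x m = 0 := by
    simp_rw [sub_smul, Finset.sum_sub_distrib]
    rw [h, sub_self]
  exact sub_eq_zero.1 (Fintype.linearIndependent_iff.1 hx.1 _ h₁ m)

theorem sum_one_smul {S : Type u} [CommRing S] {M : Type u} [AddCommGroup M] [Module S M]
    {ι : Type*} [Fintype ι] [DecidableEq ι] (x : ι → M) (k : ι) :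
    ∑ m, (1 : Matrix ι ι S) m k • x m = x k := by
  simp [Matrix.one_apply]

theorem IsBas.mul {S : Type u} [CommRing S] {M : Type u} [AddCommGroup M] [Module S M]
    {ι : Type*} [Fintype ι] [DecidableEq ι] {x : ι → M} (hx : IsBas S x) {A A' : Matrix ι ι S}
    (hA : A * A' = 1) : IsBas S fun k => ∑ m, A m k • x m := by
  refine isBas_of (fun y => ?_) fun c hc i => ?_
  · obtain ⟨c, rfl⟩ := hx.exists_sum y
    have h₁ : ∀ i, x i = ∑ l, A' l i • ∑ m, A m l • x m := fun i => by
      rw [sum_smul_sum, hA, sum_one_smul]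
    refine ⟨fun l => ∑ i, c i * A' l i, ?_⟩
    simp_rw [Finset.sum_smul]
    rw [Finset.sum_comm]
    refine Finset.sum_congr rfl fun i _ => ?_
    conv_lhs => rw [h₁ i, Finset.smul_sum]
    exact Finset.sum_congr rfl fun l _ => smul_smul _ _ _
  · have h₁ : ∑ m, (A.mulVec c) m • x m = 0 := by
      rw [← hc]
      simp_rw [Matrix.mulVec, dotProduct, Finset.sum_smul, Finset.smul_sum]
      rw [Finset.sum_comm]
      exact Finset.sum_congr rfl fun i _ => Finset.sum_congr rfl fun m _ => by
        rw [smul_smul, mul_comm]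
    have h₂ : A.mulVec c = 0 := funext (Fintype.linearIndependent_iff.1 hx.1 _ h₁)
    have h₃ := congrArg A'.mulVec h₂
    rw [Matrix.mulVec_mulVec, mul_eq_one_comm.1 hA, Matrix.one_mulVec, Matrix.mulVec_zero] at h₃
    exact congrFun h₃ i

variable {M : KisinDD D R}

theorem IsEB.mul {x : Fin D.n → M} (hx : IsEB M x) {A A' : Matrix (Fin D.n) (Fin D.n) (SS R)}
    (hA : A * A' = 1) (hs : SemiInv A) : IsEB M fun k => ∑ m, A m k • x m := by
  refine ⟨hx.1.mul hA, fun k g => M.galAction.eigen_of_gen ?_ g⟩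
  rw [map_sum, Finset.smul_sum]
  refine Finset.sum_congr rfl fun m _ => ?_
  rw [map_smulₛₗ, hx.2, smul_smul, smul_smul, mul_comm, hs]

theorem IsEB.semiInv {x y : Fin D.n → M} (hx : IsEB M x) (hy : IsEB M y)
    {A : Matrix (Fin D.n) (Fin D.n) (SS R)} (hA : ∀ k, y k = ∑ m, A m k • x m) : SemiInv A := by
  have h : (Matrix.of fun m k => cL R (D.chi m D.gen) * galS R D.gen (A m k)) =
      Matrix.of fun m k => cL R (D.chi k D.gen) * A m k := by
    refine hx.1.matrix_ext fun k => ?_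
    have h₁ := hy.2 k D.gen
    rw [hA, map_sum, Finset.smul_sum] at h₁
    refine Eq.trans (Finset.sum_congr rfl fun m _ => ?_)
      (h₁.trans (Finset.sum_congr rfl fun m _ => ?_))
    · rw [map_smulₛₗ, hx.2, smul_smul, Matrix.of_apply, mul_comm]
    · rw [smul_smul, Matrix.of_apply]
  exact fun m k => congrFun (congrFun h m) k

theorem IsEB.exists_matrix {x y : Fin D.n → M} (hx : IsEB M x) (hy : IsEB M y) :
    ∃ A A' : Matrix (Fin D.n) (Fin D.n) (SS R), A * A' = 1 ∧ SemiInv A ∧ SemiInv A' ∧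
      ∀ k, y k = ∑ m, A m k • x m := by
  obtain ⟨A, hA⟩ := hx.1.exists_matrix y
  obtain ⟨A', hA'⟩ := hy.1.exists_matrix x
  refine ⟨A, A', hx.1.matrix_ext fun k => ?_, hx.semiInv hy hA, hy.semiInv hx hA', hA⟩
  rw [sum_one_smul, ← sum_smul_sum]
  simp_rw [← hA]
  exact (hA' k).symm

theorem cL_eq (c : D.Lam) : cL R c = incl R (PowerSeries.C (algebraMap D.Lam R c)) := by
  rw [cL, cR, incl, PowerSeries.map_C]
  rfl

/-- In the j-th component equivariance reads ζ^{a_m} B_mk(ζv) = ζ^{a_k} B_mk(v), with ζ of order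
dividing d and unit differences of distinct powers. This leaves only the weight e with a_m + e ≡ a_k
modulo d. -/
theorem semiInv_iff {A : Matrix (Fin D.n) (Fin D.n) (SS R)} :
    SemiInv A ↔ ∀ j, ∃ H, A.map (pS R j) = conjMat j H := by
  have hσ : ∀ j, (algebraMap D.Lam R (D.sigma j (D.om D.gen))) ^ D.d = 1 := fun j => by
    rw [← map_pow, D.sigma_om_pow_d, map_one]
  have hχ : ∀ j i, pS R j (cL R (D.chi i D.gen)) =
      PowerSeries.C (algebraMap D.Lam R (D.sigma j (D.om D.gen)) ^ D.ex j i) := fun j i => by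
    rw [cL_eq, pS_incl, D.chi_eq_sigma j, map_pow]
  have hpS : SemiInv A ↔ ∀ j m k,
      PowerSeries.C (algebraMap D.Lam R (D.sigma j (D.om D.gen)) ^ D.ex j m) *
        PowerSeries.rescale (algebraMap D.Lam R (D.sigma j (D.om D.gen))) (pS R j (A m k)) =
      PowerSeries.C (algebraMap D.Lam R (D.sigma j (D.om D.gen)) ^ D.ex j k) * pS R j (A m k) := by
    constructor
    · intro h j m k
      have := congrArg (pS R j) (h m k)
      rwa [map_mul, map_mul, hχ, hχ, pS_galS] at this
    · intro h m k
      refine pS_ext fun j => ?_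
      rw [map_mul, map_mul, hχ, hχ, pS_galS]
      exact h j m k
  rw [hpS]
  refine forall_congr' fun j => ⟨fun h => ?_, fun ⟨H, hH⟩ m k => ?_⟩
  · refine ⟨Matrix.of fun m k => wt D.d (shift D j m k) (pS R j (A m k)), ?_⟩
    ext1 m k
    -- Taken with t = 0, so that the divisibility is an equality.
    have h₁ := dvd_sub_of_rescale D.d_pos.ne' (hσ j) (fun a b ha hb hab => by
      have h₂ := (D.isUnit_sigma_pow_sub (j := j) ha hb hab).map (algebraMap D.Lam R)
      rwa [map_sub, map_pow, map_pow] at h₂) (shift_lt j m k)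
      (k := D.ex j m) (l := D.ex j k) (by rw [ex_add_shift, Nat.add_mul_mod_self_left])
      (t := 0) (f := pS R j (A m k)) (by rw [h m k, sub_self]; exact dvd_zero _)
    rw [map_zero, zero_dvd_iff, sub_eq_zero] at h₁
    exact h₁
  · have h₁ : pS R j (A m k) = _ := congrFun (congrFun hH m) k
    rw [h₁, conjMat, Matrix.of_apply]
    refine wt_ext D.d_pos.ne' fun e he => ?_
    rw [wt_C_mul, wt_C_mul, wt_rescale (hσ j), wt_X_pow_mul_expand _ he (shift_lt _ _ _)]
    split_ifs with hes
    · rw [← mul_assoc, ← map_mul, ← pow_add, hes, ex_add_shift, pow_add, pow_mul, hσ, one_pow,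
        mul_one]
    · simp

theorem exists_matrix_of_components (B : ZMod D.f → Matrix (Fin D.n) (Fin D.n) R⟦X⟧) :
    ∃ A : Matrix (Fin D.n) (Fin D.n) (SS R), ∀ j, A.map (pS R j) = B j := by
  choose A hA using fun m k => pS_surj (R := R) fun j => B j m k
  exact ⟨Matrix.of A, fun j => by ext1 m k; exact hA m k j⟩

theorem matrix_ext_pS {A B : Matrix (Fin D.n) (Fin D.n) (SS R)}
    (h : ∀ j, A.map (pS R j) = B.map (pS R j)) : A = B := by
  ext1 m k
  exact pS_ext fun j => congrFun (congrFun (h j) m) k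

theorem matrix_mul_eq_one {A A' : Matrix (Fin D.n) (Fin D.n) (SS R)}
    (h : ∀ j, A.map (pS R j) * A'.map (pS R j) = 1) : A * A' = 1 :=
  matrix_ext_pS fun j => by
    rw [Matrix.map_mul, h, Matrix.map_one _ (map_zero _) (map_one _)]

/-- The transition matrices act on exact eigenbases. -/
theorem IsEB.exists_mul {x : Fin D.n → M} (hx : IsEB M x)
    (H B' : ZMod D.f → Matrix (Fin D.n) (Fin D.n) R⟦X⟧)
    (hH : ∀ j, conjMat j (H j) * B' j = 1) :
    ∃ y, IsEB M y ∧ ∀ j k, eps R j • y k = ∑ m, incl R (conjMat j (H j) m k) • eps R j • x m := by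
  obtain ⟨A, hA⟩ := exists_matrix_of_components fun j => conjMat j (H j)
  obtain ⟨A', hA'⟩ := exists_matrix_of_components B'
  refine ⟨_, hx.mul (A := A) (A' := A') (matrix_mul_eq_one fun j => by rw [hA, hA', hH])
    (semiInv_iff.2 fun j => ⟨_, hA j⟩), fun j k => ?_⟩
  rw [eps_smul_sum]
  exact Finset.sum_congr rfl fun m _ => by rw [← hA]; rfl

/-- Exact eigenbases differ by transition matrices. -/
theorem IsEB.exists_transition {x y : Fin D.n → M} (hx : IsEB M x) (hy : IsEB M y) :
    ∃ H H' : ZMod D.f → Matrix (Fin D.n) (Fin D.n) R⟦X⟧,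
      (∀ j, conjMat j (H j) * conjMat j (H' j) = 1) ∧
      ∀ j k, eps R j • y k = ∑ m, incl R (conjMat j (H j) m k) • eps R j • x m := by
  obtain ⟨A, A', h₁, hA, hA', hy⟩ := hx.exists_matrix hy
  choose H hH using semiInv_iff.1 hA
  choose H' hH' using semiInv_iff.1 hA'
  refine ⟨H, H', fun j => ?_, fun j k => ?_⟩
  · rw [← hH, ← hH', ← Matrix.map_mul, h₁, Matrix.map_one _ (map_zero _) (map_one _)]
  · rw [hy, eps_smul_sum]
    exact Finset.sum_congr rfl fun m _ => by rw [← hH]; rfl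

end ChangeOfBasis

end KisinDescent

namespace KisinDescent

variable {p : ℕ} [Fact p.Prime] {D : Setup.{u} p}

/-! ### R[u]/E_j^r as a quotient of R[[u]] -/

section Truncation

variable (R : NilpAlg D) (j : ZMod D.f)

/-- `R[u] / E_j^r → R[[u]] / E_j^r`. -/
def truncToSeries (r : ℕ) : Trunc R j r →+* R⟦X⟧ ⧸ Ideal.span {(ER R j : R⟦X⟧) ^ r} :=
  Ideal.quotientMap _ (Polynomial.coeToPowerSeries.ringHom : R[X] →+* R⟦X⟧) (by
    rw [Ideal.span_le, Set.singleton_subset_iff]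
    simp only [SetLike.mem_coe, Ideal.mem_comap, map_pow]
    exact Ideal.subset_span rfl)

theorem truncToSeries_mk (r : ℕ) (q : R[X]) :
    truncToSeries R j r (Trunc.mk R j r q) = Ideal.Quotient.mk _ (q : R⟦X⟧) := rfl

theorem truncMk_surjective (r : ℕ) : Function.Surjective (Trunc.mk R j r) :=
  Ideal.Quotient.mk_surjective

theorem truncMk_eq_zero_iff {r : ℕ} {q : R[X]} : Trunc.mk R j r q = 0 ↔ ER R j ^ r ∣ q := by
  rw [Trunc.mk, ← Ideal.mem_span_singleton]
  exact Ideal.Quotient.eq_zero_iff_mem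

/-- E_j^r divides a power of u, so modulo E_j^r every power series is a polynomial, and divisibility
by E_j^r may be tested among polynomials. -/
theorem truncToSeries_bijective (r : ℕ) : Function.Bijective (truncToSeries R j r) := by
  constructor
  · rw [injective_iff_map_eq_zero]
    intro x hx
    obtain ⟨q, rfl⟩ := truncMk_surjective R j r x
    rw [truncToSeries_mk, Ideal.Quotient.eq_zero_iff_mem, Ideal.mem_span_singleton] at hx
    exact (truncMk_eq_zero_iff R j).2 ((nilDist_ER R j).dvd_of_coe_dvd r hx)
  · intro y
    obtain ⟨x, rfl⟩ := Ideal.Quotient.mk_surjective y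
    obtain ⟨q, hq⟩ := (nilDist_ER R j).exists_polynomial r x
    refine ⟨Trunc.mk R j r q, ?_⟩
    rw [truncToSeries_mk, eq_comm, Ideal.Quotient.eq, Ideal.mem_span_singleton]
    exact hq

/-- The reduction map `R[[u]] → R[u] / E_j^r`. -/
def rho (r : ℕ) : R⟦X⟧ →+* Trunc R j r :=
  ((RingEquiv.ofBijective _ (truncToSeries_bijective R j r)).symm :
    R⟦X⟧ ⧸ Ideal.span {(ER R j : R⟦X⟧) ^ r} →+* Trunc R j r).comp (Ideal.Quotient.mk _)

variable {R j}

theorem truncToSeries_rho (r : ℕ) (x : R⟦X⟧) :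
    truncToSeries R j r (rho R j r x) = Ideal.Quotient.mk _ x :=
  (RingEquiv.ofBijective _ (truncToSeries_bijective R j r)).apply_symm_apply _

theorem rho_eq_zero_iff {r : ℕ} {x : R⟦X⟧} : rho R j r x = 0 ↔ (ER R j : R⟦X⟧) ^ r ∣ x := by
  rw [← (truncToSeries_bijective R j r).1.eq_iff, truncToSeries_rho, map_zero,
    Ideal.Quotient.eq_zero_iff_mem, Ideal.mem_span_singleton]

theorem rho_eq_iff {r : ℕ} {x y : R⟦X⟧} :
    rho R j r x = rho R j r y ↔ (ER R j : R⟦X⟧) ^ r ∣ x - y := by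
  rw [← rho_eq_zero_iff, map_sub, sub_eq_zero]

theorem rho_coe (r : ℕ) (q : R[X]) : rho R j r q = Trunc.mk R j r q :=
  (truncToSeries_bijective R j r).1 (truncToSeries_rho r _)

theorem exists_rho_eq (r : ℕ) (x : R⟦X⟧) :
    ∃ q : R[X], (ER R j : R⟦X⟧) ^ r ∣ x - q ∧ rho R j r x = Trunc.mk R j r q := by
  obtain ⟨q, hq⟩ := (nilDist_ER R j).exists_polynomial r x
  exact ⟨q, hq, by rw [← rho_coe, rho_eq_iff]; exact hq⟩

theorem truncStep_rho (r : ℕ) (x : R⟦X⟧) : truncStep R j r (rho R j (r + 1) x) = rho R j r x := by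
  obtain ⟨q, hq, hx⟩ := exists_rho_eq (j := j) (r + 1) x
  rw [hx, rho_eq_iff.2 ((pow_dvd_pow _ r.le_succ).trans hq), rho_coe]
  rfl

theorem truncBase_rho {R' : NilpAlg D} (h : R →ₐ[D.Lam] R') (r : ℕ) (x : R⟦X⟧) :
    truncBase j h r (rho R j r x) = rho R' j r (PowerSeries.map (h : R →+* R') x) := by
  obtain ⟨q, hq, hx⟩ := exists_rho_eq (j := j) r x
  rw [hx, truncBase_mk, ← rho_coe, eq_comm, rho_eq_iff, ← ER_map j h, Polynomial.polynomial_map_coe,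
    Polynomial.polynomial_map_coe, ← map_pow, ← map_sub]
  exact map_dvd _ hq

theorem truncToV_rho (r : ℕ) (x : R⟦X⟧) : truncToV R j r (rho R j r x) =
    Ideal.Quotient.mk (Ideal.span {PR R j ^ r}) (PowerSeries.expand D.d D.d_pos.ne' x) := by
  obtain ⟨q, hq, hx⟩ := exists_rho_eq (j := j) r x
  rw [hx]
  change Ideal.Quotient.mk _ (uToV R q) = _
  rw [uToV_eq, eq_comm, Ideal.Quotient.eq, Ideal.mem_span_singleton, PR_pow_eq, ← map_sub]
  exact map_dvd _ hq

theorem PR_pow_dvd_iff {r : ℕ} {e : ℕ} (he : e < D.d) {x : R⟦X⟧} :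
    PR R j ^ r ∣ PowerSeries.X ^ e * PowerSeries.expand D.d D.d_pos.ne' x ↔
      (ER R j : R⟦X⟧) ^ r ∣ x := by
  rw [PR_pow_eq]
  constructor
  · intro h
    have := (expand_dvd_iff _ _ _).1 h e he
    rwa [wt_X_pow_mul_expand _ he he, if_pos rfl] at this
  · exact fun h => (map_dvd _ h).mul_left _

theorem eq_zero_of_PR_pow_dvd {x : R⟦X⟧} (h : ∀ r, PR R j ^ r ∣ x) : x = 0 := by
  refine wt_ext D.d_pos.ne' fun e he => ?_
  have h₀ : wt D.d e (0 : R⟦X⟧) = 0 := by ext; simp [coeff_wt]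
  rw [h₀]
  refine (nilDist_ER R j).eq_zero fun r => ?_
  have := h r
  rw [PR_pow_eq] at this
  exact (expand_dvd_iff _ _ _).1 this e he

end Truncation

/-! ### The group L⁺𝒫_j in terms of transition matrices -/

section LoopConj

variable {R : NilpAlg D} {j : ZMod D.f}

/-- `B = D⁻¹ g(v^d) D` modulo all powers of `σ_j(P(v))`. -/
def LoopConj (j : ZMod D.f) (g : LoopP R j) (B : Matrix (Fin D.n) (Fin D.n) R⟦X⟧) : Prop :=
  ∀ r : ℕ, diagV D j (Ideal.Quotient.mk (Ideal.span {PR R j ^ r}) PowerSeries.X) *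
      B.map (Ideal.Quotient.mk (Ideal.span {PR R j ^ r})) =
    (g.1 r : Matrix (Fin D.n) (Fin D.n) (Trunc R j r)).map (truncToV R j r) *
      diagV D j (Ideal.Quotient.mk (Ideal.span {PR R j ^ r}) PowerSeries.X)

/-- Modulo σ_j(P)^r the element v is nilpotent and D cannot be cancelled. With the entries of g_r
lifted to power series, the relation becomes a divisibility in R[[v]], where cancellation is
possible. -/
theorem loopConj_iff {g : LoopP R j} {B : Matrix (Fin D.n) (Fin D.n) R⟦X⟧} :
    LoopConj j g B ↔ ∀ r m k, ∀ G : R⟦X⟧, rho R j r G = (g.1 r).1 m k →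
      PR R j ^ r ∣ PowerSeries.X ^ D.ex j m * B m k -
        PowerSeries.X ^ D.ex j k * PowerSeries.expand D.d D.d_pos.ne' G := by
  refine forall_congr' fun r => ?_
  have key : ∀ m k, ∀ G : R⟦X⟧, rho R j r G = (g.1 r).1 m k →
      ((diagV D j (Ideal.Quotient.mk (Ideal.span {PR R j ^ r}) PowerSeries.X) *
          B.map (Ideal.Quotient.mk (Ideal.span {PR R j ^ r}))) m k =
        ((g.1 r : Matrix (Fin D.n) (Fin D.n) (Trunc R j r)).map (truncToV R j r) *
          diagV D j (Ideal.Quotient.mk (Ideal.span {PR R j ^ r}) PowerSeries.X)) m k ↔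
      PR R j ^ r ∣ PowerSeries.X ^ D.ex j m * B m k -
        PowerSeries.X ^ D.ex j k * PowerSeries.expand D.d D.d_pos.ne' G) := fun m k G hG => by
    rw [diagV_mul_apply, mul_diagV_apply, Matrix.map_apply, Matrix.map_apply]
    change _ = truncToV R j r ((g.1 r).1 m k) * _ ↔ _
    rw [← hG, truncToV_rho, ← map_pow, ← map_pow, ← map_mul, ← map_mul, Ideal.Quotient.eq,
      Ideal.mem_span_singleton, mul_comm (PowerSeries.expand _ _ _)]
  constructor
  · exact fun h m k G hG => (key m k G hG).1 (congrFun (congrFun h m) k)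
  · intro h
    ext1 m k
    obtain ⟨q, hq⟩ := truncMk_surjective R j r ((g.1 r).1 m k)
    rw [← rho_coe] at hq
    exact (key m k _ hq).2 (h m k _ hq)

/-- D(B - B') is divisible by σ_j(P)^r for every r, hence zero; only then is the power of v
cancelled. -/
theorem LoopConj.unique_right {g : LoopP R j} {B B' : Matrix (Fin D.n) (Fin D.n) R⟦X⟧}
    (h : LoopConj j g B) (h' : LoopConj j g B') : B = B' := by
  ext1 m k
  refine X_pow_mul_cancel (a := D.ex j m) (sub_eq_zero.1 (eq_zero_of_PR_pow_dvd (j := j) fun r => ?_))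
  obtain ⟨q, hq⟩ := truncMk_surjective R j r ((g.1 r).1 m k)
  rw [← rho_coe] at hq
  have := dvd_sub (loopConj_iff.1 h r m k _ hq) (loopConj_iff.1 h' r m k _ hq)
  rwa [sub_sub_sub_cancel_right] at this

/-- Here each level r suffices: since a_k < d, the series v^{a_k} x(v^d) has the single weight a_k,
so it is divisible by σ_j(P)^r exactly when E_j^r divides x. -/
theorem LoopConj.unique_left {g g' : LoopP R j} {B : Matrix (Fin D.n) (Fin D.n) R⟦X⟧}
    (h : LoopConj j g B) (h' : LoopConj j g' B) : g = g' := by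
  refine Subtype.ext (funext fun r => Units.ext ?_)
  ext1 m k
  obtain ⟨q, hq⟩ := truncMk_surjective R j r ((g.1 r).1 m k)
  obtain ⟨q', hq'⟩ := truncMk_surjective R j r ((g'.1 r).1 m k)
  rw [← rho_coe] at hq hq'
  have := dvd_sub (loopConj_iff.1 h' r m k _ hq') (loopConj_iff.1 h r m k _ hq)
  rw [sub_sub_sub_cancel_left, ← mul_sub, ← map_sub, PR_pow_dvd_iff (D.ex_lt j k)] at this
  rw [← hq, ← hq', rho_eq_iff]
  exact this

theorem LoopConj.one : LoopConj j (1 : LoopP R j) 1 := fun r => by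
  have h₁ : (((1 : LoopP R j).1 r : GL (Fin D.n) (Trunc R j r)) :
      Matrix (Fin D.n) (Fin D.n) (Trunc R j r)) = 1 := rfl
  rw [h₁, Matrix.map_one _ (map_zero _) (map_one _), Matrix.map_one _ (map_zero _) (map_one _),
    one_mul, mul_one]

theorem LoopConj.mul {g g' : LoopP R j} {B B' : Matrix (Fin D.n) (Fin D.n) R⟦X⟧}
    (h : LoopConj j g B) (h' : LoopConj j g' B') : LoopConj j (g * g') (B * B') := fun r => by
  have h₁ : (((g * g').1 r : GL (Fin D.n) (Trunc R j r)) :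
      Matrix (Fin D.n) (Fin D.n) (Trunc R j r)) = (g.1 r).1 * (g'.1 r).1 := rfl
  rw [h₁, Matrix.map_mul, Matrix.map_mul, ← mul_assoc, h r, mul_assoc, h' r, mul_assoc]

theorem LoopConj.map {R' : NilpAlg D} (h : R →ₐ[D.Lam] R') {g : LoopP R j}
    {B : Matrix (Fin D.n) (Fin D.n) R⟦X⟧} (hg : LoopConj j g B) :
    LoopConj j (loopPMap j h g) (B.map (PowerSeries.map (h : R →+* R'))) := by
  rw [loopConj_iff]
  intro r m k G hG
  obtain ⟨q, hq⟩ := truncMk_surjective R j r ((g.1 r).1 m k)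
  rw [← rho_coe] at hq
  have h₁ := map_dvd (PowerSeries.map (h : R →+* R')) (loopConj_iff.1 hg r m k _ hq)
  rw [map_pow, map_PR, map_sub, map_mul, map_mul, map_pow, map_pow, PowerSeries.map_X,
    PowerSeries.map_expand] at h₁
  have h₂ : rho R' j r G = rho R' j r (PowerSeries.map (h : R →+* R') q) := by
    rw [hG, ← truncBase_rho, hq]
    rfl
  rw [rho_eq_iff, ← PR_pow_dvd_iff (D.ex_lt j k), map_sub, mul_sub] at h₂
  have h₃ := dvd_sub h₁ h₂
  rwa [sub_sub, add_sub_cancel] at h₃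

theorem exists_limit_matrix (g : LoopP R j) : ∃ G : Matrix (Fin D.n) (Fin D.n) R⟦X⟧,
    ∀ r m k, rho R j r (G m k) = (g.1 r).1 m k := by
  choose q hq using fun r m k => truncMk_surjective R j r ((g.1 r).1 m k)
  have h₁ : ∀ m k, ∃ y, ∀ r, (ER R j : R⟦X⟧) ^ r ∣ y - (q r m k : R⟦X⟧) := fun m k => by
    refine (nilDist_ER R j).exists_limit _ fun r => ?_
    rw [← rho_eq_iff, ← truncStep_rho, rho_coe, rho_coe, hq, hq, ← g.2.1 r]
    rfl
  choose G hG using h₁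
  refine ⟨Matrix.of G, fun r m k => ?_⟩
  rw [← hq, ← rho_coe, rho_eq_iff]
  exact hG m k r

theorem mem_span_X_iff {r : ℕ} {x : R⟦X⟧} (hr : (PowerSeries.X : R⟦X⟧) ∣ (ER R j : R⟦X⟧) ^ r) :
    rho R j r x ∈ Ideal.span {Trunc.mk R j r Polynomial.X} ↔ PowerSeries.X ∣ x := by
  rw [Ideal.mem_span_singleton, ← rho_coe, Polynomial.coe_X]
  constructor
  · rintro ⟨c, hc⟩
    obtain ⟨q, rfl⟩ := truncMk_surjective R j r c
    rw [← rho_coe, ← map_mul, rho_eq_iff] at hc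
    exact (dvd_sub_left (dvd_mul_right _ _)).1 (hr.trans hc)
  · exact fun h => map_dvd _ h

/-- By completeness g is the reduction of one matrix over R[[u]]. At a level r with u ∣ E_j^r,
reduction modulo u is visible in R[u]/E_j^r, and there the parabolic condition makes the entries
with a_m > a_k divisible by u. -/
theorem exists_lowerMat (g : LoopP R j) : ∃ H : Matrix (Fin D.n) (Fin D.n) R⟦X⟧,
    ∀ r m k, rho R j r (lowerMat j H m k) = (g.1 r).1 m k := by
  obtain ⟨G, hG⟩ := exists_limit_matrix g
  have h₁ : ∀ m k, PowerSeries.X ^ below D j m k ∣ G m k := fun m k => by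
    unfold below
    split_ifs with hmk
    · rw [pow_zero]
      exact one_dvd _
    · rw [pow_one]
      obtain ⟨r, hr⟩ := (nilDist_ER R j).exists_X_pow_dvd' 1
      have hr' := hr r le_rfl
      rw [pow_one] at hr'
      rw [← mem_span_X_iff hr', hG, ← Ideal.Quotient.eq_zero_iff_mem]
      exact (mem_parabolicAlg_iff_ex j _).1 (g.2.2 r).1 m k (not_le.1 hmk)
  choose H hH using h₁
  refine ⟨Matrix.of H, fun r m k => ?_⟩
  rw [← hG, hH m k]
  rfl

theorem loopConj_of_lowerMat {g : LoopP R j} {H : Matrix (Fin D.n) (Fin D.n) R⟦X⟧}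
    (hH : ∀ r m k, rho R j r (lowerMat j H m k) = (g.1 r).1 m k) :
    LoopConj j g (conjMat j H) := by
  rw [loopConj_iff]
  intro r m k G hG
  have h₁ := congrFun (congrFun (diagV_mul_conjMat j H) m) k
  rw [diagV_mul_apply, mul_diagV_apply, mul_comm (Matrix.map _ _ m k)] at h₁
  rw [h₁, Matrix.map_apply, ← mul_sub, ← map_sub, PR_pow_dvd_iff (D.ex_lt j k), ← rho_eq_iff, hG, hH]

/-- The inverse of the transition matrix is the one attached to g⁻¹: the product corresponds to 1,
as does the identity matrix, and the matrix attached to an element is unique. -/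
theorem exists_loopConj (g : LoopP R j) : ∃ H H' : Matrix (Fin D.n) (Fin D.n) R⟦X⟧,
    conjMat j H * conjMat j H' = 1 ∧ LoopConj j g (conjMat j H) := by
  obtain ⟨H, hH⟩ := exists_lowerMat g
  obtain ⟨H', hH'⟩ := exists_lowerMat g⁻¹
  have h₁ := loopConj_of_lowerMat hH
  refine ⟨H, H', ?_, h₁⟩
  have h₂ := h₁.mul (loopConj_of_lowerMat hH')
  rw [mul_inv_cancel] at h₂
  exact h₂.unique_right LoopConj.one

theorem lowerMat_mem_parabolicAlg {A : Type u} [CommRing A] (φ : R⟦X⟧ →+* A)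
    (hφ : φ PowerSeries.X = 0) (H : Matrix (Fin D.n) (Fin D.n) R⟦X⟧) :
    (lowerMat j H).map φ ∈ parabolicAlg j A := by
  rw [mem_parabolicAlg_iff_ex]
  intro m k hmk
  rw [Matrix.map_apply, lowerMat, Matrix.of_apply, below, if_neg (not_le.2 hmk), pow_one, map_mul,
    hφ, zero_mul]

theorem exists_loopP_of_conj {H H' : Matrix (Fin D.n) (Fin D.n) R⟦X⟧}
    (h : conjMat j H * conjMat j H' = 1) : ∃ g : LoopP R j, LoopConj j g (conjMat j H) := by
  have h₁ := (conjMat_mul_eq_one_iff j).1 h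
  let G : GL (Fin D.n) R⟦X⟧ := ⟨lowerMat j H, lowerMat j H', h₁, mul_eq_one_comm.1 h₁⟩
  let g : LoopP R j := ⟨fun r => Matrix.GeneralLinearGroup.map (rho R j r) G, fun r => by
      ext m k
      exact truncStep_rho r _, fun r => by
      have h₂ : ∀ K, ((lowerMat j K).map (rho R j r)).map
          (Ideal.Quotient.mk (Ideal.span {Trunc.mk R j r Polynomial.X})) ∈
            parabolicAlg j (TruncU R j r) := fun K => by
        refine lowerMat_mem_parabolicAlg ((Ideal.Quotient.mk _).comp (rho R j r)) ?_ K
        rw [RingHom.comp_apply, ← Polynomial.coe_X, rho_coe, Ideal.Quotient.eq_zero_iff_mem]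
        exact Ideal.subset_span rfl
      exact ⟨h₂ H, h₂ H'⟩⟩
  exact ⟨g, loopConj_of_lowerMat fun r m k => rfl⟩

end LoopConj

/-! ### The action of ∏_j L⁺𝒫_j on eigenbases -/

section LoopTorsor

variable {a b : ℤ} {R : NilpAlg D} {M : Y D a b R}

theorem IsEB.comp_ext {x : Fin D.n → M} (hx : IsEB M.toKisinDD x) {j : ZMod D.f}
    {B B' : Matrix (Fin D.n) (Fin D.n) R⟦X⟧}
    (h : ∀ k, ∑ m, incl R (B m k) • eps R j • x m = ∑ m, incl R (B' m k) • eps R j • x m) :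
    B = B' := by
  ext1 m k
  have h₁ : ∑ m, incl R (B m k - B' m k) • eps R j • x m = 0 := by
    simp_rw [map_sub, sub_smul, Finset.sum_sub_distrib]
    rw [h, sub_self]
  exact sub_eq_zero.1 (hx.eigenbasis.indep j (fun m => B m k - B' m k) h₁ m)

theorem Eigenbasis.exists_act (e : Eigenbasis M) (g : LoopGroup R) :
    ∃! e' : Eigenbasis M, e.Act g e' := by
  obtain ⟨x, hx, rfl⟩ := e.exists_eq
  choose H H' h₁ h₂ using fun j => exists_loopConj (g j)
  obtain ⟨y, hy, hxy⟩ := hx.exists_mul H _ h₁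
  refine ⟨hy.eigenbasis, fun j => ⟨_, hxy j, h₂ j⟩, fun e' he' => ?_⟩
  refine Eigenbasis.ext (funext fun j => funext fun k => ?_)
  obtain ⟨B, hB, hg⟩ := he' j
  obtain rfl := LoopConj.unique_right hg (h₂ j)
  exact (hB k).trans (hxy j k).symm

theorem sum_incl_one (v : Fin D.n → M) (k : Fin D.n) :
    v k = ∑ m, incl R ((1 : Matrix (Fin D.n) (Fin D.n) R⟦X⟧) m k) • v m := by
  simp [Matrix.one_apply, apply_ite (incl R), ite_smul]

theorem sum_incl_mul {Q : Type u} [AddCommGroup Q] [Module (SS R) Q]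
    (v : Fin D.n → Q) (B B' : Matrix (Fin D.n) (Fin D.n) R⟦X⟧) (k : Fin D.n) :
    ∑ l, incl R (B' l k) • ∑ m, incl R (B m l) • v m = ∑ m, incl R ((B * B') m k) • v m := by
  have := sum_smul_sum v (B.map (incl R)) (B'.map (incl R)) k
  rw [← Matrix.map_mul] at this
  exact this

theorem Eigenbasis.act_one (e : Eigenbasis M) : e.Act 1 e := fun j =>
  ⟨1, fun k => sum_incl_one (e.vec j) k, LoopConj.one⟩

theorem Eigenbasis.Act.mul {e e' e'' : Eigenbasis M} {g g' : LoopGroup R} (h : e.Act g e')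
    (h' : e'.Act g' e'') : e.Act (g * g') e'' := fun j => by
  obtain ⟨B, hB, hg⟩ := h j
  obtain ⟨B', hB', hg'⟩ := h' j
  refine ⟨B * B', fun k => ?_, LoopConj.mul hg hg'⟩
  rw [hB', ← sum_incl_mul]
  simp_rw [hB]

theorem Eigenbasis.Act.pull {R' : NilpAlg D} {h : R →ₐ[D.Lam] R'} {M' : Y D a b R'}
    {α : Arrow h M M'} {e₁ e₂ : Eigenbasis M} {g : LoopGroup R} {e₁' e₂' : Eigenbasis M'}
    (hg : e₁.Act g e₂) (h₁ : e₁.Pull α e₁') (h₂ : e₂.Pull α e₂') :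
    e₁'.Act (loopGroupMap h g) e₂' := fun j => by
  obtain ⟨B, hB, hgB⟩ := hg j
  refine ⟨B.map (PowerSeries.map (h : R →+* R')), fun k => ?_, LoopConj.map h hgB⟩
  rw [← h₂ j k, hB]
  change α.sl _ = _
  rw [map_sum]
  refine Finset.sum_congr rfl fun m _ => ?_
  rw [map_smulₛₗ, baseS_incl, Matrix.map_apply, ← h₁ j m]
  rfl

/-- Two exact eigenbases differ by matrices of the form D⁻¹ G(v^d) D with G invertible and parabolic
modulo u. Each comes from exactly one element of the loop group. -/
theorem Eigenbasis.simply_transitive (e e' : Eigenbasis M) : ∃! g : LoopGroup R, e.Act g e' := by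
  obtain ⟨x, hx, rfl⟩ := e.exists_eq
  obtain ⟨y, hy, rfl⟩ := e'.exists_eq
  obtain ⟨H, H', h₁, h₂⟩ := hx.exists_transition hy
  choose g hg using fun j => exists_loopP_of_conj (h₁ j)
  refine ⟨g, fun j => ⟨_, h₂ j, hg j⟩, fun g' hg' => funext fun j => ?_⟩
  obtain ⟨B, hB, hgB⟩ := hg' j
  obtain rfl : B = conjMat j (H j) := hx.comp_ext (j := j) fun k => (hB k).symm.trans (h₂ j k)
  exact LoopConj.unique_left hgB (hg j)

end LoopTorsor

end KisinDescent

namespace KisinDescent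

variable {p : ℕ} [Fact p.Prime] {D : Setup.{u} p}

/-! ### The order 𝔄_j and conjugation over Λ[v] -/

section Order

variable (j : ZMod D.f)

/-- `h ↦ (u^{ε_{mk}} h_{mk})`, with image the order `𝔄_j`. -/
def lowerPoly (h : Matrix (Fin D.n) (Fin D.n) D.Lam[X]) : Matrix (Fin D.n) (Fin D.n) D.Lam[X] :=
  Matrix.of fun m k => Polynomial.X ^ below D j m k * h m k

/-- `h ↦ (v^{e_{mk}} h_{mk}(v^d))`. -/
def conjPoly (h : Matrix (Fin D.n) (Fin D.n) D.Lam[X]) : Matrix (Fin D.n) (Fin D.n) D.Lam[X] :=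
  Matrix.of fun m k => Polynomial.X ^ shift D j m k * Polynomial.expand D.Lam D.d (h m k)

variable {j}

theorem isConj_lowerPoly (h : Matrix (Fin D.n) (Fin D.n) D.Lam[X]) :
    IsConj j (lowerPoly j h) (conjPoly j h) := by
  ext1 m k
  rw [diagV_mul_apply, mul_diagV_apply, Matrix.map_apply, conjPoly, lowerPoly, Matrix.of_apply,
    Matrix.of_apply, map_mul, map_pow, Polynomial.expand_X, ← mul_assoc, ← pow_add,
    ex_add_shift, ← pow_mul, pow_add]
  ring

theorem IsConj.unique {x y y' : Matrix (Fin D.n) (Fin D.n) D.Lam[X]} (h : IsConj j x y)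
    (h' : IsConj j x y') : y = y' := by
  ext1 m k
  have h₁ := congrFun (congrFun (h.trans h'.symm) m) k
  rw [diagV_mul_apply, diagV_mul_apply] at h₁
  exact (Polynomial.monic_X_pow _).isRegular.left h₁

theorem IsConj.mul {x x' y y' : Matrix (Fin D.n) (Fin D.n) D.Lam[X]} (h : IsConj j x y)
    (h' : IsConj j x' y') : IsConj j (x * x') (y * y') := by
  have h₁ : diagV D j Polynomial.X * y = _ := h
  have h₂ : diagV D j Polynomial.X * y' = _ := h'
  have h₃ : (x * x').map (Polynomial.expand D.Lam D.d) = _ :=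
    Matrix.map_mul (f := (Polynomial.expand D.Lam D.d).toRingHom)
  change diagV D j Polynomial.X * (y * y') = (x * x').map (Polynomial.expand D.Lam D.d) * _
  rw [← mul_assoc, h₁, mul_assoc, h₂, ← mul_assoc, h₃]
  rfl

theorem IsConj.add {x x' y y' : Matrix (Fin D.n) (Fin D.n) D.Lam[X]} (h : IsConj j x y)
    (h' : IsConj j x' y') : IsConj j (x + x') (y + y') := by
  have h₁ : diagV D j Polynomial.X * y = _ := h
  have h₂ : diagV D j Polynomial.X * y' = _ := h'
  change diagV D j Polynomial.X * (y + y') = (x + x').map (Polynomial.expand D.Lam D.d) * _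
  rw [mul_add, h₁, h₂, Matrix.map_add _ (map_add _), add_mul]

theorem isConj_algebraMap (q : D.Lam[X]) :
    IsConj j (algebraMap D.Lam[X] (Matrix (Fin D.n) (Fin D.n) D.Lam[X]) q)
      (algebraMap D.Lam[X] (Matrix (Fin D.n) (Fin D.n) D.Lam[X])
        (Polynomial.expand D.Lam D.d q)) := by
  change diagV D j Polynomial.X * _ = Matrix.map _ _ * _
  rw [Matrix.algebraMap_eq_diagonal, Matrix.algebraMap_eq_diagonal,
    Matrix.diagonal_map (map_zero _), diagV, Matrix.diagonal_mul_diagonal,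
    Matrix.diagonal_mul_diagonal]
  congr 1
  ext1 i
  exact mul_comm _ _

theorem lowerPoly_mem (h : Matrix (Fin D.n) (Fin D.n) D.Lam[X]) : lowerPoly j h ∈ order D j := by
  change (lowerPoly j h).map _ ∈ parabolicAlg j D.Lam
  rw [mem_parabolicAlg_iff_ex]
  intro m k hmk
  rw [Matrix.map_apply, lowerPoly, Matrix.of_apply, below, if_neg (not_le.2 hmk)]
  simp

/-- Preserving the filtration modulo u means divisibility by u of the entries with a_m > a_k. So 𝔄_j
is free over Λ[u] on the matrices u^{ε_mk} E_mk. -/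
theorem exists_eq_lowerPoly (x : order D j) : ∃ h, x.1 = lowerPoly j h := by
  have h₁ : ∀ m k, Polynomial.X ^ below D j m k ∣ x.1 m k := fun m k => by
    unfold below
    split_ifs with hmk
    · rw [pow_zero]
      exact one_dvd _
    · rw [pow_one, Polynomial.X_dvd_iff]
      exact (mem_parabolicAlg_iff_ex j _).1 x.2 m k (not_le.1 hmk)
  choose h hh using h₁
  exact ⟨Matrix.of h, by ext1 m k; exact hh m k⟩

theorem exists_isConj (x : order D j) : ∃ y, IsConj j x.1 y := by
  obtain ⟨h, hh⟩ := exists_eq_lowerPoly x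
  exact ⟨_, hh ▸ isConj_lowerPoly h⟩

end Order

/-! ### The homomorphism c ⊗ x ↦ c D⁻¹ x(v^d) D modulo σ_j(P)^N -/

section ConjHom

variable (R : NilpAlg D) (j : ZMod D.f) (N : ℕ)

theorem polyToV_expand (q : D.Lam[X]) : polyToV R j N (Polynomial.expand D.Lam D.d q) =
    truncToV R j N (algebraMap D.Lam[X] (Trunc R j N) q) := by
  change Ideal.Quotient.mk _ ((((Polynomial.expand D.Lam D.d q).map (algebraMap D.Lam R) : R[X]) :
    R⟦X⟧)) = Ideal.Quotient.mk _ (uToV R (q.map (algebraMap D.Lam R)))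
  congr 1
  rw [uToV, Polynomial.coe_eval₂RingHom, Polynomial.map_expand, Polynomial.expand_eq_sum,
    Polynomial.eval₂_eq_sum, Polynomial.sum, Polynomial.sum]
  rw [← Polynomial.coeToPowerSeries.ringHom_apply, map_sum]
  simp

theorem polyToV_X : polyToV R j N Polynomial.X = Ideal.Quotient.mk _ PowerSeries.X := by
  simp [polyToV]

variable {R N} in
-- The conjugate y of x is unique because v is regular in Λ[v], so x ↦ y respects sums and products.
-- It is linear along u ↦ v^d, which the condition on π makes the algebra structure of A.
theorem exists_orderHom {A : Type u} [CommRing A] [Algebra D.Lam[X] A] (π : D.Lam[X] →+* A)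
    (hπ : ∀ q, π (Polynomial.expand D.Lam D.d q) = algebraMap D.Lam[X] A q) :
    ∃ f : order D j →ₐ[D.Lam[X]] Matrix (Fin D.n) (Fin D.n) A,
      ∀ (x : order D j) y, IsConj j x.1 y → f x = y.map π := by
  choose y hy using exists_isConj (D := D) (j := j)
  have hmap : ∀ q, y (algebraMap D.Lam[X] (order D j) q) =
      algebraMap D.Lam[X] _ (Polynomial.expand D.Lam D.d q) := fun q =>
    (hy _).unique (isConj_algebraMap q)
  have hone : y 1 = 1 := by
    have := hmap 1
    rwa [map_one, map_one, map_one] at this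
  have hzero : y 0 = 0 := by
    have := hmap 0
    rwa [map_zero, map_zero, map_zero] at this
  exact ⟨{ toFun := fun x => (y x).map π
           map_one' := by rw [hone, Matrix.map_one _ (map_zero _) (map_one _)]
           map_mul' := fun x x' => by
             rw [(hy (x * x')).unique (IsConj.mul (hy x) (hy x')), Matrix.map_mul]
           map_zero' := by rw [hzero, Matrix.map_zero _ (map_zero _)]
           map_add' := fun x x' => by
             rw [(hy (x + x')).unique (IsConj.add (hy x) (hy x')), Matrix.map_add _ (map_add _)]
           commutes' := fun q => by
             rw [hmap, Matrix.algebraMap_eq_diagonal, Matrix.algebraMap_eq_diagonal,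
               Matrix.diagonal_map (map_zero _)]
             congr 1
             ext1 i
             exact hπ q }, fun x y' hy' => by rw [hy'.unique (hy x)]; rfl⟩

variable {R N} in
theorem exists_tensorHom {A C : Type u} [CommRing A] [Algebra D.Lam[X] A] [CommRing C]
    [Algebra D.Lam[X] C] (π : D.Lam[X] →+* A) (c : C →ₐ[D.Lam[X]] A)
    (hπ : ∀ q, π (Polynomial.expand D.Lam D.d q) = algebraMap D.Lam[X] A q) :
    ∃ ψ : (C ⊗[D.Lam[X]] order D j) →+* Matrix (Fin D.n) (Fin D.n) A,
      ∀ z (x : order D j) y, IsConj j x.1 y → ψ (z ⊗ₜ x) = c z • y.map π := by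
  obtain ⟨f, hf⟩ := exists_orderHom j π hπ
  refine ⟨(Algebra.TensorProduct.lift ((Algebra.ofId A _).restrictScalars D.Lam[X] |>.comp c) f
    fun z x => Algebra.commutes _ _).toRingHom, fun z x y hy => ?_⟩
  rw [← hf x y hy, Algebra.smul_def]
  exact Algebra.TensorProduct.lift_tmul _ _ _ _ _

theorem exists_conjHom :
    ∃ ψ : (Trunc R j N ⊗[D.Lam[X]] order D j) →+* Matrix (Fin D.n) (Fin D.n) (TruncV R j N),
      IsConjHom j N ψ :=
  exists_tensorHom j
    -- R[[v]]/σ_j(P)^N has to be a Λ[u]-algebra through u ↦ v^d.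
    (A := Along ((truncToV R j N).comp (algebraMap D.Lam[X] (Trunc R j N))))
    (polyToV R j N) { toRingHom := truncToV R j N, commutes' := fun _ => rfl }
    (polyToV_expand R j N)

variable {R}

/-- The element `∑ ρ(H_{mk}) ⊗ b_{mk}` of `R[u]/E_j^N ⊗ 𝔄_j`, with `(b_{mk})` the standard basis
of `𝔄_j`. -/
def orderTensor (H : Matrix (Fin D.n) (Fin D.n) R⟦X⟧) : Trunc R j N ⊗[D.Lam[X]] order D j :=
  ∑ m, ∑ k, rho R j N (H m k) ⊗ₜ
    (⟨lowerPoly j (Matrix.single m k 1), lowerPoly_mem _⟩ : order D j)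

variable {j N}

theorem order_eq_sum (x : order D j) (h : Matrix (Fin D.n) (Fin D.n) D.Lam[X])
    (hx : x.1 = lowerPoly j h) : x = ∑ m, ∑ k, h m k •
      (⟨lowerPoly j (Matrix.single m k 1), lowerPoly_mem _⟩ : order D j) := by
  refine Subtype.ext ?_
  rw [hx, AddSubmonoidClass.coe_finsetSum]
  simp_rw [AddSubmonoidClass.coe_finsetSum, Subalgebra.coe_smul]
  ext1 m k
  simp_rw [Matrix.sum_apply, Matrix.smul_apply, lowerPoly, Matrix.of_apply, smul_eq_mul]
  rw [Finset.sum_eq_single m, Finset.sum_eq_single k]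
  · simp [mul_comm]
  · intro k' _ hk
    simp [hk]
  · exact fun h => absurd (Finset.mem_univ _) h
  · intro m' _ hm
    exact Finset.sum_eq_zero fun k' _ => by simp [hm]
  · exact fun h => absurd (Finset.mem_univ _) h

theorem exists_eq_orderTensor (z : Trunc R j N ⊗[D.Lam[X]] order D j) :
    ∃ H : Matrix (Fin D.n) (Fin D.n) R⟦X⟧, z = orderTensor j N H := by
  induction z with
  | zero => exact ⟨0, by simp [orderTensor]⟩
  | tmul c x =>
    obtain ⟨h, hh⟩ := exists_eq_lowerPoly x
    obtain ⟨q, rfl⟩ := truncMk_surjective R j N c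
    refine ⟨Matrix.of fun m k => (((h m k).map (algebraMap D.Lam R) * q : R[X]) : R⟦X⟧), ?_⟩
    conv_lhs => rw [order_eq_sum x h hh]
    simp_rw [TensorProduct.tmul_sum, orderTensor]
    refine Finset.sum_congr rfl fun m _ => Finset.sum_congr rfl fun k _ => ?_
    rw [← TensorProduct.smul_tmul, Matrix.of_apply, rho_coe, map_mul, Algebra.smul_def]
    rfl
  | add z z' hz hz' =>
    obtain ⟨H, rfl⟩ := hz
    obtain ⟨H', rfl⟩ := hz'
    exact ⟨H + H', by simp [orderTensor, TensorProduct.add_tmul, Finset.sum_add_distrib]⟩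

theorem IsConjHom.apply_orderTensor
    {ψ : (Trunc R j N ⊗[D.Lam[X]] order D j) →+* Matrix (Fin D.n) (Fin D.n) (TruncV R j N)}
    (hψ : IsConjHom j N ψ) (H : Matrix (Fin D.n) (Fin D.n) R⟦X⟧) :
    ψ (orderTensor j N H) = (conjMat j H).map (Ideal.Quotient.mk (Ideal.span {PR R j ^ N})) := by
  rw [orderTensor, map_sum]
  simp_rw [map_sum, hψ _ ⟨lowerPoly j _, lowerPoly_mem _⟩ _ (isConj_lowerPoly _)]
  ext1 m k
  simp_rw [Matrix.sum_apply, Matrix.smul_apply, Matrix.map_apply, conjPoly, conjMat,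
    Matrix.of_apply, smul_eq_mul]
  rw [Finset.sum_eq_single m, Finset.sum_eq_single k]
  · rw [truncToV_rho, Matrix.single_apply, if_pos ⟨rfl, rfl⟩, map_one, mul_one, map_pow, polyToV_X,
      map_mul, map_pow, mul_comm]
  · intro k' _ hk
    simp [hk]
  · exact fun h => absurd (Finset.mem_univ _) h
  · intro m' _ hm
    exact Finset.sum_eq_zero fun k' _ => by simp [hm]
  · exact fun h => absurd (Finset.mem_univ _) h

/-- The entries are v^e H_mk(v^d) with e < d; such a series is divisible by σ_j(P)^N only if E_j^N
divides H_mk. Identities in R[u]/E_j^N ⊗ 𝔄_j can hence be checked on matrices over R[[v]]/σ_j(P)^N.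
-/
theorem IsConjHom.injective
    {ψ : (Trunc R j N ⊗[D.Lam[X]] order D j) →+* Matrix (Fin D.n) (Fin D.n) (TruncV R j N)}
    (hψ : IsConjHom j N ψ) : Function.Injective ψ := by
  rw [injective_iff_map_eq_zero]
  intro z hz
  obtain ⟨H, rfl⟩ := exists_eq_orderTensor z
  rw [hψ.apply_orderTensor] at hz
  have h₁ : ∀ m k, rho R j N (H m k) = 0 := fun m k => by
    have h₂ := congrFun (congrFun hz m) k
    rw [Matrix.map_apply, Matrix.zero_apply, Ideal.Quotient.eq_zero_iff_mem,
      Ideal.mem_span_singleton, conjMat, Matrix.of_apply, PR_pow_dvd_iff (shift_lt j m k)] at h₂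
    exact rho_eq_zero_iff.2 h₂
  rw [orderTensor]
  exact Finset.sum_eq_zero fun m _ => Finset.sum_eq_zero fun k _ => by
    rw [h₁, TensorProduct.zero_tmul]

theorem map_orderTensor {R' : NilpAlg D} (h : R →ₐ[D.Lam] R')
    (H : Matrix (Fin D.n) (Fin D.n) R⟦X⟧) :
    Algebra.TensorProduct.map (truncBaseAlg j h N) (AlgHom.id D.Lam[X] (order D j))
      (orderTensor j N H) = orderTensor j N (H.map (PowerSeries.map (h : R →+* R'))) := by
  simp_rw [orderTensor, map_sum, Algebra.TensorProduct.map_tmul]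
  refine Finset.sum_congr rfl fun m _ => Finset.sum_congr rfl fun k _ => ?_
  rw [Matrix.map_apply, ← truncBase_rho]
  rfl

end ConjHom

end KisinDescent

namespace KisinDescent

variable {p : ℕ} [Fact p.Prime] {D : Setup.{u} p}

/-! ### The action of ∏_j 𝒫_{j,N} on eigenbases modulo P^N -/

section ParahoricTorsor

variable {a b : ℤ} {R : NilpAlg D} {M : Y D a b R} {N : ℕ}

/-- The determinant of the product is 1 modulo an ideal in the Jacobson radical, hence a unit. -/
theorem isUnit_of_map_mul_eq_one {S : Type u} [CommRing S] {I : Ideal S}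
    (hI : I ≤ Ideal.jacobson ⊥) {ι : Type*} [Fintype ι] [DecidableEq ι] {B B' : Matrix ι ι S}
    (h : (B * B').map (Ideal.Quotient.mk I) = 1) : ∃ C : Matrix ι ι S, B * C = 1 := by
  have h₁ : Ideal.Quotient.mk I (B * B').det = 1 := by
    rw [RingHom.map_det, RingHom.mapMatrix_apply, h, Matrix.det_one]
  rw [← map_one (Ideal.Quotient.mk I), Ideal.Quotient.eq] at h₁
  have h₂ : IsUnit (B * B').det := by
    have := Ideal.mem_jacobson_bot.1 (hI h₁) 1
    rwa [mul_one, sub_add_cancel] at this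
  rw [Matrix.det_mul] at h₂
  exact ⟨B⁻¹, Matrix.mul_nonsing_inv _ (isUnit_of_mul_isUnit_left h₂)⟩

theorem span_PR_pow_le_jacobson (R : NilpAlg D) (j : ZMod D.f) (hN : N ≠ 0) :
    Ideal.span {PR R j ^ N} ≤ Ideal.jacobson (⊥ : Ideal R⟦X⟧) := by
  rw [Ideal.span_singleton_le_iff_mem]
  refine Ideal.pow_mem_of_mem _ ?_ N (Nat.pos_of_ne_zero hN)
  rw [Ideal.mem_jacobson_bot]
  intro y
  have h₁ := (Ideal.mem_jacobson_bot.1 (PS_mem_jacobson R) (incl R y)).map (pS R j)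
  rwa [map_add, map_mul, pS_PS, pS_incl, map_one] at h₁

theorem quo_smul_eq_zero {M : KisinDD D R} {t : SS R} {s : SS R} (h : t ∣ s) (v : M.Quo t) :
    s • v = 0 := by
  obtain ⟨m, rfl⟩ := quo_mk_surj v
  exact (Submodule.Quotient.mk_eq_zero _).2
    (Submodule.smul_mem_smul (Ideal.mem_span_singleton.2 h) trivial)

theorem incl_smul_eq_of_mod {j : ZMod D.f} {v : QuoN N M} (hv : InComp R j v) {c c' : R⟦X⟧}
    (h : Ideal.Quotient.mk (Ideal.span {PR R j ^ N}) c =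
      Ideal.Quotient.mk (Ideal.span {PR R j ^ N}) c') : incl R c • v = incl R c' • v := by
  rw [Ideal.Quotient.eq, Ideal.mem_span_singleton] at h
  obtain ⟨z, hz⟩ := h
  rw [← sub_eq_zero, ← sub_smul, ← map_sub, hz]
  have h₁ := hv.smul_eq (PS R ^ N * incl R z)
  rw [map_mul, map_pow, pS_PS, pS_incl, quo_smul_eq_zero (dvd_mul_right _ _)] at h₁
  exact h₁.symm

theorem EigenbasisMod.sum_congr_mod (e : EigenbasisMod N M) {j : ZMod D.f}
    {B B' : Matrix (Fin D.n) (Fin D.n) R⟦X⟧}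
    (h : B.map (Ideal.Quotient.mk (Ideal.span {PR R j ^ N})) =
      B'.map (Ideal.Quotient.mk (Ideal.span {PR R j ^ N}))) (k : Fin D.n) :
    ∑ m, incl R (B m k) • e.vec j m = ∑ m, incl R (B' m k) • e.vec j m :=
  Finset.sum_congr rfl fun m _ =>
    incl_smul_eq_of_mod (e.eigen j m).1 (congrFun (congrFun h m) k)

theorem EigenbasisMod.matrix_ext_mod (e : EigenbasisMod N M) {j : ZMod D.f}
    {B B' : Matrix (Fin D.n) (Fin D.n) R⟦X⟧}
    (h : ∀ k, ∑ m, incl R (B m k) • e.vec j m = ∑ m, incl R (B' m k) • e.vec j m) :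
    B.map (Ideal.Quotient.mk (Ideal.span {PR R j ^ N})) =
      B'.map (Ideal.Quotient.mk (Ideal.span {PR R j ^ N})) := by
  ext1 m k
  have h₁ : ∑ m, incl R (B m k - B' m k) • e.vec j m = 0 := by
    simp_rw [map_sub, sub_smul, Finset.sum_sub_distrib]
    rw [h, sub_self]
  exact Ideal.Quotient.eq.2 (e.indep j (fun m => B m k - B' m k) h₁ m)

/-- Every element of the tensor product is an `orderTensor`, on which ψ is determined. The action
thus becomes a formula in any power series representative H of g. -/
theorem EigenbasisMod.act_iff {e e' : EigenbasisMod N M} {g : ParahoricGroup N R} :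
    e.Act g e' ↔ ∀ j, ∀ H, (g j).1 = orderTensor j N H →
      ∀ k, e'.vec j k = ∑ m, incl R (conjMat j H m k) • e.vec j m := by
  refine forall_congr' fun j => ⟨?_, fun h => ?_⟩
  · rintro ⟨ψ, hψ, B, hB, hBψ⟩ H hH k
    rw [hB, e.sum_congr_mod]
    rw [hBψ, hH, hψ.apply_orderTensor]
  · obtain ⟨ψ, hψ⟩ := exists_conjHom R j N
    obtain ⟨H, hH⟩ := exists_eq_orderTensor (g j).1
    exact ⟨ψ, hψ, conjMat j H, h H hH, by rw [hH, hψ.apply_orderTensor]⟩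

theorem orderTensor_eq_iff {j : ZMod D.f} {H H' : Matrix (Fin D.n) (Fin D.n) R⟦X⟧} :
    orderTensor j N H = orderTensor j N H' ↔
      (conjMat j H).map (Ideal.Quotient.mk (Ideal.span {PR R j ^ N})) =
      (conjMat j H').map (Ideal.Quotient.mk (Ideal.span {PR R j ^ N})) := by
  obtain ⟨ψ, hψ⟩ := exists_conjHom R j N
  rw [← hψ.apply_orderTensor, ← hψ.apply_orderTensor, hψ.injective.eq_iff]

theorem conjMat_mul_of_orderTensor {j : ZMod D.f} {H H' H'' : Matrix (Fin D.n) (Fin D.n) R⟦X⟧}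
    (h : orderTensor j N H * orderTensor j N H' = orderTensor j N H'') :
    (conjMat j H * conjMat j H').map (Ideal.Quotient.mk (Ideal.span {PR R j ^ N})) =
      (conjMat j H'').map (Ideal.Quotient.mk (Ideal.span {PR R j ^ N})) := by
  obtain ⟨ψ, hψ⟩ := exists_conjHom R j N
  rw [← hψ.apply_orderTensor, ← h, map_mul, hψ.apply_orderTensor, hψ.apply_orderTensor,
    Matrix.map_mul]

theorem conjMat_one (j : ZMod D.f) : conjMat j (1 : Matrix (Fin D.n) (Fin D.n) R⟦X⟧) = 1 := by
  ext1 m k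
  rw [conjMat, Matrix.of_apply, Matrix.one_apply]
  split_ifs with h
  · subst h
    rw [shift_self, pow_zero, map_one, mul_one]
  · rw [map_zero, mul_zero]

theorem orderTensor_mul {j : ZMod D.f} {H H' : Matrix (Fin D.n) (Fin D.n) R⟦X⟧}
    (h : conjMat j H * conjMat j H' = 1) : orderTensor j N H * orderTensor j N H' = 1 := by
  obtain ⟨ψ, hψ⟩ := exists_conjHom R j N
  refine hψ.injective ?_
  rw [map_mul, map_one, hψ.apply_orderTensor, hψ.apply_orderTensor, ← Matrix.map_mul, h,
    Matrix.map_one _ (map_zero _) (map_one _)]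

theorem orderTensor_one (j : ZMod D.f) :
    orderTensor (R := R) j N 1 = 1 := by
  obtain ⟨ψ, hψ⟩ := exists_conjHom R j N
  refine hψ.injective ?_
  rw [map_one, hψ.apply_orderTensor, conjMat_one, Matrix.map_one _ (map_zero _) (map_one _)]

theorem IsEB.vec_eq_of_components {x y : Fin D.n → M} (hx : IsEB M.toKisinDD x)
    (hy : IsEB M.toKisinDD y) {j : ZMod D.f} {B : Matrix (Fin D.n) (Fin D.n) R⟦X⟧}
    (h : ∀ k, eps R j • y k = ∑ m, incl R (B m k) • eps R j • x m) (k : Fin D.n) :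
    (hy.eigenbasisMod N).vec j k = ∑ m, incl R (B m k) • (hx.eigenbasisMod N).vec j m :=
  (congrArg (QuoN.mk N) (h k)).trans (quo_mk_sum _ _ _)

theorem EigenbasisMod.exists_act (hN : N ≠ 0) (e : EigenbasisMod N M) (g : ParahoricGroup N R) :
    ∃! e' : EigenbasisMod N M, e.Act g e' := by
  obtain ⟨x, hx, rfl⟩ := e.exists_eq hN
  choose H hH using fun j => exists_eq_orderTensor (g j).1
  choose H' hH' using fun j => exists_eq_orderTensor (g j)⁻¹.1
  -- Representatives of g and g⁻¹ multiply to 1 only modulo σ_j(P)^N. This already makes the first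
  -- one invertible over R[[v]], so the action can be carried out on an exact eigenbasis.
  have h₁ : ∀ j, ∃ C, conjMat j (H j) * C = 1 := fun j => by
    refine isUnit_of_map_mul_eq_one (span_PR_pow_le_jacobson R j hN) (B' := conjMat j (H' j)) ?_
    rw [conjMat_mul_of_orderTensor (H'' := 1), conjMat_one,
      Matrix.map_one _ (map_zero _) (map_one _)]
    rw [← hH, ← hH', orderTensor_one, Units.mul_inv]
  choose C hC using h₁
  obtain ⟨y, hy, hxy⟩ := hx.exists_mul H C hC
  have h₂ := fun j => hx.vec_eq_of_components (N := N) hy (hxy j)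
  refine ⟨hy.eigenbasisMod N, EigenbasisMod.act_iff.2 fun j H' hH' k => ?_, fun e' he' => ?_⟩
  · refine (h₂ j k).trans (EigenbasisMod.sum_congr_mod _ (orderTensor_eq_iff.1 ?_) k)
    rw [← hH, ← hH']
  · refine EigenbasisMod.ext (funext fun j => funext fun k => ?_)
    exact (EigenbasisMod.act_iff.1 he' j _ (hH j) k).trans (h₂ j k).symm

theorem EigenbasisMod.act_one (e : EigenbasisMod N M) : e.Act 1 e := by
  refine EigenbasisMod.act_iff.2 fun j H hH k => ?_
  have h₁ : orderTensor j N H = orderTensor (R := R) j N 1 := by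
    rw [← hH, orderTensor_one]
    rfl
  rw [e.sum_congr_mod (orderTensor_eq_iff.1 h₁), conjMat_one]
  simp [Matrix.one_apply, apply_ite (incl R), ite_smul]

theorem EigenbasisMod.Act.mul {e e' e'' : EigenbasisMod N M} {g g' : ParahoricGroup N R}
    (h : e.Act g e') (h' : e'.Act g' e'') : e.Act (g * g') e'' := by
  refine EigenbasisMod.act_iff.2 fun j H'' hH'' k => ?_
  obtain ⟨H, hH⟩ := exists_eq_orderTensor (g j).1
  obtain ⟨H', hH'⟩ := exists_eq_orderTensor (g' j).1
  rw [EigenbasisMod.act_iff.1 h' j H' hH']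
  simp_rw [EigenbasisMod.act_iff.1 h j H hH]
  rw [sum_incl_mul]
  refine e.sum_congr_mod (conjMat_mul_of_orderTensor ?_) k
  rw [← hH, ← hH', ← hH'']
  rfl

theorem EigenbasisMod.Act.pull {R' : NilpAlg D} {h : R →ₐ[D.Lam] R'} {M' : Y D a b R'}
    {α : Arrow h M M'} {e₁ e₂ : EigenbasisMod N M} {g : ParahoricGroup N R}
    {e₁' e₂' : EigenbasisMod N M'} (hg : e₁.Act g e₂) (h₁ : e₁.Pull α e₁') (h₂ : e₂.Pull α e₂') :
    e₁'.Act (parahoricGroupMap N h g) e₂' := by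
  refine EigenbasisMod.act_iff.2 fun j H' hH' k => ?_
  obtain ⟨H, hH⟩ := exists_eq_orderTensor (g j).1
  choose x hx using fun m => quo_mk_surj (e₁.vec j m)
  have h₃ := h₂ j k (∑ m, incl R (conjMat j H m k) • x m) (by
    rw [EigenbasisMod.act_iff.1 hg j H hH k, QuoN.mk, quo_mk_sum]
    exact Finset.sum_congr rfl fun m _ => by rw [quo_mk_smul, hx])
  have h₄ : α.app (∑ m, incl R (conjMat j H m k) • x m) = ∑ m, incl R'
      (conjMat j (H.map (PowerSeries.map (h : R →+* R'))) m k) • α.app (x m) := by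
    rw [← map_conjMat]
    change α.sl _ = _
    rw [map_sum]
    refine Finset.sum_congr rfl fun m _ => ?_
    rw [map_smulₛₗ, baseS_incl]
    rfl
  rw [← h₃, h₄, QuoN.mk, quo_mk_sum]
  have h₅ : orderTensor j N H' = orderTensor j N (H.map (PowerSeries.map (h : R →+* R'))) := by
    rw [← map_orderTensor, ← hH, ← hH']
    rfl
  rw [e₁'.sum_congr_mod (orderTensor_eq_iff.1 h₅)]
  exact Finset.sum_congr rfl fun m _ => by rw [quo_mk_smul, ← h₁ j m _ (hx m)]; rfl

theorem EigenbasisMod.simply_transitive (hN : N ≠ 0) (e e' : EigenbasisMod N M) :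
    ∃! g : ParahoricGroup N R, e.Act g e' := by
  obtain ⟨x, hx, rfl⟩ := e.exists_eq hN
  obtain ⟨y, hy, rfl⟩ := e'.exists_eq hN
  obtain ⟨H, H', h₁, h₂⟩ := hx.exists_transition hy
  have h₃ := fun j => hx.vec_eq_of_components (N := N) hy (h₂ j)
  refine ⟨fun j => ⟨orderTensor j N (H j), orderTensor j N (H' j), orderTensor_mul (h₁ j),
    orderTensor_mul (mul_eq_one_comm.1 (h₁ j))⟩, EigenbasisMod.act_iff.2 fun j H₁ hH₁ k => ?_,
    fun g hg => funext fun j => Units.ext ?_⟩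
  · exact (h₃ j k).trans (EigenbasisMod.sum_congr_mod _ (orderTensor_eq_iff.1 hH₁) k)
  · obtain ⟨H₁, hH₁⟩ := exists_eq_orderTensor (g j).1
    refine hH₁.trans (orderTensor_eq_iff.2 ((hx.eigenbasisMod N).matrix_ext_mod fun k => ?_))
    exact (EigenbasisMod.act_iff.1 hg j _ hH₁ k).symm.trans (h₃ j k)

end ParahoricTorsor

end KisinDescent

namespace KisinDescent

variable {p : ℕ} [Fact p.Prime] {D : Setup.{u} p}

/-! ### Natural coordinates modulo 0 and modulo P^N -/

section Coordinates

/-- Natural coordinates on `(W ⊗ R)[[v]] / t_R`, where `t_R` is compatible with base change and with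
`Δ` and lies in the Jacobson radical. -/
structure IsCoord (t : ∀ R : NilpAlg D, SS R) {ι : Type} (κ : ∀ R : NilpAlg D, SS R → ι → R) :
    Prop where
  base : ∀ {R R' : NilpAlg D} (h : R →ₐ[D.Lam] R'), baseS h (t R) = t R'
  gal : ∀ (R : NilpAlg D) (g : D.Gal), t R ∣ galS R g (t R)
  jac : ∀ R : NilpAlg D, Ideal.span {t R} ≤ Ideal.jacobson ⊥
  nat : ∀ {R R' : NilpAlg D} (h : R →ₐ[D.Lam] R') (x : SS R) (i : ι),
    κ R' (baseS h x) i = h (κ R x i)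
  eq_iff : ∀ {R : NilpAlg D} {x y : SS R}, κ R x = κ R y ↔ t R ∣ x - y
  surj : ∀ R : NilpAlg D, Function.Surjective (κ R)

theorem isCoord_coeff : IsCoord (D := D) (ι := ZMod D.f × ℕ) (fun _ => 0)
    fun R x i => PowerSeries.coeff i.2 (pS R i.1 x) where
  base h := map_zero _
  gal R g := by rw [map_zero]
  jac R := by rw [Ideal.span_singleton_eq_bot.2 rfl]; exact bot_le
  nat h x i := by
    rw [pS_baseS, PowerSeries.coeff_map]
    rfl
  eq_iff {R x y} := by
    rw [zero_dvd_iff, sub_eq_zero]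
    exact ⟨fun h => pS_ext fun j => PowerSeries.ext fun k => congrFun h (j, k), fun h => by rw [h]⟩
  surj R c := by
    obtain ⟨x, hx⟩ := pS_surj (R := R) fun j => PowerSeries.mk fun k => c (j, k)
    refine ⟨x, funext fun i => ?_⟩
    change PowerSeries.coeff i.2 (pS R i.1 x) = c i
    rw [hx, PowerSeries.coeff_mk]

variable {R : NilpAlg D} {j : ZMod D.f}

/-- The remainder of a power series modulo `E_j^N`. -/
def remainder (j : ZMod D.f) (N : ℕ) (x : R⟦X⟧) : R[X] :=
  ((nilDist_ER R j).exists_polynomial N x).choose %ₘ (ER R j ^ N)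

theorem remainder_eq {N : ℕ} {x : R⟦X⟧} {q : R[X]} (h : (ER R j : R⟦X⟧) ^ N ∣ x - q) :
    remainder j N x = q %ₘ (ER R j ^ N) := by
  have h₁ := ((nilDist_ER R j).exists_polynomial N x).choose_spec
  have h₂ := dvd_sub h h₁
  rw [sub_sub_sub_cancel_left, ← Polynomial.coe_sub] at h₂
  have h₃ := (nilDist_ER R j).dvd_of_coe_dvd N h₂
  rw [remainder, ← sub_eq_zero, ← Polynomial.sub_modByMonic]
  exact (Polynomial.modByMonic_eq_zero_iff_dvd ((ER_monic R j).pow N)).2 h₃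

theorem dvd_sub_remainder (N : ℕ) (x : R⟦X⟧) :
    (ER R j : R⟦X⟧) ^ N ∣ x - (remainder j N x : R[X]) := by
  have h₁ := ((nilDist_ER R j).exists_polynomial N x).choose_spec
  set q := ((nilDist_ER R j).exists_polynomial N x).choose with hq
  have h₂ : ER R j ^ N ∣ q - q %ₘ (ER R j ^ N) := by
    rw [dvd_sub_comm]
    exact Polynomial.dvd_modByMonic_sub _ _
  have h₃ := coe_dvd_coe h₂
  rw [Polynomial.coe_pow, Polynomial.coe_sub] at h₃
  have := dvd_add h₁ h₃
  rwa [sub_add_sub_cancel] at this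

theorem remainder_eq_iff {N : ℕ} {x y : R⟦X⟧} :
    remainder j N x = remainder j N y ↔ (ER R j : R⟦X⟧) ^ N ∣ x - y := by
  constructor
  · intro h
    have := dvd_sub (dvd_sub_remainder (j := j) N x) (dvd_sub_remainder (j := j) N y)
    rwa [h, sub_sub_sub_cancel_right] at this
  · intro h
    obtain ⟨q, hq⟩ := (nilDist_ER R j).exists_polynomial N y
    rw [remainder_eq hq, remainder_eq (q := q)]
    have := dvd_add h hq
    rwa [sub_add_sub_cancel] at this

/-- Division by a monic polynomial commutes with base change, and the remainder does not depend on
the polynomial chosen to represent the series. -/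
theorem remainder_map {R' : NilpAlg D} (h : R →ₐ[D.Lam] R') (N : ℕ) (x : R⟦X⟧) :
    remainder j N (PowerSeries.map (h : R →+* R') x) = (remainder j N x).map (h : R →+* R') := by
  obtain ⟨q, hq⟩ := (nilDist_ER R j).exists_polynomial N x
  rw [remainder_eq hq, Polynomial.map_modByMonic _ ((ER_monic R j).pow N), Polynomial.map_pow,
    ER_map]
  refine remainder_eq ?_
  rw [← ER_map j h, Polynomial.polynomial_map_coe, Polynomial.polynomial_map_coe, ← map_pow,
    ← map_sub]
  exact map_dvd _ hq

theorem degree_ER_pow [Nontrivial R] (N : ℕ) :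
    (ER R j ^ N).degree = (N * D.EW.natDegree : ℕ) := by
  have : Nontrivial D.Lam := (algebraMap D.Lam R).domain_nontrivial
  have h : (ER R j).natDegree = D.EW.natDegree := by
    rw [ER, EL, (D.EW_spec.2.1.map _).natDegree_map, D.EW_spec.2.1.natDegree_map]
  rw [Polynomial.degree_eq_natDegree ((ER_monic R j).pow N).ne_zero, (ER_monic R j).natDegree_pow, h]

theorem coeff_remainder {N k : ℕ} (hk : N * D.EW.natDegree ≤ k) (x : R⟦X⟧) :
    (remainder j N x).coeff k = 0 := by
  cases subsingleton_or_nontrivial R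
  · exact Subsingleton.elim _ _
  · refine Polynomial.coeff_eq_zero_of_degree_lt ?_
    refine (Polynomial.degree_modByMonic_lt _ ((ER_monic R j).pow N)).trans_le ?_
    rw [degree_ER_pow]
    exact_mod_cast hk

theorem remainder_coe {N : ℕ} {q : R[X]} (hq : q.degree < (N * D.EW.natDegree : ℕ)) :
    remainder j N (q : R⟦X⟧) = q := by
  cases subsingleton_or_nontrivial R
  · exact Subsingleton.elim _ _
  · rw [remainder_eq (q := q) (by rw [sub_self]; exact dvd_zero _),
      Polynomial.modByMonic_eq_self_iff ((ER_monic R j).pow N), degree_ER_pow]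
    exact hq

theorem PS_pow_dvd_iff {N : ℕ} {x y : SS R} : PS R ^ N ∣ x - y ↔
    ∀ j, ∀ e < D.d, (ER R j : R⟦X⟧) ^ N ∣ wt D.d e (pS R j x) - wt D.d e (pS R j y) := by
  have h₁ : PS R ^ N ∣ x - y ↔ ∀ j, PR R j ^ N ∣ pS R j x - pS R j y :=
    ⟨fun h j => by
      rw [← pS_PS, ← map_pow, ← map_sub]
      exact map_dvd _ h, fun h => dvd_of_pS fun j => by
      rw [map_pow, pS_PS, map_sub]
      exact h j⟩
  rw [h₁]
  refine forall_congr' fun j => ?_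
  rw [PR_pow_eq, expand_dvd_iff]
  simp_rw [wt_sub]

/-- The coordinates modulo `P(v)^N`. -/
def coordN (N : ℕ) (R : NilpAlg D) (x : SS R)
    (i : ZMod D.f × Fin D.d × Fin (N * D.EW.natDegree)) : R :=
  (remainder i.1 N (wt D.d i.2.1 (pS R i.1 x))).coeff i.2.2

/-- Modulo P^N the ring (W ⊗ R)[[v]] is free of finite rank over R: take the component j, the weight
e < d, and the coefficients of the remainder modulo E_j^N, a monic polynomial of degree N deg E.
Finiteness of this index set is what gives representability. -/
theorem isCoord_coordN {N : ℕ} (hN : N ≠ 0) :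
    IsCoord (D := D) (fun R => PS R ^ N) (coordN N) where
  base h := by rw [map_pow, baseS_PS]
  gal R g := PS_pow_dvd_galS g N
  jac R := span_PS_pow_le_jacobson R hN
  nat h x i := by
    rw [coordN, pS_baseS, ← map_wt, remainder_map, Polynomial.coeff_map]
    rfl
  eq_iff {R x y} := by
    rw [PS_pow_dvd_iff]
    constructor
    · intro h j e he
      rw [← remainder_eq_iff]
      refine Polynomial.ext fun k => ?_
      rcases lt_or_ge k (N * D.EW.natDegree) with hk | hk
      · exact congrFun h (j, ⟨e, he⟩, ⟨k, hk⟩)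
      · rw [coeff_remainder hk, coeff_remainder hk]
    · intro h
      refine funext fun i => ?_
      rw [coordN, coordN, remainder_eq_iff.2 (h i.1 i.2.1 i.2.1.2)]
  surj R c := by
    let q : ZMod D.f → ℕ → R[X] := fun j e => if he : e < D.d then
      ∑ k : Fin (N * D.EW.natDegree), Polynomial.monomial k (c (j, ⟨e, he⟩, k)) else 0
    obtain ⟨x, hx⟩ := pS_surj (R := R) fun j => ∑ e ∈ Finset.range D.d, PowerSeries.X ^ e *
      PowerSeries.expand D.d D.d_pos.ne' (q j e : R⟦X⟧)
    have hw : ∀ j, ∀ e < D.d, wt D.d e (pS R j x) = q j e := fun j e he => by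
      have hsum : ∀ (s : Finset ℕ) (F : ℕ → R⟦X⟧),
          wt D.d e (∑ i ∈ s, F i) = ∑ i ∈ s, wt D.d e (F i) := fun s F => by
        refine PowerSeries.ext fun k => ?_
        simp [coeff_wt]
      rw [hx, hsum, Finset.sum_eq_single_of_mem e (Finset.mem_range.2 he),
        wt_X_pow_mul_expand _ he he, if_pos rfl]
      intro e' he' hne
      rw [wt_X_pow_mul_expand _ he (Finset.mem_range.1 he'), if_neg hne.symm]
    refine ⟨x, funext fun i => ?_⟩
    obtain ⟨j, e, k⟩ := i
    have hq : q j e = ∑ k : Fin (N * D.EW.natDegree), Polynomial.monomial k (c (j, e, k)) :=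
      dif_pos e.2
    rw [coordN, hw j e e.2, remainder_coe, hq, Polynomial.finsetSum_coeff]
    · simp_rw [Polynomial.coeff_monomial, Fin.val_inj]
      simp
    · rw [hq]
      refine (Polynomial.degree_sum_le _ _).trans_lt ((Finset.sup_lt_iff ?_).2 fun k _ => ?_)
      · exact WithBot.bot_lt_coe _
      · exact (Polynomial.degree_monomial_le _ _).trans_lt (by exact_mod_cast k.2)

end Coordinates

/-! ### Gluing power series modulo t over a Zariski covering -/

section Sheaf

variable {R : NilpAlg D}

/-- `R[1/g] → R[1/gg']`. -/
def awayLeft (g g' : R) : R.away g →ₐ[D.Lam] R.away (g * g') :=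
  awayLift (R.toAway (g * g')) g
    (isUnit_of_mul_isUnit_left (y := R.toAway (g * g') g') (by
      rw [← map_mul]
      exact isUnit_toAway _))

/-- `R[1/g'] → R[1/gg']`. -/
def awayRight (g g' : R) : R.away g' →ₐ[D.Lam] R.away (g * g') :=
  awayLift (R.toAway (g * g')) g'
    (isUnit_of_mul_isUnit_right (x := R.toAway (g * g') g) (by
      rw [← map_mul]
      exact isUnit_toAway _))

theorem awayLeft_comp (g g' : R) : (awayLeft g g').comp (R.toAway g) = R.toAway (g * g') :=
  awayLift_comp _ _ _

theorem awayRight_comp (g g' : R) : (awayRight g g').comp (R.toAway g') = R.toAway (g * g') :=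
  awayLift_comp _ _ _

theorem eq_of_toAway {t : Finset R} (ht : Ideal.span (t : Set R) = ⊤) {r s : R}
    (h : ∀ g : t, R.toAway g.1 r = R.toAway g.1 s) : r = s :=
  Localization.algebraMap_injective_of_span_eq_top (t : Set R) ht (funext fun g => h g)

theorem exists_glue_toAway {t : Finset R} (ht : Ideal.span (t : Set R) = ⊤)
    (z : ∀ g : t, R.away g.1) (hz : ∀ g g' : t, awayLeft g.1 g'.1 (z g) = awayRight g.1 g'.1 (z g')) :
    ∃ r : R, ∀ g : t, R.toAway g.1 r = z g :=
  (Localization.existsUnique_algebraMap_eq_of_span_eq_top (t : Set R) ht z fun g g' => hz g g').exists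

variable {t₀ : ∀ R : NilpAlg D, SS R} {ι : Type} {κ : ∀ R : NilpAlg D, SS R → ι → R}

theorem IsCoord.dvd_of_toAway (hκ : IsCoord t₀ κ) {t : Finset R}
    (ht : Ideal.span (t : Set R) = ⊤) {x : SS R}
    (h : ∀ g : t, t₀ (R.away g.1) ∣ baseS (R.toAway g.1) x) : t₀ R ∣ x := by
  rw [← sub_zero x, ← hκ.eq_iff]
  refine funext fun i => eq_of_toAway ht fun g => ?_
  rw [← hκ.nat, ← hκ.nat]
  refine congrFun (hκ.eq_iff.2 ?_) i
  rw [map_zero, sub_zero]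
  exact h g

/-- The coordinates are natural, so each of them is glued separately as an element of R. No
finiteness is needed, which allows t = 0. -/
theorem IsCoord.exists_glue (hκ : IsCoord t₀ κ) {t : Finset R}
    (ht : Ideal.span (t : Set R) = ⊤) (z : ∀ g : t, SS (R.away g.1))
    (hz : ∀ g g' : t, t₀ (R.away (g.1 * g'.1)) ∣
      baseS (awayLeft g.1 g'.1) (z g) - baseS (awayRight g.1 g'.1) (z g')) :
    ∃ x : SS R, ∀ g : t, t₀ (R.away g.1) ∣ baseS (R.toAway g.1) x - z g := by
  have h₁ : ∀ i, ∃ r : R, ∀ g : t, R.toAway g.1 r = κ _ (z g) i := fun i =>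
    exists_glue_toAway ht _ fun g g' => by
      rw [← hκ.nat, ← hκ.nat]
      exact congrFun (hκ.eq_iff.2 (hz g g')) i
  choose r hr using h₁
  obtain ⟨x, hx⟩ := hκ.surj R r
  refine ⟨x, fun g => hκ.eq_iff.1 (funext fun i => ?_)⟩
  rw [hκ.nat, hx, hr]

end Sheaf

end KisinDescent

namespace KisinDescent

variable {p : ℕ} [Fact p.Prime] {D : Setup.{u} p}

section Functionals

variable {a b : ℤ} {R R' R'' : NilpAlg D} {h : R →ₐ[D.Lam] R'} {h' : R' →ₐ[D.Lam] R''}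
  {h'' : R →ₐ[D.Lam] R''} {M : Y D a b R} {M' : Y D a b R'} {M'' : Y D a b R''}

theorem Arrow.functional_comp (hh : h'.comp h = h'') {α : Arrow h M M'} {δ : Arrow h'' M M''}
    {β : Arrow h' M' M''} (hβ : ∀ m, β.app (α.app m) = δ.app m) {s : M →ₗ[SS R] SS R}
    {s' : M' →ₗ[SS R'] SS R'} {s'' : M'' →ₗ[SS R''] SS R''}
    (hs' : ∀ m, s' (α.app m) = baseS h (s m)) (hs'' : ∀ m, s'' (δ.app m) = baseS h'' (s m))
    (v : M') : s'' (β.app v) = baseS h' (s' v) := by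
  have key : s''.comp β.sl = ((baseS h').toSemilinearMap.comp s' : M' →ₛₗ[baseS h'] SS R'') := by
    refine α.isBC.ext fun m => ?_
    change s'' (β.app (α.app m)) = baseS h' (s' (α.app m))
    rw [hβ, hs'', hs', baseS_comp, hh]
  exact LinearMap.congr_fun key v

theorem dvd_of_mem_smul {S : Type u} [CommRing S] {M : Type u} [AddCommGroup M] [Module S M]
    {t : S} {y : M} (hy : y ∈ (Ideal.span {t} • ⊤ : Submodule S M)) (s : M →ₗ[S] S) :
    t ∣ s y := by
  rw [Submodule.ideal_span_singleton_smul, Submodule.mem_smul_pointwise_iff_exists] at hy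
  obtain ⟨z, -, rfl⟩ := hy
  rw [map_smul]
  exact dvd_mul_right _ _

theorem sum_smul_mem {S : Type u} [CommRing S] {M : Type u} [AddCommGroup M] [Module S M]
    {t : S} {ι : Type*} [Fintype ι] {c : ι → S} (hc : ∀ i, t ∣ c i) (x : ι → M) :
    ∑ i, c i • x i ∈ (Ideal.span {t} • ⊤ : Submodule S M) :=
  Submodule.sum_mem _ fun i _ =>
    Submodule.smul_mem_smul (Ideal.mem_span_singleton.2 (hc i)) trivial

end Functionals

/-! ### Gluing eigenbases -/

section Glue

variable {a b : ℤ} {R : NilpAlg D} {M : Y D a b R} {t : Finset R}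
  {t₀ : ∀ R : NilpAlg D, SS R} {ι : Type} {κ : ∀ R : NilpAlg D, SS R → ι → R}
  {M' : ∀ g : t, Y D a b (R.away g.1)}

/-- Membership in tM is divisibility by t of the coefficients in a dual basis, and this is local on
Spec R. -/
theorem IsCoord.mem_of_app (hκ : IsCoord t₀ κ) (ht : Ideal.span (t : Set R) = ⊤)
    (α : ∀ g : t, Arrow (R.toAway g.1) M (M' g)) {y : M}
    (hy : ∀ g, (α g).app y ∈ (Ideal.span {t₀ (R.away g.1)} • ⊤ : Submodule (SS (R.away g.1)) (M' g))) :
    y ∈ (Ideal.span {t₀ R} • ⊤ : Submodule (SS R) M) := by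
  have := M.finite
  have := M.projective
  obtain ⟨m, q, s, hq⟩ := exists_dualBasis (SS R) M
  rw [hq y]
  refine sum_smul_mem (fun l => hκ.dvd_of_toAway ht fun g => ?_) q
  obtain ⟨s', hs'⟩ := (α g).isBC.exists_functional (s l)
  rw [← hs']
  exact dvd_of_mem_smul (hy g) s'

/-- Sections of `M / t` glue. -/
theorem IsCoord.exists_glue_module (hκ : IsCoord t₀ κ) (ht : Ideal.span (t : Set R) = ⊤)
    (α : ∀ g : t, Arrow (R.toAway g.1) M (M' g)) (v : ∀ g, M' g)
    {M'' : ∀ g g' : t, Y D a b (R.away (g.1 * g'.1))}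
    {δ : ∀ g g' : t, Arrow (R.toAway (g.1 * g'.1)) M (M'' g g')}
    {β₁ : ∀ g g' : t, Arrow (awayLeft g.1 g'.1) (M' g) (M'' g g')}
    {β₂ : ∀ g g' : t, Arrow (awayRight g.1 g'.1) (M' g') (M'' g g')}
    (hβ₁ : ∀ (g g' : t) m, (β₁ g g').app ((α g).app m) = (δ g g').app m)
    (hβ₂ : ∀ (g g' : t) m, (β₂ g g').app ((α g').app m) = (δ g g').app m)
    (hv : ∀ g g' : t, (β₁ g g').app (v g) - (β₂ g g').app (v g') ∈
      (Ideal.span {t₀ (R.away (g.1 * g'.1))} • ⊤ : Submodule (SS (R.away (g.1 * g'.1))) (M'' g g'))) :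
    ∃ y : M, ∀ g, (α g).app y - v g ∈
      (Ideal.span {t₀ (R.away g.1)} • ⊤ : Submodule (SS (R.away g.1)) (M' g)) := by
  have := M.finite
  have := M.projective
  obtain ⟨m, q, s, hq⟩ := exists_dualBasis (SS R) M
  choose s' hs' using fun g l => (α g).isBC.exists_functional (s l)
  have h₁ : ∀ l, ∃ x : SS R, ∀ g, t₀ (R.away g.1) ∣ baseS (R.toAway g.1) x - s' g l (v g) :=
    fun l => hκ.exists_glue ht _ fun g g' => by
      obtain ⟨s'', hs''⟩ := (δ g g').isBC.exists_functional (s l)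
      have h₂ := dvd_of_mem_smul (hv g g') s''
      rwa [map_sub, Arrow.functional_comp (awayLeft_comp _ _) (hβ₁ g g') (hs' g l) hs'',
        Arrow.functional_comp (awayRight_comp _ _) (hβ₂ g g') (hs' g' l) hs''] at h₂
  choose x hx using h₁
  refine ⟨∑ l, x l • q l, fun g => ?_⟩
  have h₂ : v g = ∑ l, s' g l (v g) • (α g).app (q l) :=
    (α g).isBC.dualBasis hq (fun l y => hs' g l y) (v g)
  have h₃ : (α g).app (∑ l, x l • q l) = ∑ l, baseS (R.toAway g.1) (x l) • (α g).app (q l) := by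
    change (α g).sl _ = _
    rw [map_sum]
    exact Finset.sum_congr rfl fun l _ => map_smulₛₗ _ _ _
  have h₄ : (α g).app (∑ l, x l • q l) - v g =
      ∑ l, (baseS (R.toAway g.1) (x l) - s' g l (v g)) • (α g).app (q l) := by
    rw [h₃]
    refine (congrArg (_ - ·) h₂).trans ?_
    simp_rw [sub_smul, Finset.sum_sub_distrib]
  rw [h₄]
  exact sum_smul_mem (fun l => hx l g) _

theorem sub_sum_mem {S : Type u} [CommRing S] {M : Type u} [AddCommGroup M] [Module S M]
    {t : S} {ι : Type*} [Fintype ι] {x x' : ι → M}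
    (hx : ∀ i, x i - x' i ∈ (Ideal.span {t} • ⊤ : Submodule S M)) (c : ι → S) :
    ∑ i, c i • x i - ∑ i, c i • x' i ∈ (Ideal.span {t} • ⊤ : Submodule S M) := by
  rw [← Finset.sum_sub_distrib]
  refine Submodule.sum_mem _ fun i _ => ?_
  rw [← smul_sub]
  exact Submodule.smul_mem _ _ (hx i)

theorem dvd_sub_of_sum {S : Type u} [CommRing S] {M : Type u} [AddCommGroup M] [Module S M]
    {ι : Type*} [Fintype ι] {x : ι → M} (hx : IsBas S x) {t : S} {c c' : ι → S}
    (h : ∑ i, c i • x i - ∑ i, c' i • x i ∈ (Ideal.span {t} • ⊤ : Submodule S M)) (i : ι) :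
    t ∣ c i - c' i := by
  refine mem_span_smul_of_isBas hx (c := fun i => c i - c' i) ?_ i
  simp_rw [sub_smul, Finset.sum_sub_distrib]
  exact h

theorem Arrow.app_sum {R R' : NilpAlg D} {h : R →ₐ[D.Lam] R'} {M : Y D a b R} {M' : Y D a b R'}
    (α : Arrow h M M') {ι : Type*} [Fintype ι] (c : ι → SS R) (x : ι → M) :
    α.app (∑ i, c i • x i) = ∑ i, baseS h (c i) • α.app (x i) := by
  change α.sl _ = _
  rw [map_sum]
  exact Finset.sum_congr rfl fun l _ => map_smulₛₗ _ _ _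

theorem Arrow.app_mem {R R' : NilpAlg D} {h : R →ₐ[D.Lam] R'} {M : Y D a b R} {M' : Y D a b R'}
    (α : Arrow h M M') (hκ : IsCoord t₀ κ) {y : M}
    (hy : y ∈ (Ideal.span {t₀ R} • ⊤ : Submodule (SS R) M)) :
    α.app y ∈ (Ideal.span {t₀ R'} • ⊤ : Submodule (SS R') M') :=
  map_mem_span_smul α.sl (hκ.base h) hy

theorem Arrow.app_sub {R R' : NilpAlg D} {h : R →ₐ[D.Lam] R'} {M : Y D a b R} {M' : Y D a b R'}
    (α : Arrow h M M') (x y : M) : α.app (x - y) = α.app x - α.app y := map_sub α.sl x y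

/-- Exact eigenbases that agree modulo `t` on overlaps glue modulo `t`. -/
theorem IsCoord.exists_glue_isEB (hκ : IsCoord t₀ κ) (ht : Ideal.span (t : Set R) = ⊤)
    (α : ∀ g : t, Arrow (R.toAway g.1) M (M' g)) {x' : ∀ g, Fin D.n → M' g}
    (hx' : ∀ g, IsEB (M' g).toKisinDD (x' g))
    {M'' : ∀ g g' : t, Y D a b (R.away (g.1 * g'.1))}
    {δ : ∀ g g' : t, Arrow (R.toAway (g.1 * g'.1)) M (M'' g g')}
    {β₁ : ∀ g g' : t, Arrow (awayLeft g.1 g'.1) (M' g) (M'' g g')}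
    {β₂ : ∀ g g' : t, Arrow (awayRight g.1 g'.1) (M' g') (M'' g g')}
    (hβ₁ : ∀ (g g' : t) m, (β₁ g g').app ((α g).app m) = (δ g g').app m)
    (hβ₂ : ∀ (g g' : t) m, (β₂ g g').app ((α g').app m) = (δ g g').app m)
    (hv : ∀ (g g' : t) i, (β₁ g g').app (x' g i) - (β₂ g g').app (x' g' i) ∈
      (Ideal.span {t₀ (R.away (g.1 * g'.1))} • ⊤ : Submodule (SS (R.away (g.1 * g'.1))) (M'' g g'))) :
    ∃ x : Fin D.n → M, IsEB M.toKisinDD x ∧ ∀ g i, (α g).app (x i) - x' g i ∈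
      (Ideal.span {t₀ (R.away g.1)} • ⊤ : Submodule (SS (R.away g.1)) (M' g)) := by
  choose x hx using fun i =>
    hκ.exists_glue_module ht α (fun g => x' g i) hβ₁ hβ₂ fun g g' => hv g g' i
  -- The glued vectors are known only modulo t. The eigenvector and basis properties modulo t are
  -- local, and averaging makes the family exact.
  obtain ⟨y, hy, hyx⟩ := exists_isEB_of_mod M.toKisinDD (hκ.jac R)
    (fun s hs => galS_mem_span (hκ.gal R D.gen) s hs) x
    (fun i => hκ.mem_of_app ht α fun g => by
      have h₁ := gal_mem_smul_top (γ := (M' g).gal) (hκ.gal _ D.gen) (hx i g)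
      have h₂ := Submodule.smul_mem _ (cL (R.away g.1) (D.chi i D.gen)) (hx i g)
      have h₃ := sub_mem h₁ h₂
      rw [map_sub, (hx' g).2, smul_sub, sub_sub_sub_cancel_right] at h₃
      have h₄ : (α g).app (M.gal D.gen (x i) - cL R (D.chi i D.gen) • x i) =
          (M' g).gal D.gen ((α g).app (x i)) - cL (R.away g.1) (D.chi i D.gen) • (α g).app (x i) := by
        rw [Arrow.app_sub, ← Arrow.sl_apply, (α g).sl_gal, ← Arrow.sl_apply (α g) (_ • _),
          map_smulₛₗ, baseS_cL]
        rfl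
      rw [h₄]
      exact h₃)
    (fun y => by
      -- The local coefficients of y agree modulo t on overlaps, because the two bases agree there
      -- modulo t and are independent; so the coefficients glue.
      choose c hc using fun g => (hx' g).1.exists_sum ((α g).app y)
      have h₁ : ∀ i, ∃ z : SS R, ∀ g, t₀ (R.away g.1) ∣ baseS (R.toAway g.1) z - c g i := fun i =>
        hκ.exists_glue ht _ fun g g' => by
          have h₂ : ∑ i, baseS (awayLeft g.1 g'.1) (c g i) • (β₁ g g').app (x' g i) =
              ∑ i, baseS (awayRight g.1 g'.1) (c g' i) • (β₂ g g').app (x' g' i) := by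
            rw [← Arrow.app_sum, ← Arrow.app_sum, ← hc, ← hc, hβ₁, hβ₂]
          refine dvd_sub_of_sum ((hx' g).map (β₁ g g')).1
            (c := fun i => baseS (awayLeft g.1 g'.1) (c g i))
            (c' := fun i => baseS (awayRight g.1 g'.1) (c g' i)) ?_ i
          rw [h₂, ← neg_sub]
          exact neg_mem (sub_sum_mem (fun i => hv g g' i) _)
      choose z hz using h₁
      refine ⟨z, hκ.mem_of_app ht α fun g => ?_⟩
      rw [Arrow.app_sub, hc, Arrow.app_sum, ← neg_sub]
      refine neg_mem ?_
      have h₃ := sub_sum_mem (fun i => hx i g) fun i => baseS (R.toAway g.1) (z i)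
      have h₄ := sum_smul_mem (fun i => hz i g) (x' g)
      simp_rw [sub_smul, Finset.sum_sub_distrib] at h₄
      have h₅ := add_mem h₃ h₄
      rwa [sub_add_sub_cancel] at h₅)
    (fun c hc i => Ideal.mem_span_singleton.2 (hκ.dvd_of_toAway ht fun g => by
      have h₁ := (α g).app_mem hκ hc
      rw [Arrow.app_sum] at h₁
      have h₂ := sub_sum_mem (fun i => hx i g) fun i => baseS (R.toAway g.1) (c i)
      have h₃ := sub_mem h₁ h₂
      rw [sub_sub_cancel] at h₃
      exact mem_span_smul_of_isBas (hx' g).1 h₃ i))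
  refine ⟨y, hy, fun g i => ?_⟩
  have h₁ := add_mem ((α g).app_mem hκ (hyx i)) (hx i g)
  rwa [Arrow.app_sub, sub_add_sub_cancel] at h₁

theorem exists_overlaps (α : ∀ g : t, Arrow (R.toAway g.1) M (M' g)) (g g' : t) :
    ∃ (M'' : Y D a b (R.away (g.1 * g'.1))) (δ : Arrow (R.toAway (g.1 * g'.1)) M M'')
      (β₁ : Arrow (awayLeft g.1 g'.1) (M' g) M'') (β₂ : Arrow (awayRight g.1 g'.1) (M' g') M''),
      (∀ m, β₁.app ((α g).app m) = δ.app m) ∧ ∀ m, β₂.app ((α g').app m) = δ.app m := by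
  obtain ⟨M'', ⟨δ⟩⟩ := M.exists_pullback (R.toAway (g.1 * g'.1))
  obtain ⟨β₁, h₁⟩ := (α g).exists_factor (awayLeft_comp g.1 g'.1) δ
  obtain ⟨β₂, h₂⟩ := (α g').exists_factor (awayRight_comp g.1 g'.1) δ
  exact ⟨M'', δ, β₁, β₂, h₁, h₂⟩

theorem mem_span_zero_smul {S : Type u} [CommRing S] {M : Type u} [AddCommGroup M] [Module S M]
    {y : M} : y ∈ (Ideal.span {(0 : S)} • ⊤ : Submodule S M) ↔ y = 0 := by
  rw [Ideal.span_singleton_eq_bot.2 rfl, Submodule.bot_smul, Submodule.mem_bot]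

theorem Eigenbasis.exists_glue (ht : Ideal.span (t : Set R) = ⊤)
    (α : ∀ g : t, Arrow (R.toAway g.1) M (M' g)) (e' : ∀ g : t, Eigenbasis (M' g))
    (he : ∀ (g₁ g₂ : t) (R'' : NilpAlg D) (h₁ : R.away g₁.1 →ₐ[D.Lam] R'')
      (h₂ : R.away g₂.1 →ₐ[D.Lam] R''), h₁.comp (R.toAway g₁.1) = h₂.comp (R.toAway g₂.1) →
      ∀ (M'' : Y D a b R'') (β₁ : Arrow h₁ (M' g₁) M'') (β₂ : Arrow h₂ (M' g₂) M''),
        (∀ m : M, β₁.app ((α g₁).app m) = β₂.app ((α g₂).app m)) →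
        ∀ e₁ e₂ : Eigenbasis M'', (e' g₁).Pull β₁ e₁ → (e' g₂).Pull β₂ e₂ → e₁ = e₂) :
    ∃! e : Eigenbasis M, ∀ g : t, e.Pull (α g) (e' g) := by
  choose x' hx' hex using fun g => (e' g).exists_eq
  choose M'' δ β₁ β₂ hβ₁ hβ₂ using exists_overlaps α
  obtain ⟨x, hx, hxx⟩ := isCoord_coeff.exists_glue_isEB ht α hx' hβ₁ hβ₂ fun g g' i => by
    have h₁ := he g g' _ _ _ ((awayLeft_comp _ _).trans (awayRight_comp _ _).symm) (M'' g g')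
      (β₁ g g') (β₂ g g') (fun m => (hβ₁ g g' m).trans (hβ₂ g g' m).symm) _ _
      (by rw [hex g]; exact (hx' g).pull _) (by rw [hex g']; exact (hx' g').pull _)
    have h₂ : ∀ j, eps _ j • (β₁ g g').app (x' g i) = eps _ j • (β₂ g g').app (x' g' i) :=
      fun j => congrFun (congrFun (congrArg Eigenbasis.vec h₁) j) i
    -- Agreement of all components ε_j on the overlap recovers agreement of the vectors, as the ε_j
    -- sum to 1.
    rw [mem_span_zero_smul, sub_eq_zero, ← sum_eps_smul (R := R.away (g.1 * g'.1))
      ((β₁ g g').app (x' g i)), Finset.sum_congr rfl fun j _ => h₂ j, sum_eps_smul]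
  have hα : ∀ g, (fun i => (α g).app (x i)) = x' g := fun g => funext fun i =>
    sub_eq_zero.1 (mem_span_zero_smul.1 (hxx g i))
  have hpull : ∀ g, hx.eigenbasis.Pull (α g) (e' g) := fun g => by
    have h₁ := hx.pull (α g)
    have h₂ : (hx.map (α g)).eigenbasis = e' g := by
      rw [hex g]
      exact Eigenbasis.ext (funext fun j => funext fun i =>
        congrArg (eps (R.away g.1) j • ·) (congrFun (hα g) i))
    rwa [h₂] at h₁
  refine ⟨hx.eigenbasis, hpull, fun e he => ?_⟩
  refine Eigenbasis.ext (funext fun j => funext fun i => ?_)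
  rw [← sub_eq_zero]
  refine mem_span_zero_smul.1 (isCoord_coeff.mem_of_app ht α fun g => mem_span_zero_smul.2 ?_)
  rw [Arrow.app_sub, he g, hpull g, sub_self]

theorem EigenbasisMod.exists_glue {N : ℕ} (hN : N ≠ 0) (ht : Ideal.span (t : Set R) = ⊤)
    (α : ∀ g : t, Arrow (R.toAway g.1) M (M' g)) (e' : ∀ g : t, EigenbasisMod N (M' g))
    (he : ∀ (g₁ g₂ : t) (R'' : NilpAlg D) (h₁ : R.away g₁.1 →ₐ[D.Lam] R'')
      (h₂ : R.away g₂.1 →ₐ[D.Lam] R''), h₁.comp (R.toAway g₁.1) = h₂.comp (R.toAway g₂.1) →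
      ∀ (M'' : Y D a b R'') (β₁ : Arrow h₁ (M' g₁) M'') (β₂ : Arrow h₂ (M' g₂) M''),
        (∀ m : M, β₁.app ((α g₁).app m) = β₂.app ((α g₂).app m)) →
        ∀ e₁ e₂ : EigenbasisMod N M'', (e' g₁).Pull β₁ e₁ → (e' g₂).Pull β₂ e₂ → e₁ = e₂) :
    ∃! e : EigenbasisMod N M, ∀ g : t, e.Pull (α g) (e' g) := by
  choose x' hx' hex using fun g => (e' g).exists_eq hN
  choose M'' δ β₁ β₂ hβ₁ hβ₂ using exists_overlaps α
  obtain ⟨x, hx, hxx⟩ := (isCoord_coordN hN).exists_glue_isEB ht α hx' hβ₁ hβ₂ fun g g' i => by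
    have h₁ := he g g' _ _ _ ((awayLeft_comp _ _).trans (awayRight_comp _ _).symm) (M'' g g')
      (β₁ g g') (β₂ g g') (fun m => (hβ₁ g g' m).trans (hβ₂ g g' m).symm) _ _
      (by rw [hex g]; exact (hx' g).pullMod _ N) (by rw [hex g']; exact (hx' g').pullMod _ N)
    have h₂ : ∀ j, eps (R.away (g.1 * g'.1)) j • QuoN.mk N ((β₁ g g').app (x' g i)) =
        eps (R.away (g.1 * g'.1)) j • QuoN.mk N ((β₂ g g').app (x' g' i)) :=
      fun j => congrFun (congrFun (congrArg EigenbasisMod.vec h₁) j) i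
    rw [← quo_mk_eq_iff]
    change QuoN.mk N _ = QuoN.mk N _
    rw [← sum_eps_smul (R := R.away (g.1 * g'.1)) (QuoN.mk N ((β₁ g g').app (x' g i))),
      Finset.sum_congr rfl fun j _ => h₂ j, sum_eps_smul]
  have hpull : ∀ g, (hx.eigenbasisMod N).Pull (α g) (e' g) := fun g => by
    have h₁ := hx.pullMod (α g) N
    have h₂ : (hx.map (α g)).eigenbasisMod N = e' g := by
      rw [hex g]
      exact EigenbasisMod.ext (funext fun j => funext fun i =>
        congrArg (eps (R.away g.1) j • ·) (quo_mk_eq_iff.2 (hxx g i)))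
    rwa [h₂] at h₁
  refine ⟨hx.eigenbasisMod N, hpull, fun e he => ?_⟩
  refine EigenbasisMod.ext (funext fun j => funext fun i => ?_)
  obtain ⟨m, hm⟩ := quo_mk_surj (e.vec j i)
  obtain ⟨m', hm'⟩ := quo_mk_surj ((hx.eigenbasisMod N).vec j i)
  rw [← hm, ← hm', quo_mk_eq_iff]
  refine (isCoord_coordN hN).mem_of_app ht α fun g => ?_
  rw [Arrow.app_sub, ← quo_mk_eq_iff]
  exact (he g j i m hm).trans (hpull g j i m' hm').symm

end Glue

end KisinDescent

namespace KisinDescent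

variable {p : ℕ} [Fact p.Prime] {D : Setup.{u} p}

/-! ### Representing natural equations by finitely presented algebras -/

section Representability

variable {ι : Type} {t : ∀ R : NilpAlg D, SS R} {κ : ∀ R : NilpAlg D, SS R → ι → R}

/-- The polynomial ring over `R` in the variables `σ`. -/
def NilpAlg.mvPolynomial (R : NilpAlg D) (σ : Type) : NilpAlg D where
  carrier := MvPolynomial σ R
  nilp := by
    have h := R.nilp.map (MvPolynomial.C : R →+* MvPolynomial σ R)
    rwa [map_natCast] at h

/-- The quotient of `R` by an ideal. -/
def NilpAlg.quotient (R : NilpAlg D) (I : Ideal R) : NilpAlg D where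
  carrier := R ⧸ I
  nilp := by
    have h := R.nilp.map (Ideal.Quotient.mk I)
    rwa [map_natCast] at h

/-- The structure map of `NilpAlg.mvPolynomial`. -/
def NilpAlg.toMvPolynomial (R : NilpAlg D) (σ : Type) : R →ₐ[D.Lam] R.mvPolynomial σ :=
  IsScalarTower.toAlgHom D.Lam R (MvPolynomial σ R)

/-- The structure map of `NilpAlg.quotient`. -/
def NilpAlg.toQuotient (R : NilpAlg D) (I : Ideal R) : R →ₐ[D.Lam] R.quotient I :=
  Ideal.Quotient.mkₐ D.Lam I

theorem NilpAlg.exists_eval {R R' : NilpAlg D} (h : R →ₐ[D.Lam] R') {σ : Type} (x : σ → R') :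
    ∃ c : R.mvPolynomial σ →ₐ[D.Lam] R', c.comp (R.toMvPolynomial σ) = h ∧
      ∀ s, c (MvPolynomial.X s : MvPolynomial σ R) = x s := by
  have h₁ : ∀ r, MvPolynomial.eval₂Hom (h : R →+* R') x (MvPolynomial.C r) = h r :=
    fun r => MvPolynomial.eval₂Hom_C _ _ r
  refine ⟨AlgHom.mk (MvPolynomial.eval₂Hom (h : R →+* R') x : MvPolynomial σ R →+* R')
    fun r => (h₁ _).trans (h.commutes r), AlgHom.ext h₁, fun s => ?_⟩
  exact MvPolynomial.eval₂Hom_X' _ _ s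

theorem NilpAlg.mvPolynomial_ext {R R' : NilpAlg D} {σ : Type}
    {c c' : R.mvPolynomial σ →ₐ[D.Lam] R'}
    (h : c.comp (R.toMvPolynomial σ) = c'.comp (R.toMvPolynomial σ))
    (hX : ∀ s, c (MvPolynomial.X s : MvPolynomial σ R) = c' (MvPolynomial.X s : MvPolynomial σ R)) :
    c = c' := by
  have h₁ : (c : R.mvPolynomial σ →+* R') = (c' : R.mvPolynomial σ →+* R') :=
    MvPolynomial.ringHom_ext (R := R) (σ := σ) (fun r => DFunLike.congr_fun h r) hX
  exact AlgHom.ext fun x => DFunLike.congr_fun h₁ x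

/-- Natural equations modulo `t` in finitely many unknowns are represented by a finitely presented
algebra. -/
theorem IsCoord.exists_representing [Finite ι] (hκ : IsCoord t κ) (R : NilpAlg D) {V ρ : Type}
    [Finite V] [Finite ρ] (rel : ρ → ∀ {R' : NilpAlg D}, (R →ₐ[D.Lam] R') → (V → SS R') → SS R')
    (hrel : ∀ (r : ρ) {R' R'' : NilpAlg D} (h : R →ₐ[D.Lam] R') (c : R' →ₐ[D.Lam] R'')
      (w : V → SS R'), baseS c (rel r h w) = rel r (c.comp h) fun v => baseS c (w v))
    (hcongr : ∀ (r : ρ) {R' : NilpAlg D} (h : R →ₐ[D.Lam] R') (w w' : V → SS R'),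
      (∀ v, t R' ∣ w v - w' v) → t R' ∣ rel r h w - rel r h w') :
    ∃ (B : NilpAlg D) (i : R →ₐ[D.Lam] B) (w : V → SS B), (i : R →+* B).FinitePresentation ∧
      (∀ r, t B ∣ rel r i w) ∧
      (∀ (R' : NilpAlg D) (h : R →ₐ[D.Lam] R') (w' : V → SS R'), (∀ r, t R' ∣ rel r h w') →
        ∃ c : B →ₐ[D.Lam] R', c.comp i = h ∧ ∀ v, t R' ∣ baseS c (w v) - w' v) ∧
      ∀ (R' : NilpAlg D) (c c' : B →ₐ[D.Lam] R'), c.comp i = c'.comp i →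
        (∀ v, t R' ∣ baseS c (w v) - baseS c' (w v)) → c = c' := by
  have hdvd : ∀ {R' : NilpAlg D} {x : SS R'}, κ R' x = κ R' 0 ↔ t R' ∣ x := fun {R' x} => by
    rw [hκ.eq_iff, sub_zero]
  set A := R.mvPolynomial (V × ι)
  set iA : R →ₐ[D.Lam] A := R.toMvPolynomial (V × ι)
  -- The universal unknowns: series over the polynomial ring whose coordinates are the variables.
  choose z hz using fun v : V =>
    hκ.surj A fun i => (MvPolynomial.X (v, i) : MvPolynomial (V × ι) R)
  -- The coordinates of the equations at the universal unknowns. There are finitely many, so the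
  -- quotient by them is finitely presented.
  let eqn : ρ × ι → A := fun s => κ A (rel s.1 iA z) s.2 - κ A 0 s.2
  let I : Ideal A := Ideal.span (Set.range eqn)
  let mk : A →ₐ[D.Lam] A.quotient I := A.toQuotient I
  have hz' : ∀ {R' : NilpAlg D} (c : A →ₐ[D.Lam] R') (v : V) (i : ι),
      c (MvPolynomial.X (v, i) : MvPolynomial (V × ι) R) = κ R' (baseS c (z v)) i := fun c v i => by
    rw [hκ.nat, hz]
  refine ⟨A.quotient I, mk.comp iA, fun v => baseS mk (z v), ?_, fun r => ?_, ?_, ?_⟩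
  · have h₁ : (algebraMap R (MvPolynomial (V × ι) R)).FinitePresentation :=
      RingHom.finitePresentation_algebraMap.2 inferInstance
    exact h₁.comp_surjective (g := Ideal.Quotient.mk I) Ideal.Quotient.mk_surjective
      (by rw [Ideal.mk_ker]; exact Submodule.fg_span (Set.finite_range eqn))
  · rw [← hrel, ← hdvd]
    funext i
    rw [hκ.nat, ← map_zero (baseS mk), hκ.nat]
    exact Ideal.Quotient.eq.2 (Ideal.subset_span ⟨(r, i), rfl⟩)
  · intro R' h w' hw'
    obtain ⟨c, hc, hcX⟩ := NilpAlg.exists_eval h fun s : V × ι => κ R' (w' s.1) s.2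
    have hcz : ∀ v, t R' ∣ baseS c (z v) - w' v := fun v =>
      hκ.eq_iff.1 (funext fun i => (hz' c v i).symm.trans (hcX (v, i)))
    have hI : ∀ x ∈ I, c x = 0 := fun x hx => by
      refine (Ideal.span_le (I := RingHom.ker (c : A →+* R'))).2 ?_ hx
      rintro _ ⟨s, rfl⟩
      change c (κ A (rel s.1 iA z) s.2 - κ A 0 s.2) = 0
      rw [map_sub, ← hκ.nat, ← hκ.nat, map_zero, sub_eq_zero]
      refine congrFun (hdvd.2 ?_) _
      rw [hrel, hc]
      exact (dvd_iff_dvd_of_dvd_sub (hcongr s.1 h _ _ hcz)).2 (hw' s.1)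
    obtain ⟨c₁, h₁⟩ : ∃ c₁ : A.quotient I →ₐ[D.Lam] R', c₁.comp mk = c :=
      ⟨Ideal.Quotient.liftₐ I c hI, AlgHom.ext fun x => rfl⟩
    refine ⟨c₁, ?_, fun v => ?_⟩
    · rw [← AlgHom.comp_assoc, h₁, hc]
    · rw [baseS_comp, h₁]
      exact hcz v
  · intro R' c c' hcc hw
    have h₁ : c.comp mk = c'.comp mk := by
      refine NilpAlg.mvPolynomial_ext ?_ fun s => ?_
      · rw [AlgHom.comp_assoc, AlgHom.comp_assoc]
        exact hcc
      · rw [hz' _ s.1 s.2, hz' _ s.1 s.2]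
        refine congrFun (hκ.eq_iff.2 ?_) _
        rw [← baseS_comp, ← baseS_comp]
        exact hw s.1
    exact AlgHom.ext fun x => by
      obtain ⟨y, rfl⟩ := Ideal.Quotient.mk_surjective (I := I) x
      exact DFunLike.congr_fun h₁ y

end Representability

/-! ### Formal smoothness of the universal algebra -/

section FormallySmooth

variable {a b : ℤ} {N : ℕ}

/-- `(MB, eB)` is universal among the pairs of a base change of `M` and an eigenbasis modulo
`P(v)^N`. -/
def IsUniversal {R B : NilpAlg D} {i : R →ₐ[D.Lam] B} {M : Y D a b R} {MB : Y D a b B}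
    (α : Arrow i M MB) (eB : EigenbasisMod N MB) : Prop :=
  ∀ (R' : NilpAlg D) (h : R →ₐ[D.Lam] R') (M' : Y D a b R') (β : Arrow h M M')
    (e' : EigenbasisMod N M'), ∃! c : B →ₐ[D.Lam] R', c.comp i = h ∧
      ∃ γ : Arrow c MB M', (∀ m : M, γ.app (α.app m) = β.app m) ∧ eB.Pull γ e'

theorem EigenbasisMod.Pull.comp {R R' R'' : NilpAlg D} {h : R →ₐ[D.Lam] R'}
    {h' : R' →ₐ[D.Lam] R''} {h'' : R →ₐ[D.Lam] R''} {M : Y D a b R} {M' : Y D a b R'}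
    {M'' : Y D a b R''} {α : Arrow h M M'} {β : Arrow h' M' M''} {δ : Arrow h'' M M''}
    (hδ : ∀ m, δ.app m = β.app (α.app m)) {e : EigenbasisMod N M} {e' : EigenbasisMod N M'}
    {e'' : EigenbasisMod N M''} (h₁ : e.Pull α e') (h₂ : e'.Pull β e'') : e.Pull δ e'' :=
  fun j i m hm => by rw [hδ]; exact h₂ j i _ (h₁ j i m hm)

/-- Eigenbases modulo `P(v)^N` lift along surjections with nilpotent kernel. -/
theorem EigenbasisMod.exists_lift (hN : N ≠ 0) {R R' : NilpAlg D} {h : R →ₐ[D.Lam] R'}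
    (hs : Function.Surjective h) (hn : IsNilpotent (RingHom.ker (h : R →+* R'))) {M : Y D a b R}
    {M' : Y D a b R'} (α : Arrow h M M') (e' : EigenbasisMod N M') :
    ∃ e : EigenbasisMod N M, e.Pull α e' := by
  obtain ⟨x', hx', rfl⟩ := e'.exists_eq hN
  obtain ⟨x, hx, hxx⟩ := hx'.exists_lift hs hn α
  refine ⟨hx.eigenbasisMod N, ?_⟩
  have h₁ := hx.pullMod α N
  obtain rfl : (fun i => α.app (x i)) = x' := funext hxx
  exact h₁

/-- A map B → C/I pulls the universal eigenbasis back to C/I. Since I is nilpotent this lifts to C,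
and universality turns the lift into a map B → C; the uniqueness part shows that it reduces to the
given one. -/
theorem IsUniversal.formallySmooth (hN : N ≠ 0) {R B : NilpAlg D} {i : R →ₐ[D.Lam] B}
    {M : Y D a b R} {MB : Y D a b B} {α : Arrow i M MB} {eB : EigenbasisMod N MB}
    (hu : IsUniversal α eB) : (i : R →+* B).FormallySmooth := by
  let := (i : R →+* B).toAlgebra
  change Algebra.FormallySmooth R B
  refine Algebra.FormallySmooth.of_comp_surjective fun C _ _ I hI g => ?_
  let : Algebra D.Lam C := ((algebraMap R C).comp (algebraMap D.Lam R)).toAlgebra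
  let C' : NilpAlg D :=
    { carrier := C
      nilp := by
        have h := R.nilp.map (algebraMap R C)
        rwa [map_natCast] at h }
  let h : R →ₐ[D.Lam] C' := AlgHom.mk (algebraMap R C) fun r => rfl
  let mk : C' →ₐ[D.Lam] C'.quotient I := C'.toQuotient I
  let g' : B →ₐ[D.Lam] C'.quotient I := AlgHom.mk (g : B →+* C ⧸ I) fun r => by
    rw [← i.commutes r]
    exact g.commutes (algebraMap D.Lam R r)
  have hg : g'.comp i = mk.comp h := AlgHom.ext fun r => g.commutes r
  obtain ⟨M₁, ⟨α₁⟩⟩ := M.exists_pullback h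
  obtain ⟨M₂, ⟨γ⟩⟩ := MB.exists_pullback g'
  obtain ⟨e', he', -⟩ := eB.exists_pull hN γ
  obtain ⟨δ, hδ⟩ := α.exists_comp hg γ
  obtain ⟨β, hβ⟩ := α₁.exists_factor rfl δ
  obtain ⟨e, he⟩ := EigenbasisMod.exists_lift hN (h := mk) Ideal.Quotient.mk_surjective
    (by
      refine ⟨2, ?_⟩
      have h₁ : RingHom.ker (mk : C' →+* C'.quotient I) = I := Ideal.mk_ker
      rw [h₁]
      exact hI) β e'
  obtain ⟨c, ⟨hc, γ', hγ', hpull⟩, -⟩ := hu C' h M₁ α₁ e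
  obtain ⟨δ', hδ'⟩ := γ'.exists_comp rfl β
  have h₁ : mk.comp c = g' := (hu _ _ M₂ δ e').unique
    ⟨by rw [AlgHom.comp_assoc, hc], δ', fun m => by rw [hδ', hγ', hβ], hpull.comp hδ' he⟩
    ⟨hg, γ, fun m => (hδ m).symm, he'⟩
  exact ⟨AlgHom.mk (c : B →+* C) fun r => DFunLike.congr_fun hc r,
    AlgHom.ext fun x => DFunLike.congr_fun h₁ x⟩

end FormallySmooth

end KisinDescent

namespace KisinDescent

variable {p : ℕ} [Fact p.Prime] {D : Setup.{u} p}

/-! ### Frames: bases of a projective module modulo t as pairs of matrices -/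

section MatrixCongruence

variable {S T : Type u} [CommRing S] [CommRing T] {l m n : Type*}

/-- Congruence of matrices modulo `t`. -/
def MEq (t : S) (A B : Matrix m n S) : Prop :=
  A.map (Ideal.Quotient.mk (Ideal.span {t})) = B.map (Ideal.Quotient.mk (Ideal.span {t}))

theorem mEq_iff {t : S} {A B : Matrix m n S} : MEq t A B ↔ ∀ i j, t ∣ (A - B) i j := by
  simp_rw [MEq, ← Matrix.ext_iff, Matrix.map_apply, Ideal.Quotient.eq, Ideal.mem_span_singleton]
  rfl

theorem MEq.symm {t : S} {A B : Matrix m n S} (h : MEq t A B) : MEq t B A := Eq.symm h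

theorem MEq.mul [Fintype m] {t : S} {A A' : Matrix l m S} {B B' : Matrix m n S} (hA : MEq t A A')
    (hB : MEq t B B') : MEq t (A * B) (A' * B') := by
  rw [MEq, Matrix.map_mul, Matrix.map_mul, hA, hB]

theorem MEq.sub {t : S} {A A' B B' : Matrix m n S} (hA : MEq t A A') (hB : MEq t B B') :
    MEq t (A - B) (A' - B') := by
  rw [MEq, Matrix.map_sub _ (map_sub _), Matrix.map_sub _ (map_sub _), hA, hB]

theorem MEq.map {t : S} {t' : T} {g : S →+* T} (hg : t' ∣ g t) {A B : Matrix m n S}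
    (h : MEq t A B) : MEq t' (A.map g) (B.map g) :=
  mEq_iff.2 fun i j => hg.trans (by
    have h₁ := map_dvd g (mEq_iff.1 h i j)
    rwa [Matrix.sub_apply, map_sub] at h₁)

/-- `Z` and `Y` are inverse to each other between `S ^ n` and the image of the idempotent `e`,
modulo `t`. -/
structure IsFrame [Fintype m] [Fintype n] [DecidableEq n] (t : S) (e : Matrix m m S) (Z : Matrix m n S)
    (Y : Matrix n m S) : Prop where
  inv : MEq t (Y * Z) 1
  proj : MEq t (Z * Y) e

variable [Fintype m] [Fintype n] [DecidableEq n] {t : S} {e : Matrix m m S} {Z Z' : Matrix m n S} {Y Y' : Matrix n m S}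

theorem IsFrame.map (hZ : IsFrame t e Z Y) {t' : T} {g : S →+* T} (hg : t' ∣ g t) :
    IsFrame t' (e.map g) (Z.map g) (Y.map g) := by
  refine ⟨?_, ?_⟩
  · have h := hZ.inv.map hg
    rwa [Matrix.map_mul, Matrix.map_one _ (map_zero g) (map_one g)] at h
  · have h := hZ.proj.map hg
    rwa [Matrix.map_mul] at h

theorem IsFrame.mul_left (hZ : IsFrame t e Z Y) : MEq t (e * Z) Z := by
  have h := hZ.inv
  have h' := hZ.proj
  rw [MEq, Matrix.map_mul] at h h' ⊢
  rw [← h', Matrix.mul_assoc, h, Matrix.map_one _ (map_zero _) (map_one _), Matrix.mul_one]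

theorem IsFrame.mul_right (hZ : IsFrame t e Z Y) : MEq t (Y * e) Y := by
  have h := hZ.inv
  have h' := hZ.proj
  rw [MEq, Matrix.map_mul] at h h' ⊢
  rw [← h', ← Matrix.mul_assoc, h, Matrix.map_one _ (map_zero _) (map_one _), Matrix.one_mul]

/-- A frame satisfies eZ ≡ Z, so Z is determined by eZ, that is, by the vectors it defines. Then Y'
≡ Y'e ≡ Y'ZY ≡ Y'Z'Y ≡ Y. -/
theorem IsFrame.unique (hZ : IsFrame t e Z Y) (hZ' : IsFrame t e Z' Y')
    (h : MEq t (e * Z) (e * Z')) : MEq t Z Z' ∧ MEq t Y Y' := by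
  have hz : MEq t Z Z' := (hZ.mul_left.symm.trans h).trans hZ'.mul_left
  refine ⟨hz, ?_⟩
  have h₁ := hZ'.inv
  have h₂ := hZ'.mul_right
  have h₃ := hZ.proj
  rw [MEq, Matrix.map_mul] at h₁ h₂ h₃
  rw [MEq, ← h₂, ← h₃, ← Matrix.mul_assoc, hz, h₁, Matrix.map_one _ (map_zero _) (map_one _),
    Matrix.one_mul]

end MatrixCongruence

section Frames

variable {S : Type u} [CommRing S] {Q : Type u} [AddCommGroup Q] [Module S Q] {m n : ℕ}
  {q : Fin m → Q} {s : Fin m → Q →ₗ[S] S}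

theorem sum_mul_smul (A : Matrix (Fin m) (Fin n) S) (c : Fin n → S) (q : Fin m → Q) :
    ∑ k, c k • ∑ l, A l k • q l = ∑ l, (A.mulVec c) l • q l := by
  simp_rw [Finset.smul_sum, Matrix.mulVec, dotProduct, Finset.sum_smul, smul_smul]
  rw [Finset.sum_comm]
  simp_rw [mul_comm]

theorem apply_sum_smul (c : Fin m → S) (l : Fin m) :
    s l (∑ l', c l' • q l') = ((Matrix.of fun l l' => s l (q l')).mulVec c) l := by
  rw [map_sum]
  simp_rw [map_smul, Matrix.mulVec, dotProduct, Matrix.of_apply, smul_eq_mul, mul_comm]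

variable {t : S} {Z : Matrix (Fin m) (Fin n) S} {Y : Matrix (Fin n) (Fin m) S}

theorem mulVec_dvd (A : Matrix (Fin m) (Fin n) S) {c : Fin n → S} (hc : ∀ k, t ∣ c k) (l : Fin m) :
    t ∣ A.mulVec c l := by
  rw [Matrix.mulVec, dotProduct]
  exact Finset.dvd_sum fun k _ => (hc k).mul_left _

theorem MEq.mulVec {A B : Matrix (Fin m) (Fin n) S} (h : MEq t A B) (c : Fin n → S) (l : Fin m) :
    t ∣ A.mulVec c l - B.mulVec c l := by
  rw [← Pi.sub_apply, ← Matrix.sub_mulVec, Matrix.mulVec, dotProduct]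
  exact Finset.dvd_sum fun k _ => (mEq_iff.1 h l k).mul_right _

theorem IsFrame.exists_sum (hq : ∀ y, y = ∑ l, s l y • q l)
    (hZ : IsFrame t (Matrix.of fun l l' => s l (q l')) Z Y) (y : Q) :
    ∃ c : Fin n → S, y - ∑ k, c k • ∑ l, Z l k • q l ∈ (Ideal.span {t} • ⊤ : Submodule S Q) := by
  refine ⟨Y.mulVec fun l => s l y, ?_⟩
  have h : y = ∑ l, ((Matrix.of fun l l' => s l (q l')).mulVec fun l => s l y) l • q l := by
    simp_rw [← apply_sum_smul, ← hq]
  rw [sum_mul_smul, Matrix.mulVec_mulVec]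
  nth_rw 1 [h]
  rw [← Finset.sum_sub_distrib]
  simp_rw [← sub_smul]
  exact sum_smul_mem (fun l => hZ.proj.symm.mulVec _ l) q

theorem IsFrame.dvd_of_sum (hZ : IsFrame t (Matrix.of fun l l' => s l (q l')) Z Y) {c : Fin n → S}
    (hc : ∑ k, c k • ∑ l, Z l k • q l ∈ (Ideal.span {t} • ⊤ : Submodule S Q)) (k : Fin n) :
    t ∣ c k := by
  have h₁ : ∀ l, t ∣ Z.mulVec c l := fun l => by
    have h := dvd_of_mem_smul hc (s l)
    rw [sum_mul_smul, apply_sum_smul, Matrix.mulVec_mulVec] at h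
    exact (dvd_iff_dvd_of_dvd_sub (hZ.mul_left.mulVec c l)).1 h
  have h₂ := mulVec_dvd Y h₁ k
  rw [Matrix.mulVec_mulVec] at h₂
  have h₃ := (dvd_iff_dvd_of_dvd_sub (hZ.inv.mulVec c k)).1 h₂
  rwa [Matrix.one_mulVec] at h₃

theorem mEq_of_sum_sub_mem {Z' : Matrix (Fin m) (Fin n) S}
    (h : ∀ k, ∑ l, Z l k • q l - ∑ l, Z' l k • q l ∈ (Ideal.span {t} • ⊤ : Submodule S Q)) :
    MEq t (Matrix.of (fun l l' => s l (q l')) * Z) (Matrix.of (fun l l' => s l (q l')) * Z') :=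
  mEq_iff.2 fun l k => by
    have h₁ := dvd_of_mem_smul (h k) (s l)
    rwa [map_sub, apply_sum_smul, apply_sum_smul] at h₁

/-- Z consists of the coefficients s_l(x_k) of the basis in the dual basis, and Y of the coordinates
of the generators q_l in the basis. -/
theorem IsBas.exists_frame {x : Fin n → Q} (hx : IsBas S x) (hq : ∀ y, y = ∑ l, s l y • q l) :
    ∃ (Z : Matrix (Fin m) (Fin n) S) (Y : Matrix (Fin n) (Fin m) S), Y * Z = 1 ∧
      Z * Y = Matrix.of (fun l l' => s l (q l')) ∧ (∀ k, x k = ∑ l, Z l k • q l) ∧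
      ∀ l k, Z l k = s l (x k) := by
  choose Y hY using fun l => hx.exists_sum (q l)
  refine ⟨Matrix.of fun l k => s l (x k), Matrix.of fun k l => Y l k, ?_, ?_, fun k => hq (x k),
    fun _ _ => rfl⟩
  · have h : ∀ k', ∑ k, (∑ l, Y l k * s l (x k') - (1 : Matrix (Fin n) (Fin n) S) k k') • x k = 0 :=
      fun k' => by
        simp_rw [sub_smul, Finset.sum_sub_distrib, Matrix.one_apply, ite_smul, one_smul, zero_smul,
          Finset.sum_ite_eq', Finset.mem_univ, if_true, Finset.sum_smul]
        rw [Finset.sum_comm, sub_eq_zero]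
        conv_rhs => rw [hq (x k')]
        refine Finset.sum_congr rfl fun l _ => ?_
        conv_rhs => rw [hY l, Finset.smul_sum]
        simp_rw [smul_smul, mul_comm]
    ext k k'
    exact sub_eq_zero.1 (Fintype.linearIndependent_iff.1 hx.1 _ (h k') k)
  · ext l l'
    conv_rhs => rw [Matrix.of_apply, hY l', map_sum]
    simp_rw [map_smul, smul_eq_mul, Matrix.mul_apply, Matrix.of_apply, mul_comm]

end Frames

end KisinDescent

namespace KisinDescent

variable {p : ℕ} [Fact p.Prime] {D : Setup.{u} p}

/-! ### The universal eigenbasis modulo P^N and smoothness -/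

section Smooth

variable {a b : ℤ} {N : ℕ}

theorem IsEB.eigenbasisMod_eq_iff {R : NilpAlg D} {M : Y D a b R} {x x' : Fin D.n → M}
    (hx : IsEB M.toKisinDD x) (hx' : IsEB M.toKisinDD x') :
    hx.eigenbasisMod N = hx'.eigenbasisMod N ↔ ∀ i, x i - x' i ∈
      (Ideal.span {PS R ^ N} • ⊤ : Submodule (SS R) M) := by
  simp_rw [← quo_mk_eq_iff]
  refine ⟨fun h i => ?_, fun h => EigenbasisMod.ext (funext fun j => funext fun i =>
    congrArg (eps R j • ·) (h i))⟩
  have h₁ : ∀ j, eps R j • QuoN.mk N (x i) = eps R j • QuoN.mk N (x' i) :=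
    fun j => congrFun (congrFun (congrArg EigenbasisMod.vec h) j) i
  change QuoN.mk N _ = QuoN.mk N _
  rw [← sum_eps_smul (R := R) (QuoN.mk N (x i)), Finset.sum_congr rfl fun j _ => h₁ j, sum_eps_smul]

theorem IsEB.pullMod_iff {R R' : NilpAlg D} {h : R →ₐ[D.Lam] R'} {M : Y D a b R}
    {M' : Y D a b R'} {x : Fin D.n → M} (hx : IsEB M.toKisinDD x) (α : Arrow h M M')
    {x' : Fin D.n → M'} (hx' : IsEB M'.toKisinDD x') :
    (hx.eigenbasisMod N).Pull α (hx'.eigenbasisMod N) ↔ ∀ i, α.app (x i) - x' i ∈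
      (Ideal.span {PS R' ^ N} • ⊤ : Submodule (SS R') M') := by
  rw [← (hx.map α).eigenbasisMod_eq_iff hx']
  exact ⟨fun h₁ => (hx.pullMod α N).unique h₁, fun h₁ => h₁ ▸ hx.pullMod α N⟩

/-- The diagonal matrix of the values of the characters `χ_i` at the generator of `Δ`. -/
def chiDiag (R : NilpAlg D) : Matrix (Fin D.n) (Fin D.n) (SS R) :=
  Matrix.diagonal fun i => cL R (D.chi i D.gen)

theorem chiDiag_map {R R' : NilpAlg D} (h : R →ₐ[D.Lam] R') :
    (chiDiag R).map (baseS h) = chiDiag R' := by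
  rw [chiDiag, Matrix.diagonal_map (map_zero _), chiDiag]
  simp_rw [baseS_cL]

section Relations

variable {m : ℕ}

/-- The indices of the entries of `Z` and `Y`. -/
abbrev FrameVar (D : Setup.{u} p) (m : ℕ) : Type := Fin m × Fin D.n ⊕ Fin D.n × Fin m

/-- The indices of the equations for `Z` and `Y`. -/
abbrev FrameEqn (D : Setup.{u} p) (m : ℕ) : Type :=
  Fin D.n × Fin D.n ⊕ Fin m × Fin m ⊕ Fin m × Fin D.n

/-- The matrix `Z`. -/
def frameZ {S : Type u} (w : FrameVar D m → S) : Matrix (Fin m) (Fin D.n) S :=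
  Matrix.of fun l k => w (Sum.inl (l, k))

/-- The matrix `Y`. -/
def frameY {S : Type u} (w : FrameVar D m → S) : Matrix (Fin D.n) (Fin m) S :=
  Matrix.of fun k l => w (Sum.inr (k, l))

/-- The equations for the coordinates of an eigenbasis: `Y Z = 1`, `Z Y = e` and `G ĝ(Z) = Z χ`. -/
def frameRel {R : NilpAlg D} (e G : Matrix (Fin m) (Fin m) (SS R)) (r : FrameEqn D m)
    {R' : NilpAlg D} (h : R →ₐ[D.Lam] R') (w : FrameVar D m → SS R') : SS R' :=
  Sum.elim (fun x => (frameY w * frameZ w - 1 : Matrix (Fin D.n) (Fin D.n) (SS R')) x.1 x.2)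
    (Sum.elim (fun x => (frameZ w * frameY w - e.map (baseS h)) x.1 x.2)
      fun x => (G.map (baseS h) * (frameZ w).map (galS R' D.gen) -
        frameZ w * chiDiag R') x.1 x.2) r

variable {R R' R'' : NilpAlg D} (e G : Matrix (Fin m) (Fin m) (SS R)) (h : R →ₐ[D.Lam] R')

theorem frameRel_dvd_iff {t : SS R'} {w : FrameVar D m → SS R'} :
    (∀ r, t ∣ frameRel e G r h w) ↔ IsFrame t (e.map (baseS h)) (frameZ w) (frameY w) ∧
      MEq t (G.map (baseS h) * (frameZ w).map (galS R' D.gen)) (frameZ w * chiDiag R') := by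
  refine ⟨fun H => ⟨⟨mEq_iff.2 fun i j => H (Sum.inl (i, j)),
    mEq_iff.2 fun i j => H (Sum.inr (Sum.inl (i, j)))⟩,
    mEq_iff.2 fun i j => H (Sum.inr (Sum.inr (i, j)))⟩, fun H r => ?_⟩
  rcases r with x | x | x
  · exact mEq_iff.1 H.1.1 x.1 x.2
  · exact mEq_iff.1 H.1.2 x.1 x.2
  · exact mEq_iff.1 H.2 x.1 x.2

theorem baseS_frameRel (r : FrameEqn D m) (c : R' →ₐ[D.Lam] R'') (w : FrameVar D m → SS R') :
    baseS c (frameRel e G r h w) = frameRel e G r (c.comp h) fun v => baseS c (w v) := by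
  have hb : ∀ A : Matrix (Fin m) (Fin m) (SS R),
      (A.map (baseS h)).map (baseS c) = A.map (baseS (c.comp h)) := fun A => by
    ext i j
    simp only [Matrix.map_apply, baseS_comp]
  have hg : ((frameZ w).map (galS R' D.gen)).map (baseS c) =
      ((frameZ w).map (baseS c)).map (galS R'' D.gen) := by
    ext i j
    simp only [Matrix.map_apply, galS_baseS]
  rcases r with x | x | x
  · change ((frameY w * frameZ w - 1).map (baseS c)) x.1 x.2 = _
    rw [Matrix.map_sub _ (map_sub _), Matrix.map_mul, Matrix.map_one _ (map_zero _) (map_one _)]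
    rfl
  · change ((frameZ w * frameY w - e.map (baseS h)).map (baseS c)) x.1 x.2 = _
    rw [Matrix.map_sub _ (map_sub _), Matrix.map_mul, hb]
    rfl
  · change ((G.map (baseS h) * (frameZ w).map (galS R' D.gen) -
      frameZ w * chiDiag R').map (baseS c)) x.1 x.2 = _
    rw [Matrix.map_sub _ (map_sub _), Matrix.map_mul, Matrix.map_mul, hb, hg, chiDiag_map]
    rfl

theorem frameRel_congr {t : SS R'} (ht : t ∣ galS R' D.gen t) (r : FrameEqn D m)
    {w w' : FrameVar D m → SS R'} (hw : ∀ v, t ∣ w v - w' v) :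
    t ∣ frameRel e G r h w - frameRel e G r h w' := by
  have hZ : MEq t (frameZ w) (frameZ w') := mEq_iff.2 fun i j => hw _
  have hY : MEq t (frameY w) (frameY w') := mEq_iff.2 fun i j => hw _
  rcases r with x | x | x
  · exact mEq_iff.1 ((hY.mul hZ).sub (rfl : MEq t _ _)) x.1 x.2
  · exact mEq_iff.1 ((hZ.mul hY).sub (rfl : MEq t _ _)) x.1 x.2
  · exact mEq_iff.1 ((MEq.mul (rfl : MEq t _ _) (hZ.map ht)).sub (hZ.mul rfl)) x.1 x.2

end Relations

section Universal

variable {R R' : NilpAlg D} {h : R →ₐ[D.Lam] R'} {M : Y D a b R} {M' : Y D a b R'} {m : ℕ}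
  {q : Fin m → M} {s : Fin m → M →ₗ[SS R] SS R}

/-- The matrix of the action of the generator of `Δ` on a generating system. -/
def galMatrix (q : Fin m → M) (s : Fin m → M →ₗ[SS R] SS R) : Matrix (Fin m) (Fin m) (SS R) :=
  Matrix.of fun l l' => s l (M.gal D.gen (q l'))

/-- The projector attached to a dual basis. -/
def projMatrix (q : Fin m → M) (s : Fin m → M →ₗ[SS R] SS R) : Matrix (Fin m) (Fin m) (SS R) :=
  Matrix.of fun l l' => s l (q l')

theorem projMatrix_map (β : Arrow h M M') {s' : Fin m → M' →ₗ[SS R'] SS R'}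
    (hs : ∀ l y, s' l (β.app y) = baseS h (s l y)) :
    (projMatrix q s).map (baseS h) = projMatrix (fun l => β.app (q l)) s' :=
  Matrix.ext fun _ _ => (hs _ _).symm

theorem galMatrix_map (β : Arrow h M M') {s' : Fin m → M' →ₗ[SS R'] SS R'}
    (hs : ∀ l y, s' l (β.app y) = baseS h (s l y)) :
    (galMatrix q s).map (baseS h) = galMatrix (fun l => β.app (q l)) s' :=
  Matrix.ext fun _ _ => ((congrArg _ (β.sl_gal _ _).symm).trans (hs _ _)).symm

theorem gal_sum_smul (Z : Matrix (Fin m) (Fin D.n) (SS R)) (k : Fin D.n)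
    (hq : ∀ y, y = ∑ l, s l y • q l) :
    M.gal D.gen (∑ l, Z l k • q l) =
      ∑ l, (galMatrix q s * Z.map (galS R D.gen)) l k • q l := by
  rw [map_sum]
  simp_rw [map_smulₛₗ, Matrix.mul_apply, Finset.sum_smul]
  rw [Finset.sum_comm]
  refine Finset.sum_congr rfl fun l _ => ?_
  conv_lhs => rw [hq (M.gal D.gen (q l)), Finset.smul_sum]
  refine Finset.sum_congr rfl fun l' _ => ?_
  rw [smul_smul, mul_comm]
  rfl

theorem mul_chiDiag_apply (Z : Matrix (Fin m) (Fin D.n) (SS R)) (l : Fin m) (k : Fin D.n) :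
    (Z * chiDiag R) l k = cL R (D.chi k D.gen) * Z l k := by
  rw [chiDiag, Matrix.mul_diagonal, mul_comm]

/-- Solutions modulo `P(v)^N` of the equations come from exact eigenbases. -/
theorem exists_isEB_of_isFrame (hN : N ≠ 0) (hq : ∀ y, y = ∑ l, s l y • q l)
    {Z : Matrix (Fin m) (Fin D.n) (SS R)} {Y : Matrix (Fin D.n) (Fin m) (SS R)}
    (hZ : IsFrame (PS R ^ N) (projMatrix q s) Z Y)
    (hG : MEq (PS R ^ N) (galMatrix q s * Z.map (galS R D.gen)) (Z * chiDiag R)) :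
    ∃ x, IsEB M.toKisinDD x ∧ ∀ k, x k - ∑ l, Z l k • q l ∈
      (Ideal.span {PS R ^ N} • ⊤ : Submodule (SS R) M) := by
  refine exists_isEB_of_mod M.toKisinDD (span_PS_pow_le_jacobson R hN)
    (galS_mem_span (PS_pow_dvd_galS D.gen N)) (fun k => ∑ l, Z l k • q l) (fun k => ?_)
    (fun y => hZ.exists_sum hq y)
    fun c hc k => Ideal.mem_span_singleton.2 (hZ.dvd_of_sum hc k)
  rw [gal_sum_smul Z k hq, Finset.smul_sum]
  simp_rw [smul_smul, ← mul_chiDiag_apply]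
  rw [← Finset.sum_sub_distrib]
  simp_rw [← sub_smul]
  exact sum_smul_mem (fun l => mEq_iff.1 hG l k) q

/-- An exact eigenbasis gives a solution of the equations. -/
theorem IsEB.exists_frame {x : Fin D.n → M} (hx : IsEB M.toKisinDD x)
    (hq : ∀ y, y = ∑ l, s l y • q l) (t : SS R) :
    ∃ (Z : Matrix (Fin m) (Fin D.n) (SS R)) (Y : Matrix (Fin D.n) (Fin m) (SS R)),
      IsFrame t (projMatrix q s) Z Y ∧
      MEq t (galMatrix q s * Z.map (galS R D.gen)) (Z * chiDiag R) ∧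
      ∀ k, x k = ∑ l, Z l k • q l := by
  obtain ⟨Z, Y, h₁, h₂, h₃, h₄⟩ := hx.1.exists_frame hq
  refine ⟨Z, Y, ⟨by rw [h₁]; rfl, by rw [h₂]; rfl⟩, congrArg (Matrix.map · _) ?_, h₃⟩
  refine Matrix.ext fun l k => ?_
  have h₅ := congrArg (s l) (hx.2 k D.gen)
  rw [map_smul, ← h₄] at h₅
  rw [mul_chiDiag_apply, ← smul_eq_mul, ← h₅]
  conv_rhs => rw [hq (x k)]
  rw [map_sum, map_sum, Matrix.mul_apply]
  refine Finset.sum_congr rfl fun l' _ => ?_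
  rw [map_smulₛₗ, map_smul, smul_eq_mul, mul_comm, ← h₄]
  rfl

end Universal

/-- In a dual basis (q, s) of M a family of vectors is a matrix Z. The matrix Y certifies that it is
a basis modulo P^N, and the third equation is equivariance under the generator of Δ. The frame
equations make Z and Y unique, so solutions correspond to eigenbases modulo P^N and the representing
algebra is universal. -/
theorem exists_isUniversal (hN : N ≠ 0) {R : NilpAlg D} (M : Y D a b R) :
    ∃ (B : NilpAlg D) (i : R →ₐ[D.Lam] B) (MB : Y D a b B) (α : Arrow i M MB)
      (eB : EigenbasisMod N MB), (i : R →+* B).FinitePresentation ∧ IsUniversal α eB := by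
  have := M.finite
  have := M.projective
  obtain ⟨m, q, s, hq⟩ := exists_dualBasis (SS R) M
  have hκ := isCoord_coordN (D := D) hN
  obtain ⟨B, i, w, hfp, hw, hB, hB'⟩ := hκ.exists_representing R
    (frameRel (projMatrix q s) (galMatrix q s))
    (fun r _ _ h c w => baseS_frameRel _ _ h r c w)
    fun r _ h w w' => frameRel_congr _ _ h (hκ.gal _ _) r
  obtain ⟨MB, ⟨α⟩⟩ := M.exists_pullback i
  choose sB hsB using fun l => α.isBC.exists_functional (s l)
  have hqB := α.isBC.dualBasis hq hsB
  have hw' := (frameRel_dvd_iff _ _ _).1 hw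
  rw [projMatrix_map α hsB, galMatrix_map α hsB] at hw'
  obtain ⟨x, hx, hxw⟩ := exists_isEB_of_isFrame hN hqB hw'.1 hw'.2
  refine ⟨B, i, MB, α, hx.eigenbasisMod N, hfp, fun R' h M' β e' => ?_⟩
  obtain ⟨x', hx', rfl⟩ := e'.exists_eq hN
  choose s' hs' using fun l => β.isBC.exists_functional (s l)
  have hq' := β.isBC.dualBasis hq hs'
  obtain ⟨Z', Y', hZ', hG', hxZ'⟩ := hx'.exists_frame hq' (PS R' ^ N)
  -- The universal eigenbasis agrees with the vectors ∑ Z_lk q_l only modulo P^N, which is enough to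
  -- express the pullback condition through the universal matrix Z.
  have hpull : ∀ (c : B →ₐ[D.Lam] R') (γ : Arrow c MB M'), (∀ m, γ.app (α.app m) = β.app m) →
      ((hx.eigenbasisMod N).Pull γ (hx'.eigenbasisMod N) ↔
        ∀ k, ∑ l, (frameZ w).map (baseS c) l k • β.app (q l) - ∑ l, Z' l k • β.app (q l) ∈
          (Ideal.span {PS R' ^ N} • ⊤ : Submodule (SS R') M')) := fun c γ hγ => by
    rw [hx.pullMod_iff γ hx']
    refine forall_congr' fun k => ?_
    have h₁ := γ.app_mem hκ (hxw k)
    rw [Arrow.app_sub, Arrow.app_sum] at h₁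
    have h₂ : ∑ l, baseS c (frameZ w l k) • γ.app (α.sl (q l)) =
        ∑ l, (frameZ w).map (baseS c) l k • β.app (q l) :=
      Finset.sum_congr rfl fun l _ => congrArg _ (hγ (q l))
    rw [h₂] at h₁
    have h₃ : x' k = ∑ l, Z' l k • β.app (q l) := hxZ' k
    rw [h₃]
    refine ⟨fun h₄ => ?_, fun h₄ => ?_⟩
    · have h₅ := sub_mem h₄ h₁
      rwa [sub_sub_sub_cancel_left] at h₅
    · have h₅ := add_mem h₁ h₄
      rwa [sub_add_sub_cancel] at h₅
  have hsol : ∀ c : B →ₐ[D.Lam] R', c.comp i = h →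
      IsFrame (PS R' ^ N) (projMatrix (fun l => β.app (q l)) s') ((frameZ w).map (baseS c))
        ((frameY w).map (baseS c)) := fun c hc => by
    have h₁ := (((frameRel_dvd_iff _ _ _).1 hw).1).map (t' := PS R' ^ N) (g := baseS c)
      (dvd_of_eq (hκ.base c).symm)
    have h₂ : ((projMatrix q s).map (baseS i)).map (baseS c) = (projMatrix q s).map (baseS h) := by
      refine Matrix.ext fun l l' => ?_
      rw [Matrix.map_apply, Matrix.map_apply, baseS_comp, hc, Matrix.map_apply]
    rwa [h₂, projMatrix_map β hs'] at h₁
  obtain ⟨c, hc, hcw⟩ := hB R' h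
    (Sum.elim (fun x => Z' x.1 x.2) fun x => Y' x.1 x.2)
    ((frameRel_dvd_iff _ _ _).2 ⟨by rw [projMatrix_map β hs']; exact hZ',
      by rw [galMatrix_map β hs']; exact hG'⟩)
  obtain ⟨γ, hγ⟩ := α.exists_factor hc β
  refine ⟨c, ⟨hc, γ, hγ, (hpull c γ hγ).2 fun k => ?_⟩, ?_⟩
  · rw [← Finset.sum_sub_distrib]
    simp_rw [← sub_smul]
    exact sum_smul_mem (fun l => hcw (Sum.inl (l, k))) _
  · rintro c' ⟨hc', γ', hγ', hp⟩
    -- The pullback condition gives agreement of eZ only; uniqueness of frames gives Z and Y, hence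
    -- all coordinates of the universal solution.
    obtain ⟨h₁, h₂⟩ := (hsol c' hc').unique hZ' (mEq_of_sum_sub_mem ((hpull c' γ' hγ').1 hp))
    refine hB' R' c' c (hc'.trans hc.symm) fun v => ?_
    rw [← sub_sub_sub_cancel_right]
    refine dvd_sub ?_ (hcw v)
    rcases v with v | v
    · exact mEq_iff.1 h₁ v.1 v.2
    · exact mEq_iff.1 h₂ v.1 v.2

theorem eigenbasisMod_isSmooth (hN : N ≠ 0) : IsSmoothOver (D := D) (a := a) (b := b)
    (fun _ M => EigenbasisMod N M) (fun _ _ _ _ _ α => EigenbasisMod.Pull α) := fun _ M => by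
  obtain ⟨B, i, MB, α, eB, hfp, hu⟩ := exists_isUniversal hN M
  exact ⟨B, i, MB, α, eB, RingHom.smooth_def.2 ⟨hu.formallySmooth hN, hfp⟩, hu⟩

end Smooth

end KisinDescent

end

theorem mainTheorem8 (p : ℕ) [Fact p.Prime] (D : KisinDescent.Setup.{u} p) (a b : ℤ) (hab : a ≤ b)
    (N : ℕ) (hN : b - a < (N : ℤ)) :
    KisinDescent.HasPullbacks D a b ∧
    KisinDescent.IsZariskiTorsor (D := D) (a := a) (b := b)
      (fun _ M => KisinDescent.Eigenbasis M)
      (fun _ _ _ _ _ α => KisinDescent.Eigenbasis.Pull α)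
      KisinDescent.LoopGroup
      (fun _ _ h => KisinDescent.loopGroupMap h)
      (fun _ _ => KisinDescent.Eigenbasis.Act) ∧
    KisinDescent.IsZariskiTorsor (D := D) (a := a) (b := b)
      (fun _ M => KisinDescent.EigenbasisMod N M)
      (fun _ _ _ _ _ α => KisinDescent.EigenbasisMod.Pull α)
      (KisinDescent.ParahoricGroup N)
      (fun _ _ h => KisinDescent.parahoricGroupMap N h)
      (fun _ _ => KisinDescent.EigenbasisMod.Act) ∧
    KisinDescent.IsSmoothOver (D := D) (a := a) (b := b)
      (fun _ M => KisinDescent.EigenbasisMod N M)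
      (fun _ _ _ _ _ α => KisinDescent.EigenbasisMod.Pull α) ∧
    KisinDescent.IsFormallySmoothOver (D := D) (a := a) (b := b)
      (fun _ M => KisinDescent.Eigenbasis M)
      (fun _ _ _ _ _ α => KisinDescent.Eigenbasis.Pull α) := by
  -- N > b - a ≥ 0, so N is positive and P^N lies in the Jacobson radical.
  have hN0 : N ≠ 0 := by omega
  refine ⟨fun R R' h M => M.exists_pullback h, ⟨?_, ?_, ?_, ?_, ?_, ?_, ?_, ?_⟩,
    ⟨?_, ?_, ?_, ?_, ?_, ?_, ?_, ?_⟩, ?_, KisinDescent.eigenbasis_isFormallySmooth⟩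
  · exact fun R R' h M M' α e => e.exists_pull α
  · exact fun R M t ht M' α e' he => KisinDescent.Eigenbasis.exists_glue ht α e' he
  · exact fun R M e g => e.exists_act g
  · exact fun R M e => e.act_one
  · exact fun R M e e' e'' g g' h h' => h.mul h'
  · exact fun R R' h M M' α e₁ e₂ g e₁' e₂' hg h₁ h₂ => hg.pull h₁ h₂
  · exact fun R M e e' => e.simply_transitive e'
  · intro R M
    obtain ⟨t, ht, hM⟩ := M.exists_locally_isEB
    refine ⟨t, ht, fun g hg => ?_⟩
    obtain ⟨M', α, x, hx⟩ := hM g hg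
    exact ⟨M', α, ⟨hx.eigenbasis⟩⟩
  · exact fun R R' h M M' α e => e.exists_pull hN0 α
  · exact fun R M t ht M' α e' he => KisinDescent.EigenbasisMod.exists_glue hN0 ht α e' he
  · exact fun R M e g => e.exists_act hN0 g
  · exact fun R M e => e.act_one
  · exact fun R M e e' e'' g g' h h' => h.mul h'
  · exact fun R R' h M M' α e₁ e₂ g e₁' e₂' hg h₁ h₂ => hg.pull h₁ h₂
  · exact fun R M e e' => e.simply_transitive hN0 e'
  · intro R M
    obtain ⟨t, ht, hM⟩ := M.exists_locally_isEB
    refine ⟨t, ht, fun g hg => ?_⟩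
    obtain ⟨M', α, x, hx⟩ := hM g hg
    exact ⟨M', α, ⟨hx.eigenbasisMod N⟩⟩
  · exact KisinDescent.eigenbasisMod_isSmooth hN0
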